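/- Let $n\ge 2$, $1\le p\le q\le\infty$ and $s\in\mathbb R$. For Schwartz functions $f$ on $\mathbb R^n$ write $\hat f(\xi)=\int e^{-2\pi i x\cdot\xi}f(x)\,dx$, let $e^{it\sqrt{-\Delta}}f(x)=\int e^{2\pi i(x\cdot\xi+t|\xi|)}\hat f(\xi)\,d\xi$, and let $\|f\|_{W^{s,p}(\mathbb R^n)}=\|\langle D\rangle^s f\|_{L^p(\mathbb R^n)}$, where $\langle D\rangle^s$ is the Fourier multiplier with symbol $(1+|\xi|^2)^{s/2}$. For $\alpha\in\mathbb C$, $t\in[1,2]$ and a Schwartz function $f$, let $\mathfrak M^\alpha_t f(x)$ be the value at $\alpha$ of the entire function of $\alpha$ which for $\operatorname{Re}\alpha>0$ is given by $$\mathfrak M^\alpha_t f(x)=\frac1{\Gamma(\alpha)}\int_{|y|\le1}(1-|y|^2)^{\alpha-1}f(x-ty)\,dy .$$ For $f\in L^p(\mathbb R^n)$, $\mathfrak M^\alpha_t f$ denotes the tempered distribution $\varphi\mapsto\int f\,\mathfrak M^\alpha_t\varphi\,dx$ (the convolution kernel of $\mathfrak M^\alpha_t$ is even, so this agrees with the above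 for Schwartz $f$). Suppose that the local smoothing estimate $$\big\|e^{it\sqrt{-\Delta}}f\big\|_{L^q(\mathbb R^n\times[1,2])}\le C\,\|f\|_{W^{s,p}(\mathbb R^n)}$$ holds for all Schwartz functions $f$, with a constant $C$ independent of $f$. Then for every $\alpha\in\mathbb C$ with $$\operatorname{Re}\alpha>s-\frac{n-1}2+\frac1q$$ there is a constant $C'<\infty$, independent of $f$, such that $$\Big\|\sup_{t\in[1,2]}|\mathfrak M^\alpha_t f|\Big\|_{L^q(\mathbb R^n)}\le C'\,\|f\|_{L^p(\mathbb R^n)}$$ for all Schwartz functions $f$ and, more generally, for all $f\in L^p(\mathbb R^n)$ in the following sense: for each $t\in[1,2]$ the distribution $\mathfrak M^\alpha_t f$ is a function in $L^q(\mathbb R^n)$, and these functions can be chosen on null sets so that $t\mapsto\mathfrak M^\alpha_tf(x)$ is continuous on $[1,2]$ for almost every $x$ and the above inequality holds. -/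

import Mathlib

open MeasureTheory
open scoped ENNReal NNReal FourierTransform SchwartzMap

namespace SteinSpherical

open Metric Set

/-- `Γ(β)⁻¹ ∫_{|y| ≤ 1} (1 - |y|²)^(β - 1) g(y) dy`; the integral converges absolutely for
`Re β > 0` and `g` continuous. -/
noncomputable def ballMean {n : ℕ} (β : ℂ) (g : EuclideanSpace ℝ (Fin n) → ℂ) : ℂ :=
  (Complex.Gamma β)⁻¹ *
    ∫ y in closedBall (0 : EuclideanSpace ℝ (Fin n)) 1,
      ((1 - ‖y‖ ^ 2 : ℝ) : ℂ) ^ (β - 1) * g y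

theorem integrableOn_weight {n : ℕ} {a : ℝ} (ha : 0 < a) :
    IntegrableOn (fun y : EuclideanSpace ℝ (Fin n) => (1 - ‖y‖ ^ 2) ^ (a - 1)) (ball 0 1) := by
  rcases subsingleton_or_nontrivial (EuclideanSpace ℝ (Fin n)) with h | h
  · have : (fun y : EuclideanSpace ℝ (Fin n) => (1 - ‖y‖ ^ 2) ^ (a - 1)) = fun _ => (1 : ℝ) := by
      funext y
      simp [Subsingleton.elim y 0]
    rw [this]
    exact integrableOn_const (measure_ball_lt_top.ne)
  · rw [integrableOn_fun_norm_addHaar volume (f := fun r : ℝ => (1 - r ^ 2) ^ (a - 1))]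
    have h1 : IntegrableOn (fun y : ℝ => (1 - y) ^ (a - 1)) (Ioo 0 1) := by
      have := ((intervalIntegral.intervalIntegrable_rpow' (a := 0) (b := 1)
        (r := a - 1) (by linarith)).comp_sub_left 1).symm
      rw [intervalIntegrable_iff_integrableOn_Ioo_of_le (by norm_num)] at this
      simpa using this
    have h2 : ContinuousOn (fun y : ℝ => y ^ (Module.finrank ℝ (EuclideanSpace ℝ (Fin n)) - 1)
        * (1 + y) ^ (a - 1)) (Icc 0 1) := by
      refine (continuous_pow _).continuousOn.mul (ContinuousOn.rpow_const (by fun_prop) ?_)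
      intro y hy
      left
      have := hy.1
      positivity
    have h3 := (integrableOn_Icc_iff_integrableOn_Ioo (μ := volume) |>.mpr h1).mul_continuousOn h2 isCompact_Icc
    refine (h3.mono_set Ioo_subset_Icc_self).congr_fun ?_ measurableSet_Ioo
    intro y hy
    have h4 : (1 - y ^ 2) = (1 - y) * (1 + y) := by ring
    simp only [smul_eq_mul]
    rw [h4, Real.mul_rpow (by linarith [hy.2]) (by linarith [hy.1])]
    ring

theorem closedBall_ae_eq {n : ℕ} :
    (closedBall (0 : EuclideanSpace ℝ (Fin n)) 1) =ᵐ[volume] ball (0 : EuclideanSpace ℝ (Fin n)) 1 := by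
  have h : volume (sphere (0 : EuclideanSpace ℝ (Fin n)) 1) = 0 :=
    Measure.addHaar_sphere_of_ne_zero _ _ one_ne_zero
  rw [← ball_union_sphere]
  exact union_ae_eq_left_of_ae_eq_empty (ae_eq_empty.mpr h)

theorem weight_pos {n : ℕ} {y : EuclideanSpace ℝ (Fin n)} (hy : y ∈ ball (0 : EuclideanSpace ℝ (Fin n)) 1) :
    0 < 1 - ‖y‖ ^ 2 ∧ 1 - ‖y‖ ^ 2 ≤ 1 := by
  have : ‖y‖ < 1 := by simpa using hy
  have h0 := norm_nonneg y
  constructor <;> nlinarith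

theorem aesm_integrand {n : ℕ} (β : ℂ) {g : EuclideanSpace ℝ (Fin n) → ℂ} (hg : Continuous g) :
    AEStronglyMeasurable (fun y => ((1 - ‖y‖ ^ 2 : ℝ) : ℂ) ^ β * g y)
      (volume.restrict (ball (0 : EuclideanSpace ℝ (Fin n)) 1)) := by
  refine ContinuousOn.aestronglyMeasurable ?_ measurableSet_ball
  refine ContinuousOn.mul (ContinuousOn.cpow_const (by fun_prop) ?_) hg.continuousOn
  intro y hy
  exact Complex.ofReal_mem_slitPlane.mpr (weight_pos hy).1

theorem integrable_integrand {n : ℕ} {β : ℂ} (hβ : -1 < β.re)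
    {g : EuclideanSpace ℝ (Fin n) → ℂ} (hg : Continuous g) :
    IntegrableOn (fun y => ((1 - ‖y‖ ^ 2 : ℝ) : ℂ) ^ β * g y)
      (ball (0 : EuclideanSpace ℝ (Fin n)) 1) := by
  obtain ⟨K, hK⟩ := (isCompact_closedBall (0 : EuclideanSpace ℝ (Fin n)) 1).exists_bound_of_continuousOn
    hg.continuousOn
  refine Integrable.mono' ((integrableOn_weight (n := n) (a := β.re + 1) (by linarith)).mul_const K)
    (aesm_integrand β hg) ?_
  refine (ae_restrict_iff' measurableSet_ball).mpr (Filter.Eventually.of_forall fun y hy => ?_)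
  rw [norm_mul, Complex.norm_cpow_eq_rpow_re_of_pos (weight_pos hy).1]
  simp only [add_sub_cancel_right]
  exact mul_le_mul_of_nonneg_left (hK y (ball_subset_closedBall hy))
    (Real.rpow_nonneg (weight_pos hy).1.le _)

theorem differentiableAt_ballMean {n : ℕ} {g : EuclideanSpace ℝ (Fin n) → ℂ} (hg : Continuous g)
    {β : ℂ} (hβ : 0 < β.re) : DifferentiableAt ℂ (fun b => ballMean b g) β := by
  unfold ballMean
  refine (Complex.differentiable_one_div_Gamma β).mul ?_
  simp only [setIntegral_congr_set (closedBall_ae_eq (n := n))]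
  obtain ⟨K, hK⟩ := (isCompact_closedBall (0 : EuclideanSpace ℝ (Fin n)) 1).exists_bound_of_continuousOn
    hg.continuousOn
  set a : ℝ := β.re / 4 with ha
  have ha0 : 0 < a := by positivity
  refine (hasDerivAt_integral_of_dominated_loc_of_deriv_le
    (F' := fun b y => ((1 - ‖y‖ ^ 2 : ℝ) : ℂ) ^ (b - 1) *
      (Complex.log ((1 - ‖y‖ ^ 2 : ℝ) : ℂ) * g y))
    (bound := fun y => (1 - ‖y‖ ^ 2) ^ (a - 1) * (1 / a * K))
    (s := ball β (β.re / 2)) (ball_mem_nhds _ (by positivity))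
    (Filter.Eventually.of_forall fun b => aesm_integrand (b - 1) hg)
    (integrable_integrand (by simpa using hβ) hg) ?_ ?_
    ((integrableOn_weight ha0).mul_const _) ?_).2.differentiableAt
  · refine ContinuousOn.aestronglyMeasurable ?_ measurableSet_ball
    have hs : ∀ y ∈ ball (0 : EuclideanSpace ℝ (Fin n)) 1,
      ((1 - ‖y‖ ^ 2 : ℝ) : ℂ) ∈ Complex.slitPlane := fun y hy =>
        Complex.ofReal_mem_slitPlane.mpr (weight_pos hy).1
    refine ContinuousOn.mul (ContinuousOn.cpow_const (by fun_prop) hs)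
      (ContinuousOn.mul (ContinuousOn.clog (by fun_prop) hs) hg.continuousOn)
  · refine (ae_restrict_iff' measurableSet_ball).mpr (Filter.Eventually.of_forall fun y hy b hb => ?_)
    obtain ⟨hu0, hu1⟩ := weight_pos hy
    have hbre : β.re / 2 < b.re := by
      have h1 : ‖b - β‖ < β.re / 2 := by simpa [dist_eq_norm] using hb
      have h2 := (abs_le.mp (Complex.abs_re_le_norm (b - β))).1
      simp only [Complex.sub_re] at h2
      linarith
    rw [norm_mul, norm_mul, Complex.norm_cpow_eq_rpow_re_of_pos hu0, ← Complex.ofReal_log hu0.le,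
      Complex.norm_real, Real.norm_eq_abs]
    set u := 1 - ‖y‖ ^ 2
    have h3 := (Real.abs_log_mul_self_rpow_lt u a hu0 hu1 ha0).le
    rw [abs_mul, abs_of_nonneg (Real.rpow_nonneg hu0.le a)] at h3
    have h4 : u ^ (b - 1).re ≤ u ^ (a - 1) * u ^ a := by
      rw [← Real.rpow_add hu0]
      refine Real.rpow_le_rpow_of_exponent_ge hu0 hu1 ?_
      simp only [Complex.sub_re, Complex.one_re]
      linarith
    have h5 := hK y (ball_subset_closedBall hy)
    have h6 : 0 ≤ u ^ (a - 1) := Real.rpow_nonneg hu0.le _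
    calc u ^ (b - 1).re * (|Real.log u| * ‖g y‖)
        ≤ (u ^ (a - 1) * u ^ a) * (|Real.log u| * ‖g y‖) := by gcongr
      _ = u ^ (a - 1) * ((|Real.log u| * u ^ a) * ‖g y‖) := by ring
      _ ≤ u ^ (a - 1) * (1 / a * K) := by gcongr
  · refine (ae_restrict_iff' measurableSet_ball).mpr (Filter.Eventually.of_forall fun y hy b hb => ?_)
    obtain ⟨hu0, hu1⟩ := weight_pos hy
    have h1 : HasDerivAt (fun b : ℂ => b - 1) 1 b := (hasDerivAt_id b).sub_const 1
    have h2 := (h1.const_cpow (c := ((1 - ‖y‖ ^ 2 : ℝ) : ℂ))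
      (Or.inl (Complex.ofReal_ne_zero.mpr hu0.ne'))).mul_const (g y)
    rw [mul_one, mul_assoc] at h2
    exact h2


/-- The weight `(1 - |y|²)₊ ^ β`, used to construct the continuation. -/
noncomputable def wt {n : ℕ} (β : ℂ) (y : EuclideanSpace ℝ (Fin n)) : ℂ :=
  ((max (1 - ‖y‖ ^ 2) 0 : ℝ) : ℂ) ^ β

theorem continuous_wt {n : ℕ} {β : ℂ} (hβ : 0 < β.re) :
    Continuous (wt β : EuclideanSpace ℝ (Fin n) → ℂ) :=
  (Complex.continuous_ofReal_cpow_const hβ).comp (by fun_prop)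

theorem wt_zero_of_notMem {n : ℕ} {β : ℂ} (hβ : 0 < β.re) {y : EuclideanSpace ℝ (Fin n)}
    (hy : y ∉ closedBall (0 : EuclideanSpace ℝ (Fin n)) 1) : wt β y = 0 := by
  have h1 : 1 < ‖y‖ := by simpa using hy
  have h2 : max (1 - ‖y‖ ^ 2) 0 = 0 := max_eq_right (by nlinarith)
  have h3 : β ≠ 0 := fun h => by simp [h] at hβ
  simp [wt, h2, h3]

theorem hasCompactSupport_wt {n : ℕ} {β : ℂ} (hβ : 0 < β.re) :
    HasCompactSupport (wt β : EuclideanSpace ℝ (Fin n) → ℂ) :=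
  HasCompactSupport.intro (isCompact_closedBall 0 1) fun _ hy => wt_zero_of_notMem hβ hy

theorem integrable_wt_mul {n : ℕ} {β : ℂ} (hβ : 0 < β.re) {g : EuclideanSpace ℝ (Fin n) → ℂ}
    (hg : Continuous g) : Integrable (fun y => wt β y * g y) :=
  ((continuous_wt hβ).mul hg).integrable_of_hasCompactSupport (hasCompactSupport_wt hβ).mul_right

theorem ballMean_eq {n : ℕ} {β : ℂ} (hβ : 1 < β.re) (g : EuclideanSpace ℝ (Fin n) → ℂ) :
    ballMean β g = (Complex.Gamma β)⁻¹ * ∫ y, wt (β - 1) y * g y := by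
  have hb : 0 < (β - 1).re := by simpa using hβ
  unfold ballMean
  rw [← setIntegral_eq_integral_of_forall_compl_eq_zero
    (s := closedBall (0 : EuclideanSpace ℝ (Fin n)) 1)
    (f := fun y => wt (β - 1) y * g y) fun y hy => by rw [wt_zero_of_notMem hb hy, zero_mul]]
  congr 1
  refine setIntegral_congr_fun measurableSet_closedBall fun y hy => ?_
  have h1 : ‖y‖ ≤ 1 := by simpa using hy
  have h2 : max (1 - ‖y‖ ^ 2) 0 = 1 - ‖y‖ ^ 2 :=
    max_eq_left (by nlinarith [norm_nonneg y])
  simp only [wt, h2]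

theorem hasDerivAt_max_cpow {β : ℂ} (hβ : 2 < β.re) (u : ℝ) :
    HasDerivAt (fun u : ℝ => ((max u 0 : ℝ) : ℂ) ^ β) (β * ((max u 0 : ℝ) : ℂ) ^ (β - 1)) u := by
  have hβ0 : β ≠ 0 := fun h => by norm_num [h] at hβ
  have hβ1 : β - 1 ≠ 0 := fun h => by
    have := congrArg Complex.re h
    simp at this
    linarith
  rcases lt_trichotomy u 0 with hu | hu | hu
  · rw [max_eq_right hu.le, Complex.ofReal_zero, Complex.zero_cpow hβ1, mul_zero]
    refine (hasDerivAt_const u (0 : ℂ)).congr_of_eventuallyEq ?_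
    filter_upwards [eventually_lt_nhds hu] with v hv
    rw [max_eq_right hv.le, Complex.ofReal_zero, Complex.zero_cpow hβ0]
  · subst hu
    rw [max_self, Complex.ofReal_zero, Complex.zero_cpow hβ1, mul_zero]
    have hO : (fun v : ℝ => ((max v 0 : ℝ) : ℂ) ^ β) =O[nhds 0] fun v => ‖v - 0‖ ^ 2 := by
      refine Asymptotics.IsBigO.of_bound 1 ?_
      filter_upwards [eventually_lt_nhds (zero_lt_one (α := ℝ))] with v hv
      rcases le_or_gt v 0 with h | h
      · rw [max_eq_right h, Complex.ofReal_zero, Complex.zero_cpow hβ0, norm_zero]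
        positivity
      · rw [max_eq_left h.le, Complex.norm_cpow_eq_rpow_re_of_pos h]
        have h5 : v ^ β.re ≤ v ^ (2 : ℝ) := Real.rpow_le_rpow_of_exponent_ge h hv.le hβ.le
        simpa using h5
    have := (hO.hasFDerivAt (by norm_num)).hasDerivAt
    simpa using this
  · rw [max_eq_left hu.le]
    have h1 : HasDerivAt (fun x : ℂ => x ^ β) (β * (u : ℂ) ^ (β - 1)) (u : ℂ) := by
      have := (hasDerivAt_id (u : ℂ)).cpow_const (c := β) (Complex.ofReal_mem_slitPlane.mpr hu)
      simpa using this
    refine h1.comp_ofReal.congr_of_eventuallyEq ?_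
    filter_upwards [eventually_gt_nhds hu] with v hv
    rw [max_eq_left hv.le]

theorem hasFDerivAt_wt {n : ℕ} {β : ℂ} (hβ : 2 < β.re) (y : EuclideanSpace ℝ (Fin n)) :
    ∃ D : EuclideanSpace ℝ (Fin n) →L[ℝ] ℂ, HasFDerivAt (wt β) D y ∧
      ∀ v, D v = -2 * β * wt (β - 1) y * (inner ℝ y v : ℝ) := by
  have h1 : HasFDerivAt (fun y : EuclideanSpace ℝ (Fin n) => 1 - ‖y‖ ^ 2)
      (-(2 • (innerSL ℝ y))) y := by
    simpa using ((hasStrictFDerivAt_norm_sq y).hasFDerivAt).const_sub 1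
  have h2 := (hasDerivAt_max_cpow hβ (1 - ‖y‖ ^ 2)).hasFDerivAt.comp y h1
  refine ⟨_, h2, fun v => ?_⟩
  simp [wt]
  ring

theorem wt_norm_sq {n : ℕ} {β : ℂ} (hβ : 1 < β.re) (y : EuclideanSpace ℝ (Fin n)) :
    wt (β - 1) y * ((‖y‖ ^ 2 : ℝ) : ℂ) = wt (β - 1) y - wt β y := by
  have hβ1 : β - 1 ≠ 0 := fun h => by
    have := congrArg Complex.re h
    simp at this
    linarith
  have hβ0 : β ≠ 0 := fun h => by norm_num [h] at hβ
  unfold wt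
  rcases le_or_gt (1 - ‖y‖ ^ 2) 0 with h | h
  · rw [max_eq_right h, Complex.ofReal_zero, Complex.zero_cpow hβ1, Complex.zero_cpow hβ0]
    ring
  · rw [max_eq_left h.le]
    have hu : ((1 - ‖y‖ ^ 2 : ℝ) : ℂ) ≠ 0 := Complex.ofReal_ne_zero.mpr h.ne'
    have : ((1 - ‖y‖ ^ 2 : ℝ) : ℂ) ^ β
        = ((1 - ‖y‖ ^ 2 : ℝ) : ℂ) ^ (β - 1) * ((1 - ‖y‖ ^ 2 : ℝ) : ℂ) := by
      nth_rewrite 3 [← Complex.cpow_one ((1 - ‖y‖ ^ 2 : ℝ) : ℂ)]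
      rw [← Complex.cpow_add _ _ hu, sub_add_cancel]
    rw [this]
    push_cast
    ring

/-- The radial derivative `y ↦ y · ∇g(y)`. -/
noncomputable def radialDeriv {n : ℕ} (g : EuclideanSpace ℝ (Fin n) → ℂ)
    (y : EuclideanSpace ℝ (Fin n)) : ℂ := fderiv ℝ g y y

theorem integral_parts {n : ℕ} {β : ℂ} (hβ : 2 < β.re) {g : EuclideanSpace ℝ (Fin n) → ℂ}
    (hg : ContDiff ℝ 1 g) :
    ∫ y, wt β y * (n * g y + radialDeriv g y) =
      2 * β * (∫ y, wt (β - 1) y * g y) - 2 * β * ∫ y, wt β y * g y := by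
  have hb0 : 0 < β.re := by linarith
  have hb1 : 0 < (β - 1).re := by simp; linarith
  have hgd : Differentiable ℝ g := hg.differentiable one_ne_zero
  have hgf : Continuous (fderiv ℝ g) := hg.continuous_fderiv one_ne_zero
  let e : Fin n → EuclideanSpace ℝ (Fin n) := fun i => EuclideanSpace.single i 1
  have hderiv : ∀ i y, fderiv ℝ (fun y : EuclideanSpace ℝ (Fin n) => ((y i : ℝ) : ℂ) * g y) y (e i)
      = g y + ((y i : ℝ) : ℂ) * fderiv ℝ g y (e i) := by
    intro i y
    have h1 : HasFDerivAt (fun y : EuclideanSpace ℝ (Fin n) => ((y i : ℝ) : ℂ))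
        (Complex.ofRealCLM.comp (EuclideanSpace.proj i)) y :=
      (Complex.ofRealCLM.comp (EuclideanSpace.proj (𝕜 := ℝ) i)).hasFDerivAt
    have h2 : HasFDerivAt (fun y : EuclideanSpace ℝ (Fin n) => ((y i : ℝ) : ℂ) * g y) _ y :=
      h1.mul (hgd y).hasFDerivAt
    rw [h2.fderiv]
    simp [e]
    ring
  have hfw : ∀ i y, fderiv ℝ (wt β : EuclideanSpace ℝ (Fin n) → ℂ) y (e i)
      = -2 * β * wt (β - 1) y * ((y i : ℝ) : ℂ) := by
    intro i y
    obtain ⟨D, hD, hv⟩ := hasFDerivAt_wt hβ y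
    rw [hD.fderiv, hv]
    simp [e, EuclideanSpace.inner_single_right]
  have hyc : ∀ i, Continuous fun y : EuclideanSpace ℝ (Fin n) => ((y i : ℝ) : ℂ) := fun i => by
    fun_prop
  have hge : ∀ i, Continuous fun y => fderiv ℝ g y (e i) := fun i => hgf.clm_apply continuous_const
  have key : ∀ i, ∫ y, wt β y * (g y + ((y i : ℝ) : ℂ) * fderiv ℝ g y (e i)) =
      ∫ y, wt (β - 1) y * (2 * β * ((y i : ℝ) : ℂ) ^ 2 * g y) := by
    intro i
    have := integral_mul_fderiv_eq_neg_fderiv_mul_of_integrable (μ := volume)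
      (f := (wt β : EuclideanSpace ℝ (Fin n) → ℂ))
      (g := fun y : EuclideanSpace ℝ (Fin n) => ((y i : ℝ) : ℂ) * g y) (v := e i) ?_ ?_ ?_
      (fun x _ => (hasFDerivAt_wt hβ x).choose_spec.1.differentiableAt) ?_
    · simp only [hderiv, hfw] at this
      rw [this, ← integral_neg]
      congr 1
      funext y
      ring
    · simp only [hfw]
      have := integrable_wt_mul hb1 (g := fun y : EuclideanSpace ℝ (Fin n) =>
        -2 * β * ((y i : ℝ) : ℂ) * (((y i : ℝ) : ℂ) * g y))
        ((continuous_const.mul (hyc i)).mul ((hyc i).mul hg.continuous))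
      refine this.congr (Filter.Eventually.of_forall fun y => ?_)
      simp only
      ring
    · simp only [hderiv]
      exact integrable_wt_mul hb0 (hg.continuous.add ((hyc i).mul (hge i)))
    · exact integrable_wt_mul hb0 ((hyc i).mul hg.continuous)
    · intro x _
      exact ((Complex.ofRealCLM.comp
        (EuclideanSpace.proj (𝕜 := ℝ) i)).differentiableAt).mul (hgd x)
  have hL : ∀ y, wt β y * (n * g y + radialDeriv g y)
      = ∑ i, wt β y * (g y + ((y i : ℝ) : ℂ) * fderiv ℝ g y (e i)) := by
    intro y
    have h1 : radialDeriv g y = ∑ i, ((y i : ℝ) : ℂ) * fderiv ℝ g y (e i) := by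
      have h2 : y = ∑ i, y i • e i := by
        ext j
        simp [e, Finset.sum_apply, Pi.single_apply]
      unfold radialDeriv
      conv_lhs => rw [show fderiv ℝ g y y = fderiv ℝ g y (∑ i, y i • e i) from congrArg _ h2]
      simp
    rw [h1, ← Finset.mul_sum, Finset.sum_add_distrib]
    simp
  simp only [hL]
  have hint : ∀ i, Integrable fun y : EuclideanSpace ℝ (Fin n) =>
      wt β y * (g y + ((y i : ℝ) : ℂ) * fderiv ℝ g y (e i)) := fun i =>
    integrable_wt_mul hb0 (hg.continuous.add ((hyc i).mul (hge i)))
  have hint' : ∀ i, Integrable fun y : EuclideanSpace ℝ (Fin n) =>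
      wt (β - 1) y * (2 * β * ((y i : ℝ) : ℂ) ^ 2 * g y) := fun i =>
    integrable_wt_mul hb1 ((continuous_const.mul ((hyc i).pow 2)).mul hg.continuous)
  rw [integral_finsetSum _ fun i _ => hint i]
  simp only [key]
  rw [← integral_finsetSum _ fun i _ => hint' i]
  rw [← integral_const_mul, ← integral_const_mul, ← integral_sub
    ((integrable_wt_mul hb1 hg.continuous).const_mul _)
    ((integrable_wt_mul hb0 hg.continuous).const_mul _)]
  congr 1
  funext y
  have h3 : ((‖y‖ ^ 2 : ℝ) : ℂ) = ∑ i, ((y i : ℝ) : ℂ) ^ 2 := by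
    rw [EuclideanSpace.real_norm_sq_eq]
    push_cast
    rfl
  have h4 := wt_norm_sq (β := β) (by linarith) y
  rw [h3] at h4
  have h5 : ∑ i, wt (β - 1) y * (2 * β * ((y i : ℝ) : ℂ) ^ 2 * g y)
      = 2 * β * g y * (wt (β - 1) y * ∑ i, ((y i : ℝ) : ℂ) ^ 2) := by
    rw [Finset.mul_sum, Finset.mul_sum]
    refine Finset.sum_congr rfl fun i _ => ?_
    ring
  rw [h5, h4]
  ring

theorem ballMean_recurrence {n : ℕ} {β : ℂ} (hβ : 2 < β.re) {g : EuclideanSpace ℝ (Fin n) → ℂ}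
    (hg : ContDiff ℝ 1 g) :
    ballMean β g = (β + n / 2) * ballMean (β + 1) g + 1 / 2 * ballMean (β + 1) (radialDeriv g) := by
  have hβ0 : β ≠ 0 := fun h => by norm_num [h] at hβ
  have hG : Complex.Gamma β ≠ 0 := Complex.Gamma_ne_zero_of_re_pos (by linarith)
  have hr : Continuous (radialDeriv g) := (hg.continuous_fderiv one_ne_zero).clm_apply continuous_id
  have hb0 : 0 < β.re := by linarith
  have h := integral_parts hβ hg
  have h1 : ∫ y, wt β y * (n * g y + radialDeriv g y)
      = n * (∫ y, wt β y * g y) + ∫ y, wt β y * radialDeriv g y := by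
    rw [← integral_const_mul, ← integral_add ((integrable_wt_mul hb0 hg.continuous).const_mul _)
      (integrable_wt_mul hb0 hr)]
    congr 1
    funext y
    ring
  rw [h1] at h
  rw [ballMean_eq (by linarith), ballMean_eq (by simp; linarith), ballMean_eq (by simp; linarith),
    Complex.Gamma_add_one β hβ0, add_sub_cancel_right]
  set A := ∫ y, wt (β - 1) y * g y
  set B := ∫ y, wt β y * g y
  set C := ∫ y, wt β y * radialDeriv g y
  field_simp
  linear_combination -h

theorem exists_halfPlane_continuation {n : ℕ} (k : ℕ) :
    ∀ g : EuclideanSpace ℝ (Fin n) → ℂ, ContDiff ℝ (⊤ : ℕ∞) g →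
      ∃ F : ℂ → ℂ, DifferentiableOn ℂ F {β | -(k : ℝ) < β.re} ∧
        ∀ β : ℂ, 0 < β.re → F β = ballMean β g := by
  induction k with
  | zero =>
    intro g hg
    refine ⟨fun β => ballMean β g, fun β hβ => ?_, fun β _ => rfl⟩
    exact (differentiableAt_ballMean hg.continuous (by simpa using hβ)).differentiableWithinAt
  | succ k ih =>
    intro g hg
    have hr : ContDiff ℝ (⊤ : ℕ∞) (radialDeriv g) :=
      (hg.fderiv_right (m := (⊤ : ℕ∞)) (by simp)).clm_apply contDiff_id
    obtain ⟨F, hF, hF'⟩ := ih g hg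
    obtain ⟨H, hH, hH'⟩ := ih _ hr
    have hmaps : MapsTo (fun β : ℂ => β + 1) {β | -((k + 1 : ℕ) : ℝ) < β.re}
        {β | -(k : ℝ) < β.re} := by
      intro β hβ
      simp only [mem_ofPred_eq, Nat.cast_add, Nat.cast_one, Complex.add_re, Complex.one_re] at hβ ⊢
      linarith
    have hd : DifferentiableOn ℂ (fun β : ℂ => (β + n / 2) * F (β + 1) + 1 / 2 * H (β + 1))
        {β | -((k + 1 : ℕ) : ℝ) < β.re} :=
      (DifferentiableOn.mul (by fun_prop) (hF.comp (by fun_prop) hmaps)).add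
        ((hH.comp (by fun_prop) hmaps).const_mul _)
    refine ⟨_, hd, ?_⟩
    have hopen : IsOpen {β : ℂ | 0 < β.re} := isOpen_lt continuous_const Complex.continuous_re
    have h1 : AnalyticOnNhd ℂ (fun β : ℂ => (β + n / 2) * F (β + 1) + 1 / 2 * H (β + 1))
        {β | 0 < β.re} := by
      refine (hd.mono fun β hβ => ?_).analyticOnNhd hopen
      have h0 : (0 : ℝ) < β.re := hβ
      have : (0 : ℝ) ≤ ((k + 1 : ℕ) : ℝ) := Nat.cast_nonneg _
      simp only [mem_ofPred_eq]
      linarith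
    have h2 : AnalyticOnNhd ℂ (fun β : ℂ => ballMean β g) {β | 0 < β.re} :=
      DifferentiableOn.analyticOnNhd (fun β hβ =>
        (differentiableAt_ballMean hg.continuous hβ).differentiableWithinAt) hopen
    refine h1.eqOn_of_preconnected_of_eventuallyEq h2
      (convex_halfSpace_re_gt 0).isPreconnected (z₀ := 3) (by simp) ?_
    have h3 : ∀ᶠ β : ℂ in nhds 3, 2 < β.re :=
      (isOpen_lt continuous_const Complex.continuous_re).mem_nhds (by simp; norm_num)
    filter_upwards [h3] with β hβ
    rw [hF' _ (by simp; linarith), hH' _ (by simp; linarith),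
      ← ballMean_recurrence hβ (hg.of_le (by exact_mod_cast le_top))]

/-- For smooth `g`, the function `β ↦ ballMean β g` on `Re β > 0` extends to an entire function. -/
theorem exists_entire_continuation {n : ℕ} {g : EuclideanSpace ℝ (Fin n) → ℂ}
    (hg : ContDiff ℝ (⊤ : ℕ∞) g) :
    ∃ F : ℂ → ℂ, Differentiable ℂ F ∧ ∀ β : ℂ, 0 < β.re → F β = ballMean β g := by
  choose F hF hF' using fun k : ℕ => exists_halfPlane_continuation k g hg
  have hopen : ∀ k : ℕ, IsOpen {β : ℂ | -(k : ℝ) < β.re} := fun k =>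
    isOpen_lt continuous_const Complex.continuous_re
  have hEq : ∀ k l : ℕ, k ≤ l → EqOn (F k) (F l) {β | -(k : ℝ) < β.re} := by
    intro k l hkl
    have hsub : {β : ℂ | -(k : ℝ) < β.re} ⊆ {β : ℂ | -(l : ℝ) < β.re} := by
      intro β hβ
      have h0 : (k : ℝ) ≤ l := Nat.cast_le.mpr hkl
      simp only [mem_ofPred_eq] at hβ ⊢
      linarith
    refine ((hF k).analyticOnNhd (hopen k)).eqOn_of_preconnected_of_eventuallyEq
      (((hF l).mono hsub).analyticOnNhd (hopen k)) (convex_halfSpace_re_gt _).isPreconnected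
      (z₀ := 1) ?_ ?_
    · have : (0 : ℝ) ≤ (k : ℝ) := Nat.cast_nonneg _
      simp only [mem_ofPred_eq, Complex.one_re]
      linarith
    · have h3 : ∀ᶠ β : ℂ in nhds 1, 0 < β.re :=
        (isOpen_lt continuous_const Complex.continuous_re).mem_nhds (by simp)
      filter_upwards [h3] with β hβ
      rw [hF' k β hβ, hF' l β hβ]
  let N : ℂ → ℕ := fun β => ⌈-β.re⌉₊ + 1
  have hN : ∀ β : ℂ, -(N β : ℝ) < β.re := fun β => by
    have := Nat.le_ceil (-β.re)
    simp only [N, Nat.cast_add, Nat.cast_one]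
    linarith
  have hval : ∀ (k : ℕ) (β : ℂ), -(k : ℝ) < β.re → F (N β) β = F k β := by
    intro k β hβ
    rcases le_total (N β) k with h | h
    · exact hEq _ _ h (hN β)
    · exact (hEq _ _ h hβ).symm
  refine ⟨fun β => F (N β) β, fun β => ?_, fun β hβ => hF' _ β hβ⟩
  have h1 : {b : ℂ | -(N β : ℝ) < b.re} ∈ nhds β := (hopen (N β)).mem_nhds (hN β)
  refine ((hF (N β)).differentiableAt h1).congr_of_eventuallyEq ?_
  filter_upwards [h1] with b hb
  exact hval _ _ hb

/-- Entire functions that agree on `Re β > 0` are equal. -/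
theorem entire_ext {F H : ℂ → ℂ} (hF : Differentiable ℂ F) (hH : Differentiable ℂ H)
    (h : ∀ β : ℂ, 0 < β.re → F β = H β) : F = H := by
  refine AnalyticOnNhd.eq_of_eventuallyEq (z₀ := 1)
    (hF.differentiableOn.analyticOnNhd isOpen_univ)
    (hH.differentiableOn.analyticOnNhd isOpen_univ) ?_
  have h3 : ∀ᶠ β : ℂ in nhds 1, 0 < β.re :=
    (isOpen_lt continuous_const Complex.continuous_re).mem_nhds (by simp)
  exact h3.mono h

theorem contDiff_shift {n : ℕ} (t : ℝ) (f : 𝓢(EuclideanSpace ℝ (Fin n), ℂ))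
    (x : EuclideanSpace ℝ (Fin n)) : ContDiff ℝ (⊤ : ℕ∞) fun y => f (x - t • y) :=
  (f.smooth ⊤).comp (by fun_prop)

/-- Stein's spherical mean `𝔐^α_t f(x)` of complex order `α` of a Schwartz function: the value at
`α` of the unique entire function which for `Re β > 0` is given by
`Γ(β)⁻¹ ∫_{|y| ≤ 1} (1 - |y|²)^(β - 1) f(x - t y) dy`. -/
noncomputable def steinMean {n : ℕ} (α : ℂ) (t : ℝ) (f : 𝓢(EuclideanSpace ℝ (Fin n), ℂ))
    (x : EuclideanSpace ℝ (Fin n)) : ℂ :=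
  (exists_entire_continuation (contDiff_shift t f x)).choose α

theorem differentiable_steinMean {n : ℕ} (t : ℝ) (f : 𝓢(EuclideanSpace ℝ (Fin n), ℂ))
    (x : EuclideanSpace ℝ (Fin n)) : Differentiable ℂ fun α => steinMean α t f x :=
  (exists_entire_continuation (contDiff_shift t f x)).choose_spec.1

theorem steinMean_of_re_pos {n : ℕ} {α : ℂ} (hα : 0 < α.re) (t : ℝ)
    (f : 𝓢(EuclideanSpace ℝ (Fin n), ℂ)) (x : EuclideanSpace ℝ (Fin n)) :
    steinMean α t f x = (Complex.Gamma α)⁻¹ *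
      ∫ y in closedBall (0 : EuclideanSpace ℝ (Fin n)) 1,
        ((1 - ‖y‖ ^ 2 : ℝ) : ℂ) ^ (α - 1) * f (x - t • y) :=
  (exists_entire_continuation (contDiff_shift t f x)).choose_spec.2 α hα

theorem steinMean_unique {n : ℕ} (t : ℝ) (f : 𝓢(EuclideanSpace ℝ (Fin n), ℂ))
    (x : EuclideanSpace ℝ (Fin n)) {F : ℂ → ℂ} (hF : Differentiable ℂ F)
    (h : ∀ β : ℂ, 0 < β.re → F β = (Complex.Gamma β)⁻¹ *
      ∫ y in closedBall (0 : EuclideanSpace ℝ (Fin n)) 1,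
        ((1 - ‖y‖ ^ 2 : ℝ) : ℂ) ^ (β - 1) * f (x - t • y)) (α : ℂ) :
    F α = steinMean α t f x :=
  congrFun (entire_ext hF (differentiable_steinMean t f x) fun β hβ => by
    rw [h β hβ, steinMean_of_re_pos hβ]) α

/-- `u = 𝔐^α_t f` for a (not necessarily smooth) function `f`, in the sense of tempered
distributions. The kernel of `𝔐^α_t` is even, so the operator is its own transpose for the bilinear
pairing `∫ u φ`, and `𝔐^α_t f` is the distribution `φ ↦ ∫ f · 𝔐^α_t φ`. -/
def IsSteinMean {n : ℕ} (α : ℂ) (t : ℝ) (f u : EuclideanSpace ℝ (Fin n) → ℂ) : Prop :=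
  ∀ φ : 𝓢(EuclideanSpace ℝ (Fin n), ℂ), ∫ x, u x * φ x = ∫ x, f x * steinMean α t φ x

/-- The half-wave propagator `e^{it√-Δ} f(x) = ∫ e^{2πi(x·ξ + t|ξ|)} 𝓕f(ξ) dξ`, where
`𝓕f(ξ) = ∫ e^{-2πi x·ξ} f(x) dx`, so that `√-Δ` has the symbol `2π|ξ|`. -/
noncomputable def halfWave {n : ℕ} (t : ℝ) (f : 𝓢(EuclideanSpace ℝ (Fin n), ℂ))
    (x : EuclideanSpace ℝ (Fin n)) : ℂ :=
  𝓕⁻ (fun ξ : EuclideanSpace ℝ (Fin n) =>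
    Complex.exp (2 * Real.pi * Complex.I * t * ‖ξ‖) * 𝓕 (f : EuclideanSpace ℝ (Fin n) → ℂ) ξ) x

/-- The Sobolev norm `‖f‖_{W^{s,p}} = ‖⟨D⟩^s f‖_{L^p}`, where `⟨D⟩^s` is the Fourier multiplier
with the symbol `(1 + |ξ|²)^(s/2)`. -/
noncomputable def sobolevNorm {n : ℕ} (s : ℝ) (p : ℝ≥0∞) (f : 𝓢(EuclideanSpace ℝ (Fin n), ℂ)) :
    ℝ≥0∞ :=
  eLpNorm (𝓕⁻ (fun ξ : EuclideanSpace ℝ (Fin n) =>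
    (((1 + ‖ξ‖ ^ 2) ^ (s / 2) : ℝ) : ℂ) * 𝓕 (f : EuclideanSpace ℝ (Fin n) → ℂ) ξ)) p volume

/-- The local smoothing estimate
`‖e^{it√-Δ} f‖_{L^q(ℝⁿ × [1,2])} ≤ C ‖f‖_{W^{s,p}(ℝⁿ)}` for Schwartz functions. -/
def LocalSmoothing (n : ℕ) (p q : ℝ≥0∞) (s : ℝ) : Prop :=
  ∃ C : ℝ≥0, ∀ f : 𝓢(EuclideanSpace ℝ (Fin n), ℂ),
    eLpNorm (fun z : EuclideanSpace ℝ (Fin n) × ℝ => halfWave z.2 f z.1) q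
      (volume.prod (volume.restrict (Icc 1 2))) ≤ C * sobolevNorm s p f

end SteinSpherical

/-!
The spherical mean `𝔐^α_t` averages `f` over the ball with the weight `(1 - |y|²)^(α - 1)`, so on the
Fourier side it is the multiplier obtained by integrating `e^{-2πi t ξ·y}` against that weight.
Slicing the ball orthogonally to `ξ` turns this into a one-dimensional integral of `e^{2πi t r|ξ|}`
with the weight `(1 - r²)^(λ - 1)`, `λ = α + (n - 1)/2`. Hence `𝔐^α_t f` is a mean of order `λ` of the
half-wave flow over the times `[-t, t]` (`steinMean_eq_integral_halfWave`; analytic continuation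
reaches all `α` with `Re λ > 0`).

The half-wave flow continues analytically to times in the upper half-plane, where `e^{i(t + iu)√-Δ}`
is damped. Cauchy's theorem (`integral_contour_shift`) moves the integral over `[-t, t]` to the other
three sides of a rectangle (`enorm_steinMean_le`). The weight is bounded on the top side, where the
flow is smoothing (`exists_top_bound`), and is comparable to `u^(λ - 1)` on the vertical sides at
height `u`. There the flow is estimated as follows.

* The Poisson semigroup is subordinate to the heat semigroup (`exp_neg_mul_eq_integral`), and heat
  regularization at scale `c` maps `L^p` to `W^{s,p}` with norm `O(1 + c^{-s'})`, for any `s' > s`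
  (`sobolevNorm_heat_le`). So the local smoothing estimate gives an `L^p → L^q` space-time estimate
  at height `u` with the loss `u^{-s'}` (`eLpNorm_cwave_le`).
* The flow is holomorphic, so by Cauchy's estimate a time derivative at height `u` costs `u^{-1}`.
  The one-dimensional Sobolev inequality on intervals of length about `u` then bounds the supremum
  over the times, with the further loss `u^{-1/q}` (`exists_horizontal_bound`).

Altogether the vertical sides contribute at most `∫ u^{Re λ - 1 - s' - 1/q} du`, which converges at
`u = 0` for a suitable `s' > s` precisely when `Re λ > s + 1/q`; this is the assumption on `α`.
Dilations carry the estimate from a short interval of times to `[1, 2]` (`maximalBound_Icc_one_two`).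
The bound for the heat flow needs `s ≥ 0`, but wave packets of high frequency are transported almost
rigidly, so no local smoothing estimate holds with `s < 0` (`LocalSmoothing.nonneg`).

The passage from Schwartz functions to `L^p` is a density argument for `p < ∞`
(`MaximalBound.exists_extension`); the distribution `φ ↦ ∫ f 𝔐^α_t φ` is identified through the
self-duality `integral_steinMean_mul` of the means and their rapid decay on Schwartz functions
(`exists_pow_mul_norm_steinMean_le`). For `p = q = ∞` Schwartz functions are not dense. But a maximal
estimate on `L^∞` fails for negative orders, where the kernel is not integrable
(`MaximalBound.not_top_of_neg`), and a local smoothing estimate that reached an order `Re α ≤ 0` would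
also reach negative ones. So `Re α > 0` (`LocalSmoothing.re_pos_of_top`), and `𝔐^α_t` is given by the
dilates of an integrable kernel (`exists_extension_top`).
-/

namespace SteinSpherical

variable {n : ℕ}

/-! ### Integral inequalities in `L^q` -/

/-- **Minkowski's integral inequality** in a dominated form: if the `L^q` norms of the slices
`F(·, v)` are at most `K v * A`, then `∫ F(·, v) dν(v)` has `L^q` norm at most `A ∫ K dν`. -/
theorem eLpNorm_lintegral_le {X V : Type*} [MeasurableSpace X] [MeasurableSpace V]
    {μ : Measure X} {ν : Measure V} [SFinite μ] [SFinite ν] {q : ℝ≥0∞} (hq : 1 ≤ q)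
    {F : X → V → ℝ≥0∞} (hF : AEMeasurable (Function.uncurry F) (μ.prod ν))
    {K : V → ℝ≥0∞} (hK : AEMeasurable K ν) (hK0 : ∀ᵐ v ∂ν, K v ≠ 0) (hKt : ∀ᵐ v ∂ν, K v ≠ ∞)
    {A : ℝ≥0∞} (h : ∀ᵐ v ∂ν, eLpNorm (fun x => F x v) q μ ≤ K v * A) :
    eLpNorm (fun x => ∫⁻ v, F x v ∂ν) q μ ≤ A * ∫⁻ v, K v ∂ν := by
  -- measurable representatives agree with `F` on almost every slice, in both directions
  wlog hm : Measurable (Function.uncurry F) ∧ Measurable K generalizing F K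
  · have e1 : ∀ᵐ x ∂μ, ∀ᵐ v ∂ν, F x v = hF.mk (Function.uncurry F) (x, v) :=
      Measure.ae_ae_of_ae_prod hF.ae_eq_mk
    have e2 : ∀ᵐ v ∂ν, ∀ᵐ x ∂μ, F x v = hF.mk (Function.uncurry F) (x, v) := by
      have := (Measure.measurePreserving_swap (μ := ν) (ν := μ)).quasiMeasurePreserving.ae
        hF.ae_eq_mk
      exact Measure.ae_ae_of_ae_prod this
    have := this (F := fun x v => hF.mk (Function.uncurry F) (x, v)) (K := hK.mk K)
      hF.measurable_mk.aemeasurable hK.measurable_mk.aemeasurable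
      (by filter_upwards [hK0, hK.ae_eq_mk] with v h1 h2; rwa [← h2])
      (by filter_upwards [hKt, hK.ae_eq_mk] with v h1 h2; rwa [← h2])
      (by
        filter_upwards [h, e2, hK.ae_eq_mk] with v h1 h2 h3
        rw [← h3, ← eLpNorm_congr_ae h2]
        exact h1)
      ⟨hF.measurable_mk, hK.measurable_mk⟩
    rw [lintegral_congr_ae hK.ae_eq_mk]
    refine le_trans (le_of_eq (eLpNorm_congr_ae ?_)) this
    filter_upwards [e1] with x hx
    exact lintegral_congr_ae hx
  obtain ⟨hFm, hKm⟩ := hm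
  rcases eq_or_ne q ∞ with rfl | hqt
  · have h1 : ∀ᵐ v ∂ν, ∀ᵐ x ∂μ, F x v ≤ K v * A := by
      filter_upwards [h] with v hv
      rw [eLpNorm_exponent_top] at hv
      filter_upwards [ae_le_eLpNormEssSup (f := fun x => F x v) (μ := μ)] with x hx
      exact le_trans (by simpa using hx) hv
    have h2 : ∀ᵐ x ∂μ, ∀ᵐ v ∂ν, F x v ≤ K v * A := by
      rw [Measure.ae_ae_comm]
      · exact h1
      · exact measurableSet_le hFm ((hKm.comp measurable_snd).mul_const A)
    rw [eLpNorm_exponent_top]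
    refine eLpNormEssSup_le_of_ae_enorm_bound ?_
    filter_upwards [h2] with x hx
    rw [enorm_eq_self]
    calc ∫⁻ v, F x v ∂ν ≤ ∫⁻ v, K v * A ∂ν := lintegral_mono_ae hx
      _ = A * ∫⁻ v, K v ∂ν := by rw [lintegral_mul_const _ hKm, mul_comm]
  have hq0 : q ≠ 0 := (zero_lt_one.trans_le hq).ne'
  set r := q.toReal with hr
  have hr1 : 1 ≤ r := by
    rw [hr, ← ENNReal.toReal_one]
    exact (ENNReal.toReal_le_toReal ENNReal.one_ne_top hqt).2 hq
  have hr0 : 0 < r := by linarith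
  have hslice : ∀ᵐ v ∂ν, ∫⁻ x, F x v ^ r ∂μ ≤ (K v * A) ^ r := by
    filter_upwards [h] with v hv
    rw [eLpNorm_eq_lintegral_rpow_enorm_toReal hq0 hqt] at hv
    simp only [enorm_eq_self] at hv
    rwa [one_div, ENNReal.rpow_inv_le_iff hr0] at hv
  rw [eLpNorm_eq_lintegral_rpow_enorm_toReal hq0 hqt, one_div, ENNReal.rpow_inv_le_iff hr0]
  simp only [enorm_eq_self]
  rcases hr1.eq_or_lt with hr1 | hr1
  · simp only [← hr, ← hr1, ENNReal.rpow_one] at hslice ⊢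
    rw [lintegral_lintegral_swap hFm.aemeasurable]
    calc ∫⁻ v, ∫⁻ x, F x v ∂μ ∂ν ≤ ∫⁻ v, K v * A ∂ν := lintegral_mono_ae hslice
      _ = A * ∫⁻ v, K v ∂ν := by rw [lintegral_mul_const _ hKm, mul_comm]
  · have hc : r.HolderConjugate (r.conjExponent) := Real.HolderConjugate.conjExponent hr1
    set r' := r.conjExponent
    have hr'0 : 0 < r' := hc.symm.pos
    -- Hölder, with the integrand split as `(F K^{-1/r'}) K^{1/r'}`
    have hpt : ∀ x, (∫⁻ v, F x v ∂ν) ^ r ≤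
        (∫⁻ v, F x v ^ r * K v ^ (1 - r) ∂ν) * (∫⁻ v, K v ∂ν) ^ (r - 1) := by
      intro x
      have hFx : Measurable (F x) := hFm.comp measurable_prodMk_left
      have e : ∫⁻ v, F x v ∂ν = ∫⁻ v, (F x v * K v ^ (-(1 / r'))) * K v ^ (1 / r') ∂ν := by
        refine lintegral_congr_ae ?_
        filter_upwards [hK0, hKt] with v h0 ht
        rw [mul_assoc, ← ENNReal.rpow_add _ _ h0 ht, neg_add_cancel, ENNReal.rpow_zero, mul_one]
      have := ENNReal.lintegral_mul_le_Lp_mul_Lq ν hc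
        (f := fun v => F x v * K v ^ (-(1 / r'))) (g := fun v => K v ^ (1 / r'))
        (hFx.mul (hKm.pow_const _)).aemeasurable (hKm.pow_const _).aemeasurable
      calc (∫⁻ v, F x v ∂ν) ^ r ≤ ((∫⁻ v, (F x v * K v ^ (-(1 / r'))) ^ r ∂ν) ^ (1 / r) *
            (∫⁻ v, (K v ^ (1 / r')) ^ r' ∂ν) ^ (1 / r')) ^ r := by
            rw [e]
            exact ENNReal.rpow_le_rpow this hr0.le
        _ = (∫⁻ v, F x v ^ r * K v ^ (1 - r) ∂ν) * (∫⁻ v, K v ∂ν) ^ (r - 1) := by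
            have hrr : r / r' = r - 1 := hc.div_conj_eq_sub_one
            rw [ENNReal.mul_rpow_of_nonneg _ _ hr0.le, ← ENNReal.rpow_mul, ← ENNReal.rpow_mul,
              one_div_mul_cancel hr0.ne', ENNReal.rpow_one]
            congr 1
            · refine lintegral_congr fun v => ?_
              rw [ENNReal.mul_rpow_of_nonneg _ _ hr0.le, ← ENNReal.rpow_mul]
              congr 2
              rw [neg_mul, one_div_mul_eq_div, hrr]
              ring
            · rw [one_div_mul_eq_div, hrr]
              congr 1
              refine lintegral_congr fun v => ?_
              rw [← ENNReal.rpow_mul, one_div_mul_cancel hr'0.ne', ENNReal.rpow_one]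
    have hmeas : Measurable (Function.uncurry fun x v => F x v ^ r * K v ^ (1 - r)) :=
      (hFm.pow_const r).mul ((hKm.comp measurable_snd).pow_const (1 - r))
    calc ∫⁻ x, (∫⁻ v, F x v ∂ν) ^ r ∂μ
        ≤ ∫⁻ x, (∫⁻ v, F x v ^ r * K v ^ (1 - r) ∂ν) * (∫⁻ v, K v ∂ν) ^ (r - 1) ∂μ :=
          lintegral_mono hpt
      _ = (∫⁻ v, ∫⁻ x, F x v ^ r * K v ^ (1 - r) ∂μ ∂ν) * (∫⁻ v, K v ∂ν) ^ (r - 1) := by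
          have hm : Measurable fun x => ∫⁻ v, F x v ^ r * K v ^ (1 - r) ∂ν :=
            hmeas.lintegral_prod_right'
          rw [lintegral_mul_const _ hm, lintegral_lintegral_swap hmeas.aemeasurable]
      _ ≤ (∫⁻ v, K v * A ^ r ∂ν) * (∫⁻ v, K v ∂ν) ^ (r - 1) := by
          refine mul_le_mul_left (lintegral_mono_ae ?_) _
          filter_upwards [hslice, hK0, hKt] with v hv h0 ht
          have hFv : Measurable fun x => F x v := hFm.comp measurable_prodMk_right
          rw [lintegral_mul_const _ (hFv.pow_const r)]
          calc (∫⁻ x, F x v ^ r ∂μ) * K v ^ (1 - r) ≤ (K v * A) ^ r * K v ^ (1 - r) :=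
                mul_le_mul_left hv _
            _ = (K v ^ r * K v ^ (1 - r)) * A ^ r := by
                rw [ENNReal.mul_rpow_of_nonneg _ _ hr0.le]
                ring
            _ = K v * A ^ r := by
                rw [← ENNReal.rpow_add _ _ h0 ht, add_sub_cancel, ENNReal.rpow_one]
      _ = (A * ∫⁻ v, K v ∂ν) ^ r := by
          rw [lintegral_mul_const _ hKm, ENNReal.mul_rpow_of_nonneg _ _ hr0.le]
          have e : (∫⁻ v, K v ∂ν) ^ r = (∫⁻ v, K v ∂ν) * (∫⁻ v, K v ∂ν) ^ (r - 1) := by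
            nth_rewrite 2 [← ENNReal.rpow_one (∫⁻ v, K v ∂ν)]
            rw [← ENNReal.rpow_add_of_nonneg _ _ zero_le_one (by linarith), add_sub_cancel]
          rw [e]
          ring

/-- A function in `L^p` with a uniform bound lies in `L^q` for `p ≤ q`. -/
theorem eLpNorm_le_of_le_of_forall_le {X : Type*} [MeasurableSpace X] {μ : Measure X}
    {p q : ℝ≥0∞} (hp : 1 ≤ p) (hpq : p ≤ q) {h : X → ℝ≥0∞} {A : ℝ≥0∞} (hA : A ≠ ∞)
    (h1 : eLpNorm h p μ ≤ A) (h2 : ∀ x, h x ≤ A) : eLpNorm h q μ ≤ A := by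
  rcases eq_or_ne q ∞ with rfl | hqt
  · rw [eLpNorm_exponent_top]
    exact eLpNormEssSup_le_of_ae_enorm_bound (Filter.Eventually.of_forall fun x => by simpa using h2 x)
  have hpt : p ≠ ∞ := fun hh => hqt (top_le_iff.1 (hh ▸ hpq))
  have hp0 : p ≠ 0 := (zero_lt_one.trans_le hp).ne'
  have hq0 : q ≠ 0 := (zero_lt_one.trans_le (hp.trans hpq)).ne'
  have hp0' : 0 < p.toReal := ENNReal.toReal_pos hp0 hpt
  have hq0' : 0 < q.toReal := ENNReal.toReal_pos hq0 hqt
  have hle : p.toReal ≤ q.toReal := (ENNReal.toReal_le_toReal hpt hqt).2 hpq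
  rw [eLpNorm_eq_lintegral_rpow_enorm_toReal hp0 hpt, one_div, ENNReal.rpow_inv_le_iff hp0'] at h1
  rw [eLpNorm_eq_lintegral_rpow_enorm_toReal hq0 hqt, one_div, ENNReal.rpow_inv_le_iff hq0']
  simp only [enorm_eq_self] at h1 ⊢
  have hs : q.toReal = p.toReal + (q.toReal - p.toReal) := by ring
  have hAt : A ^ (q.toReal - p.toReal) ≠ ∞ :=
    ENNReal.rpow_ne_top_of_nonneg (by linarith) hA
  calc ∫⁻ x, h x ^ q.toReal ∂μ ≤ ∫⁻ x, h x ^ p.toReal * A ^ (q.toReal - p.toReal) ∂μ := by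
        refine lintegral_mono fun x => ?_
        nth_rewrite 1 [hs]
        rw [ENNReal.rpow_add_of_nonneg _ _ hp0'.le (by linarith)]
        exact mul_le_mul_right (ENNReal.rpow_le_rpow (h2 x) (by linarith)) _
    _ = (∫⁻ x, h x ^ p.toReal ∂μ) * A ^ (q.toReal - p.toReal) := lintegral_mul_const' _ _ hAt
    _ ≤ A ^ p.toReal * A ^ (q.toReal - p.toReal) := mul_le_mul_left h1 _
    _ = A ^ q.toReal := by
        rw [← ENNReal.rpow_add_of_nonneg _ _ hp0'.le (by linarith), ← hs]

/-! ### Fourier multipliers with Schwartz symbols -/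

theorem hasTemperateGrowth_fderiv {E F : Type*} [NormedAddCommGroup E] [NormedSpace ℝ E]
    [NormedAddCommGroup F] [NormedSpace ℝ F] {A : E → F} (hA : A.HasTemperateGrowth) :
    (fderiv ℝ A).HasTemperateGrowth := by
  refine ⟨hA.1.fderiv_right (m := (⊤ : ℕ∞)) (by simp), fun k => ?_⟩
  obtain ⟨N, C, h⟩ := hA.2 (k + 1)
  exact ⟨N, C, fun x => by rw [norm_iteratedFDeriv_fderiv]; exact h x⟩

/-- A Gaussian times a function `A` of temperate growth decays rapidly with all its derivatives. By
induction on their number: one derivative replaces `A` by `A' - 2⟨x, ·⟩ A`, again of temperate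
growth, with values in a larger space. -/
theorem exists_gaussian_decay {E : Type} [NormedAddCommGroup E] [InnerProductSpace ℝ E]
    (k : ℕ) : ∀ (N : ℕ) (F : Type) [NormedAddCommGroup F] [NormedSpace ℝ F] (A : E → F),
      A.HasTemperateGrowth → ∃ C, ∀ x,
        ‖x‖ ^ N * ‖iteratedFDeriv ℝ k (fun x => Real.exp (-‖x‖ ^ 2) • A x) x‖ ≤ C := by
  induction k with
  | zero =>
    intro N F _ _ A hA
    obtain ⟨m, C, hC⟩ := hA.2 0
    have hC0 : 0 ≤ C := by
      have := (norm_nonneg _).trans (hC 0)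
      simpa using this
    set M : ℕ := N + m
    refine ⟨C * 2 ^ m * (1 + (M.factorial : ℝ) * 1), fun x => ?_⟩
    have h1 := hC x
    rw [norm_iteratedFDeriv_zero] at h1 ⊢
    rw [norm_smul, Real.norm_of_nonneg (Real.exp_pos _).le]
    have hx := norm_nonneg x
    have key : ‖x‖ ^ N * (1 + ‖x‖) ^ m * Real.exp (-‖x‖ ^ 2) ≤ 2 ^ m * (1 + (M.factorial : ℝ) * 1) := by
      rcases le_total ‖x‖ 1 with h | h
      · calc ‖x‖ ^ N * (1 + ‖x‖) ^ m * Real.exp (-‖x‖ ^ 2) ≤ 1 * 2 ^ m * 1 := by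
              gcongr
              · exact pow_le_one₀ hx h
              · linarith
              · exact Real.exp_le_one_iff.2 (by nlinarith)
          _ ≤ _ := by nlinarith [pow_pos (zero_lt_two (α := ℝ)) m,
              (Nat.cast_nonneg M.factorial : (0 : ℝ) ≤ _)]
      · have h3 : ‖x‖ ^ M ≤ M.factorial * Real.exp (‖x‖ ^ 2) := by
          have h4 := Real.pow_div_factorial_le_exp (‖x‖ ^ 2) (by positivity) M
          rw [div_le_iff₀ (by positivity)] at h4
          calc ‖x‖ ^ M ≤ (‖x‖ ^ 2) ^ M := by gcongr; nlinarith
            _ ≤ _ := by linarith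
        calc ‖x‖ ^ N * (1 + ‖x‖) ^ m * Real.exp (-‖x‖ ^ 2)
            ≤ ‖x‖ ^ N * (2 * ‖x‖) ^ m * Real.exp (-‖x‖ ^ 2) := by gcongr; linarith
          _ = 2 ^ m * (‖x‖ ^ M * Real.exp (-‖x‖ ^ 2)) := by
              rw [mul_pow, pow_add]; ring
          _ ≤ 2 ^ m * ((M.factorial * Real.exp (‖x‖ ^ 2)) * Real.exp (-‖x‖ ^ 2)) := by gcongr
          _ = 2 ^ m * (M.factorial * 1) := by
              rw [mul_assoc, ← Real.exp_add, add_neg_cancel, Real.exp_zero]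
          _ ≤ _ := by gcongr; linarith
    calc ‖x‖ ^ N * (Real.exp (-‖x‖ ^ 2) * ‖A x‖)
        ≤ ‖x‖ ^ N * (Real.exp (-‖x‖ ^ 2) * (C * (1 + ‖x‖) ^ m)) := by gcongr
      _ = C * (‖x‖ ^ N * (1 + ‖x‖) ^ m * Real.exp (-‖x‖ ^ 2)) := by ring
      _ ≤ C * (2 ^ m * (1 + (M.factorial : ℝ) * 1)) := by gcongr
      _ = _ := by ring
  | succ k ih =>
    intro N F _ _ A hA
    have hB : Function.HasTemperateGrowth (fun x : E =>
        fderiv ℝ A x + ContinuousLinearMap.smulRightL ℝ E F (((-2 : ℝ) • innerSL ℝ) x) (A x)) :=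
      (hasTemperateGrowth_fderiv hA).add
        ((ContinuousLinearMap.smulRightL ℝ E F).bilinear_hasTemperateGrowth
          ((-2 : ℝ) • innerSL ℝ : E →L[ℝ] E →L[ℝ] ℝ).hasTemperateGrowth hA)
    obtain ⟨C, hC⟩ := ih N (E →L[ℝ] F) _ hB
    refine ⟨C, fun x => ?_⟩
    rw [← norm_iteratedFDeriv_fderiv]
    convert! hC x using 4
    funext y
    have h1 : HasFDerivAt (fun y : E => Real.exp (-‖y‖ ^ 2))
        (Real.exp (-‖y‖ ^ 2) • (-(2 • (innerSL ℝ y)) : E →L[ℝ] ℝ)) y := by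
      have := ((hasStrictFDerivAt_norm_sq y).hasFDerivAt).neg.exp
      simpa using this
    have h2 : HasFDerivAt A (fderiv ℝ A y) y :=
      (hA.1.differentiable (by simp) y).hasFDerivAt
    rw [show fderiv ℝ (fun x => Real.exp (-‖x‖ ^ 2) • A x) y = _ from (h1.smul h2).fderiv]
    ext v
    simp
    module

/-- The Schwartz function `ξ ↦ |ξ|^(2j) exp(-|ξ|²)`. -/
noncomputable def gaussMonomial (n j : ℕ) : 𝓢(EuclideanSpace ℝ (Fin n), ℂ) where
  toFun ξ := Real.exp (-‖ξ‖ ^ 2) • ((‖ξ‖ ^ 2 : ℝ) : ℂ) ^ j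
  smooth' := by
    refine ContDiff.smul ((contDiff_norm_sq ℝ).neg.exp) (ContDiff.pow ?_ _)
    exact Complex.ofRealCLM.contDiff.comp (contDiff_norm_sq ℝ)
  decay' k l := by
    refine exists_gaussian_decay l k ℂ (fun ξ => ((‖ξ‖ ^ 2 : ℝ) : ℂ) ^ j) ?_
    exact (Function.HasTemperateGrowth.comp Function.Complex.hasTemperateGrowth_ofReal
      (Function.hasTemperateGrowth_norm_sq _)).pow j

theorem gaussMonomial_apply {n j : ℕ} (ξ : EuclideanSpace ℝ (Fin n)) :
    gaussMonomial n j ξ = ((‖ξ‖ ^ 2 : ℝ) : ℂ) ^ j * Complex.exp (-(‖ξ‖ ^ 2 : ℝ)) := by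
  change Real.exp (-‖ξ‖ ^ 2) • ((‖ξ‖ ^ 2 : ℝ) : ℂ) ^ j = _
  rw [Complex.real_smul, mul_comm]
  push_cast
  rfl

/-- The Fourier multiplier with symbol `m`, applied to a Schwartz function:
`𝓕⁻ (m 𝓕 f)`. -/
noncomputable def multOp (m : EuclideanSpace ℝ (Fin n) → ℂ)
    (f : 𝓢(EuclideanSpace ℝ (Fin n), ℂ)) (x : EuclideanSpace ℝ (Fin n)) : ℂ :=
  𝓕⁻ (fun ξ => m ξ * 𝓕 (f : EuclideanSpace ℝ (Fin n) → ℂ) ξ) x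

theorem multOp_eq (m : EuclideanSpace ℝ (Fin n) → ℂ) (f : 𝓢(EuclideanSpace ℝ (Fin n), ℂ))
    (x : EuclideanSpace ℝ (Fin n)) :
    multOp m f x = ∫ ξ, Complex.exp (2 * Real.pi * inner ℝ ξ x * Complex.I) *
      (m ξ * 𝓕 (f : EuclideanSpace ℝ (Fin n) → ℂ) ξ) := by
  rw [multOp, Real.fourierInv_eq']
  simp

theorem halfWave_eq_multOp (t : ℝ) (f : 𝓢(EuclideanSpace ℝ (Fin n), ℂ)) :
    halfWave t f = multOp (fun ξ => Complex.exp (2 * Real.pi * Complex.I * t * ‖ξ‖)) f :=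
  rfl

theorem sobolevNorm_eq_multOp (s : ℝ) (p : ℝ≥0∞) (f : 𝓢(EuclideanSpace ℝ (Fin n), ℂ)) :
    sobolevNorm s p f =
      eLpNorm (multOp (fun ξ => (((1 + ‖ξ‖ ^ 2) ^ (s / 2) : ℝ) : ℂ)) f) p volume :=
  rfl

attribute [irreducible] multOp

theorem integrable_fourier (f : 𝓢(EuclideanSpace ℝ (Fin n), ℂ)) :
    Integrable (𝓕 (f : EuclideanSpace ℝ (Fin n) → ℂ)) := by
  rw [← SchwartzMap.fourier_coe]
  exact (𝓕 f).integrable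

theorem continuous_fourier (f : 𝓢(EuclideanSpace ℝ (Fin n), ℂ)) :
    Continuous (𝓕 (f : EuclideanSpace ℝ (Fin n) → ℂ)) := by
  rw [← SchwartzMap.fourier_coe]
  exact (𝓕 f).continuous

theorem fourierInv_fourier_apply (f : 𝓢(EuclideanSpace ℝ (Fin n), ℂ))
    (x : EuclideanSpace ℝ (Fin n)) :
    𝓕⁻ (𝓕 (f : EuclideanSpace ℝ (Fin n) → ℂ)) x = f x := by
  rw [f.continuous.fourierInv_fourier_eq f.integrable (integrable_fourier f)]

theorem norm_exp_inner (x ξ : EuclideanSpace ℝ (Fin n)) :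
    ‖Complex.exp (2 * Real.pi * (inner ℝ ξ x : ℝ) * Complex.I)‖ = 1 := by
  have := Complex.norm_exp_ofReal_mul_I (2 * Real.pi * inner ℝ ξ x)
  push_cast at this
  exact this

/-- The self-adjointness `∫ 𝓕⁻f g = ∫ f 𝓕⁻g` of the inverse Fourier transform. -/
theorem integral_fourierInv_mul {f g : EuclideanSpace ℝ (Fin n) → ℂ} (hf : Integrable f)
    (hg : Integrable g) : ∫ x, 𝓕⁻ f x * g x = ∫ x, f x * 𝓕⁻ g x := by
  have := VectorFourier.integral_fourierIntegral_smul_eq_flip (μ := volume) (ν := volume)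
    (L := -innerₗ (EuclideanSpace ℝ (Fin n))) (e := Real.fourierChar) Real.continuous_fourierChar
    (by exact continuous_inner.neg) hf hg
  simp only [VectorFourier.fourierIntegral, smul_eq_mul] at this
  simp only [Real.fourierInv_eq]
  convert! this using 5
  · simp
  · simp [real_inner_comm]

/-- A dilated Schwartz symbol acts by convolution with a dilated Schwartz kernel. -/
theorem multOp_schwartz_eq (m : 𝓢(EuclideanSpace ℝ (Fin n), ℂ)) {c : ℝ} (hc : 0 < c)
    (f : 𝓢(EuclideanSpace ℝ (Fin n), ℂ)) (x : EuclideanSpace ℝ (Fin n)) :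
    multOp (fun ξ => m (c • ξ)) f x =
      ∫ y, f (x - c • y) * 𝓕⁻ (m : EuclideanSpace ℝ (Fin n) → ℂ) y := by
  have hf : Integrable fun y => f (x - c • y) := by
    have h1 := (f.integrable (μ := volume)).comp_sub_left x
    have := h1.comp_smul hc.ne'
    exact this
  have h := integral_fourierInv_mul hf m.integrable
  rw [← h]
  have h2 : ∀ ξ, 𝓕⁻ (fun y => f (x - c • y)) (c • ξ) = (c ^ n)⁻¹ *
      (Complex.exp (2 * Real.pi * inner ℝ ξ x * Complex.I) *
        𝓕 (f : EuclideanSpace ℝ (Fin n) → ℂ) ξ) := by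
    intro ξ
    rw [Real.fourierInv_eq', Real.fourier_eq']
    simp only [smul_eq_mul]
    have e1 := Measure.integral_comp_smul_of_nonneg (volume : Measure (EuclideanSpace ℝ (Fin n)))
      (fun y => Complex.exp (2 * Real.pi * inner ℝ ξ y * Complex.I) * f (x - y)) c (hR := hc.le)
    have e2 := integral_sub_left_eq_self
      (fun y => Complex.exp (2 * Real.pi * inner ℝ ξ y * Complex.I) * f (x - y)) volume x
    rw [← e2] at e1
    rw [finrank_euclideanSpace_fin, Complex.real_smul] at e1
    push_cast at e1 ⊢
    convert! e1 using 3 with y y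
    · rw [real_inner_smul_right, real_inner_smul_right, real_inner_comm]
    · rw [← integral_const_mul]
      congr 1
      funext y
      rw [sub_sub_cancel, ← mul_assoc, ← Complex.exp_add, inner_sub_right, real_inner_comm y ξ]
      congr 2
      push_cast
      ring
  have e3 := Measure.integral_comp_smul_of_nonneg (volume : Measure (EuclideanSpace ℝ (Fin n)))
    (fun ξ => 𝓕⁻ (fun y => f (x - c • y)) ξ * m ξ) c (hR := hc.le)
  rw [finrank_euclideanSpace_fin, eq_inv_smul_iff₀ (by positivity)] at e3
  rw [← e3, multOp_eq, Complex.real_smul, ← integral_const_mul]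
  congr 1
  funext ξ
  rw [h2]
  have : (c : ℂ) ^ n ≠ 0 := pow_ne_zero _ (Complex.ofReal_ne_zero.2 hc.ne')
  push_cast
  field_simp

theorem eLpNorm_comp_sub_smul (f : 𝓢(EuclideanSpace ℝ (Fin n), ℂ)) {c : ℝ} (hc : 0 < c)
    (x : EuclideanSpace ℝ (Fin n)) (p : ℝ≥0∞) :
    eLpNorm (fun y => f (x - c • y)) p volume =
      ENNReal.ofReal ((c ^ n)⁻¹) ^ (1 / p).toReal * eLpNorm f p volume := by
  have h1 : Measure.map (fun y : EuclideanSpace ℝ (Fin n) => x - c • y) volume =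
      ENNReal.ofReal ((c ^ n)⁻¹) • volume := by
    have h2 := Measure.map_addHaar_smul (volume : Measure (EuclideanSpace ℝ (Fin n))) hc.ne'
    rw [finrank_euclideanSpace_fin, abs_of_nonneg (by positivity)] at h2
    have h3 : Measure.map (fun y : EuclideanSpace ℝ (Fin n) => x - y) volume = volume :=
      (Measure.measurePreserving_sub_left volume x).map_eq
    have := Measure.map_map (μ := (volume : Measure (EuclideanSpace ℝ (Fin n))))
      (f := (c • ·)) (g := fun y => x - y) (by fun_prop) (by fun_prop)
    rw [h2, Measure.map_smul, h3] at this
    exact this.symm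
  have h4 := eLpNorm_map_measure (p := p) (μ := (volume : Measure (EuclideanSpace ℝ (Fin n))))
    (f := fun y : EuclideanSpace ℝ (Fin n) => x - c • y) (g := f)
    f.continuous.aestronglyMeasurable (by fun_prop)
  rw [h1, eLpNorm_smul_measure_of_ne_zero (by simpa using by positivity)] at h4
  simpa [Function.comp_def] using h4.symm

/-- A Schwartz multiplier is bounded on `L^p`, uniformly in `p` and under dilations of the symbol. -/
theorem eLpNorm_multOp_schwartz_le (m : 𝓢(EuclideanSpace ℝ (Fin n), ℂ)) :
    ∃ C : ℝ≥0, ∀ (p : ℝ≥0∞), 1 ≤ p → ∀ c : ℝ, 0 < c → ∀ f : 𝓢(EuclideanSpace ℝ (Fin n), ℂ),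
      eLpNorm (multOp (fun ξ => m (c • ξ)) f) p volume ≤ C * eLpNorm f p volume := by
  -- a Gaussian is added to the kernel so that `K` vanishes nowhere, as `eLpNorm_lintegral_le` requires
  set K : EuclideanSpace ℝ (Fin n) → ℝ≥0∞ :=
    fun y => ‖(𝓕⁻ m) y‖ₑ + ‖gaussMonomial n 0 y‖ₑ with hK
  have hKm : Measurable K := by
    have h1 := (𝓕⁻ m).continuous
    have h2 := (gaussMonomial n 0).continuous
    exact (h1.enorm.add h2.enorm).measurable
  have hKint : ∫⁻ y, K y ≠ ∞ := by
    rw [lintegral_add_left (𝓕⁻ m).continuous.enorm.measurable]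
    exact ENNReal.add_ne_top.2 ⟨(𝓕⁻ m).integrable.2.ne, (gaussMonomial n 0).integrable.2.ne⟩
  have hK0 : ∀ y, K y ≠ 0 := fun y => by
    simp [hK, gaussMonomial_apply]
  refine ⟨(∫⁻ y, K y).toNNReal, fun p hp c hc f => ?_⟩
  rw [ENNReal.coe_toNNReal hKint, mul_comm]
  have hcont : Continuous fun z : EuclideanSpace ℝ (Fin n) × EuclideanSpace ℝ (Fin n) =>
      ‖f (z.1 - c • z.2)‖ₑ * ‖𝓕⁻ m z.2‖ₑ := by
    have h1 : Continuous fun z : EuclideanSpace ℝ (Fin n) × EuclideanSpace ℝ (Fin n) =>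
      f (z.1 - c • z.2) * 𝓕⁻ m z.2 :=
      (f.continuous.comp (by fun_prop)).mul ((𝓕⁻ m).continuous.comp continuous_snd)
    simpa only [enorm_mul] using h1.enorm
  refine le_trans ?_ (eLpNorm_lintegral_le (μ := volume) (ν := volume) hp
    (F := fun x y => ‖f (x - c • y)‖ₑ * ‖𝓕⁻ m y‖ₑ) hcont.measurable.aemeasurable (K := K)
    hKm.aemeasurable (.of_forall hK0) (.of_forall fun y => by simp [hK]) (.of_forall fun y => ?_))
  · refine eLpNorm_mono_enorm fun x => ?_
    rw [multOp_schwartz_eq m hc, enorm_eq_self]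
    refine (enorm_integral_le_lintegral_enorm _).trans (le_of_eq ?_)
    simp_rw [enorm_mul, SchwartzMap.fourierInv_coe]
  · have h1 : eLpNorm (fun x => ‖f (x - c • y)‖ₑ * ‖𝓕⁻ m y‖ₑ) p volume
        = eLpNorm (fun x => (𝓕⁻ m y) • f (x - c • y)) p volume := by
      refine eLpNorm_congr_enorm_ae (.of_forall fun x => ?_)
      rw [enorm_eq_self, enorm_smul, mul_comm]
    have h2 : eLpNorm (fun x => f (x - c • y)) p volume = eLpNorm f p volume := by
      have := eLpNorm_comp_measurePreserving (p := p) (g := (f : EuclideanSpace ℝ (Fin n) → ℂ))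
        f.continuous.aestronglyMeasurable
        (measurePreserving_sub_right (volume : Measure (EuclideanSpace ℝ (Fin n))) (c • y))
      exact this
    rw [h1]
    change eLpNorm ((𝓕⁻ m y) • fun x => f (x - c • y)) p volume ≤ _
    rw [eLpNorm_const_smul, h2]
    exact mul_le_mul_left (le_add_right le_rfl) _

/-- A dilated Schwartz multiplier maps `L^p` to `L^∞`, by Hölder. The sharp power `c^{-n/p}` is replaced
by the cruder `1 + c^{-n}`. -/
theorem enorm_multOp_schwartz_le (m : 𝓢(EuclideanSpace ℝ (Fin n), ℂ)) (p : ℝ≥0∞) (hp : 1 ≤ p) :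
    ∃ C : ℝ≥0, ∀ c : ℝ, 0 < c → ∀ (f : 𝓢(EuclideanSpace ℝ (Fin n), ℂ)) x,
      ‖multOp (fun ξ => m (c • ξ)) f x‖ₑ ≤
        C * ENNReal.ofReal (1 + (c ^ n)⁻¹) * eLpNorm f p volume := by
  set p' := p.conjExponent
  have : p.HolderConjugate p' := ENNReal.HolderConjugate.conjExponent hp
  have hfin := (𝓕⁻ m).eLpNorm_lt_top p' (volume : Measure (EuclideanSpace ℝ (Fin n)))
  refine ⟨(eLpNorm (𝓕⁻ m : 𝓢(EuclideanSpace ℝ (Fin n), ℂ)) p' volume).toNNReal, fun c hc f x => ?_⟩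
  rw [ENNReal.coe_toNNReal hfin.ne, multOp_schwartz_eq m hc]
  refine (enorm_integral_le_lintegral_enorm _).trans ?_
  have h1 := eLpNorm_smul_le_mul_eLpNorm (p := p) (q := p') (r := 1) (μ := volume)
    (f := (𝓕⁻ m : 𝓢(EuclideanSpace ℝ (Fin n), ℂ))) (φ := fun y => f (x - c • y)) (𝓕⁻ m).continuous.aestronglyMeasurable
    (f.continuous.comp (by fun_prop)).aestronglyMeasurable
  rw [eLpNorm_one_eq_lintegral_enorm] at h1
  simp only [← SchwartzMap.fourierInv_coe]
  refine le_trans h1 ?_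
  rw [eLpNorm_comp_sub_smul f hc x p]
  have h2 : ENNReal.ofReal ((c ^ n)⁻¹) ^ (1 / p).toReal ≤ ENNReal.ofReal (1 + (c ^ n)⁻¹) := by
    have hle : (1 / p).toReal ≤ 1 := by
      have : (1 / p) ≤ 1 := by
        rw [one_div]
        exact ENNReal.inv_le_one.2 hp
      simpa using ENNReal.toReal_mono ENNReal.one_ne_top this
    calc ENNReal.ofReal ((c ^ n)⁻¹) ^ (1 / p).toReal
        ≤ ENNReal.ofReal (1 + (c ^ n)⁻¹) ^ (1 / p).toReal :=
          ENNReal.rpow_le_rpow (ENNReal.ofReal_le_ofReal (by linarith)) ENNReal.toReal_nonneg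
      _ ≤ ENNReal.ofReal (1 + (c ^ n)⁻¹) ^ (1 : ℝ) := by
          refine ENNReal.rpow_le_rpow_of_exponent_le ?_ hle
          rw [← ENNReal.ofReal_one]
          exact ENNReal.ofReal_le_ofReal (by have : 0 < (c ^ n)⁻¹ := by positivity
                                             linarith)
      _ = _ := ENNReal.rpow_one _
  calc _ ≤ ENNReal.ofReal (1 + (c ^ n)⁻¹) * eLpNorm f p volume * eLpNorm (𝓕⁻ m : 𝓢(EuclideanSpace ℝ (Fin n), ℂ)) p' volume := by
        gcongr
    _ = _ := by ring

/-! ### Subordination of the Poisson semigroup to the heat semigroup -/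

/-- The Fourier transform of `e^{-w|x|}`, for complex `w`. -/
theorem integral_exp_neg_mul_abs {w : ℂ} (hw : 0 < w.re) (τ : ℝ) :
    Integrable (fun x : ℝ => Complex.exp (-w * |x|)) ∧
    𝓕 (fun x : ℝ => Complex.exp (-w * |x|)) τ = 2 * w / (w ^ 2 + 4 * Real.pi ^ 2 * τ ^ 2) := by
  have hi : ∀ τ : ℝ, IntegrableOn (fun x : ℝ => Complex.exp ((w - 2 * Real.pi * τ * Complex.I) * x))
      (Set.Iic 0) := fun τ => integrableOn_exp_mul_complex_Iic (by simpa using hw) 0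
  have hj : ∀ τ : ℝ, IntegrableOn (fun x : ℝ => Complex.exp ((-w - 2 * Real.pi * τ * Complex.I) * x))
      (Set.Ioi 0) := fun τ => integrableOn_exp_mul_complex_Ioi (by simpa using hw) 0
  have ei : ∀ τ x : ℝ, x ∈ Set.Iic 0 → Complex.exp ((w - 2 * Real.pi * τ * Complex.I) * x) =
      Complex.exp ((-2 * Real.pi * (τ * x) : ℝ) * Complex.I) * Complex.exp (-w * |x|) := by
    intro τ x hx
    rw [abs_of_nonpos hx, ← Complex.exp_add]
    congr 1
    push_cast
    ring
  have ej : ∀ τ x : ℝ, x ∈ Set.Ioi 0 → Complex.exp ((-w - 2 * Real.pi * τ * Complex.I) * x) =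
      Complex.exp ((-2 * Real.pi * (τ * x) : ℝ) * Complex.I) * Complex.exp (-w * |x|) := by
    intro τ x hx
    rw [abs_of_pos hx, ← Complex.exp_add]
    congr 1
    push_cast
    ring
  have hi' := fun τ => (hi τ).congr_fun (ei τ) measurableSet_Iic
  have hj' := fun τ => (hj τ).congr_fun (ej τ) measurableSet_Ioi
  constructor
  · have h1 := (hi' 0).union (hj' 0)
    rw [Set.Iic_union_Ioi, integrableOn_univ] at h1
    simpa using h1
  · have e1 : ∀ v : ℝ, inner ℝ v τ = τ * v := fun v => by simp
    rw [Real.fourier_eq']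
    simp only [e1, smul_eq_mul]
    rw [← intervalIntegral.integral_Iic_add_Ioi (hi' τ) (hj' τ),
      ← setIntegral_congr_fun measurableSet_Iic (ei τ),
      ← setIntegral_congr_fun measurableSet_Ioi (ej τ),
      integral_exp_mul_complex_Iic (by simpa using hw),
      integral_exp_mul_complex_Ioi (by simpa using hw)]
    have h1 : w - 2 * Real.pi * τ * Complex.I ≠ 0 := fun h => by
      have := congrArg Complex.re h
      simp at this
      linarith
    have h2 : -w - 2 * Real.pi * τ * Complex.I ≠ 0 := fun h => by
      have := congrArg Complex.re h
      simp at this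
      linarith
    have h3 : w ^ 2 + 4 * Real.pi ^ 2 * τ ^ 2 =
        -((w - 2 * Real.pi * τ * Complex.I) * (-w - 2 * Real.pi * τ * Complex.I)) := by
      linear_combination (4 * Real.pi ^ 2 * τ ^ 2 : ℂ) * Complex.I_sq
    rw [h3]
    simp only [Complex.ofReal_zero, mul_zero, Complex.exp_zero]
    field_simp
    ring

theorem integrable_inv_add_sq {b : ℝ} (hb : 0 < b) :
    Integrable fun τ : ℝ => (b + 4 * Real.pi ^ 2 * τ ^ 2)⁻¹ := by
  have h1 := (integrable_inv_one_add_sq.comp_mul_left'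
    (show (2 * Real.pi / Real.sqrt b) ≠ 0 by positivity)).const_mul b⁻¹
  refine h1.congr (.of_forall fun τ => ?_)
  simp only
  rw [mul_pow, div_pow, Real.sq_sqrt hb.le]
  field_simp
  ring

/-- The subordination formula
`e^{-wρ} = (w/√π) ∫_0^∞ v^{-1/2} e^{-v w²} e^{-ρ²/(4v)} dv`, valid for complex `w` in the sector
`Re w > 0`, `Re w² > 0`. -/
theorem exp_neg_mul_eq_integral {w : ℂ} (hw : 0 < w.re) (hw2 : 0 < (w ^ 2).re) {ρ : ℝ}
    (hρ : 0 ≤ ρ) : Complex.exp (-w * ρ) = ∫ v in Set.Ioi (0 : ℝ),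
      (w / Real.sqrt Real.pi * ((v ^ (-1 / 2 : ℝ) : ℝ) : ℂ) * Complex.exp (-v * w ^ 2)) *
        Complex.exp (-(ρ ^ 2 / (4 * v))) := by
  have hI := (integral_exp_neg_mul_abs hw 0).1
  have hF : 𝓕 (fun x : ℝ => Complex.exp (-w * |x|)) =
      fun τ : ℝ => 2 * w / (w ^ 2 + 4 * Real.pi ^ 2 * τ ^ 2) :=
    funext fun τ => (integral_exp_neg_mul_abs hw τ).2
  set b := (w ^ 2).re with hb
  have hre : ∀ τ : ℝ, (w ^ 2 + 4 * Real.pi ^ 2 * τ ^ 2 : ℂ).re = b + 4 * Real.pi ^ 2 * τ ^ 2 := by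
    intro τ
    have : (4 * Real.pi ^ 2 * τ ^ 2 : ℂ) = ((4 * Real.pi ^ 2 * τ ^ 2 : ℝ) : ℂ) := by push_cast; rfl
    rw [Complex.add_re, this, Complex.ofReal_re]
  have hpos : ∀ τ : ℝ, 0 < b + 4 * Real.pi ^ 2 * τ ^ 2 := fun τ => by positivity
  have hne : ∀ τ : ℝ, (w ^ 2 + 4 * Real.pi ^ 2 * τ ^ 2 : ℂ) ≠ 0 := fun τ h => by
    have := hre τ
    rw [h, Complex.zero_re] at this
    exact (hpos τ).ne this
  have hFi : Integrable (fun τ : ℝ => 2 * w / (w ^ 2 + 4 * Real.pi ^ 2 * τ ^ 2)) := by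
    refine ((integrable_inv_add_sq hw2).const_mul ‖2 * w‖).mono' ?_ (.of_forall fun τ => ?_)
    · exact (Continuous.div (by fun_prop) (by fun_prop) hne).aestronglyMeasurable
    · rw [norm_div, div_eq_mul_inv]
      gcongr
      rw [← hre]
      exact Complex.re_le_norm _
  -- `e^{-wρ}` is recovered from the Fourier transform of `e^{-w|x|}` by inversion
  have hinv := congrFun (Continuous.fourierInv_fourier_eq (f := fun x : ℝ => Complex.exp (-w * |x|))
    (by fun_prop) hI (hF ▸ hFi)) ρ
  rw [hF, Real.fourierInv_eq'] at hinv
  simp only [abs_of_nonneg hρ, smul_eq_mul] at hinv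
  rw [← hinv]
  -- the Fourier transform is a Laplace integral of Gaussians in `τ`; this is where `Re w² > 0` enters
  have hlap : ∀ τ : ℝ, 2 * w / (w ^ 2 + 4 * Real.pi ^ 2 * τ ^ 2) = ∫ v in Set.Ioi (0 : ℝ),
      2 * w * Complex.exp (-(w ^ 2 + 4 * Real.pi ^ 2 * τ ^ 2) * v) := by
    intro τ
    rw [integral_const_mul, integral_exp_mul_complex_Ioi]
    · simp only [Complex.ofReal_zero, mul_zero, Complex.exp_zero]
      have := hne τ
      field_simp
    · rw [Complex.neg_re, hre]
      linarith [hpos τ]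
  have e1 : ∀ τ : ℝ, inner ℝ τ ρ = ρ * τ := fun v => by simp
  simp only [e1, hlap, ← integral_const_mul]
  -- after interchanging the integrals, the inner one is the Fourier transform of a Gaussian
  rw [integral_integral_swap]
  · refine setIntegral_congr_fun measurableSet_Ioi fun v hv => ?_
    have hv : 0 < v := hv
    have hg := fourier_gaussian_innerProductSpace (b := ((4 * Real.pi ^ 2 * v : ℝ) : ℂ)) (V := ℝ)
      (by rw [Complex.ofReal_re]; positivity) (-ρ)
    rw [← Real.fourierInv_eq_fourier_neg, Real.fourierInv_eq'] at hg
    simp only [e1, smul_eq_mul] at hg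
    calc ∫ τ : ℝ, Complex.exp ((2 * Real.pi * (ρ * τ) : ℝ) * Complex.I) *
          (2 * w * Complex.exp (-(w ^ 2 + 4 * Real.pi ^ 2 * τ ^ 2) * v))
        = 2 * w * Complex.exp (-v * w ^ 2) * ∫ τ : ℝ,
          Complex.exp ((2 * Real.pi * (ρ * τ) : ℝ) * Complex.I) *
            Complex.exp (-((4 * Real.pi ^ 2 * v : ℝ) : ℂ) * (‖τ‖ : ℂ) ^ 2) := by
          rw [← integral_const_mul]
          congr 1
          funext τ
          have h1 : ((‖τ‖ : ℝ) : ℂ) ^ 2 = (τ : ℂ) ^ 2 := by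
            rw [← Complex.ofReal_pow, Real.norm_eq_abs, sq_abs, Complex.ofReal_pow]
          rw [h1]
          have h2 : Complex.exp (-(w ^ 2 + 4 * Real.pi ^ 2 * τ ^ 2) * v) = Complex.exp (-v * w ^ 2) *
              Complex.exp (-((4 * Real.pi ^ 2 * v : ℝ) : ℂ) * (τ : ℂ) ^ 2) := by
            rw [← Complex.exp_add]
            congr 1
            push_cast
            ring
          rw [h2]
          ring
      _ = _ := by
          rw [hg]
          have h3 : (Real.pi / ((4 * Real.pi ^ 2 * v : ℝ) : ℂ)) ^ ((Module.finrank ℝ ℝ : ℂ) / 2) =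
              (((4 * Real.pi)⁻¹ ^ (1 / 2 : ℝ) * v ^ (-1 / 2 : ℝ) : ℝ) : ℂ) := by
            rw [← Complex.ofReal_div, Module.finrank_self]
            have : ((1 : ℕ) : ℂ) / 2 = ((1 / 2 : ℝ) : ℂ) := by push_cast; rfl
            rw [this, ← Complex.ofReal_cpow (by positivity)]
            congr 1
            have h4 : Real.pi / (4 * Real.pi ^ 2 * v) = (4 * Real.pi)⁻¹ * v⁻¹ := by
              have := Real.pi_ne_zero
              field_simp
            rw [h4, Real.mul_rpow (by positivity) (by positivity), Real.inv_rpow hv.le,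
              ← Real.rpow_neg hv.le]
            norm_num
          have h5 : 2 * (4 * Real.pi)⁻¹ ^ (1 / 2 : ℝ) = (Real.sqrt Real.pi)⁻¹ := by
            rw [← Real.sqrt_eq_rpow, Real.sqrt_inv, Real.sqrt_mul (by norm_num),
              show (4 : ℝ) = 2 ^ 2 by norm_num, Real.sqrt_sq (by norm_num)]
            field_simp
          have h6 : -(Real.pi : ℂ) ^ 2 * ((‖-ρ‖ : ℝ) : ℂ) ^ 2 / ((4 * Real.pi ^ 2 * v : ℝ) : ℂ) =
              -((ρ : ℂ) ^ 2 / (4 * v)) := by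
            have h7 : ((‖-ρ‖ : ℝ) : ℂ) ^ 2 = (ρ : ℂ) ^ 2 := by
              rw [← Complex.ofReal_pow, Real.norm_eq_abs, sq_abs, neg_sq, Complex.ofReal_pow]
            rw [h7]
            have h8 : (Real.pi : ℂ) ≠ 0 := Complex.ofReal_ne_zero.2 Real.pi_ne_zero
            have h9 : (v : ℂ) ≠ 0 := Complex.ofReal_ne_zero.2 hv.ne'
            push_cast
            field_simp
          generalize (4 * Real.pi)⁻¹ ^ (1 / 2 : ℝ) = c at h3 h5
          rw [h3, h6]
          have h5' := congrArg (fun r : ℝ => (r : ℂ)) h5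
          simp only [Complex.ofReal_mul, Complex.ofReal_inv] at h5'
          push_cast at h5' ⊢
          rw [div_eq_mul_inv w, ← h5']
          ring
  · have hc : Continuous (Function.uncurry fun τ v : ℝ =>
        Complex.exp ((2 * Real.pi * (ρ * τ) : ℝ) * Complex.I) *
          (2 * w * Complex.exp (-(w ^ 2 + 4 * Real.pi ^ 2 * τ ^ 2) * v))) := by
      fun_prop
    have hn : ∀ τ v : ℝ, ‖Complex.exp ((2 * Real.pi * (ρ * τ) : ℝ) * Complex.I) *
          (2 * w * Complex.exp (-(w ^ 2 + 4 * Real.pi ^ 2 * τ ^ 2) * v))‖ =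
        ‖2 * w‖ * Real.exp (-(b + 4 * Real.pi ^ 2 * τ ^ 2) * v) := by
      intro τ v
      rw [norm_mul, norm_mul, Complex.norm_exp_ofReal_mul_I, one_mul, Complex.norm_exp,
        Complex.re_mul_ofReal, Complex.neg_re, hre]
    rw [integrable_prod_iff hc.aestronglyMeasurable]
    constructor
    · refine .of_forall fun τ => ?_
      refine Integrable.mono' ((integrableOn_exp_mul_Ioi
        (show -(b + 4 * Real.pi ^ 2 * τ ^ 2) < 0 by linarith [hpos τ]) 0).const_mul ‖2 * w‖)
        (hc.comp (by fun_prop)).aestronglyMeasurable (.of_forall fun v => ?_)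
      exact (hn τ v).le
    · simp only [Function.uncurry, hn]
      refine ((integrable_inv_add_sq hw2).const_mul ‖2 * w‖).congr (.of_forall fun τ => ?_)
      simp only
      rw [integral_const_mul, integral_exp_mul_Ioi
        (show -(b + 4 * Real.pi ^ 2 * τ ^ 2) < 0 by linarith [hpos τ]), mul_zero, Real.exp_zero,
        neg_div_neg_eq, one_div]

/-! ### Superpositions of multipliers -/

theorem measurable_multOp {P : Type*} [MeasurableSpace P]
    {M : P → EuclideanSpace ℝ (Fin n) → ℂ} (hM : Measurable (Function.uncurry M))
    (f : 𝓢(EuclideanSpace ℝ (Fin n), ℂ)) :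
    Measurable fun z : EuclideanSpace ℝ (Fin n) × P => multOp (M z.2) f z.1 := by
  simp only [multOp_eq]
  have h0 : Continuous fun w : EuclideanSpace ℝ (Fin n) × EuclideanSpace ℝ (Fin n) =>
      Complex.exp (2 * Real.pi * inner ℝ w.2 w.1 * Complex.I) := by fun_prop
  have h1 : Measurable fun z : (EuclideanSpace ℝ (Fin n) × P) × EuclideanSpace ℝ (Fin n) =>
      (z.1.1, z.2) := (measurable_fst.comp measurable_fst).prodMk measurable_snd
  have h2 : Measurable fun z : (EuclideanSpace ℝ (Fin n) × P) × EuclideanSpace ℝ (Fin n) =>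
      (z.1.2, z.2) := (measurable_snd.comp measurable_fst).prodMk measurable_snd
  have h3 : Measurable fun z : (EuclideanSpace ℝ (Fin n) × P) × EuclideanSpace ℝ (Fin n) =>
      𝓕 (f : EuclideanSpace ℝ (Fin n) → ℂ) z.2 :=
    (continuous_fourier f).measurable.comp measurable_snd
  have h := (h0.measurable.comp h1).mul ((hM.comp h2).mul h3)
  exact h.stronglyMeasurable.integral_prod_right.measurable

theorem measurable_multOp_apply {m : EuclideanSpace ℝ (Fin n) → ℂ} (hm : Measurable m)
    (f : 𝓢(EuclideanSpace ℝ (Fin n), ℂ)) : Measurable (multOp m f) := by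
  have h1 : Measurable (Function.uncurry fun (_ : ℝ) (ξ : EuclideanSpace ℝ (Fin n)) => m ξ) :=
    hm.comp measurable_snd
  have h2 : Measurable fun x : EuclideanSpace ℝ (Fin n) => (x, (0 : ℝ)) :=
    measurable_id.prodMk measurable_const
  have h3 : Measurable fun z : EuclideanSpace ℝ (Fin n) × ℝ => multOp m f z.1 :=
    measurable_multOp h1 f
  exact Measurable.comp (g := fun z : EuclideanSpace ℝ (Fin n) × ℝ => multOp m f z.1) h3 h2

theorem norm_multOp_le (m : EuclideanSpace ℝ (Fin n) → ℂ) (f : 𝓢(EuclideanSpace ℝ (Fin n), ℂ))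
    (x : EuclideanSpace ℝ (Fin n)) (hm : ∀ ξ, ‖m ξ‖ ≤ 1) :
    ‖multOp m f x‖ ≤ ∫ ξ, ‖𝓕 (f : EuclideanSpace ℝ (Fin n) → ℂ) ξ‖ := by
  rw [multOp_eq]
  refine norm_integral_le_of_norm_le (integrable_fourier f).norm (.of_forall fun ξ => ?_)
  rw [norm_mul, norm_exp_inner, one_mul, norm_mul]
  exact mul_le_of_le_one_left (norm_nonneg _) (hm ξ)

/-- The multiplier whose symbol is a superposition of symbols is the superposition of the multipliers. -/
theorem multOp_integral {V : Type*} [MeasurableSpace V] {ν : Measure V} [SFinite ν]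
    (M : V → EuclideanSpace ℝ (Fin n) → ℂ) (f : 𝓢(EuclideanSpace ℝ (Fin n), ℂ))
    (hint : Integrable (fun z : EuclideanSpace ℝ (Fin n) × V =>
      M z.2 z.1 * 𝓕 (f : EuclideanSpace ℝ (Fin n) → ℂ) z.1) (volume.prod ν))
    (x : EuclideanSpace ℝ (Fin n)) :
    multOp (fun ξ => ∫ v, M v ξ ∂ν) f x = ∫ v, multOp (M v) f x ∂ν := by
  simp only [multOp_eq]
  rw [← integral_integral_swap]
  · congr 1
    funext ξ
    rw [integral_const_mul, integral_mul_const]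
  · refine hint.norm.mono' ?_ (.of_forall fun z => ?_)
    · refine AEStronglyMeasurable.mul ?_ hint.1
      have h0 : Continuous fun ξ : EuclideanSpace ℝ (Fin n) =>
          Complex.exp (2 * Real.pi * inner ℝ ξ x * Complex.I) := by fun_prop
      exact (h0.measurable.comp measurable_fst).aestronglyMeasurable
    · simp only [Function.uncurry]
      rw [norm_mul, norm_exp_inner, one_mul]

/-- The integrability needed in `multOp_integral`, from a bound `κ v * B ξ` on the symbols. -/
theorem integrable_symbol {V : Type*} [MeasurableSpace V] {ν : Measure V} [SFinite ν]
    {M : V → EuclideanSpace ℝ (Fin n) → ℂ} (hM : Measurable (Function.uncurry M))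
    (f : 𝓢(EuclideanSpace ℝ (Fin n), ℂ)) {κ : V → ℝ} (hκ : Integrable κ ν)
    {B : EuclideanSpace ℝ (Fin n) → ℝ}
    (hB : Integrable fun ξ => B ξ * 𝓕 (f : EuclideanSpace ℝ (Fin n) → ℂ) ξ)
    (hMB : ∀ᵐ v ∂ν, ∀ ξ, ‖M v ξ‖ ≤ κ v * B ξ) :
    Integrable (fun z : EuclideanSpace ℝ (Fin n) × V =>
      M z.2 z.1 * 𝓕 (f : EuclideanSpace ℝ (Fin n) → ℂ) z.1) (volume.prod ν) := by
  refine (hB.norm.mul_prod hκ.norm).mono' ?_ ?_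
  · refine (Measurable.aestronglyMeasurable ?_)
    exact (hM.comp (measurable_snd.prodMk measurable_fst)).mul
      ((continuous_fourier f).measurable.comp measurable_fst)
  · have : ∀ᵐ z : EuclideanSpace ℝ (Fin n) × V ∂(volume.prod ν), ∀ ξ, ‖M z.2 ξ‖ ≤ κ z.2 * B ξ :=
      Measure.quasiMeasurePreserving_snd.ae hMB
    filter_upwards [this] with z hz
    have h1 := (hz z.1).trans (le_abs_self _)
    rw [norm_mul, norm_mul, Complex.norm_real, Real.norm_eq_abs, Real.norm_eq_abs]
    calc ‖M z.2 z.1‖ * ‖𝓕 (f : EuclideanSpace ℝ (Fin n) → ℂ) z.1‖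
        ≤ |κ z.2 * B z.1| * ‖𝓕 (f : EuclideanSpace ℝ (Fin n) → ℂ) z.1‖ := by gcongr
      _ = _ := by rw [abs_mul]; ring

/-! ### The heat semigroup and the Sobolev norm -/

theorem hasTemperateGrowth_gauss (n : ℕ) (c : ℝ) :
    Function.HasTemperateGrowth fun ξ : EuclideanSpace ℝ (Fin n) => gaussMonomial n 0 (c • ξ) :=
  Function.HasTemperateGrowth.comp (gaussMonomial n 0).hasTemperateGrowth
    (c • ContinuousLinearMap.id ℝ (EuclideanSpace ℝ (Fin n))).hasTemperateGrowth

/-- The heat flow: the Schwartz function with Fourier transform `exp(-c²|ξ|²) 𝓕f`. -/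
noncomputable def heat (c : ℝ) (f : 𝓢(EuclideanSpace ℝ (Fin n), ℂ)) :
    𝓢(EuclideanSpace ℝ (Fin n), ℂ) :=
  SchwartzMap.fourierMultiplierCLM ℂ (fun ξ => gaussMonomial n 0 (c • ξ)) f

theorem fourier_heat (c : ℝ) (f : 𝓢(EuclideanSpace ℝ (Fin n), ℂ))
    (ξ : EuclideanSpace ℝ (Fin n)) :
    𝓕 (heat c f : EuclideanSpace ℝ (Fin n) → ℂ) ξ =
      gaussMonomial n 0 (c • ξ) * 𝓕 (f : EuclideanSpace ℝ (Fin n) → ℂ) ξ := by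
  rw [← SchwartzMap.fourier_coe, heat, SchwartzMap.fourierMultiplierCLM_apply,
    FourierTransform.fourier_fourierInv_eq,
    SchwartzMap.smulLeftCLM_apply_apply (hasTemperateGrowth_gauss n c), smul_eq_mul,
    SchwartzMap.fourier_coe]

theorem gauss_smul (c : ℝ) (ξ : EuclideanSpace ℝ (Fin n)) :
    gaussMonomial n 0 (c • ξ) = ((Real.exp (-(c ^ 2 * ‖ξ‖ ^ 2)) : ℝ) : ℂ) := by
  rw [gaussMonomial_apply, norm_smul, mul_pow, Real.norm_eq_abs, sq_abs]
  push_cast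
  simp

theorem multOp_heat (m : EuclideanSpace ℝ (Fin n) → ℂ) (c : ℝ)
    (f : 𝓢(EuclideanSpace ℝ (Fin n), ℂ)) (x : EuclideanSpace ℝ (Fin n)) :
    multOp m (heat c f) x = multOp (fun ξ => m ξ * gaussMonomial n 0 (c • ξ)) f x := by
  simp only [multOp_eq, fourier_heat, mul_assoc]

theorem heat_apply (c : ℝ) (f : 𝓢(EuclideanSpace ℝ (Fin n), ℂ)) (x : EuclideanSpace ℝ (Fin n)) :
    heat c f x = multOp (fun ξ => gaussMonomial n 0 (c • ξ)) f x := by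
  have := multOp_heat (fun _ => 1) c f x
  simp only [one_mul] at this
  rw [← this, multOp_eq, ← fourierInv_fourier_apply (heat c f), Real.fourierInv_eq']
  simp

/-- The heat flow with the symbol `(1 + |ξ|²)^k`. -/
theorem eLpNorm_polynomial_heat_le (n k : ℕ) :
    ∃ C : ℝ≥0, ∀ p : ℝ≥0∞, 1 ≤ p → ∀ c : ℝ, 0 < c → ∀ f : 𝓢(EuclideanSpace ℝ (Fin n), ℂ),
      eLpNorm (multOp (fun ξ => (((1 + ‖ξ‖ ^ 2) ^ k : ℝ) : ℂ) * gaussMonomial n 0 (c • ξ)) f)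
        p volume ≤ C * ENNReal.ofReal (1 + (c ^ (2 * k))⁻¹) * eLpNorm f p volume := by
  choose C hC using fun j => eLpNorm_multOp_schwartz_le (gaussMonomial n j)
  refine ⟨∑ j ∈ Finset.range (k + 1), (k.choose j : ℝ≥0) * C j, fun p hp c hc f => ?_⟩
  obtain ⟨a, ha⟩ : ∃ a : ℕ → ℂ, ∀ j, a j = ((k.choose j * (c ^ (2 * j))⁻¹ : ℝ) : ℂ) :=
    ⟨_, fun _ => rfl⟩
  -- the binomial expansion of `(1 + |ξ|²)^k`, each `|ξ|^{2j}` being absorbed by the dilated Gaussian at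
  -- the cost of `c^{-2j}`
  have e : multOp (fun ξ => (((1 + ‖ξ‖ ^ 2) ^ k : ℝ) : ℂ) * gaussMonomial n 0 (c • ξ)) f =
      ∑ j ∈ Finset.range (k + 1), a j •
        multOp (fun ξ => gaussMonomial n j (c • ξ)) f := by
    funext x
    simp only [Finset.sum_apply, Pi.smul_apply, smul_eq_mul, multOp_eq, ← integral_const_mul]
    rw [← integral_finsetSum]
    · congr 1
      funext ξ
      have hc' : (c : ℂ) ≠ 0 := Complex.ofReal_ne_zero.2 hc.ne'
      have h1 : ∀ j, gaussMonomial n j (c • ξ) =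
          (c : ℂ) ^ (2 * j) * ((‖ξ‖ ^ 2 : ℝ) : ℂ) ^ j * gaussMonomial n 0 (c • ξ) := by
        intro j
        rw [gaussMonomial_apply, gaussMonomial_apply, norm_smul, mul_pow, Real.norm_eq_abs, sq_abs]
        push_cast
        ring
      have h2 : (((1 + ‖ξ‖ ^ 2) ^ k : ℝ) : ℂ) = ∑ j ∈ Finset.range (k + 1),
          (k.choose j : ℂ) * ((‖ξ‖ ^ 2 : ℝ) : ℂ) ^ j := by
        rw [add_comm, add_pow]
        push_cast
        refine Finset.sum_congr rfl fun j _ => ?_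
        ring
      rw [h2, Finset.sum_mul, Finset.sum_mul, Finset.mul_sum]
      refine Finset.sum_congr rfl fun j _ => ?_
      rw [h1 j, ha]
      push_cast
      field_simp
    · intro j _
      refine Integrable.const_mul ?_ _
      have h3 : Continuous fun ξ : EuclideanSpace ℝ (Fin n) => gaussMonomial n j (c • ξ) :=
        (gaussMonomial n j).continuous.comp (by fun_prop)
      refine Integrable.bdd_mul (c := 1) ?_ (Continuous.aestronglyMeasurable (by fun_prop))
        (.of_forall fun ξ => (norm_exp_inner x ξ).le)
      refine Integrable.bdd_mul (c := SchwartzMap.seminorm ℝ 0 0 (gaussMonomial n j))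
        (integrable_fourier f) h3.aestronglyMeasurable
        (.of_forall fun ξ => SchwartzMap.norm_le_seminorm ℝ _ _)
  rw [e]
  refine (eLpNorm_sum_le (fun j _ => ?_) hp).trans ?_
  · exact ((measurable_multOp_apply ((gaussMonomial n j).continuous.comp
      (continuous_const_smul c)).measurable f).aestronglyMeasurable).const_smul _
  · push_cast
    rw [Finset.sum_mul, Finset.sum_mul]
    refine Finset.sum_le_sum fun j hj => ?_
    rw [eLpNorm_const_smul]
    have hjk : j ≤ k := Nat.lt_succ_iff.1 (Finset.mem_range.1 hj)
    have h4 : (c ^ (2 * j))⁻¹ ≤ 1 + (c ^ (2 * k))⁻¹ := by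
      rw [← inv_pow, ← inv_pow]
      have hci : 0 < c⁻¹ := by positivity
      rcases le_total c⁻¹ 1 with h | h
      · have := pow_le_one₀ (n := 2 * j) hci.le h
        have : 0 < c⁻¹ ^ (2 * k) := by positivity
        linarith
      · have := pow_le_pow_right₀ h (show 2 * j ≤ 2 * k by omega)
        linarith
    have h5 : ‖a j‖ₑ ≤
        (k.choose j : ℝ≥0∞) * ENNReal.ofReal (1 + (c ^ (2 * k))⁻¹) := by
      rw [ha, ← ofReal_norm, Complex.norm_real, Real.norm_of_nonneg (by positivity),
        ENNReal.ofReal_mul (by positivity), ENNReal.ofReal_natCast]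
      gcongr
    calc _ ≤ (k.choose j : ℝ≥0∞) * ENNReal.ofReal (1 + (c ^ (2 * k))⁻¹) *
          (C j * eLpNorm f p volume) := mul_le_mul' h5 (hC j p hp c hc f)
      _ = _ := by ring

theorem multOp_const_mul (a : ℂ) (m : EuclideanSpace ℝ (Fin n) → ℂ)
    (f : 𝓢(EuclideanSpace ℝ (Fin n), ℂ)) (x : EuclideanSpace ℝ (Fin n)) :
    multOp (fun ξ => a * m ξ) f x = a * multOp m f x := by
  simp only [multOp_eq, ← integral_const_mul]
  congr 1
  funext ξ
  ring

theorem eLpNorm_multOp_const_mul (a : ℂ) (m : EuclideanSpace ℝ (Fin n) → ℂ)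
    (f : 𝓢(EuclideanSpace ℝ (Fin n), ℂ)) (p : ℝ≥0∞) :
    eLpNorm (multOp (fun ξ => a * m ξ) f) p volume = ‖a‖ₑ * eLpNorm (multOp m f) p volume := by
  rw [← eLpNorm_const_smul]
  congr 1
  funext x
  exact multOp_const_mul a m f x

/-- Minkowski's inequality for a superposition of multipliers. -/
theorem eLpNorm_multOp_integral_le {V : Type*} [MeasurableSpace V] {ν : Measure V} [SFinite ν]
    {M : V → EuclideanSpace ℝ (Fin n) → ℂ} (hM : Measurable (Function.uncurry M))
    (f : 𝓢(EuclideanSpace ℝ (Fin n), ℂ))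
    (hint : Integrable (fun z : EuclideanSpace ℝ (Fin n) × V =>
      M z.2 z.1 * 𝓕 (f : EuclideanSpace ℝ (Fin n) → ℂ) z.1) (volume.prod ν))
    {q : ℝ≥0∞} (hq : 1 ≤ q) {K : V → ℝ≥0∞} (hK : AEMeasurable K ν) (hK0 : ∀ᵐ v ∂ν, K v ≠ 0)
    (hKt : ∀ᵐ v ∂ν, K v ≠ ∞) {A : ℝ≥0∞}
    (h : ∀ᵐ v ∂ν, eLpNorm (multOp (M v) f) q volume ≤ K v * A) :
    eLpNorm (multOp (fun ξ => ∫ v, M v ξ ∂ν) f) q volume ≤ A * ∫⁻ v, K v ∂ν := by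
  refine le_trans ?_ (eLpNorm_lintegral_le (μ := volume) (ν := ν) hq
    (F := fun x v => ‖multOp (M v) f x‖ₑ) (measurable_multOp hM f).enorm.aemeasurable hK hK0 hKt ?_)
  · refine eLpNorm_mono_enorm fun x => ?_
    rw [multOp_integral M f hint, enorm_eq_self]
    exact enorm_integral_le_lintegral_enorm _
  · filter_upwards [h] with v hv
    simpa only [eLpNorm_enorm] using hv

theorem integrable_polynomial_mul_fourier (k : ℕ) (f : 𝓢(EuclideanSpace ℝ (Fin n), ℂ)) :
    Integrable fun ξ : EuclideanSpace ℝ (Fin n) =>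
      (1 + ‖ξ‖ ^ 2) ^ k * 𝓕 (f : EuclideanSpace ℝ (Fin n) → ℂ) ξ := by
  have hg : Function.HasTemperateGrowth fun ξ : EuclideanSpace ℝ (Fin n) =>
      (1 + ‖ξ‖ ^ 2) ^ k :=
    ((Function.HasTemperateGrowth.const 1).add (Function.hasTemperateGrowth_norm_sq _)).pow k
  have := (SchwartzMap.smulLeftCLM ℂ (fun ξ : EuclideanSpace ℝ (Fin n) => (1 + ‖ξ‖ ^ 2) ^ k)
    (𝓕 f)).integrable (μ := volume)
  refine this.congr (.of_forall fun ξ => ?_)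
  rw [SchwartzMap.smulLeftCLM_apply_apply hg, SchwartzMap.fourier_coe, Complex.real_smul]
  push_cast
  rfl

/-- The weight `(1 + |ξ|²)^(s/2) exp(-c²|ξ|²)` is a Gamma integral of the weights
`(1 + |ξ|²)^k exp(-(c² + w)|ξ|²)`. -/
theorem sobolevSymbol_eq_integral {a : ℝ} (ha : 0 < a) (k : ℕ) (c : ℝ)
    (ξ : EuclideanSpace ℝ (Fin n)) :
    (((1 + ‖ξ‖ ^ 2) ^ (k - a : ℝ) : ℝ) : ℂ) * gaussMonomial n 0 (c • ξ) =
      ∫ w in Set.Ioi (0 : ℝ), ((w ^ (a - 1) * Real.exp (-w) / Real.Gamma a : ℝ) : ℂ) *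
        ((((1 + ‖ξ‖ ^ 2) ^ k : ℝ) : ℂ) * gaussMonomial n 0 (Real.sqrt (c ^ 2 + w) • ξ)) := by
  have hx : 0 < 1 + ‖ξ‖ ^ 2 := by positivity
  have hG := Real.Gamma_pos_of_pos ha
  have h1 : ∀ w ∈ Set.Ioi (0 : ℝ), ((w ^ (a - 1) * Real.exp (-w) / Real.Gamma a : ℝ) : ℂ) *
        ((((1 + ‖ξ‖ ^ 2) ^ k : ℝ) : ℂ) * gaussMonomial n 0 (Real.sqrt (c ^ 2 + w) • ξ)) =
      (((1 + ‖ξ‖ ^ 2) ^ k / Real.Gamma a * Real.exp (-(c ^ 2 * ‖ξ‖ ^ 2)) *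
        (w ^ (a - 1) * Real.exp (-((1 + ‖ξ‖ ^ 2) * w))) : ℝ) : ℂ) := by
    intro w hw
    have hw : 0 < w := hw
    rw [gauss_smul, Real.sq_sqrt (by positivity)]
    have : Real.exp (-((c ^ 2 + w) * ‖ξ‖ ^ 2)) * Real.exp (-w) = Real.exp (-(c ^ 2 * ‖ξ‖ ^ 2)) *
        Real.exp (-((1 + ‖ξ‖ ^ 2) * w)) := by
      rw [← Real.exp_add, ← Real.exp_add]
      ring_nf
    rw [← Complex.ofReal_mul, ← Complex.ofReal_mul]
    congr 1
    linear_combination (w ^ (a - 1) * (1 + ‖ξ‖ ^ 2) ^ k / Real.Gamma a) * this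
  rw [setIntegral_congr_fun measurableSet_Ioi h1, integral_complex_ofReal, integral_const_mul,
    Real.integral_rpow_mul_exp_neg_mul_Ioi ha hx, gauss_smul, ← Complex.ofReal_mul]
  congr 1
  rw [Real.rpow_sub hx, Real.rpow_natCast, one_div, Real.inv_rpow hx.le]
  have := (Real.rpow_pos_of_pos hx a).ne'
  field_simp

/-- Heat regularization at scale `c` gains `s` derivatives, with norm `O(1 + c^{-s'})`. The loss of
`s' - s` keeps the superposition in `sobolevSymbol_eq_integral` integrable. -/
theorem sobolevNorm_heat_le (n : ℕ) {s s' : ℝ} (hs0 : 0 ≤ s) (hs : s < s') :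
    ∃ C : ℝ≥0, ∀ p : ℝ≥0∞, 1 ≤ p → ∀ c : ℝ, 0 < c → ∀ f : 𝓢(EuclideanSpace ℝ (Fin n), ℂ),
      sobolevNorm s p (heat c f) ≤ C * ENNReal.ofReal (1 + c ^ (-s')) * eLpNorm f p volume := by
  -- an integer `k` above `s/2` is used in order to deal with polynomial symbols only
  obtain ⟨k, hk⟩ := exists_nat_gt (s / 2)
  set a : ℝ := k - s / 2 with ha
  have ha0 : 0 < a := by linarith
  -- with `ε > 0` the majorant `K` below is integrable at `w = 0`, uniformly in `c` up to the factor
  -- `c^{-(s + 2ε)}`, and `s + 2ε ≤ s'`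
  set ε := min (a / 2) ((s' - s) / 2) with hε
  have hε0 : 0 < ε := lt_min (by linarith) (by linarith)
  have hεa : ε ≤ a / 2 := min_le_left _ _
  have hεs : ε ≤ (s' - s) / 2 := min_le_right _ _
  obtain ⟨C, hC⟩ := eLpNorm_polynomial_heat_le n k
  have hG := Real.Gamma_pos_of_pos ha0
  have hGε := Real.Gamma_pos_of_pos hε0
  set D : ℝ := 1 + 2 * (Real.Gamma ε / Real.Gamma a) with hD
  have hD0 : 0 < D := by positivity
  refine ⟨C * D.toNNReal, fun p hp c hc f => ?_⟩
  set κ : ℝ → ℝ := fun w => w ^ (a - 1) * Real.exp (-w) / Real.Gamma a with hκ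
  have hκ0 : ∀ w ∈ Set.Ioi (0 : ℝ), 0 < κ w := fun w hw => by
    have := Real.rpow_pos_of_pos (show 0 < w from hw) (a - 1)
    simp only [hκ]
    positivity
  have hint : ∀ b : ℝ, 0 < b → IntegrableOn (fun w : ℝ => w ^ (b - 1) * Real.exp (-w)) (Set.Ioi 0) :=
    fun b hb => by simpa only [mul_comm] using Real.GammaIntegral_convergent hb
  have hκi : IntegrableOn κ (Set.Ioi 0) := (hint a ha0).div_const _
  set e : ℝ := c ^ (-(s + 2 * ε)) with he
  have he0 : 0 < e := Real.rpow_pos_of_pos hc _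
  set K : ℝ → ℝ := fun w => κ w + e / Real.Gamma a * (w ^ (ε - 1) * Real.exp (-w)) with hKdef
  have hKi : IntegrableOn K (Set.Ioi 0) := hκi.add ((hint ε hε0).const_mul _)
  have hKpos : ∀ w ∈ Set.Ioi (0 : ℝ), 0 < K w := fun w hw => by
    have := Real.rpow_pos_of_pos (show 0 < w from hw) (ε - 1)
    have := hκ0 w hw
    simp only [hKdef]
    positivity
  have hKint : ∫ w in Set.Ioi (0 : ℝ), K w = 1 + e * (Real.Gamma ε / Real.Gamma a) := by
    simp only [hKdef, hκ]
    rw [integral_add hκi ((hint ε hε0).const_mul _), integral_div, integral_const_mul]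
    have h1 : ∀ b : ℝ, 0 < b → ∫ w in Set.Ioi (0 : ℝ), w ^ (b - 1) * Real.exp (-w) = Real.Gamma b := by
      intro b hb
      rw [Real.Gamma_eq_integral hb]
      simp only [mul_comm]
    rw [h1 a ha0, h1 ε hε0]
    field_simp
  have hsym : multOp (fun ξ => (((1 + ‖ξ‖ ^ 2) ^ (s / 2) : ℝ) : ℂ)) (heat c f) =
      multOp (fun ξ => ∫ w in Set.Ioi (0 : ℝ), ((κ w : ℝ) : ℂ) *
        ((((1 + ‖ξ‖ ^ 2) ^ k : ℝ) : ℂ) * gaussMonomial n 0 (Real.sqrt (c ^ 2 + w) • ξ))) f := by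
    funext x
    rw [multOp_heat]
    congr 1
    funext ξ
    have := sobolevSymbol_eq_integral ha0 k c ξ
    rw [← this]
    congr 4
    rw [ha]
    ring
  rw [sobolevNorm_eq_multOp, hsym]
  have hM : Measurable (Function.uncurry fun (w : ℝ) (ξ : EuclideanSpace ℝ (Fin n)) =>
      ((κ w : ℝ) : ℂ) *
        ((((1 + ‖ξ‖ ^ 2) ^ k : ℝ) : ℂ) * gaussMonomial n 0 (Real.sqrt (c ^ 2 + w) • ξ))) := by
    refine Measurable.mul ?_ (Continuous.measurable ?_)
    · have : Measurable κ := by fun_prop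
      exact Complex.measurable_ofReal.comp (this.comp measurable_fst)
    · refine Continuous.mul (by fun_prop) ((gaussMonomial n 0).continuous.comp ?_)
      fun_prop
  refine (eLpNorm_multOp_integral_le (ν := volume.restrict (Set.Ioi 0)) hM f
    (integrable_symbol hM f (κ := κ) hκi (B := fun ξ => (1 + ‖ξ‖ ^ 2) ^ k) ?_ ?_) hp
    (K := fun w => ENNReal.ofReal (K w)) ?_ ?_ ?_ (A := C * eLpNorm f p volume) ?_).trans ?_
  · have := integrable_polynomial_mul_fourier k f
    push_cast
    exact this
  · filter_upwards [ae_restrict_mem measurableSet_Ioi] with w hw ξ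
    rw [gauss_smul, norm_mul, norm_mul, Complex.norm_real, Complex.norm_real, Complex.norm_real,
      Real.norm_of_nonneg (hκ0 w hw).le, Real.norm_of_nonneg (by positivity),
      Real.norm_of_nonneg (Real.exp_pos _).le]
    have : Real.exp (-(Real.sqrt (c ^ 2 + w) ^ 2 * ‖ξ‖ ^ 2)) ≤ 1 :=
      Real.exp_le_one_iff.2 (by have := sq_nonneg (Real.sqrt (c ^ 2 + w)); nlinarith [sq_nonneg ‖ξ‖])
    have h2 := (hκ0 w hw).le
    exact mul_le_mul_of_nonneg_left (mul_le_of_le_one_right (by positivity) this) h2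
  · exact hKi.1.aemeasurable.ennreal_ofReal
  · filter_upwards [ae_restrict_mem measurableSet_Ioi] with w hw
    simpa using hKpos w hw
  · exact .of_forall fun w => ENNReal.ofReal_ne_top
  · filter_upwards [ae_restrict_mem measurableSet_Ioi] with w hw
    have hw : 0 < w := hw
    have hcw : 0 < Real.sqrt (c ^ 2 + w) := Real.sqrt_pos.2 (by positivity)
    rw [eLpNorm_multOp_const_mul]
    refine (mul_le_mul_right (hC p hp _ hcw f) _).trans ?_
    rw [← ofReal_norm, Complex.norm_real, Real.norm_of_nonneg (hκ0 w hw).le]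
    have h3 : κ w * (1 + (Real.sqrt (c ^ 2 + w) ^ (2 * k))⁻¹) ≤ K w := by
      rw [pow_mul, Real.sq_sqrt (by positivity)]
      -- `(c² + w)^{-k} ≤ (c²)^{-(s/2+ε)} w^{-(a-ε)}`, since `k = (s/2 + ε) + (a - ε)`
      have h4 : ((c ^ 2 + w) ^ k)⁻¹ ≤ e * w ^ (ε - a) := by
        have h5 : (c ^ 2 + w) ^ k = (c ^ 2 + w) ^ (s / 2 + ε) * (c ^ 2 + w) ^ (a - ε) := by
          rw [← Real.rpow_add (by positivity), ← Real.rpow_natCast]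
          congr 1
          rw [ha]
          ring
        have h6 : e = ((c ^ 2) ^ (s / 2 + ε))⁻¹ := by
          rw [he, ← Real.rpow_natCast c 2, ← Real.rpow_mul hc.le, Real.rpow_neg hc.le]
          congr 2
          push_cast
          ring
        rw [h5, h6, mul_inv, show ε - a = -(a - ε) by ring, Real.rpow_neg hw.le]
        have p1 : 0 < (c ^ 2) ^ (s / 2 + ε) := by positivity
        have p2 : 0 < w ^ (a - ε) := by positivity
        gcongr <;> nlinarith [sq_nonneg c]
      have h7 : κ w * (e * w ^ (ε - a)) = e / Real.Gamma a * (w ^ (ε - 1) * Real.exp (-w)) := by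
        have : w ^ (a - 1) * w ^ (ε - a) = w ^ (ε - 1) := by
          rw [← Real.rpow_add hw]
          congr 1
          ring
        rw [← this, hκ]
        ring
      have := mul_le_mul_of_nonneg_left h4 (hκ0 w hw).le
      rw [h7] at this
      rw [mul_add, mul_one, hKdef]
      linarith
    calc ENNReal.ofReal (κ w) * (C * ENNReal.ofReal (1 + (Real.sqrt (c ^ 2 + w) ^ (2 * k))⁻¹) *
          eLpNorm f p volume)
        = ENNReal.ofReal (κ w * (1 + (Real.sqrt (c ^ 2 + w) ^ (2 * k))⁻¹)) *
          (C * eLpNorm f p volume) := by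
          rw [ENNReal.ofReal_mul (hκ0 w hw).le]
          ring
      _ ≤ _ := mul_le_mul_left (ENNReal.ofReal_le_ofReal h3) _
  · rw [← ofReal_integral_eq_lintegral_ofReal hKi ((ae_restrict_iff' measurableSet_Ioi).2
      (.of_forall fun w hw => (hKpos w hw).le)), hKint]
    have h8 : 1 + e * (Real.Gamma ε / Real.Gamma a) ≤ D * (1 + c ^ (-s')) := by
      have h9 : e ≤ 1 + c ^ (-s') := by
        rcases le_total c 1 with h | h
        · have : e ≤ c ^ (-s') := Real.rpow_le_rpow_of_exponent_ge hc h (by linarith)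
          linarith
        · have : e ≤ 1 := Real.rpow_le_one_of_one_le_of_nonpos h (by linarith)
          have := Real.rpow_pos_of_pos hc (-s')
          linarith
      have h10 : 0 < Real.Gamma ε / Real.Gamma a := by positivity
      have := Real.rpow_pos_of_pos hc (-s')
      rw [hD]
      nlinarith
    calc C * eLpNorm f p volume * ENNReal.ofReal (1 + e * (Real.Gamma ε / Real.Gamma a))
        ≤ C * eLpNorm f p volume * ENNReal.ofReal (D * (1 + c ^ (-s'))) := by gcongr
      _ = _ := by
        rw [ENNReal.ofReal_mul hD0.le, ENNReal.coe_mul]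
        change _ = C * ENNReal.ofReal D * _ * _
        ring

/-! ### The half-wave propagator at complex times -/

/-- The half-wave propagator at a complex time `z` with `Im z ≥ 0`. -/
noncomputable def cwave (z : ℂ) (f : 𝓢(EuclideanSpace ℝ (Fin n), ℂ))
    (x : EuclideanSpace ℝ (Fin n)) : ℂ :=
  multOp (fun ξ => Complex.exp (2 * Real.pi * Complex.I * z * ‖ξ‖)) f x

theorem cwave_ofReal (t : ℝ) (f : 𝓢(EuclideanSpace ℝ (Fin n), ℂ)) :
    cwave (t : ℂ) f = halfWave t f := by
  rw [halfWave_eq_multOp]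
  rfl

theorem norm_wave_symbol (z : ℂ) (r : ℝ) :
    ‖Complex.exp (2 * Real.pi * Complex.I * z * r)‖ = Real.exp (-(2 * Real.pi * z.im * r)) := by
  rw [Complex.norm_exp]
  congr 1
  have : 2 * Real.pi * Complex.I * z * r = ((2 * Real.pi * r : ℝ) : ℂ) * (Complex.I * z) := by
    push_cast
    ring
  rw [this, Complex.re_ofReal_mul, Complex.I_mul_re]
  ring

theorem norm_wave_symbol_le {z : ℂ} (hz : 0 ≤ z.im) (ξ : EuclideanSpace ℝ (Fin n)) :
    ‖Complex.exp (2 * Real.pi * Complex.I * z * ‖ξ‖)‖ ≤ 1 := by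
  rw [norm_wave_symbol, Real.exp_le_one_iff]
  have := Real.pi_pos
  have : 0 ≤ 2 * Real.pi * z.im * ‖ξ‖ := by positivity
  linarith

theorem norm_cwave_le {z : ℂ} (hz : 0 ≤ z.im) (f : 𝓢(EuclideanSpace ℝ (Fin n), ℂ))
    (x : EuclideanSpace ℝ (Fin n)) :
    ‖cwave z f x‖ ≤ ∫ ξ, ‖𝓕 (f : EuclideanSpace ℝ (Fin n) → ℂ) ξ‖ :=
  norm_multOp_le _ f x (norm_wave_symbol_le hz)

theorem continuousOn_cwave (f : 𝓢(EuclideanSpace ℝ (Fin n), ℂ)) :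
    ContinuousOn (fun z : ℂ × EuclideanSpace ℝ (Fin n) => cwave z.1 f z.2) {z | 0 ≤ z.1.im} := by
  simp only [cwave, multOp_eq]
  refine continuousOn_of_dominated
    (bound := fun ξ => ‖𝓕 (f : EuclideanSpace ℝ (Fin n) → ℂ) ξ‖) ?_ ?_ ?_ ?_
  · intro z _
    have := continuous_fourier f
    exact Continuous.aestronglyMeasurable (by fun_prop)
  · intro z hz
    refine .of_forall fun ξ => ?_
    rw [norm_mul, norm_exp_inner, one_mul, norm_mul]
    exact mul_le_of_le_one_left (norm_nonneg _) (norm_wave_symbol_le hz ξ)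
  · exact (integrable_fourier f).norm
  · exact .of_forall fun ξ => Continuous.continuousOn (by fun_prop)

theorem measurable_cwave (f : 𝓢(EuclideanSpace ℝ (Fin n), ℂ)) :
    Measurable fun z : EuclideanSpace ℝ (Fin n) × ℂ => cwave z.2 f z.1 := by
  simp only [cwave]
  exact measurable_multOp (M := fun (z : ℂ) (ξ : EuclideanSpace ℝ (Fin n)) =>
    Complex.exp (2 * Real.pi * Complex.I * z * ‖ξ‖)) (Continuous.measurable (by fun_prop)) f

theorem differentiableAt_cwave (f : 𝓢(EuclideanSpace ℝ (Fin n), ℂ))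
    (x : EuclideanSpace ℝ (Fin n)) {z : ℂ} (hz : 0 < z.im) :
    DifferentiableAt ℂ (fun z => cwave z f x) z := by
  simp only [cwave, multOp_eq]
  have hfc := continuous_fourier f
  have hopen : IsOpen {z : ℂ | 0 < z.im} := isOpen_lt continuous_const Complex.continuous_im
  refine (hasDerivAt_integral_of_dominated_loc_of_deriv_le
    (F' := fun (z : ℂ) ξ => Complex.exp (2 * Real.pi * inner ℝ ξ x * Complex.I) *
      (Complex.exp (2 * Real.pi * Complex.I * z * ‖ξ‖) * (2 * Real.pi * Complex.I * ‖ξ‖) *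
        𝓕 (f : EuclideanSpace ℝ (Fin n) → ℂ) ξ))
    (bound := fun ξ => 2 * Real.pi * ‖(1 + ‖ξ‖ ^ 2) ^ 1 *
      𝓕 (f : EuclideanSpace ℝ (Fin n) → ℂ) ξ‖)
    (hopen.mem_nhds hz) (.of_forall fun z => Continuous.aestronglyMeasurable (by fun_prop))
    ?_ (Continuous.aestronglyMeasurable (by fun_prop)) ?_ ?_ ?_).2.differentiableAt
  · refine (integrable_fourier f).norm.mono' (Continuous.aestronglyMeasurable (by fun_prop))
      (.of_forall fun ξ => ?_)
    rw [norm_mul, norm_exp_inner, one_mul, norm_mul]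
    exact mul_le_of_le_one_left (norm_nonneg _) (norm_wave_symbol_le hz.le ξ)
  · refine .of_forall fun ξ w hw => ?_
    have h1 := norm_wave_symbol_le (n := n) (show 0 ≤ w.im from le_of_lt hw) ξ
    have h2 : ‖(2 * Real.pi * Complex.I * ‖ξ‖ : ℂ)‖ = 2 * Real.pi * ‖ξ‖ := by
      simp [abs_of_pos Real.pi_pos]
    have h3 : ‖((1 : ℂ) + (‖ξ‖ : ℂ) ^ 2) ^ 1‖ = 1 + ‖ξ‖ ^ 2 := by
      have : ((1 : ℂ) + (‖ξ‖ : ℂ) ^ 2) ^ 1 = ((1 + ‖ξ‖ ^ 2 : ℝ) : ℂ) := by push_cast; ring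
      rw [this, Complex.norm_real, Real.norm_of_nonneg (by positivity)]
    rw [norm_mul, norm_exp_inner, one_mul, norm_mul, norm_mul, h2, norm_mul, h3]
    have h4 : ‖ξ‖ ≤ 1 + ‖ξ‖ ^ 2 := by nlinarith [sq_nonneg (‖ξ‖ - 1), norm_nonneg ξ]
    have := Real.pi_pos
    calc ‖Complex.exp (2 * Real.pi * Complex.I * w * ‖ξ‖)‖ * (2 * Real.pi * ‖ξ‖) *
          ‖𝓕 (f : EuclideanSpace ℝ (Fin n) → ℂ) ξ‖
        ≤ 1 * (2 * Real.pi * (1 + ‖ξ‖ ^ 2)) * ‖𝓕 (f : EuclideanSpace ℝ (Fin n) → ℂ) ξ‖ := by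
          gcongr
      _ = _ := by ring
  · have := (integrable_polynomial_mul_fourier 1 f).norm.const_mul (2 * Real.pi)
    exact this
  · refine .of_forall fun ξ w hw => ?_
    have h1 : HasDerivAt (fun z : ℂ => 2 * Real.pi * Complex.I * z * (‖ξ‖ : ℂ))
        (2 * Real.pi * Complex.I * ‖ξ‖) w := by
      simpa using ((hasDerivAt_id w).const_mul (2 * Real.pi * Complex.I : ℂ)).mul_const (‖ξ‖ : ℂ)
    exact ((h1.cexp).mul_const _).const_mul _

/-! ### Local smoothing at complex times -/

/-- The moments of the weight in the subordination formula at `w = 2πu`. -/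
theorem lintegral_subordination_weight {u b : ℝ} (hu : 0 < u) (hb : 0 ≤ b) :
    IntegrableOn (fun v : ℝ => 2 * Real.pi * u / Real.sqrt Real.pi * v ^ (-1 / 2 : ℝ) *
      Real.exp (-v * (2 * Real.pi * u) ^ 2) * v ^ (b / 2)) (Set.Ioi 0) ∧
    ∫ v in Set.Ioi (0 : ℝ), 2 * Real.pi * u / Real.sqrt Real.pi * v ^ (-1 / 2 : ℝ) *
      Real.exp (-v * (2 * Real.pi * u) ^ 2) * v ^ (b / 2) =
        Real.Gamma ((b + 1) / 2) / Real.sqrt Real.pi * (2 * Real.pi * u) ^ (-b) := by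
  set w := 2 * Real.pi * u with hw
  have hw0 : 0 < w := by have := Real.pi_pos; positivity
  have e : ∀ v ∈ Set.Ioi (0 : ℝ), w / Real.sqrt Real.pi * v ^ (-1 / 2 : ℝ) *
      Real.exp (-v * w ^ 2) * v ^ (b / 2) =
      w / Real.sqrt Real.pi * (v ^ ((b + 1) / 2 - 1) * Real.exp (-(w ^ 2 * v))) := by
    intro v hv
    have hv : 0 < v := hv
    have : v ^ ((b + 1) / 2 - 1) = v ^ (-1 / 2 : ℝ) * v ^ (b / 2) := by
      rw [← Real.rpow_add hv]
      congr 1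
      ring
    rw [this]
    ring_nf
  constructor
  · refine IntegrableOn.congr_fun ?_ (fun v hv => (e v hv).symm) measurableSet_Ioi
    refine Integrable.const_mul ?_ _
    have := integrableOn_rpow_mul_exp_neg_mul_rpow (p := 1) (s := (b + 1) / 2 - 1) (b := w ^ 2)
      (by linarith) one_pos (by positivity)
    simp only [Real.rpow_one, neg_mul] at this
    exact this
  · rw [setIntegral_congr_fun measurableSet_Ioi e, integral_const_mul,
      Real.integral_rpow_mul_exp_neg_mul_Ioi (by linarith) (by positivity)]
    have : (1 / w ^ 2) ^ ((b + 1) / 2) = w ^ (-b) * w⁻¹ := by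
      rw [one_div, ← Real.rpow_natCast, ← Real.rpow_neg hw0.le, ← Real.rpow_mul hw0.le,
        ← Real.rpow_neg_one w, ← Real.rpow_add hw0]
      congr 1
      push_cast
      ring
    rw [this]
    field_simp

/-- The subordination of `cwave (t + iu)` to the half-wave flow of the heat-regularized data. -/
theorem cwave_eq_integral_halfWave {u : ℝ} (hu : 0 < u) (t : ℝ)
    (f : 𝓢(EuclideanSpace ℝ (Fin n), ℂ)) (x : EuclideanSpace ℝ (Fin n)) :
    cwave (t + u * Complex.I) f x = ∫ v in Set.Ioi (0 : ℝ),
      ((2 * Real.pi * u / Real.sqrt Real.pi * v ^ (-1 / 2 : ℝ) *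
        Real.exp (-v * (2 * Real.pi * u) ^ 2) : ℝ) : ℂ) *
        halfWave t (heat (2 * Real.sqrt v)⁻¹ f) x := by
  set κ : ℝ → ℝ := fun v => 2 * Real.pi * u / Real.sqrt Real.pi * v ^ (-1 / 2 : ℝ) *
    Real.exp (-v * (2 * Real.pi * u) ^ 2) with hκ
  have hκi : IntegrableOn κ (Set.Ioi 0) := by
    have := (lintegral_subordination_weight hu (le_refl 0)).1
    simp only [zero_div, Real.rpow_zero, mul_one] at this
    exact this
  have hpi := Real.pi_pos
  set M : ℝ → EuclideanSpace ℝ (Fin n) → ℂ := fun v ξ => (κ v : ℂ) *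
    (Complex.exp (2 * Real.pi * Complex.I * t * ‖ξ‖) *
      gaussMonomial n 0 ((2 * Real.sqrt v)⁻¹ • ξ)) with hMdef
  have hM : Measurable (Function.uncurry M) := by
    have h1 : Measurable κ := by fun_prop
    have h0 : Measurable fun z : ℝ × EuclideanSpace ℝ (Fin n) => (2 * Real.sqrt z.1)⁻¹ := by
      fun_prop
    have h2 : Measurable fun z : ℝ × EuclideanSpace ℝ (Fin n) => (2 * Real.sqrt z.1)⁻¹ • z.2 :=
      h0.smul measurable_snd
    have h3 : Continuous fun z : ℝ × EuclideanSpace ℝ (Fin n) =>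
        Complex.exp (2 * Real.pi * Complex.I * t * ‖z.2‖) := by fun_prop
    exact (Complex.measurable_ofReal.comp (h1.comp measurable_fst)).mul
      (h3.measurable.mul ((gaussMonomial n 0).continuous.measurable.comp h2))
  have hint := integrable_symbol (ν := volume.restrict (Set.Ioi 0)) hM f (κ := κ) hκi
    (B := fun _ => 1) (by simpa using integrable_fourier f) (by
      filter_upwards [ae_restrict_mem measurableSet_Ioi] with v hv ξ
      have hv : 0 < v := hv
      have h1 := norm_wave_symbol_le (n := n) (z := (t : ℂ)) (by simp) ξ
      simp only [hMdef]
      rw [gauss_smul, norm_mul, norm_mul, Complex.norm_real, Complex.norm_real,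
        Real.norm_of_nonneg (Real.exp_pos _).le, Real.norm_of_nonneg (by positivity)]
      have h2 : Real.exp (-((2 * Real.sqrt v)⁻¹ ^ 2 * ‖ξ‖ ^ 2)) ≤ 1 := by
        rw [Real.exp_le_one_iff]
        have : 0 ≤ (2 * Real.sqrt v)⁻¹ ^ 2 * ‖ξ‖ ^ 2 := by positivity
        linarith
      refine mul_le_mul_of_nonneg_left ?_ (by positivity)
      exact mul_le_one₀ h1 (Real.exp_pos _).le h2)
  have hsym : (fun ξ : EuclideanSpace ℝ (Fin n) =>
      Complex.exp (2 * Real.pi * Complex.I * (t + u * Complex.I) * ‖ξ‖)) =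
      fun ξ => ∫ v in Set.Ioi (0 : ℝ), M v ξ := by
    funext ξ
    have h1 := exp_neg_mul_eq_integral (w := ((2 * Real.pi * u : ℝ) : ℂ))
      (by rw [Complex.ofReal_re]; positivity)
      (by rw [← Complex.ofReal_pow, Complex.ofReal_re]; positivity) (norm_nonneg ξ)
    have h2 : Complex.exp (2 * Real.pi * Complex.I * (t + u * Complex.I) * ‖ξ‖) =
        Complex.exp (2 * Real.pi * Complex.I * t * ‖ξ‖) *
          Complex.exp (-((2 * Real.pi * u : ℝ) : ℂ) * ‖ξ‖) := by
      rw [← Complex.exp_add]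
      congr 1
      push_cast
      linear_combination (2 * Real.pi * u * ‖ξ‖ : ℂ) * Complex.I_sq
    rw [h2, h1, ← integral_const_mul]
    refine setIntegral_congr_fun measurableSet_Ioi fun v hv => ?_
    have hv : 0 < v := hv
    simp only [hMdef, hκ]
    rw [gauss_smul]
    have h3 : (2 * Real.sqrt v)⁻¹ ^ 2 * ‖ξ‖ ^ 2 = ‖ξ‖ ^ 2 / (4 * v) := by
      rw [inv_pow, mul_pow, Real.sq_sqrt hv.le]
      field_simp
      ring
    rw [h3]
    push_cast
    ring
  rw [cwave, hsym, multOp_integral M f hint]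
  refine setIntegral_congr_fun measurableSet_Ioi fun v hv => ?_
  simp only [hMdef]
  rw [multOp_const_mul, halfWave_eq_multOp, multOp_heat]

/-- Local smoothing at complex times: the regularization `e^{-2πu√-Δ}` replaces the Sobolev norm by
the `L^p` norm at the price of the factor `1 + u^{-s'}`. -/
theorem eLpNorm_cwave_le {p q : ℝ≥0∞} {s s' : ℝ} (hp : 1 ≤ p) (hq : 1 ≤ q) (hs0 : 0 ≤ s)
    (hs : s < s') (hLS : LocalSmoothing n p q s) :
    ∃ C : ℝ≥0, ∀ u : ℝ, 0 < u → ∀ f : 𝓢(EuclideanSpace ℝ (Fin n), ℂ),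
      eLpNorm (fun z : EuclideanSpace ℝ (Fin n) × ℝ => cwave (z.2 + u * Complex.I) f z.1) q
        (volume.prod (volume.restrict (Set.Icc 1 2))) ≤
          C * ENNReal.ofReal (1 + u ^ (-s')) * eLpNorm f p volume := by
  obtain ⟨C₁, hC₁⟩ := hLS
  obtain ⟨C₂, hC₂⟩ := sobolevNorm_heat_le n hs0 hs
  have hs'0 : 0 ≤ s' := by linarith
  have hpi := Real.pi_pos
  set D : ℝ := 1 + 2 ^ s' * (Real.Gamma ((s' + 1) / 2) / Real.sqrt Real.pi *
    (2 * Real.pi) ^ (-s')) with hD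
  have hG : 0 < Real.Gamma ((s' + 1) / 2) := Real.Gamma_pos_of_pos (by linarith)
  have hD0 : 0 < D := by positivity
  refine ⟨C₁ * C₂ * D.toNNReal, fun u hu f => ?_⟩
  set κ : ℝ → ℝ := fun v => 2 * Real.pi * u / Real.sqrt Real.pi * v ^ (-1 / 2 : ℝ) *
    Real.exp (-v * (2 * Real.pi * u) ^ 2) with hκ
  have hκ0 : ∀ v ∈ Set.Ioi (0 : ℝ), 0 < κ v := fun v hv => by
    have := Real.rpow_pos_of_pos (show 0 < v from hv) (-1 / 2)
    simp only [hκ]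
    positivity
  obtain ⟨i1, e1⟩ := lintegral_subordination_weight hu (le_refl 0)
  obtain ⟨i2, e2⟩ := lintegral_subordination_weight hu hs'0
  simp only [zero_div, Real.rpow_zero, mul_one, zero_add, Real.Gamma_one_half_eq,
    div_self (Real.sqrt_pos.2 hpi).ne', neg_zero] at i1 e1
  -- `K v = κ v (1 + c^{-s'})`, where `c = 1/(2√v)` is the scale of the heat regularization
  set K : ℝ → ℝ := fun v => κ v + 2 ^ s' * (κ v * v ^ (s' / 2)) with hK
  have hKi : IntegrableOn K (Set.Ioi 0) := i1.add (i2.const_mul _)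
  have hKpos : ∀ v ∈ Set.Ioi (0 : ℝ), 0 < K v := fun v hv => by
    have := Real.rpow_pos_of_pos (show 0 < v from hv) (s' / 2)
    have := hκ0 v hv
    simp only [hK]
    positivity
  have hKint : ∫ v in Set.Ioi (0 : ℝ), K v =
      1 + 2 ^ s' * (Real.Gamma ((s' + 1) / 2) / Real.sqrt Real.pi * (2 * Real.pi * u) ^ (-s')) := by
    simp only [hK]
    rw [integral_add i1 (i2.const_mul _), integral_const_mul, e1, e2]
  have hmeas : Measurable (Function.uncurry fun (z : EuclideanSpace ℝ (Fin n) × ℝ) (v : ℝ) =>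
      ‖(κ v : ℂ) * halfWave z.2 (heat (2 * Real.sqrt v)⁻¹ f) z.1‖ₑ) := by
    have h1 : Measurable κ := by fun_prop
    have h2 : Measurable fun z : (ℝ × ℝ) × EuclideanSpace ℝ (Fin n) =>
        (2 * Real.sqrt z.1.2)⁻¹ • z.2 := by
      have h0 : Measurable fun z : (ℝ × ℝ) × EuclideanSpace ℝ (Fin n) =>
        (2 * Real.sqrt z.1.2)⁻¹ := by fun_prop
      exact h0.smul measurable_snd
    have h3 : Continuous fun z : (ℝ × ℝ) × EuclideanSpace ℝ (Fin n) =>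
        Complex.exp (2 * Real.pi * Complex.I * z.1.1 * ‖z.2‖) := by fun_prop
    have h4 := measurable_multOp (P := ℝ × ℝ) (M := fun r ξ =>
      Complex.exp (2 * Real.pi * Complex.I * r.1 * ‖ξ‖) *
        gaussMonomial n 0 ((2 * Real.sqrt r.2)⁻¹ • ξ))
      (h3.measurable.mul ((gaussMonomial n 0).continuous.measurable.comp h2)) f
    have h5 : Measurable fun w : (EuclideanSpace ℝ (Fin n) × ℝ) × ℝ => (w.1.1, (w.1.2, w.2)) :=
      (measurable_fst.comp measurable_fst).prodMk
        ((measurable_snd.comp measurable_fst).prodMk measurable_snd)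
    have h6 := (Complex.measurable_ofReal.comp (h1.comp measurable_snd)).mul (h4.comp h5)
    have h7 := h6.enorm
    convert h7 using 1
    funext w
    simp only [Function.uncurry, Pi.mul_apply, Function.comp_apply]
    rw [halfWave_eq_multOp, multOp_heat]
  refine le_trans ?_ ((eLpNorm_lintegral_le (μ := volume.prod (volume.restrict (Set.Icc 1 2)))
    (ν := volume.restrict (Set.Ioi 0)) hq
    (F := fun (z : EuclideanSpace ℝ (Fin n) × ℝ) (v : ℝ) =>
      ‖(κ v : ℂ) * halfWave z.2 (heat (2 * Real.sqrt v)⁻¹ f) z.1‖ₑ) hmeas.aemeasurable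
    (K := fun v => ENNReal.ofReal (K v)) hKi.1.aemeasurable.ennreal_ofReal ?_
    (.of_forall fun v => ENNReal.ofReal_ne_top) (A := C₁ * C₂ * eLpNorm f p volume) ?_).trans ?_)
  · refine eLpNorm_mono_enorm fun z => ?_
    rw [cwave_eq_integral_halfWave hu, enorm_eq_self]
    exact enorm_integral_le_lintegral_enorm _
  · filter_upwards [ae_restrict_mem measurableSet_Ioi] with v hv
    simpa using hKpos v hv
  · filter_upwards [ae_restrict_mem measurableSet_Ioi] with v hv
    have hv : 0 < v := hv
    have hc : 0 < (2 * Real.sqrt v)⁻¹ := by positivity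
    rw [eLpNorm_enorm]
    have h1 : eLpNorm (fun z : EuclideanSpace ℝ (Fin n) × ℝ =>
        (κ v : ℂ) * halfWave z.2 (heat (2 * Real.sqrt v)⁻¹ f) z.1) q
          (volume.prod (volume.restrict (Set.Icc 1 2))) =
        ENNReal.ofReal (κ v) * eLpNorm (fun z : EuclideanSpace ℝ (Fin n) × ℝ =>
          halfWave z.2 (heat (2 * Real.sqrt v)⁻¹ f) z.1) q
            (volume.prod (volume.restrict (Set.Icc 1 2))) := by
      have h2 : ENNReal.ofReal (κ v) = ‖(κ v : ℂ)‖ₑ := by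
        rw [← ofReal_norm, Complex.norm_real, Real.norm_of_nonneg (hκ0 v hv).le]
      rw [h2, ← eLpNorm_const_smul]
      rfl
    rw [h1]
    have h3 : κ v * (1 + ((2 * Real.sqrt v)⁻¹) ^ (-s')) = K v := by
      rw [Real.inv_rpow (by positivity), ← Real.rpow_neg (by positivity), neg_neg,
        Real.mul_rpow (by norm_num) (by positivity), Real.sqrt_eq_rpow, ← Real.rpow_mul hv.le, hK]
      ring_nf
    calc _ ≤ ENNReal.ofReal (κ v) * (C₁ * (C₂ * ENNReal.ofReal (1 + ((2 * Real.sqrt v)⁻¹) ^ (-s')) *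
          eLpNorm f p volume)) := by
          gcongr
          exact (hC₁ _).trans (mul_le_mul_right (hC₂ p hp _ hc f) _)
      _ = ENNReal.ofReal (κ v * (1 + ((2 * Real.sqrt v)⁻¹) ^ (-s'))) *
          (C₁ * C₂ * eLpNorm f p volume) := by
          rw [ENNReal.ofReal_mul (hκ0 v hv).le]
          ring
      _ = _ := by rw [h3]
  · rw [← ofReal_integral_eq_lintegral_ofReal hKi ((ae_restrict_iff' measurableSet_Ioi).2
      (.of_forall fun w hw => (hKpos w hw).le)), hKint]
    have h8 : 1 + 2 ^ s' * (Real.Gamma ((s' + 1) / 2) / Real.sqrt Real.pi *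
        (2 * Real.pi * u) ^ (-s')) ≤ D * (1 + u ^ (-s')) := by
      rw [Real.mul_rpow (by positivity) hu.le, hD]
      have h9 := Real.rpow_pos_of_pos hu (-s')
      have h10 : 0 < 2 ^ s' * (Real.Gamma ((s' + 1) / 2) / Real.sqrt Real.pi *
        (2 * Real.pi) ^ (-s')) := by positivity
      nlinarith
    calc C₁ * C₂ * eLpNorm f p volume * ENNReal.ofReal (1 + 2 ^ s' * (Real.Gamma ((s' + 1) / 2) /
          Real.sqrt Real.pi * (2 * Real.pi * u) ^ (-s')))
        ≤ C₁ * C₂ * eLpNorm f p volume * ENNReal.ofReal (D * (1 + u ^ (-s'))) := by gcongr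
      _ = _ := by
        rw [ENNReal.ofReal_mul hD0.le, ENNReal.coe_mul, ENNReal.coe_mul]
        change _ = C₁ * C₂ * ENNReal.ofReal D * _ * _
        ring

/-! ### Maximal bounds on horizontal segments in the upper half-plane -/

/-- A one-dimensional Sobolev embedding: a function is bounded on an interval by its average and the
total variation. -/
theorem enorm_le_average_add_lintegral_deriv {G G' : ℝ → ℂ} {a b t : ℝ} (hab : a < b)
    (ht : t ∈ Set.Icc a b) (hG : ∀ τ ∈ Set.Icc a b, HasDerivAt G (G' τ) τ)
    (hG' : ContinuousOn G' (Set.Icc a b)) :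
    ‖G t‖ₑ ≤ ENNReal.ofReal (b - a)⁻¹ * (∫⁻ τ in Set.Icc a b, ‖G τ‖ₑ) +
      ∫⁻ τ in Set.Icc a b, ‖G' τ‖ₑ := by
  have hpos : 0 < b - a := sub_pos.2 hab
  have key : ∀ τ ∈ Set.Icc a b, ‖G t‖ₑ ≤ ‖G τ‖ₑ + ∫⁻ σ in Set.Icc a b, ‖G' σ‖ₑ := by
    intro τ hτ
    have hsub : Set.uIcc τ t ⊆ Set.Icc a b := Set.uIcc_subset_Icc hτ ht
    have h1 : ∫ σ in τ..t, G' σ = G t - G τ :=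
      intervalIntegral.integral_eq_sub_of_hasDerivAt (fun σ hσ => hG σ (hsub hσ))
        ((hG'.mono hsub).intervalIntegrable)
    have h2 : G t = G τ + ∫ σ in τ..t, G' σ := by rw [h1]; ring
    rw [h2]
    refine (enorm_add_le _ _).trans (add_le_add le_rfl ?_)
    have h3 : ‖∫ σ in τ..t, G' σ‖ₑ = ‖∫ σ in Set.uIoc τ t, G' σ‖ₑ := by
      rw [← ofReal_norm, ← ofReal_norm, intervalIntegral.norm_intervalIntegral_eq]
    rw [h3]
    refine (enorm_integral_le_lintegral_enorm _).trans (lintegral_mono_set ?_)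
    exact Set.uIoc_subset_uIcc.trans hsub
  have h4 : ∫⁻ _τ in Set.Icc a b, ‖G t‖ₑ ≤
      ∫⁻ τ in Set.Icc a b, (‖G τ‖ₑ + ∫⁻ σ in Set.Icc a b, ‖G' σ‖ₑ) :=
    setLIntegral_mono' measurableSet_Icc key
  have hGc : ContinuousOn G (Set.Icc a b) := fun τ hτ => (hG τ hτ).continuousAt.continuousWithinAt
  rw [lintegral_const, lintegral_add_right _ measurable_const, lintegral_const,
    Measure.restrict_apply_univ, Real.volume_Icc] at h4
  have h5 : ENNReal.ofReal (b - a)⁻¹ * ENNReal.ofReal (b - a) = 1 := by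
    rw [← ENNReal.ofReal_mul (by positivity), inv_mul_cancel₀ hpos.ne', ENNReal.ofReal_one]
  calc ‖G t‖ₑ = ENNReal.ofReal (b - a)⁻¹ * (‖G t‖ₑ * ENNReal.ofReal (b - a)) := by
        rw [mul_left_comm, h5, mul_one]
    _ ≤ ENNReal.ofReal (b - a)⁻¹ * ((∫⁻ τ in Set.Icc a b, ‖G τ‖ₑ) +
          (∫⁻ τ in Set.Icc a b, ‖G' τ‖ₑ) * ENNReal.ofReal (b - a)) := by gcongr
    _ = _ := by
      rw [mul_add, mul_left_comm _ (∫⁻ τ in Set.Icc a b, ‖G' τ‖ₑ), h5, mul_one]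

/-- Hölder on a short interval. -/
theorem lintegral_Icc_le_eLpNorm {g : ℝ → ℝ≥0∞} {a b c d : ℝ} {q : ℝ≥0∞} (hq : 1 ≤ q)
    (hg : Measurable g) (hab : a < b) (hsub : Set.Icc a b ⊆ Set.Icc c d) :
    ∫⁻ τ in Set.Icc a b, g τ ≤
      ENNReal.ofReal ((b - a) ^ (1 - (q⁻¹).toReal)) *
        eLpNorm g q (volume.restrict (Set.Icc c d)) := by
  have h1 := eLpNorm_le_eLpNorm_mul_rpow_measure_univ hq
    (hg.aestronglyMeasurable (μ := volume.restrict (Set.Icc a b)))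
  rw [eLpNorm_one_eq_lintegral_enorm] at h1
  simp only [enorm_eq_self] at h1
  refine h1.trans ?_
  rw [mul_comm, Measure.restrict_apply_univ, Real.volume_Icc,
    ENNReal.ofReal_rpow_of_pos (sub_pos.2 hab), ENNReal.toReal_inv, ENNReal.toReal_one, div_one,
    one_div]
  gcongr

/-- Cauchy's estimate for the half-wave flow, with the average over the circle in place of the maximum,
so that it can be used with `L^q` norms. -/
theorem enorm_deriv_cwave_le (f : 𝓢(EuclideanSpace ℝ (Fin n), ℂ)) (x : EuclideanSpace ℝ (Fin n))
    {z : ℂ} {r : ℝ} (hr : 0 < r) (hz : r < z.im) :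
    ‖deriv (fun w => cwave w f x) z‖ₑ ≤ ENNReal.ofReal (2 * Real.pi * r)⁻¹ *
      ∫⁻ θ in Set.Ioc 0 (2 * Real.pi), ‖cwave (circleMap z r θ) f x‖ₑ := by
  have hpi := Real.pi_pos
  have hU : IsOpen {w : ℂ | 0 < w.im} := isOpen_lt continuous_const Complex.continuous_im
  have hball : Metric.closedBall z r ⊆ {w : ℂ | 0 < w.im} := by
    intro w hw
    have h1 : ‖w - z‖ ≤ r := by simpa [dist_eq_norm] using hw
    have h2 := (abs_le.1 (Complex.abs_im_le_norm (w - z))).1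
    simp only [Complex.sub_im] at h2
    change 0 < w.im
    linarith
  rw [← Complex.cderiv_eq_deriv hU
    (fun w hw => (differentiableAt_cwave f x hw).differentiableWithinAt) hr hball, Complex.cderiv,
    circleIntegral, enorm_smul, intervalIntegral.integral_of_le (by positivity)]
  have h1 : ∀ θ : ℝ, ‖deriv (circleMap z r) θ • (((circleMap z r θ - z) ^ 2)⁻¹ •
      cwave (circleMap z r θ) f x)‖ₑ = ENNReal.ofReal r⁻¹ * ‖cwave (circleMap z r θ) f x‖ₑ := by
    intro θ
    rw [enorm_smul, enorm_smul, ← mul_assoc]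
    congr 1
    rw [← ofReal_norm, ← ofReal_norm, ← ENNReal.ofReal_mul (norm_nonneg _)]
    congr 1
    simp only [deriv_circleMap, circleMap_sub_center, norm_mul, norm_inv, norm_pow,
      norm_circleMap_zero, Complex.norm_I, abs_of_pos hr]
    field_simp
  have h2 : ‖(2 * Real.pi * Complex.I : ℂ)⁻¹‖ₑ * ENNReal.ofReal r⁻¹ =
      ENNReal.ofReal (2 * Real.pi * r)⁻¹ := by
    rw [← ofReal_norm, ← ENNReal.ofReal_mul (norm_nonneg _)]
    congr 1
    simp only [mul_inv_rev, Complex.inv_I, norm_mul, norm_neg, Complex.norm_I, norm_inv,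
      Complex.norm_real, Real.norm_of_nonneg hpi.le, Complex.norm_ofNat]
    ring
  calc _ ≤ ‖(2 * Real.pi * Complex.I : ℂ)⁻¹‖ₑ * (ENNReal.ofReal r⁻¹ *
        ∫⁻ θ in Set.Ioc 0 (2 * Real.pi), ‖cwave (circleMap z r θ) f x‖ₑ) := by
        gcongr
        refine (enorm_integral_le_lintegral_enorm _).trans ?_
        simp only [h1]
        rw [lintegral_const_mul' _ _ ENNReal.ofReal_ne_top]
    _ = _ := by rw [← mul_assoc, h2]

/-- An iterated `L^q` norm is the `L^q` norm on the product. -/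
theorem eLpNorm_eLpNorm_eq {X Y : Type*} [MeasurableSpace X] [MeasurableSpace Y] {μ : Measure X}
    {ν : Measure Y} [SFinite μ] [SFinite ν] {q : ℝ≥0∞} (hq : q ≠ 0) (hqt : q ≠ ∞)
    {g : X × Y → ℝ≥0∞} (hg : Measurable g) :
    eLpNorm (fun x => eLpNorm (fun y => g (x, y)) q ν) q μ = eLpNorm g q (μ.prod ν) := by
  have hq0 : q.toReal ≠ 0 := (ENNReal.toReal_pos hq hqt).ne'
  simp only [eLpNorm_eq_lintegral_rpow_enorm_toReal hq hqt, enorm_eq_self, ← ENNReal.rpow_mul,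
    one_div_mul_cancel hq0, ENNReal.rpow_one]
  rw [lintegral_prod _ (by fun_prop)]

theorem measurable_eLpNorm_right {X Y : Type*} [MeasurableSpace X] [MeasurableSpace Y]
    {ν : Measure Y} [SFinite ν] {q : ℝ≥0∞} (hq : q ≠ 0) (hqt : q ≠ ∞)
    {g : X × Y → ℝ≥0∞} (hg : Measurable g) :
    Measurable fun x => eLpNorm (fun y => g (x, y)) q ν := by
  simp only [eLpNorm_eq_lintegral_rpow_enorm_toReal hq hqt, enorm_eq_self]
  have : Measurable fun z : X × Y => g z ^ q.toReal := by fun_prop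
  exact this.lintegral_prod_right'.pow_const _

theorem eLpNorm_const_mul_ennreal_le {X : Type*} [MeasurableSpace X] {μ : Measure X} {q c : ℝ≥0∞}
    (hc : c ≠ ∞) (g : X → ℝ≥0∞) : eLpNorm (fun x => c * g x) q μ ≤ c * eLpNorm g q μ := by
  lift c to ℝ≥0 using hc
  exact eLpNorm_le_mul_eLpNorm_of_ae_le_mul' (.of_forall fun x => by simp) q

theorem continuous_cwave_line (f : 𝓢(EuclideanSpace ℝ (Fin n), ℂ)) {u : ℝ} (hu : 0 < u) :
    Continuous fun z : EuclideanSpace ℝ (Fin n) × ℝ => cwave (z.2 + u * Complex.I) f z.1 := by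
  have h1 : Continuous fun z : EuclideanSpace ℝ (Fin n) × ℝ => ((z.2 : ℂ) + u * Complex.I, z.1) := by
    fun_prop
  have := (continuousOn_cwave f).comp (s := Set.univ) h1.continuousOn (fun z _ => by
    simpa using hu.le)
  rw [← continuousOn_univ]
  exact this

/-- The local smoothing estimate at height `h ∈ [u/2, ∞)` for small `u`. -/
theorem eLpNorm_cwave_le_of_height {p q : ℝ≥0∞} {s s' : ℝ} (hp : 1 ≤ p) (hq : 1 ≤ q) (hs0 : 0 ≤ s)
    (hs : s < s') (hLS : LocalSmoothing n p q s) :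
    ∃ C : ℝ≥0, ∀ u ∈ Set.Ioc (0 : ℝ) 2, ∀ h : ℝ, u / 2 ≤ h →
      ∀ f : 𝓢(EuclideanSpace ℝ (Fin n), ℂ),
      eLpNorm (fun z : EuclideanSpace ℝ (Fin n) × ℝ => cwave (z.2 + h * Complex.I) f z.1) q
        (volume.prod (volume.restrict (Set.Icc 1 2))) ≤
          C * ENNReal.ofReal (u ^ (-s')) * eLpNorm f p volume := by
  obtain ⟨C, hC⟩ := eLpNorm_cwave_le hp hq hs0 hs hLS
  refine ⟨C * (2 * 2 ^ s' : ℝ).toNNReal, fun u hu h hh f => ?_⟩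
  obtain ⟨hu0, hu2⟩ := hu
  have h0 : 0 < h := by linarith
  refine (hC h h0 f).trans ?_
  have h1 : h ^ (-s') ≤ 2 ^ s' * u ^ (-s') := by
    have : h ^ (-s') ≤ (u / 2) ^ (-s') :=
      Real.rpow_le_rpow_of_nonpos (by linarith) hh (by linarith)
    refine this.trans (le_of_eq ?_)
    rw [Real.div_rpow hu0.le (by norm_num), Real.rpow_neg (by norm_num : (0:ℝ) ≤ 2), div_inv_eq_mul,
      mul_comm]
  have h2 : 1 ≤ 2 ^ s' * u ^ (-s') := by
    rw [Real.rpow_neg hu0.le, ← div_eq_mul_inv, one_le_div (by positivity)]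
    exact Real.rpow_le_rpow hu0.le hu2 (by linarith)
  have h3 : 1 + h ^ (-s') ≤ 2 * 2 ^ s' * u ^ (-s') := by linarith
  calc C * ENNReal.ofReal (1 + h ^ (-s')) * eLpNorm f p volume
      ≤ C * ENNReal.ofReal (2 * 2 ^ s' * u ^ (-s')) * eLpNorm f p volume := by gcongr
    _ = _ := by
      rw [ENNReal.ofReal_mul (by positivity), ENNReal.coe_mul]
      change _ = C * ENNReal.ofReal (2 * 2 ^ s') * _ * _
      ring

/-- Circle averages of the half-wave flow, in `L^q`. -/
theorem eLpNorm_lintegral_circle_cwave_le {q A : ℝ≥0∞} (hq : 1 ≤ q) {u : ℝ}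
    (hu : u ∈ Set.Ioc (0 : ℝ) 2) (f : 𝓢(EuclideanSpace ℝ (Fin n), ℂ))
    (hA : ∀ h : ℝ, u / 2 ≤ h →
      eLpNorm (fun z : EuclideanSpace ℝ (Fin n) × ℝ => cwave (z.2 + h * Complex.I) f z.1) q
        (volume.prod (volume.restrict (Set.Icc 1 2))) ≤ A) :
    eLpNorm (fun z : EuclideanSpace ℝ (Fin n) × ℝ => ∫⁻ θ in Set.Ioc 0 (2 * Real.pi),
      ‖cwave (circleMap (z.2 + u * Complex.I) (u / 8) θ) f z.1‖ₑ) q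
        (volume.prod (volume.restrict (Set.Icc (5 / 4) (3 / 2)))) ≤
          A * ENNReal.ofReal (2 * Real.pi) := by
  obtain ⟨hu0, hu2⟩ := hu
  have hm : Measurable (Function.uncurry fun (z : EuclideanSpace ℝ (Fin n) × ℝ) (θ : ℝ) =>
      ‖cwave (circleMap (z.2 + u * Complex.I) (u / 8) θ) f z.1‖ₑ) := by
    have h1 : Measurable fun w : (EuclideanSpace ℝ (Fin n) × ℝ) × ℝ =>
        (w.1.1, circleMap (w.1.2 + u * Complex.I) (u / 8) w.2) := by
      unfold circleMap
      fun_prop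
    exact ((measurable_cwave f).comp h1).enorm
  have := eLpNorm_lintegral_le (μ := volume.prod (volume.restrict (Set.Icc (5 / 4) (3 / 2))))
    (ν := volume.restrict (Set.Ioc 0 (2 * Real.pi))) hq hm.aemeasurable (K := fun _ => 1)
    aemeasurable_const (by simp) (by simp) (A := A) (.of_forall fun θ => ?_)
  · simpa using this
  · rw [eLpNorm_enorm, one_mul]
    have hcos := Real.cos_le_one θ
    have hcos' := Real.neg_one_le_cos θ
    have hsin' := Real.neg_one_le_sin θ
    refine le_trans ?_ (hA (u + u / 8 * Real.sin θ) (by nlinarith))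
    -- a point of the circle is a horizontal translate of its centre, at another height; the translation
    -- keeps the times in `[1, 2]` since `u/8 ≤ 1/4`
    have hshift : MeasurePreserving (fun z : EuclideanSpace ℝ (Fin n) × ℝ =>
        (z.1, z.2 + u / 8 * Real.cos θ)) (volume.prod (volume.restrict
          ((fun t : ℝ => t + u / 8 * Real.cos θ) ⁻¹' (Set.Icc 1 2))))
        (volume.prod (volume.restrict (Set.Icc 1 2))) :=
      (MeasurePreserving.id _).prod
        ((measurePreserving_add_right volume (u / 8 * Real.cos θ)).restrict_preimage
          measurableSet_Icc)
    rw [← eLpNorm_comp_measurePreserving (continuous_cwave_line f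
      (by nlinarith : 0 < u + u / 8 * Real.sin θ)).aestronglyMeasurable hshift]
    have h1 : ((fun z : EuclideanSpace ℝ (Fin n) × ℝ =>
        cwave (z.2 + (u + u / 8 * Real.sin θ : ℝ) * Complex.I) f z.1) ∘
          fun z : EuclideanSpace ℝ (Fin n) × ℝ => (z.1, z.2 + u / 8 * Real.cos θ)) =
        fun z : EuclideanSpace ℝ (Fin n) × ℝ =>
        cwave (circleMap (z.2 + u * Complex.I) (u / 8) θ) f z.1 := by
      funext z
      simp only [Function.comp_apply]
      congr 1
      rw [circleMap, Complex.exp_mul_I, ← Complex.ofReal_cos, ← Complex.ofReal_sin]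
      push_cast
      ring
    rw [h1]
    refine eLpNorm_mono_measure _ (Measure.prod_mono le_rfl (Measure.restrict_mono_set _ ?_))
    intro t ht
    simp only [Set.mem_preimage, Set.mem_Icc] at ht ⊢
    constructor <;> nlinarith

/-- On the segment `[5/4, 3/2] + iu` the half-wave flow is dominated by a function of `x` whose
`L^q` norm loses only `u^{-1/q}` compared with the space-time norm. -/
theorem exists_horizontal_bound {p q : ℝ≥0∞} {s s' : ℝ} (hp : 1 ≤ p) (hq : 1 ≤ q) (hs0 : 0 ≤ s)
    (hs : s < s') (hLS : LocalSmoothing n p q s) :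
    ∃ C : ℝ≥0, ∀ f : 𝓢(EuclideanSpace ℝ (Fin n), ℂ), ∃ B : EuclideanSpace ℝ (Fin n) → ℝ → ℝ≥0∞,
      Measurable (Function.uncurry B) ∧
      (∀ u ∈ Set.Ioc (0 : ℝ) 2, ∀ t ∈ Set.Icc (5 / 4 : ℝ) (3 / 2), ∀ x,
        ‖cwave (t + u * Complex.I) f x‖ₑ ≤ B x u) ∧
      ∀ u ∈ Set.Ioc (0 : ℝ) 2, eLpNorm (fun x => B x u) q volume ≤
        C * ENNReal.ofReal (u ^ (-(s' + (q⁻¹).toReal))) * eLpNorm f p volume := by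
  obtain ⟨C, hC⟩ := eLpNorm_cwave_le_of_height hp hq hs0 hs hLS
  have hpi := Real.pi_pos
  have hpi3 := Real.pi_gt_three
  rcases eq_or_ne q ∞ with rfl | hqt
  · refine ⟨C, fun f => ⟨fun _ u => C * ENNReal.ofReal (u ^ (-s')) * eLpNorm f p volume, ?_, ?_, ?_⟩⟩
    · have : Measurable fun u : ℝ => u ^ (-s') := by fun_prop
      exact ((this.ennreal_ofReal.const_mul _).mul_const _).comp measurable_snd
    · intro u hu t ht x
      set A := C * ENNReal.ofReal (u ^ (-s')) * eLpNorm f p volume with hA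
      have h1 := hC u hu u (by linarith [hu.1]) f
      rw [eLpNorm_exponent_top] at h1
      have h2 := (enorm_ae_le_eLpNormEssSup (fun z : EuclideanSpace ℝ (Fin n) × ℝ =>
        cwave (z.2 + u * Complex.I) f z.1)
          (volume.prod (volume.restrict (Set.Icc 1 2)))).mono fun z hz => hz.trans h1
      -- the estimate holds almost everywhere, hence everywhere by continuity
      by_contra hlt
      rw [not_le] at hlt
      set U : Set (EuclideanSpace ℝ (Fin n) × ℝ) :=
        {z | A < ‖cwave (z.2 + u * Complex.I) f z.1‖ₑ} ∩ Set.univ ×ˢ Set.Ioo 1 2 with hU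
      have hUo : IsOpen U := (isOpen_lt continuous_const (continuous_cwave_line f hu.1).enorm).inter
        (isOpen_univ.prod isOpen_Ioo)
      have hne : U.Nonempty := ⟨(x, t), hlt, trivial, by
        constructor
        · linarith [ht.1]
        · linarith [ht.2]⟩
      have hpos : 0 < (volume.prod volume : Measure (EuclideanSpace ℝ (Fin n) × ℝ)) U :=
        hUo.measure_pos _ hne
      have hz : (volume.prod (volume.restrict (Set.Icc 1 2)) :
          Measure (EuclideanSpace ℝ (Fin n) × ℝ)) U = 0 := by
        refine measure_mono_null (fun z hz => ?_) (ae_iff.1 h2)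
        exact not_le.2 hz.1
      have hrest : (volume.prod (volume.restrict (Set.Icc 1 2)) :
          Measure (EuclideanSpace ℝ (Fin n) × ℝ)) =
            (volume.prod volume).restrict (Set.univ ×ˢ Set.Icc 1 2) := by
        rw [← Measure.prod_restrict, Measure.restrict_univ]
      rw [hrest, Measure.restrict_apply hUo.measurableSet, Set.inter_eq_self_of_subset_left] at hz
      · exact hpos.ne' hz
      · rintro z ⟨_, _, h3⟩
        exact ⟨trivial, Set.Ioo_subset_Icc_self h3⟩
    · intro u hu
      simp only [ENNReal.inv_top, ENNReal.toReal_zero, add_zero]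
      rw [eLpNorm_exponent_top]
      exact eLpNormEssSup_le_of_ae_enorm_bound (.of_forall fun x => le_rfl)
  have hq0 : q ≠ 0 := (zero_lt_one.trans_le hq).ne'
  set I : Measure ℝ := volume.restrict (Set.Icc (5 / 4) (3 / 2)) with hI
  set κ : ℝ := (q⁻¹).toReal with hκ
  refine ⟨(16 ^ κ : ℝ).toNNReal * (1 + (2 * Real.pi).toNNReal) * C, fun f => ?_⟩
  set g₀ : (EuclideanSpace ℝ (Fin n) × ℝ) × ℝ → ℝ≥0∞ := fun w =>
    ‖cwave (w.2 + w.1.2 * Complex.I) f w.1.1‖ₑ with hg₀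
  set g₁ : (EuclideanSpace ℝ (Fin n) × ℝ) × ℝ → ℝ≥0∞ := fun w =>
    ∫⁻ θ in Set.Ioc 0 (2 * Real.pi),
      ‖cwave (circleMap (w.2 + w.1.2 * Complex.I) (w.1.2 / 8) θ) f w.1.1‖ₑ with hg₁
  have hm₀ : Measurable g₀ := by
    have h1 : Measurable fun w : (EuclideanSpace ℝ (Fin n) × ℝ) × ℝ =>
        (w.1.1, (w.2 : ℂ) + w.1.2 * Complex.I) := by fun_prop
    exact ((measurable_cwave f).comp h1).enorm
  have hm₁ : Measurable g₁ := by
    have h1 : Measurable fun w : ((EuclideanSpace ℝ (Fin n) × ℝ) × ℝ) × ℝ =>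
        (w.1.1.1, circleMap (w.1.2 + w.1.1.2 * Complex.I) (w.1.1.2 / 8) w.2) := by
      unfold circleMap
      fun_prop
    exact (((measurable_cwave f).comp h1).enorm).lintegral_prod_right'
  set N₀ : EuclideanSpace ℝ (Fin n) × ℝ → ℝ≥0∞ := fun z => eLpNorm (fun τ => g₀ (z, τ)) q I
  set N₁ : EuclideanSpace ℝ (Fin n) × ℝ → ℝ≥0∞ := fun z => eLpNorm (fun τ => g₁ (z, τ)) q I
  have hN₀ : Measurable N₀ := measurable_eLpNorm_right hq0 hqt hm₀
  have hN₁ : Measurable N₁ := measurable_eLpNorm_right hq0 hqt hm₁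
  refine ⟨fun x u => ENNReal.ofReal ((u / 16) ^ (-κ)) * (N₀ (x, u) + N₁ (x, u)), ?_, ?_, ?_⟩
  · have : Measurable fun z : EuclideanSpace ℝ (Fin n) × ℝ => (z.2 / 16) ^ (-κ) := by fun_prop
    exact this.ennreal_ofReal.mul (hN₀.add hN₁)
  · intro u hu t ht x
    obtain ⟨hu0, hu2⟩ := hu
    -- `u ≤ 2`, so an interval of length `u/16 ≤ 1/8` with the endpoint `t` fits into `[5/4, 3/2]`
    set r := u / 16 with hr
    have hr0 : 0 < r := by positivity
    obtain ⟨a, hta, hsub⟩ : ∃ a, t ∈ Set.Icc a (a + r) ∧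
        Set.Icc a (a + r) ⊆ Set.Icc (5 / 4) (3 / 2) := by
      rcases le_total t (11 / 8) with h | h
      · exact ⟨t, ⟨le_rfl, by linarith⟩, Set.Icc_subset_Icc ht.1 (by linarith)⟩
      · refine ⟨t - r, ⟨by linarith, by linarith⟩, Set.Icc_subset_Icc ?_ ?_⟩
        · linarith
        · linarith [ht.2]
    have hd : ∀ τ : ℝ, HasDerivAt (fun τ : ℝ => cwave (τ + u * Complex.I) f x)
        (deriv (fun w => cwave w f x) (τ + u * Complex.I)) τ := by
      intro τ
      have h1 := (differentiableAt_cwave f x (z := τ + u * Complex.I) (by simpa using hu0)).hasDerivAt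
      have h2 : HasDerivAt (fun τ : ℝ => (τ : ℂ) + u * Complex.I) 1 τ :=
        (Complex.ofRealCLM.hasDerivAt (x := τ)).add_const _
      have h3 := h1.comp τ h2
      rw [mul_one] at h3
      exact h3
    have hc : Continuous fun τ : ℝ => deriv (fun w => cwave w f x) (τ + u * Complex.I) := by
      have hU : IsOpen {w : ℂ | 0 < w.im} := isOpen_lt continuous_const Complex.continuous_im
      have h1 : ContinuousOn (deriv fun w => cwave w f x) {w : ℂ | 0 < w.im} :=
        (DifferentiableOn.deriv (fun w hw =>
          (differentiableAt_cwave f x hw).differentiableWithinAt) hU).continuousOn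
      have h2 := h1.comp (s := Set.univ) (f := fun τ : ℝ => (τ : ℂ) + u * Complex.I)
        (by fun_prop) (fun τ _ => by simpa using hu0)
      rw [← continuousOn_univ]
      exact h2
    have h1 := enorm_le_average_add_lintegral_deriv (by linarith) hta (fun τ _ => hd τ)
      hc.continuousOn
    have h2 : ∫⁻ τ in Set.Icc a (a + r), ‖deriv (fun w => cwave w f x) (τ + u * Complex.I)‖ₑ ≤
        ENNReal.ofReal r⁻¹ * ∫⁻ τ in Set.Icc a (a + r), g₁ ((x, u), τ) := by
      rw [← lintegral_const_mul' _ _ ENNReal.ofReal_ne_top]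
      refine lintegral_mono fun τ => ?_
      -- the circles of radius `u/8` stay well inside the upper half-plane
      refine (enorm_deriv_cwave_le f x (r := u / 8) (by linarith) (by simp; linarith)).trans ?_
      refine mul_le_mul_left (ENNReal.ofReal_le_ofReal ?_) _
      exact inv_anti₀ hr0 (by nlinarith)
    have h3 := lintegral_Icc_le_eLpNorm (g := fun τ => g₀ ((x, u), τ)) hq (by fun_prop)
      (show a < a + r by linarith) hsub
    have h4 := lintegral_Icc_le_eLpNorm (g := fun τ => g₁ ((x, u), τ)) hq (by fun_prop)
      (show a < a + r by linarith) hsub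
    rw [add_sub_cancel_left] at h1 h3 h4
    -- the average contributes `r^{-1}`, and Hölder gives back `r^{1 - 1/q}`
    have h5 : ENNReal.ofReal r⁻¹ * ENNReal.ofReal (r ^ (1 - κ)) = ENNReal.ofReal (r ^ (-κ)) := by
      rw [← ENNReal.ofReal_mul (by positivity), ← Real.rpow_neg_one, ← Real.rpow_add hr0]
      congr 2
      ring
    calc ‖cwave (t + u * Complex.I) f x‖ₑ
        ≤ ENNReal.ofReal r⁻¹ * (ENNReal.ofReal (r ^ (1 - κ)) * N₀ (x, u)) +
          ENNReal.ofReal r⁻¹ * (ENNReal.ofReal (r ^ (1 - κ)) * N₁ (x, u)) := by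
          refine h1.trans (add_le_add ?_ (h2.trans ?_))
          · gcongr
          · gcongr
      _ = ENNReal.ofReal (r ^ (-κ)) * (N₀ (x, u) + N₁ (x, u)) := by
        rw [← mul_assoc, ← mul_assoc, h5, mul_add]
  · intro u hu
    have hu0 := hu.1
    set A := C * ENNReal.ofReal (u ^ (-s')) * eLpNorm f p volume with hA
    have h0 : eLpNorm (fun x => N₀ (x, u)) q volume ≤ A := by
      have : eLpNorm (fun x => N₀ (x, u)) q volume = eLpNorm (fun z : EuclideanSpace ℝ (Fin n) × ℝ =>
          ‖cwave (z.2 + u * Complex.I) f z.1‖ₑ) q (volume.prod I) :=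
        eLpNorm_eLpNorm_eq hq0 hqt (g := fun z : EuclideanSpace ℝ (Fin n) × ℝ =>
          ‖cwave (z.2 + u * Complex.I) f z.1‖ₑ) (continuous_cwave_line f hu0).measurable.enorm
      rw [this, eLpNorm_enorm]
      refine (eLpNorm_mono_measure _ (Measure.prod_mono le_rfl
        (Measure.restrict_mono_set _ ?_))).trans (hC u hu u (by linarith) f)
      exact Set.Icc_subset_Icc (by norm_num) (by norm_num)
    have h1 : eLpNorm (fun x => N₁ (x, u)) q volume ≤ A * ENNReal.ofReal (2 * Real.pi) := by
      have h2 : Measurable fun z : EuclideanSpace ℝ (Fin n) × ℝ => g₁ ((z.1, u), z.2) := by fun_prop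
      have : eLpNorm (fun x => N₁ (x, u)) q volume = eLpNorm (fun z : EuclideanSpace ℝ (Fin n) × ℝ =>
          g₁ ((z.1, u), z.2)) q (volume.prod I) :=
        eLpNorm_eLpNorm_eq hq0 hqt (g := fun z : EuclideanSpace ℝ (Fin n) × ℝ =>
          g₁ ((z.1, u), z.2)) h2
      rw [this]
      exact eLpNorm_lintegral_circle_cwave_le hq hu f fun h hh => hC u hu h hh f
    refine (eLpNorm_const_mul_ennreal_le ENNReal.ofReal_ne_top _).trans ?_
    have hn₀ : Measurable fun x => N₀ (x, u) := hN₀.comp measurable_prodMk_right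
    have hn₁ : Measurable fun x => N₁ (x, u) := hN₁.comp measurable_prodMk_right
    have h2 : eLpNorm (fun x => N₀ (x, u) + N₁ (x, u)) q volume ≤
        A + A * ENNReal.ofReal (2 * Real.pi) :=
      (eLpNorm_add_le hn₀.aestronglyMeasurable hn₁.aestronglyMeasurable hq).trans
        (add_le_add h0 h1)
    refine (mul_le_mul_right h2 _).trans (le_of_eq ?_)
    have h3 : (u / 16) ^ (-κ) = 16 ^ κ * u ^ (-κ) := by
      rw [Real.div_rpow hu0.le (by norm_num), Real.rpow_neg (by norm_num : (0:ℝ) ≤ 16),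
        div_inv_eq_mul, mul_comm]
    have h4 : u ^ (-(s' + κ)) = u ^ (-κ) * u ^ (-s') := by
      rw [← Real.rpow_add hu0]
      congr 1
      ring
    rw [h3, h4, ENNReal.ofReal_mul (p := 16 ^ κ) (by positivity),
      ENNReal.ofReal_mul (p := u ^ (-κ)) (by positivity), hA,
      ENNReal.coe_mul, ENNReal.coe_mul, ENNReal.coe_add, ENNReal.coe_one]
    change ENNReal.ofReal (16 ^ κ) * _ * _ =
      ENNReal.ofReal (16 ^ κ) * (1 + ENNReal.ofReal (2 * Real.pi)) * C * _ * _
    generalize ENNReal.ofReal (2 * Real.pi) = w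
    ring

/-! ### Slicing the ball: means of functions of one linear coordinate -/

/-- The truncated power `s₊ ^ (a - 1)`. -/
noncomputable def truncPow (a : ℂ) (s : ℝ) : ℂ := if 0 < s then (s : ℂ) ^ (a - 1) else 0

theorem measurable_truncPow (a : ℂ) : Measurable (truncPow a) := by
  refine Measurable.ite measurableSet_Ioi ?_ measurable_const
  exact Complex.measurable_ofReal.pow_const _

theorem truncPow_of_pos (a : ℂ) {s : ℝ} (hs : 0 < s) : truncPow a s = (s : ℂ) ^ (a - 1) := if_pos hs

theorem truncPow_of_nonpos (a : ℂ) {s : ℝ} (hs : s ≤ 0) : truncPow a s = 0 := if_neg hs.not_gt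

theorem norm_truncPow_of_pos (a : ℂ) {s : ℝ} (hs : 0 < s) : ‖truncPow a s‖ = s ^ (a.re - 1) := by
  rw [truncPow_of_pos a hs, Complex.norm_cpow_eq_rpow_re_of_pos hs]
  simp

theorem truncPow_mul (a : ℂ) {s : ℝ} (hs : 0 < s) (r : ℝ) :
    truncPow a (s * r) = (s : ℂ) ^ (a - 1) * truncPow a r := by
  rcases le_or_gt r 0 with hr | hr
  · rw [truncPow_of_nonpos a hr, truncPow_of_nonpos a (mul_nonpos_of_nonneg_of_nonpos hs.le hr),
      mul_zero]
  · rw [truncPow_of_pos a hr, truncPow_of_pos a (mul_pos hs hr), Complex.ofReal_mul,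
      Complex.mul_cpow_ofReal_nonneg hs.le hr.le]

theorem truncPow_one_sub_norm_sq (a : ℂ) (g : EuclideanSpace ℝ (Fin n) → ℂ) :
    (fun y : EuclideanSpace ℝ (Fin n) => truncPow a (1 - ‖y‖ ^ 2) * g y) =
      (Metric.ball (0 : EuclideanSpace ℝ (Fin n)) 1).indicator fun y =>
        ((1 - ‖y‖ ^ 2 : ℝ) : ℂ) ^ (a - 1) * g y := by
  funext y
  by_cases hy : y ∈ Metric.ball (0 : EuclideanSpace ℝ (Fin n)) 1
  · rw [Set.indicator_of_mem hy, truncPow_of_pos a (weight_pos hy).1]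
  · rw [Set.indicator_of_notMem hy, truncPow_of_nonpos, zero_mul]
    have : 1 ≤ ‖y‖ := by simpa using hy
    nlinarith

theorem ballMean_eq_integral_truncPow (a : ℂ) (g : EuclideanSpace ℝ (Fin n) → ℂ) :
    ballMean a g = (Complex.Gamma a)⁻¹ *
      ∫ y : EuclideanSpace ℝ (Fin n), truncPow a (1 - ‖y‖ ^ 2) * g y := by
  rw [truncPow_one_sub_norm_sq, integral_indicator Metric.isOpen_ball.measurableSet, ballMean,
    setIntegral_congr_set closedBall_ae_eq]

theorem integrable_truncPow_mul {a : ℂ} (ha : 0 < a.re) {g : EuclideanSpace ℝ (Fin n) → ℂ}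
    (hg : Continuous g) :
    Integrable fun y : EuclideanSpace ℝ (Fin n) => truncPow a (1 - ‖y‖ ^ 2) * g y := by
  rw [truncPow_one_sub_norm_sq, integrable_indicator_iff Metric.isOpen_ball.measurableSet]
  exact integrable_integrand (by simpa using ha) hg

theorem integrable_truncPow_mul_exp {a : ℂ} (ha : 0 < a.re) :
    Integrable fun s : ℝ => truncPow a s * Complex.exp (-s) := by
  have h := Complex.GammaIntegral_convergent ha
  have : (fun s : ℝ => truncPow a s * Complex.exp (-s)) =
      (Set.Ioi 0).indicator fun s : ℝ => ((-s).exp : ℂ) * (s : ℂ) ^ (a - 1) := by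
    funext s
    by_cases hs : s ∈ Set.Ioi (0 : ℝ)
    · rw [Set.indicator_of_mem hs, truncPow_of_pos a hs]
      push_cast
      ring
    · rw [Set.indicator_of_notMem hs, truncPow_of_nonpos a (not_lt.1 hs), zero_mul]
  rw [this, integrable_indicator_iff measurableSet_Ioi]
  exact h

theorem integral_truncPow_mul_exp {a : ℂ} (ha : 0 < a.re) :
    ∫ s : ℝ, truncPow a s * Complex.exp (-s) = Complex.Gamma a := by
  rw [Complex.Gamma_eq_integral ha, Complex.GammaIntegral,
    ← integral_indicator measurableSet_Ioi]
  congr 1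
  funext s
  by_cases hs : s ∈ Set.Ioi (0 : ℝ)
  · rw [Set.indicator_of_mem hs, truncPow_of_pos a hs]
    push_cast
    ring
  · rw [Set.indicator_of_notMem hs, truncPow_of_nonpos a (not_lt.1 hs), zero_mul]

/-- The integral over the slice `{|w|² < s}`, by scaling. -/
theorem integral_truncPow_sub_norm_sq (a : ℂ) (s : ℝ) :
    ∫ w : EuclideanSpace ℝ (Fin n), truncPow a (s - ‖w‖ ^ 2) =
      truncPow (a + n / 2) s * ∫ w : EuclideanSpace ℝ (Fin n), truncPow a (1 - ‖w‖ ^ 2) := by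
  rcases le_or_gt s 0 with hs | hs
  · rw [truncPow_of_nonpos _ hs, zero_mul]
    have : ∀ w : EuclideanSpace ℝ (Fin n), truncPow a (s - ‖w‖ ^ 2) = 0 := fun w =>
      truncPow_of_nonpos _ (by nlinarith [sq_nonneg ‖w‖])
    simp [this]
  · have h1 := Measure.integral_comp_smul (μ := volume)
      (fun w : EuclideanSpace ℝ (Fin n) => truncPow a (s - ‖w‖ ^ 2)) (Real.sqrt s)
    have hs' : 0 < Real.sqrt s := Real.sqrt_pos.2 hs
    have h2 : ∀ w : EuclideanSpace ℝ (Fin n), truncPow a (s - ‖Real.sqrt s • w‖ ^ 2) =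
        (s : ℂ) ^ (a - 1) * truncPow a (1 - ‖w‖ ^ 2) := by
      intro w
      rw [← truncPow_mul a hs, norm_smul, Real.norm_of_nonneg hs'.le, mul_pow, Real.sq_sqrt hs.le]
      congr 1
      ring
    simp only [h2] at h1
    rw [integral_const_mul, finrank_euclideanSpace_fin, abs_of_pos (by positivity)] at h1
    have h3 : (s : ℂ) ^ (n / 2 : ℂ) = ((Real.sqrt s ^ n : ℝ) : ℂ) := by
      have : ((n / 2 : ℝ) : ℂ) = (n / 2 : ℂ) := by push_cast; rfl
      rw [← this, ← Complex.ofReal_cpow hs.le, Real.sqrt_eq_rpow, ← Real.rpow_natCast,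
        ← Real.rpow_mul hs.le]
      congr 2
      ring
    have h4 : ((Real.sqrt s ^ n : ℝ) : ℂ) ≠ 0 := Complex.ofReal_ne_zero.2 (by positivity)
    rw [truncPow_of_pos _ hs, show a + n / 2 - 1 = (a - 1) + n / 2 by ring,
      Complex.cpow_add _ _ (Complex.ofReal_ne_zero.2 hs.ne'), h3, mul_right_comm, h1,
      Complex.real_smul, Complex.ofReal_inv]
    field_simp

/-- The total mass of the weight `(1 - |w|²)₊ ^ (a - 1)`, from the two ways of computing
`∬ (s - |w|²)₊ ^ (a - 1) e^{-s} dw ds`. -/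
theorem integral_truncPow_one_sub_norm_sq {a : ℂ} (ha : 0 < a.re) :
    (∫ w : EuclideanSpace ℝ (Fin n), truncPow a (1 - ‖w‖ ^ 2)) * Complex.Gamma (a + n / 2) =
      (Real.pi : ℂ) ^ (n / 2 : ℂ) * Complex.Gamma a := by
  set c := ∫ w : EuclideanSpace ℝ (Fin n), truncPow a (1 - ‖w‖ ^ 2) with hc
  have hre : 0 < (a + n / 2).re := by
    have : (n / 2 : ℂ) = ((n / 2 : ℝ) : ℂ) := by push_cast; rfl
    rw [this, Complex.add_re, Complex.ofReal_re]
    positivity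
  have hslice : ∀ w : EuclideanSpace ℝ (Fin n), ∀ s : ℝ,
      truncPow a (s - ‖w‖ ^ 2) * Complex.exp (-s) = Complex.exp (-‖w‖ ^ 2) *
        (truncPow a (s - ‖w‖ ^ 2) * Complex.exp (-(s - ‖w‖ ^ 2 : ℝ))) := by
    intro w s
    rw [mul_left_comm, ← Complex.exp_add]
    congr 2
    push_cast
    ring
  have hgauss : Integrable fun w : EuclideanSpace ℝ (Fin n) => Complex.exp (-‖w‖ ^ 2) := by
    have := GaussianFourier.integrable_cexp_neg_mul_sq_norm_add (V := EuclideanSpace ℝ (Fin n))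
      (b := 1) (by simp) 0 0
    simpa using this
  have hint : Integrable (fun z : EuclideanSpace ℝ (Fin n) × ℝ =>
      truncPow a (z.2 - ‖z.1‖ ^ 2) * Complex.exp (-z.2)) (volume.prod volume) := by
    refine (integrable_prod_iff ?_).2 ⟨.of_forall fun w => ?_, ?_⟩
    · refine Measurable.aestronglyMeasurable (Measurable.mul ((measurable_truncPow a).comp ?_) ?_)
      · fun_prop
      · fun_prop
    · simp only [hslice]
      exact ((integrable_truncPow_mul_exp ha).comp_sub_right _).const_mul _
    · have : ∀ w : EuclideanSpace ℝ (Fin n),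
          ∫ s : ℝ, ‖truncPow a (s - ‖w‖ ^ 2) * Complex.exp (-s)‖ =
          ‖Complex.exp (-‖w‖ ^ 2)‖ * ∫ s : ℝ, ‖truncPow a s * Complex.exp (-s)‖ := by
        intro w
        simp only [hslice w, norm_mul (Complex.exp (-‖w‖ ^ 2))]
        rw [integral_const_mul, integral_sub_right_eq_self
          (fun s : ℝ => ‖truncPow a s * Complex.exp (-(s : ℂ))‖) (‖w‖ ^ 2)]
      simp only [this]
      exact hgauss.norm.mul_const _
  have h1 : ∫ w : EuclideanSpace ℝ (Fin n), ∫ s : ℝ,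
      truncPow a (s - ‖w‖ ^ 2) * Complex.exp (-s) = (Real.pi : ℂ) ^ (n / 2 : ℂ) * Complex.Gamma a := by
    have : ∀ w : EuclideanSpace ℝ (Fin n),
          ∫ s : ℝ, truncPow a (s - ‖w‖ ^ 2) * Complex.exp (-s) =
          Complex.exp (-‖w‖ ^ 2) * Complex.Gamma a := by
      intro w
      simp only [hslice w]
      rw [integral_const_mul, integral_sub_right_eq_self
        (fun s : ℝ => truncPow a s * Complex.exp (-(s : ℂ))) (‖w‖ ^ 2),
        ← integral_truncPow_mul_exp ha]
    simp only [this]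
    rw [integral_mul_const]
    congr 1
    have := GaussianFourier.integral_cexp_neg_mul_sq_norm (V := EuclideanSpace ℝ (Fin n))
      (b := 1) (by simp)
    simpa using this
  rw [← h1, integral_integral_swap hint]
  have h2 : ∀ s : ℝ, ∫ w : EuclideanSpace ℝ (Fin n),
      truncPow a (s - ‖w‖ ^ 2) * Complex.exp (-s) =
        c * (truncPow (a + n / 2) s * Complex.exp (-s)) := by
    intro s
    rw [integral_mul_const, integral_truncPow_sub_norm_sq]
    ring
  simp only [h2]
  rw [integral_const_mul, integral_truncPow_mul_exp hre]

/-- The point of `ℝ^(m+1)` with first coordinate `r` and remaining coordinates `w`. -/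
noncomputable def consPoint {m : ℕ} (z : ℝ × EuclideanSpace ℝ (Fin m)) :
    EuclideanSpace ℝ (Fin (m + 1)) := WithLp.toLp 2 (Fin.cons z.1 z.2.ofLp)

theorem norm_sq_consPoint {m : ℕ} (z : ℝ × EuclideanSpace ℝ (Fin m)) :
    ‖consPoint z‖ ^ 2 = z.1 ^ 2 + ‖z.2‖ ^ 2 := by
  rw [EuclideanSpace.real_norm_sq_eq, EuclideanSpace.real_norm_sq_eq, Fin.sum_univ_succ]
  simp [consPoint]

/-- `consPoint` identifies `ℝ × ℝ^m` with `ℝ^(m+1)` as measure spaces. -/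
theorem measurableEmbedding_consPoint_and_measurePreserving {m : ℕ} :
    MeasurableEmbedding (consPoint (m := m)) ∧
      MeasurePreserving (consPoint (m := m)) (volume.prod volume) volume := by
  have h1 := (PiLp.volume_preserving_ofLp (Fin m) : MeasurePreserving _ _ _)
  have h2 : MeasurePreserving (fun z : ℝ × EuclideanSpace ℝ (Fin m) => (z.1, z.2.ofLp))
      (volume.prod volume) (volume.prod volume) := (MeasurePreserving.id volume).prod h1
  have h3 := (volume_preserving_piFinSuccAbove (fun _ : Fin (m + 1) => ℝ) 0).symm
  have h4 := PiLp.volume_preserving_toLp (Fin (m + 1))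
  have e : consPoint (m := m) = (WithLp.toLp 2) ∘
      (MeasurableEquiv.piFinSuccAbove (fun _ : Fin (m + 1) => ℝ) 0).symm ∘
        fun z : ℝ × EuclideanSpace ℝ (Fin m) => (z.1, z.2.ofLp) := by
    funext z
    simp [consPoint, MeasurableEquiv.piFinSuccAbove, Fin.insertNthEquiv]
  constructor
  · rw [e]
    refine (MeasurableEquiv.toLp 2 (Fin (m + 1) → ℝ)).measurableEmbedding.comp
      ((MeasurableEquiv.measurableEmbedding _).comp ?_)
    exact ((MeasurableEquiv.refl ℝ).prodCongr
      (MeasurableEquiv.toLp 2 (Fin m → ℝ)).symm).measurableEmbedding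
  · rw [e]
    exact h4.comp (h3.comp h2)

/-- The ball mean of order `a` in dimension `m + 1` of a function of the first coordinate is a
one-dimensional mean of order `a + m/2`. -/
theorem ballMean_comp_coord {m : ℕ} {a : ℂ} (ha : 0 < a.re) {φ : ℝ → ℂ} (hφ : Continuous φ) :
    ballMean a (fun y : EuclideanSpace ℝ (Fin (m + 1)) => φ (y 0)) =
      (Real.pi : ℂ) ^ (m / 2 : ℂ) * ((Complex.Gamma (a + m / 2))⁻¹ *
        ∫ r : ℝ, truncPow (a + m / 2) (1 - r ^ 2) * φ r) := by
  obtain ⟨hme, hmp⟩ := measurableEmbedding_consPoint_and_measurePreserving (m := m)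
  have hg : Continuous fun y : EuclideanSpace ℝ (Fin (m + 1)) => φ (y 0) := by fun_prop
  have hint := (hmp.integrable_comp_emb hme).2 (integrable_truncPow_mul ha hg)
  have h0 : ∀ z : ℝ × EuclideanSpace ℝ (Fin m),
      truncPow a (1 - ‖consPoint z‖ ^ 2) * φ (consPoint z 0) =
        φ z.1 * truncPow a ((1 - z.1 ^ 2) - ‖z.2‖ ^ 2) := by
    intro z
    rw [norm_sq_consPoint, mul_comm, sub_sub]
    simp [consPoint]
  rw [ballMean_eq_integral_truncPow, ← hmp.integral_comp hme]
  simp only [Function.comp_def, h0] at hint ⊢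
  rw [integral_prod _ hint]
  have h5 : ∀ r : ℝ, ∫ w : EuclideanSpace ℝ (Fin m), φ r * truncPow a ((1 - r ^ 2) - ‖w‖ ^ 2) =
      φ r * (truncPow (a + m / 2) (1 - r ^ 2) *
        ∫ w : EuclideanSpace ℝ (Fin m), truncPow a (1 - ‖w‖ ^ 2)) := fun r => by
    rw [integral_const_mul, integral_truncPow_sub_norm_sq]
  simp only [h5]
  have hre : 0 < (a + m / 2).re := by
    have : (m / 2 : ℂ) = ((m / 2 : ℝ) : ℂ) := by push_cast; rfl
    rw [this, Complex.add_re, Complex.ofReal_re]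
    positivity
  have h1 := integral_truncPow_one_sub_norm_sq (n := m) ha
  have h2 := Complex.Gamma_ne_zero_of_re_pos ha
  have h3 := Complex.Gamma_ne_zero_of_re_pos hre
  have h4 : ∫ r : ℝ, φ r * (truncPow (a + m / 2) (1 - r ^ 2) *
      ∫ w : EuclideanSpace ℝ (Fin m), truncPow a (1 - ‖w‖ ^ 2)) =
      (∫ w : EuclideanSpace ℝ (Fin m), truncPow a (1 - ‖w‖ ^ 2)) *
        ∫ r : ℝ, truncPow (a + m / 2) (1 - r ^ 2) * φ r := by
    rw [← integral_const_mul]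
    congr 1
    funext r
    ring
  rw [h4]
  generalize (∫ w : EuclideanSpace ℝ (Fin m), truncPow a (1 - ‖w‖ ^ 2)) = c at h1
  generalize (∫ r : ℝ, truncPow (a + m / 2) (1 - r ^ 2) * φ r) = J
  generalize Complex.Gamma (a + m / 2) = G at h1 h3
  field_simp
  linear_combination J * h1

theorem ballMean_comp_isometry (a : ℂ) (L : EuclideanSpace ℝ (Fin n) ≃ₗᵢ[ℝ] EuclideanSpace ℝ (Fin n))
    (g : EuclideanSpace ℝ (Fin n) → ℂ) : ballMean a (fun y => g (L y)) = ballMean a g := by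
  rw [ballMean_eq_integral_truncPow, ballMean_eq_integral_truncPow]
  congr 1
  have := L.measurePreserving.integral_comp L.toHomeomorph.measurableEmbedding
    (fun y => truncPow a (1 - ‖y‖ ^ 2) * g y)
  simp only [L.norm_map] at this
  exact this

/-- Ball means of functions of a linear form. -/
theorem ballMean_comp_inner {m : ℕ} {a : ℂ} (ha : 0 < a.re) {φ : ℝ → ℂ} (hφ : Continuous φ)
    (ξ : EuclideanSpace ℝ (Fin (m + 1))) :
    ballMean a (fun y => φ (inner ℝ ξ y)) =
      (Real.pi : ℂ) ^ (m / 2 : ℂ) * ((Complex.Gamma (a + m / 2))⁻¹ *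
        ∫ r : ℝ, truncPow (a + m / 2) (1 - r ^ 2) * φ (‖ξ‖ * r)) := by
  set e₀ : EuclideanSpace ℝ (Fin (m + 1)) := ‖ξ‖ • EuclideanSpace.single 0 1 with he
  have hnorm : ‖ξ‖ = ‖e₀‖ := by simp [he, norm_smul]
  have hL := Submodule.reflection_sub hnorm
  -- a reflection carries `ξ` to the first coordinate axis
  set L := (Submodule.span ℝ {ξ - e₀})ᗮ.reflection with hLdef
  have h1 : ∀ y, inner ℝ ξ y = ‖ξ‖ * (L y) 0 := by
    intro y
    rw [← L.inner_map_map ξ y, hL, he, real_inner_smul_left, EuclideanSpace.inner_single_left]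
    simp
  simp only [h1]
  rw [ballMean_comp_isometry a L (fun y => φ (‖ξ‖ * y 0)),
    ballMean_comp_coord ha (φ := fun r => φ (‖ξ‖ * r)) (by fun_prop)]

/-! ### The Poisson formula for the spherical means -/

theorem multOp_exp_inner (t : ℝ) (y : EuclideanSpace ℝ (Fin n))
    (f : 𝓢(EuclideanSpace ℝ (Fin n), ℂ)) (x : EuclideanSpace ℝ (Fin n)) :
    multOp (fun ξ => Complex.exp (-(2 * Real.pi * Complex.I * t * (inner ℝ ξ y : ℝ)))) f x =
      f (x - t • y) := by
  rw [multOp_eq, ← fourierInv_fourier_apply f (x - t • y), Real.fourierInv_eq']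
  congr 1
  funext ξ
  rw [← mul_assoc, ← Complex.exp_add, smul_eq_mul, inner_sub_right, real_inner_smul_right]
  congr 2
  push_cast
  ring

theorem continuous_halfWave (f : 𝓢(EuclideanSpace ℝ (Fin n), ℂ)) :
    Continuous fun z : ℝ × EuclideanSpace ℝ (Fin n) => halfWave z.1 f z.2 := by
  have h1 : Continuous fun z : ℝ × EuclideanSpace ℝ (Fin n) => ((z.1 : ℂ), z.2) := by fun_prop
  have := (continuousOn_cwave f).comp (s := Set.univ) h1.continuousOn (fun z _ => by simp)
  simp only [Function.comp_def, cwave_ofReal] at this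
  rwa [continuousOn_univ] at this

theorem re_add_half (a : ℂ) (m : ℕ) : (a + m / 2).re = a.re + m / 2 := by
  have : (m / 2 : ℂ) = ((m / 2 : ℝ) : ℂ) := by push_cast; rfl
  rw [this, Complex.add_re, Complex.ofReal_re]

/-- One-dimensional means as ball means, so that their analyticity in the order is
`differentiableAt_ballMean`. -/
theorem integral_truncPow_eq_ballMean {a : ℂ} (ha : 0 < a.re) {φ : ℝ → ℂ} (hφ : Continuous φ) :
    (Complex.Gamma a)⁻¹ * ∫ r : ℝ, truncPow a (1 - r ^ 2) * φ r =
      ballMean a (fun y : EuclideanSpace ℝ (Fin 1) => φ (y 0)) := by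
  rw [ballMean_comp_coord (m := 0) ha hφ]
  simp

theorem integrable_truncPow_one_sub_sq {a : ℂ} (ha : 0 < a.re) :
    Integrable fun r : ℝ => truncPow a (1 - r ^ 2) := by
  have h1 := integrable_truncPow_mul (n := 1) ha (g := fun _ => 1) continuous_const
  obtain ⟨hme, hmp⟩ := measurableEmbedding_consPoint_and_measurePreserving (m := 0)
  have h2 := (hmp.integrable_comp_emb hme).2 h1
  have h3 : ((fun y : EuclideanSpace ℝ (Fin 1) => truncPow a (1 - ‖y‖ ^ 2) * 1) ∘ consPoint) =
      fun z : ℝ × EuclideanSpace ℝ (Fin 0) => truncPow a (1 - z.1 ^ 2) := by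
    funext z
    simp [norm_sq_consPoint, Subsingleton.elim z.2 0]
  rw [h3] at h2
  have h4 := h2.prod_left_ae
  obtain ⟨y, hy⟩ := h4.exists
  exact hy

/-- The Poisson formula where the defining integral converges: both sides are Fourier multipliers,
whose symbols agree by `ballMean_comp_inner`. -/
theorem steinMean_eq_integral_halfWave_of_re_pos {m : ℕ} {a : ℂ} (ha : 0 < a.re) (t : ℝ)
    (f : 𝓢(EuclideanSpace ℝ (Fin (m + 1)), ℂ)) (x : EuclideanSpace ℝ (Fin (m + 1))) :
    steinMean a t f x = (Real.pi : ℂ) ^ (m / 2 : ℂ) * ((Complex.Gamma (a + m / 2))⁻¹ *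
      ∫ r : ℝ, truncPow (a + m / 2) (1 - r ^ 2) * halfWave (t * r) f x) := by
  have hre : 0 < (a + m / 2).re := by rw [re_add_half]; positivity
  have h0 : steinMean a t f x = ballMean a fun y => f (x - t • y) := steinMean_of_re_pos ha t f x
  rw [h0, ballMean_eq_integral_truncPow]
  have hnorm : ∀ b : ℝ, ‖Complex.exp (2 * Real.pi * Complex.I * b)‖ = 1 := fun b => by
    have := Complex.norm_exp_ofReal_mul_I (2 * Real.pi * b)
    rw [← this]
    congr 2
    push_cast
    ring
  set M : EuclideanSpace ℝ (Fin (m + 1)) → EuclideanSpace ℝ (Fin (m + 1)) → ℂ := fun y ξ =>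
    truncPow a (1 - ‖y‖ ^ 2) *
      Complex.exp (-(2 * Real.pi * Complex.I * t * (inner ℝ ξ y : ℝ))) with hMdef
  have hMm : Measurable (Function.uncurry M) := by
    have h1 : Measurable fun z : EuclideanSpace ℝ (Fin (m + 1)) × EuclideanSpace ℝ (Fin (m + 1)) =>
        truncPow a (1 - ‖z.1‖ ^ 2) := (measurable_truncPow a).comp (by fun_prop)
    have h2 : Continuous fun z : EuclideanSpace ℝ (Fin (m + 1)) × EuclideanSpace ℝ (Fin (m + 1)) =>
        Complex.exp (-(2 * Real.pi * Complex.I * t * (inner ℝ z.2 z.1 : ℝ))) := by fun_prop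
    exact h1.mul h2.measurable
  have hMi := integrable_symbol (ν := volume) hMm f
    (κ := fun y => ‖truncPow a (1 - ‖y‖ ^ 2) * 1‖)
    (integrable_truncPow_mul ha (g := fun _ => 1) continuous_const).norm
    (B := fun _ => 1) (by simpa using integrable_fourier f) (.of_forall fun y ξ => by
      have h1 := hnorm (-(t * inner ℝ ξ y))
      have h2 : -(2 * Real.pi * Complex.I * t * (inner ℝ ξ y : ℝ)) =
        2 * Real.pi * Complex.I * (-(t * inner ℝ ξ y) : ℝ) := by push_cast; ring
      simp only [hMdef]
      rw [norm_mul, h2, h1, mul_one, mul_one, mul_one])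
  have h1 := multOp_integral M f hMi x
  have h2 : ∀ y, multOp (M y) f x = truncPow a (1 - ‖y‖ ^ 2) * f (x - t • y) := fun y => by
    simp only [hMdef]
    rw [multOp_const_mul, multOp_exp_inner]
  simp only [h2] at h1
  rw [← h1, ← multOp_const_mul]
  set M' : ℝ → EuclideanSpace ℝ (Fin (m + 1)) → ℂ := fun r ξ =>
    truncPow (a + m / 2) (1 - r ^ 2) *
      Complex.exp (2 * Real.pi * Complex.I * (t * r : ℝ) * ‖ξ‖) with hM'def
  have hMm' : Measurable (Function.uncurry M') := by
    have h1 : Measurable fun z : ℝ × EuclideanSpace ℝ (Fin (m + 1)) =>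
        truncPow (a + m / 2) (1 - z.1 ^ 2) := (measurable_truncPow _).comp (by fun_prop)
    have h2 : Continuous fun z : ℝ × EuclideanSpace ℝ (Fin (m + 1)) =>
        Complex.exp (2 * Real.pi * Complex.I * (t * z.1 : ℝ) * ‖z.2‖) := by fun_prop
    exact h1.mul h2.measurable
  have hMi' := integrable_symbol (ν := volume) hMm' f
    (κ := fun r => ‖truncPow (a + m / 2) (1 - r ^ 2)‖) (integrable_truncPow_one_sub_sq hre).norm
    (B := fun _ => 1) (by simpa using integrable_fourier f) (.of_forall fun r ξ => by
      have h1 := hnorm (t * r * ‖ξ‖)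
      have h2 : 2 * Real.pi * Complex.I * (t * r : ℝ) * ‖ξ‖ =
        2 * Real.pi * Complex.I * (t * r * ‖ξ‖ : ℝ) := by push_cast; ring
      simp only [hM'def]
      rw [norm_mul, h2, h1])
  have h3 := multOp_integral M' f hMi' x
  have h4 : ∀ r, multOp (M' r) f x =
      truncPow (a + m / 2) (1 - r ^ 2) * halfWave (t * r) f x := fun r => by
    simp only [hM'def]
    rw [multOp_const_mul, halfWave_eq_multOp]
  simp only [h4] at h3
  rw [← h3, ← multOp_const_mul, ← multOp_const_mul]
  congr 1
  funext ξ
  -- it remains to compare the symbols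
  have h5 := ballMean_comp_inner (m := m) ha
    (φ := fun r : ℝ => Complex.exp (-(2 * Real.pi * Complex.I * t * r))) (by fun_prop) ξ
  rw [ballMean_eq_integral_truncPow] at h5
  simp only [hMdef, hM'def]
  -- `r ↦ -r` accounts for the sign in the exponent
  rw [h5, ← integral_neg_eq_self]
  congr 3
  funext r
  rw [neg_sq]
  congr 2
  push_cast
  ring

/-- The spherical mean of order `α` is a one-dimensional mean, of order `α + (n - 1)/2`, of the
half-wave flow over the times `[-t, t]`. -/
theorem steinMean_eq_integral_halfWave {m : ℕ} {a : ℂ} (ha : 0 < (a + m / 2).re) (t : ℝ)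
    (f : 𝓢(EuclideanSpace ℝ (Fin (m + 1)), ℂ)) (x : EuclideanSpace ℝ (Fin (m + 1))) :
    steinMean a t f x = (Real.pi : ℂ) ^ (m / 2 : ℂ) * ((Complex.Gamma (a + m / 2))⁻¹ *
      ∫ r : ℝ, truncPow (a + m / 2) (1 - r ^ 2) * halfWave (t * r) f x) := by
  have hφ : Continuous fun r : ℝ => halfWave (t * r) f x :=
    Continuous.comp (g := fun z : ℝ × EuclideanSpace ℝ (Fin (m + 1)) => halfWave z.1 f z.2)
      (f := fun r : ℝ => (t * r, x)) (continuous_halfWave f) (by fun_prop)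
  have hopen : IsOpen {b : ℂ | -(m / 2 : ℝ) < b.re} :=
    isOpen_lt continuous_const Complex.continuous_re
  have h1 : AnalyticOnNhd ℂ (fun b => steinMean b t f x) {b : ℂ | -(m / 2 : ℝ) < b.re} :=
    (differentiable_steinMean t f x).differentiableOn.analyticOnNhd hopen
  have h2 : AnalyticOnNhd ℂ (fun b : ℂ => (Real.pi : ℂ) ^ (m / 2 : ℂ) *
      ballMean (b + m / 2) (fun y : EuclideanSpace ℝ (Fin 1) => halfWave (t * y 0) f x))
      {b : ℂ | -(m / 2 : ℝ) < b.re} := by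
    refine DifferentiableOn.analyticOnNhd (fun b hb => ?_) hopen
    have hb' : 0 < (b + m / 2).re := by
      rw [re_add_half]
      have : -(m / 2 : ℝ) < b.re := hb
      linarith
    have h3 : Continuous fun y : EuclideanSpace ℝ (Fin 1) => halfWave (t * y 0) f x :=
      Continuous.comp (g := fun r : ℝ => halfWave (t * r) f x)
        (f := fun y : EuclideanSpace ℝ (Fin 1) => y 0) hφ (by fun_prop)
    have h4 := (differentiableAt_ballMean h3 hb').comp b
      (differentiableAt_id.add_const (m / 2 : ℂ))
    exact (h4.const_mul _).differentiableWithinAt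
  -- both sides are analytic in the order on `Re b > -m/2`, and they agree near `1`
  have h3 := h1.eqOn_of_preconnected_of_eventuallyEq h2
    (convex_halfSpace_re_gt _).isPreconnected (z₀ := 1) ?_ ?_
  · have ha' : a ∈ {b : ℂ | -(m / 2 : ℝ) < b.re} := by
      rw [re_add_half] at ha
      change -(m / 2 : ℝ) < a.re
      linarith
    rw [integral_truncPow_eq_ballMean ha hφ]
    have h6 := h3 ha'
    beta_reduce at h6
    rw [h6]
  · change -(m / 2 : ℝ) < (1 : ℂ).re
    have : (0 : ℝ) ≤ m / 2 := by positivity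
    simp only [Complex.one_re]
    linarith
  · have h5 : ∀ᶠ b : ℂ in nhds 1, 0 < b.re :=
      (isOpen_lt continuous_const Complex.continuous_re).mem_nhds (by simp)
    filter_upwards [h5] with b hb
    have hre : 0 < (b + m / 2).re := by rw [re_add_half]; positivity
    rw [steinMean_eq_integral_halfWave_of_re_pos hb, integral_truncPow_eq_ballMean hre hφ]

/-! ### Moving the contour into the upper half-plane -/

theorem rpow_le_add_rpow {lo x hi : ℝ} (hlo : 0 < lo) (h1 : lo ≤ x) (h2 : x ≤ hi) (b : ℝ) :
    x ^ b ≤ lo ^ b + hi ^ b := by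
  have hx : 0 < x := hlo.trans_le h1
  rcases le_total 0 b with hb | hb
  · have := Real.rpow_le_rpow hx.le h2 hb
    have := Real.rpow_nonneg hlo.le b
    linarith
  · have := Real.rpow_le_rpow_of_nonpos hlo h1 hb
    have := Real.rpow_nonneg (hx.le.trans h2) b
    linarith

theorem norm_cpow_le_exp (w a : ℂ) (hw : w ≠ 0) :
    ‖w ^ a‖ ≤ Real.exp (Real.pi * |a.im|) * ‖w‖ ^ a.re := by
  rw [Complex.norm_cpow_of_ne_zero hw, div_eq_mul_inv, ← Real.exp_neg, mul_comm]
  gcongr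
  calc -(w.arg * a.im) ≤ |w.arg * a.im| := neg_le_abs _
    _ = |w.arg| * |a.im| := abs_mul _ _
    _ ≤ Real.pi * |a.im| := by gcongr; exact Complex.abs_arg_le_pi w

/-- The weight `(1 - z²)^(b - 1)` of the contour integral. -/
noncomputable def contourWeight (b z : ℂ) : ℂ := (1 - z ^ 2) ^ (b - 1)

theorem contourWeight_re_im (r v : ℝ) :
    (1 - ((r : ℂ) + v * Complex.I) ^ 2).re = 1 - r ^ 2 + v ^ 2 ∧
      (1 - ((r : ℂ) + v * Complex.I) ^ 2).im = -(2 * r * v) := by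
  have : 1 - ((r : ℂ) + v * Complex.I) ^ 2 =
      ((1 - r ^ 2 + v ^ 2 : ℝ) : ℂ) + ((-(2 * r * v) : ℝ) : ℂ) * Complex.I := by
    push_cast
    linear_combination (-(v : ℂ) ^ 2) * Complex.I_sq
  rw [this, Complex.add_re, Complex.add_im, Complex.re_ofReal_mul, Complex.im_ofReal_mul,
    Complex.ofReal_re, Complex.ofReal_im, Complex.I_re, Complex.I_im]
  simp

theorem norm_one_sub_sq_le {r v : ℝ} (hr : r ∈ Set.Icc (-1 : ℝ) 1) (hv : v ∈ Set.Icc (0 : ℝ) (4 / 3)) :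
    ‖1 - ((r : ℂ) + v * Complex.I) ^ 2‖ ≤ 6 := by
  obtain ⟨h1, h2⟩ := contourWeight_re_im r v
  refine (Complex.norm_le_abs_re_add_abs_im _).trans ?_
  rw [h1, h2, abs_neg]
  have h3 : |1 - r ^ 2 + v ^ 2| ≤ 25 / 9 := by
    rw [abs_le]
    constructor <;> nlinarith [hr.1, hr.2, hv.1, hv.2]
  have h4 : |2 * r * v| ≤ 8 / 3 := by
    rw [abs_le]
    constructor <;> nlinarith [hr.1, hr.2, hv.1, hv.2]
  linarith

theorem contourWeight_slitPlane {r v : ℝ} (hr : r ∈ Set.Icc (-1 : ℝ) 1)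
    (h : 0 < v ∨ r ∈ Set.Ioo (-1 : ℝ) 1) :
    1 - ((r : ℂ) + v * Complex.I) ^ 2 ∈ Complex.slitPlane := by
  left
  rw [(contourWeight_re_im r v).1]
  rcases h with h | h
  · nlinarith [hr.1, hr.2, pow_pos h 2]
  · nlinarith [h.1, h.2, sq_nonneg v]

/-- A bound for the weight inside the rectangle, uniform in the height: the real part of `1 - z²` is at
least `1 - r²`. -/
theorem norm_contourWeight_le (b : ℂ) {r v : ℝ} (hr : r ∈ Set.Ioo (-1 : ℝ) 1)
    (hv : v ∈ Set.Icc (0 : ℝ) (4 / 3)) :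
    ‖contourWeight b (r + v * Complex.I)‖ ≤ Real.exp (Real.pi * |b.im|) *
      (‖truncPow b (1 - r ^ 2)‖ + 6 ^ (b.re - 1)) := by
  have hpos : 0 < 1 - r ^ 2 := by nlinarith [hr.1, hr.2]
  have h0 := contourWeight_slitPlane (Set.Ioo_subset_Icc_self hr) (v := v) (Or.inr hr)
  have h1 := norm_cpow_le_exp _ (b - 1) (Complex.slitPlane_ne_zero h0)
  rw [contourWeight]
  refine h1.trans ?_
  simp only [Complex.sub_im, Complex.one_im, sub_zero, Complex.sub_re, Complex.one_re]
  rw [norm_truncPow_of_pos b hpos]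
  gcongr
  refine rpow_le_add_rpow hpos ?_ (norm_one_sub_sq_le (Set.Ioo_subset_Icc_self hr) hv) _
  refine le_trans ?_ (Complex.re_le_norm _)
  rw [(contourWeight_re_im r v).1]
  nlinarith [sq_nonneg v]

/-- On the vertical sides `|1 - z²|` is comparable to the height, since its imaginary part is `∓2v`. -/
theorem norm_contourWeight_side_le (b : ℂ) {r v : ℝ} (hr : r = 1 ∨ r = -1)
    (hv : v ∈ Set.Ioc (0 : ℝ) (4 / 3)) :
    ‖contourWeight b (r + v * Complex.I)‖ ≤ Real.exp (Real.pi * |b.im|) *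
      ((2 ^ (b.re - 1) + 6 ^ (b.re - 1)) * v ^ (b.re - 1)) := by
  have hr' : r ∈ Set.Icc (-1 : ℝ) 1 := by rcases hr with rfl | rfl <;> norm_num
  have hr2 : r ^ 2 = 1 := by rcases hr with rfl | rfl <;> norm_num
  have hra : |r| = 1 := by rcases hr with rfl | rfl <;> norm_num
  have hv0 : 0 < v := hv.1
  have h0 := contourWeight_slitPlane hr' (v := v) (Or.inl hv0)
  have h1 := norm_cpow_le_exp _ (b - 1) (Complex.slitPlane_ne_zero h0)
  rw [contourWeight]
  refine h1.trans ?_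
  simp only [Complex.sub_im, Complex.one_im, sub_zero, Complex.sub_re, Complex.one_re]
  gcongr
  rw [add_mul, ← Real.mul_rpow (by norm_num) hv0.le, ← Real.mul_rpow (by norm_num) hv0.le]
  obtain ⟨h2, h3⟩ := contourWeight_re_im r v
  have h4 : |2 * r * v| = 2 * v := by
    rw [abs_mul, abs_mul, hra, abs_of_pos hv0]
    norm_num
  refine rpow_le_add_rpow (by positivity) ?_ ?_ _
  · have := Complex.abs_im_le_norm (1 - ((r : ℂ) + v * Complex.I) ^ 2)
    rwa [h3, abs_neg, h4] at this
  · refine (Complex.norm_le_abs_re_add_abs_im _).trans ?_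
    rw [h2, h3, abs_neg, h4, hr2, abs_of_nonneg (by nlinarith)]
    nlinarith [hv.2]

/-- On the top side the real part of `1 - z²` is at least `(4/3)² > 1`. -/
theorem norm_contourWeight_top_le (b : ℂ) {r : ℝ} (hr : r ∈ Set.Icc (-1 : ℝ) 1) :
    ‖contourWeight b (r + (4 / 3 : ℝ) * Complex.I)‖ ≤ Real.exp (Real.pi * |b.im|) *
      (1 + 6 ^ (b.re - 1)) := by
  have h0 := contourWeight_slitPlane hr (v := 4 / 3) (Or.inl (by norm_num))
  have h1 := norm_cpow_le_exp _ (b - 1) (Complex.slitPlane_ne_zero h0)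
  rw [contourWeight]
  refine h1.trans ?_
  simp only [Complex.sub_im, Complex.one_im, sub_zero, Complex.sub_re, Complex.one_re]
  gcongr
  have := rpow_le_add_rpow one_pos (x := ‖1 - ((r : ℂ) + (4 / 3 : ℝ) * Complex.I) ^ 2‖) ?_
    (norm_one_sub_sq_le hr (v := 4 / 3) (by norm_num)) (b.re - 1)
  · rwa [Real.one_rpow] at this
  · refine le_trans ?_ (Complex.re_le_norm _)
    rw [(contourWeight_re_im r (4 / 3)).1]
    nlinarith [hr.1, hr.2]

theorem differentiableAt_contourWeight (b : ℂ) {z : ℂ} (hz : 1 - z ^ 2 ∈ Complex.slitPlane) :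
    DifferentiableAt ℂ (contourWeight b) z := by
  unfold contourWeight
  exact DifferentiableAt.cpow_const (by fun_prop) hz

theorem continuousAt_contourWeight (b : ℂ) {z : ℂ} (hz : 1 - z ^ 2 ∈ Complex.slitPlane) :
    ContinuousAt (contourWeight b) z :=
  (differentiableAt_contourWeight b hz).continuousAt

section ContourShift

variable {b : ℂ} {G : ℂ → ℂ} {K : ℝ}

theorem continuousOn_contour (hGc : ContinuousOn G {z | 0 ≤ z.im}) {s : Set ℝ} {γ : ℝ → ℂ}
    (hγ : Continuous γ) (h0 : ∀ r ∈ s, 0 ≤ (γ r).im)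
    (h1 : ∀ r ∈ s, 1 - γ r ^ 2 ∈ Complex.slitPlane) :
    ContinuousOn (fun r => contourWeight b (γ r) * G (γ r)) s := by
  intro r hr
  have h2 := (continuousAt_contourWeight b (h1 r hr)).comp_continuousWithinAt
    (hγ.continuousWithinAt (s := s) (x := r))
  have h3 := (hGc (γ r) (h0 r hr)).comp (hγ.continuousWithinAt (s := s) (x := r)) h0
  exact h2.mul h3

theorem intervalIntegrable_contour_side (hb : 0 < b.re) (hGc : ContinuousOn G {z | 0 ≤ z.im})
    (hGb : ∀ z, 0 ≤ z.im → ‖G z‖ ≤ K) {r : ℝ} (hr : r = 1 ∨ r = -1) :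
    IntervalIntegrable (fun v : ℝ => contourWeight b (r + v * Complex.I) * G (r + v * Complex.I))
      volume 0 (4 / 3) := by
  have hr' : r ∈ Set.Icc (-1 : ℝ) 1 := by rcases hr with rfl | rfl <;> norm_num
  rw [intervalIntegrable_iff_integrableOn_Ioc_of_le (by norm_num)]
  have h1 : IntegrableOn (fun v : ℝ => Real.exp (Real.pi * |b.im|) *
      ((2 ^ (b.re - 1) + 6 ^ (b.re - 1)) * v ^ (b.re - 1)) * K) (Set.Ioc 0 (4 / 3)) := by
    have := intervalIntegral.intervalIntegrable_rpow' (a := 0) (b := 4 / 3) (r := b.re - 1)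
      (by linarith)
    rw [intervalIntegrable_iff_integrableOn_Ioc_of_le (by norm_num)] at this
    exact ((this.const_mul _).const_mul _).mul_const _
  refine h1.mono' ?_ ?_
  · refine ContinuousOn.aestronglyMeasurable ?_ measurableSet_Ioc
    refine continuousOn_contour hGc (by fun_prop) (fun v hv => ?_) fun v hv => ?_
    · simpa using hv.1.le
    · exact contourWeight_slitPlane hr' (Or.inl hv.1)
  · refine (ae_restrict_iff' measurableSet_Ioc).2 (.of_forall fun v hv => ?_)
    rw [norm_mul]
    have h2 := hGb (r + v * Complex.I) (by simpa using hv.1.le)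
    have h3 := norm_contourWeight_side_le b hr hv
    exact mul_le_mul h3 h2 (norm_nonneg _) ((norm_nonneg _).trans h3)

/-- Cauchy's theorem for `(1 - z²)^(b - 1) G(z)` on `[-1, 1] × [0, 4/3]`. The corners `±1` are
integrable singularities since `Re b > 0`. -/
theorem integral_contour_shift (hb : 0 < b.re) (hGd : ∀ z : ℂ, 0 < z.im → DifferentiableAt ℂ G z)
    (hGc : ContinuousOn G {z | 0 ≤ z.im}) (hGb : ∀ z, 0 ≤ z.im → ‖G z‖ ≤ K) :
    ∫ r : ℝ, truncPow b (1 - r ^ 2) * G r =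
      (∫ r : ℝ in (-1)..1, contourWeight b (r + (4 / 3 : ℝ) * Complex.I) *
        G (r + (4 / 3 : ℝ) * Complex.I)) +
      Complex.I * (∫ v : ℝ in 0..(4 / 3), contourWeight b ((-1 : ℝ) + v * Complex.I) *
        G ((-1 : ℝ) + v * Complex.I)) -
      Complex.I * ∫ v : ℝ in 0..(4 / 3), contourWeight b ((1 : ℝ) + v * Complex.I) *
        G ((1 : ℝ) + v * Complex.I) := by
  set H : ℂ → ℂ := fun z => contourWeight b z * G z with hH
  -- the rectangle is cut off at height `δ`, and `δ → 0`
  have hbot : Filter.Tendsto (fun δ : ℝ => ∫ r : ℝ in (-1)..1, H (r + δ * Complex.I))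
      (nhdsWithin 0 (Set.Ioo 0 (4 / 3))) (nhds (∫ r : ℝ in (-1)..1, H (r + (0 : ℝ) * Complex.I))) := by
    refine intervalIntegral.tendsto_integral_filter_of_dominated_convergence
      (fun r => Real.exp (Real.pi * |b.im|) *
        (‖truncPow b (1 - r ^ 2)‖ + 6 ^ (b.re - 1)) * K) ?_ ?_ ?_ ?_
    · filter_upwards [self_mem_nhdsWithin] with δ hδ
      rw [Set.uIoc_of_le (by norm_num)]
      refine ContinuousOn.aestronglyMeasurable ?_ measurableSet_Ioc
      refine continuousOn_contour hGc (γ := fun r : ℝ => (r : ℂ) + δ * Complex.I) (by fun_prop)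
        (fun r hr => ?_) fun r hr => ?_
      · simpa using hδ.1.le
      · exact contourWeight_slitPlane (Set.Ioc_subset_Icc_self hr) (Or.inl hδ.1)
    · filter_upwards [self_mem_nhdsWithin] with δ hδ
      have hne : ∀ᵐ r : ℝ, r ≠ 1 := by simp [ae_iff]
      filter_upwards [hne] with r hr1 hr
      rw [Set.uIoc_of_le (by norm_num)] at hr
      have hr' : r ∈ Set.Ioo (-1 : ℝ) 1 := ⟨hr.1, lt_of_le_of_ne hr.2 hr1⟩
      have h2 := hGb (r + δ * Complex.I) (by simpa using hδ.1.le)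
      have h3 := norm_contourWeight_le b hr' (Set.Ioo_subset_Icc_self hδ)
      rw [norm_mul]
      exact mul_le_mul h3 h2 (norm_nonneg _) ((norm_nonneg _).trans h3)
    · have h1 : IntervalIntegrable (fun r : ℝ => ‖truncPow b (1 - r ^ 2)‖) volume (-1) 1 :=
        (integrable_truncPow_one_sub_sq hb).norm.intervalIntegrable
      exact ((h1.add intervalIntegrable_const).const_mul _).mul_const _
    · have hne : ∀ᵐ r : ℝ, r ≠ 1 := by simp [ae_iff]
      filter_upwards [hne] with r hr1 hr
      rw [Set.uIoc_of_le (by norm_num)] at hr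
      have hr' : r ∈ Set.Ioo (-1 : ℝ) 1 := ⟨hr.1, lt_of_le_of_ne hr.2 hr1⟩
      have := continuousOn_contour (b := b) hGc (s := Set.Ici 0)
        (γ := fun δ : ℝ => (r : ℂ) + δ * Complex.I) (by fun_prop) (fun δ hδ => by simpa using hδ)
        (fun δ hδ => contourWeight_slitPlane (Set.Ioo_subset_Icc_self hr') (Or.inr hr'))
      exact (this 0 (by simp)).mono_left (nhdsWithin_mono _ fun δ hδ => le_of_lt hδ.1)
  have hside : ∀ r : ℝ, (r = 1 ∨ r = -1) → Filter.Tendsto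
      (fun δ : ℝ => ∫ v : ℝ in δ..(4 / 3), H (r + v * Complex.I))
      (nhdsWithin 0 (Set.Ioo 0 (4 / 3))) (nhds (∫ v : ℝ in 0..(4 / 3), H (r + v * Complex.I))) := by
    intro r hr
    have h1 := intervalIntegrable_contour_side hb hGc hGb hr
    rw [intervalIntegrable_iff_integrableOn_Icc_of_le (by norm_num)] at h1
    have h2 := intervalIntegral.continuousOn_primitive_interval_left (a := 0) (b := 4 / 3)
      (f := fun v : ℝ => H (r + v * Complex.I)) (μ := volume)
      (by rw [Set.uIcc_of_le (by norm_num)]; exact h1)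
    rw [Set.uIcc_of_le (by norm_num)] at h2
    exact (h2 0 (by norm_num)).mono_left (nhdsWithin_mono _ Set.Ioo_subset_Icc_self)
  have hrect : ∀ δ ∈ Set.Ioo (0 : ℝ) (4 / 3), ∫ r : ℝ in (-1)..1, H (r + δ * Complex.I) =
      (∫ r : ℝ in (-1)..1, H (r + (4 / 3 : ℝ) * Complex.I)) +
      Complex.I * (∫ v : ℝ in δ..(4 / 3), H ((-1 : ℝ) + v * Complex.I)) -
      Complex.I * ∫ v : ℝ in δ..(4 / 3), H ((1 : ℝ) + v * Complex.I) := by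
    intro δ hδ
    have h1 := Complex.integral_boundary_rect_eq_zero_of_differentiableOn H
      ((-1 : ℝ) + δ * Complex.I) ((1 : ℝ) + (4 / 3 : ℝ) * Complex.I) ?_
    · have e1 : (((-1 : ℝ) : ℂ) + δ * Complex.I).re = -1 := by simp
      have e2 : (((-1 : ℝ) : ℂ) + δ * Complex.I).im = δ := by simp
      have e3 : (((1 : ℝ) : ℂ) + (4 / 3 : ℝ) * Complex.I).re = 1 := by simp
      have e4 : (((1 : ℝ) : ℂ) + (4 / 3 : ℝ) * Complex.I).im = 4 / 3 := by simp
      rw [e1, e2, e3, e4, smul_eq_mul, smul_eq_mul] at h1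
      linear_combination h1
    · intro z hz
      have hz' := Complex.mem_reProdIm.1 hz
      simp only [Complex.add_re, Complex.ofReal_re, Complex.mul_re, Complex.I_re, mul_zero,
        Complex.ofReal_im, Complex.I_im, mul_one, sub_self, add_zero, Complex.add_im,
        Complex.mul_im, zero_add] at hz'
      rw [Set.uIcc_of_le (by norm_num), Set.uIcc_of_le hδ.2.le] at hz'
      have hz0 : 0 < z.im := hδ.1.trans_le hz'.2.1
      have h2 := contourWeight_slitPlane hz'.1 (Or.inl hz0)
      rw [Complex.re_add_im] at h2
      exact ((differentiableAt_contourWeight b h2).mul (hGd z hz0)).differentiableWithinAt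
  have hlim := ((hside (-1) (Or.inr rfl)).const_mul Complex.I).const_add
    (∫ r : ℝ in (-1)..1, H (r + (4 / 3 : ℝ) * Complex.I)) |>.sub
      ((hside 1 (Or.inl rfl)).const_mul Complex.I)
  have hne : (nhdsWithin (0 : ℝ) (Set.Ioo 0 (4 / 3))).NeBot :=
    left_nhdsWithin_Ioo_neBot (by norm_num)
  have hfin := tendsto_nhds_unique (hbot.congr' (by
    filter_upwards [self_mem_nhdsWithin] with δ hδ using hrect δ hδ)) hlim
  rw [← hfin, intervalIntegral.integral_of_le (by norm_num), integral_Ioc_eq_integral_Ioo]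
  rw [← setIntegral_eq_integral_of_forall_compl_eq_zero (s := Set.Ioo (-1 : ℝ) 1)]
  · refine setIntegral_congr_fun measurableSet_Ioo fun r hr => ?_
    have hpos : 0 < 1 - r ^ 2 := by nlinarith [hr.1, hr.2]
    simp only [hH, contourWeight]
    rw [truncPow_of_pos b hpos]
    push_cast
    simp
  · intro r hr
    rw [truncPow_of_nonpos, zero_mul]
    simp only [Set.mem_Ioo, not_and_or, not_lt] at hr
    rcases hr with h | h <;> nlinarith

end ContourShift

/-- Rescaling a weighted integral over a vertical segment. -/
theorem lintegral_rpow_comp_mul_le {t b : ℝ} (ht : t ∈ Set.Icc (1 : ℝ) (3 / 2)) {B : ℝ → ℝ≥0∞}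
    (hB : Measurable B) :
    ∫⁻ u in Set.Ioc (0 : ℝ) (4 / 3), ENNReal.ofReal (u ^ b) * B (t * u) ≤
      ENNReal.ofReal (1 + (3 / 2) ^ (-b)) *
        ∫⁻ v in Set.Ioc (0 : ℝ) 2, ENNReal.ofReal (v ^ b) * B v := by
  have ht0 : 0 < t := by linarith [ht.1]
  set F : ℝ → ℝ≥0∞ := (Set.Ioc (0 : ℝ) 2).indicator fun v => ENNReal.ofReal (v ^ b) * B v with hF
  have hm : Measurable F := by
    refine Measurable.indicator ?_ measurableSet_Ioc
    have : Measurable fun v : ℝ => v ^ b := by fun_prop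
    exact this.ennreal_ofReal.mul hB
  have h1 : ∫⁻ u, F (t * u) ≤ ∫⁻ v, F v := by
    conv_rhs => rw [← Real.smul_map_volume_mul_left ht0.ne']
    rw [lintegral_smul_measure, lintegral_map hm (measurable_const_mul t), abs_of_pos ht0,
      smul_eq_mul]
    exact le_mul_of_one_le_left' (by simpa using ht.1)
  rw [← lintegral_indicator measurableSet_Ioc (f := fun v => ENNReal.ofReal (v ^ b) * B v)]
  refine le_trans ?_ (mul_le_mul_right h1 _)
  rw [← lintegral_indicator measurableSet_Ioc, ← lintegral_const_mul _ (by fun_prop)]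
  refine lintegral_mono fun u => ?_
  by_cases hu : u ∈ Set.Ioc (0 : ℝ) (4 / 3)
  · have htu : t * u ∈ Set.Ioc (0 : ℝ) 2 :=
      ⟨mul_pos ht0 hu.1, by nlinarith [ht.2, hu.2, hu.1, ht.1]⟩
    rw [Set.indicator_of_mem hu, hF, Set.indicator_of_mem htu, ← mul_assoc,
      ← ENNReal.ofReal_mul (by positivity)]
    refine mul_le_mul_left (ENNReal.ofReal_le_ofReal ?_) _
    have h2 : u ^ b = t ^ (-b) * (t * u) ^ b := by
      rw [Real.mul_rpow ht0.le hu.1.le, ← mul_assoc, ← Real.rpow_add ht0]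
      simp
    have h3 := rpow_le_add_rpow one_pos ht.1 ht.2 (-b)
    rw [Real.one_rpow] at h3
    rw [h2]
    have := Real.rpow_nonneg htu.1.le b
    gcongr
  · rw [Set.indicator_of_notMem hu]
    exact zero_le

/-- The spherical mean is controlled by the half-wave flow on three sides of a rectangle in the
upper half-plane. -/
theorem enorm_steinMean_le {m : ℕ} {α : ℂ} (hα : 0 < (α + m / 2).re) :
    ∃ K : ℝ≥0, ∀ (f : 𝓢(EuclideanSpace ℝ (Fin (m + 1)), ℂ)) (x : EuclideanSpace ℝ (Fin (m + 1))),
      ∀ t ∈ Set.Icc (1 : ℝ) (3 / 2), ∀ (B₁ B₂ : ℝ → ℝ≥0∞) (H : ℝ≥0∞), Measurable B₁ → Measurable B₂ →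
      (∀ v ∈ Set.Ioc (0 : ℝ) 2, ‖cwave (t + v * Complex.I) f x‖ₑ ≤ B₁ v) →
      (∀ v ∈ Set.Ioc (0 : ℝ) 2, ‖cwave (-t + v * Complex.I) f x‖ₑ ≤ B₂ v) →
      (∀ r ∈ Set.Icc (-1 : ℝ) 1, ‖cwave (t * (r + (4 / 3 : ℝ) * Complex.I)) f x‖ₑ ≤ H) →
      ‖steinMean α t f x‖ₑ ≤ K * (H + (∫⁻ v in Set.Ioc (0 : ℝ) 2,
        ENNReal.ofReal (v ^ ((α + m / 2).re - 1)) * B₁ v) + ∫⁻ v in Set.Ioc (0 : ℝ) 2,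
        ENNReal.ofReal (v ^ ((α + m / 2).re - 1)) * B₂ v) := by
  set b : ℂ := α + m / 2 with hb
  set A : ℝ := Real.exp (Real.pi * |b.im|) with hA
  have hA0 : 0 < A := Real.exp_pos _
  set c₀ : ℝ≥0 := ‖(Real.pi : ℂ) ^ (m / 2 : ℂ) * (Complex.Gamma b)⁻¹‖₊ with hc₀
  set c₁ : ℝ := A * (1 + 6 ^ (b.re - 1)) * 2 with hc₁
  set c₂ : ℝ := A * (2 ^ (b.re - 1) + 6 ^ (b.re - 1)) * (1 + (3 / 2) ^ (-(b.re - 1))) with hc₂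
  refine ⟨c₀ * (c₁ + c₂).toNNReal, fun f x t ht B₁ B₂ H hB₁ hB₂ h₁ h₂ hH => ?_⟩
  have ht0 : 0 < t := by linarith [ht.1]
  set G : ℂ → ℂ := fun z => cwave (t * z) f x with hG
  have him : ∀ z : ℂ, (t * z).im = t * z.im := fun z => by simp
  have hGd : ∀ z : ℂ, 0 < z.im → DifferentiableAt ℂ G z := fun z hz => by
    have h3 : DifferentiableAt ℂ (fun w => cwave w f x) (t * z) :=
      differentiableAt_cwave f x (by rw [him]; positivity)
    exact DifferentiableAt.comp (g := fun w => cwave w f x) (f := fun w : ℂ => t * w) z h3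
      (by fun_prop)
  have hGc : ContinuousOn G {z | 0 ≤ z.im} := by
    refine ContinuousOn.comp
      (g := fun z : ℂ × EuclideanSpace ℝ (Fin (m + 1)) => cwave z.1 f z.2)
      (f := fun z : ℂ => (t * z, x)) (continuousOn_cwave f) (by fun_prop) fun z hz => ?_
    change 0 ≤ (t * z).im
    rw [him]
    exact mul_nonneg ht0.le hz
  have hGb : ∀ z : ℂ, 0 ≤ z.im →
      ‖G z‖ ≤ ∫ ξ, ‖𝓕 (f : EuclideanSpace ℝ (Fin (m + 1)) → ℂ) ξ‖ := fun z hz =>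
    norm_cwave_le (by rw [him]; positivity) f x
  have hG0 : ∀ r : ℝ, halfWave (t * r) f x = G r := fun r => by
    rw [hG, ← cwave_ofReal, Complex.ofReal_mul]
  rw [steinMean_eq_integral_halfWave hα]
  simp only [hG0]
  rw [integral_contour_shift hα hGd hGc hGb, ← mul_assoc, enorm_mul]
  have htop : ‖∫ r : ℝ in (-1)..1, contourWeight b (r + (4 / 3 : ℝ) * Complex.I) *
      G (r + (4 / 3 : ℝ) * Complex.I)‖ₑ ≤ ENNReal.ofReal c₁ * H := by
    rw [intervalIntegral.integral_of_le (by norm_num)]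
    refine (enorm_integral_le_lintegral_enorm _).trans ?_
    have : ∀ r ∈ Set.Ioc (-1 : ℝ) 1, ‖contourWeight b (r + (4 / 3 : ℝ) * Complex.I) *
        G (r + (4 / 3 : ℝ) * Complex.I)‖ₑ ≤ ENNReal.ofReal (A * (1 + 6 ^ (b.re - 1))) * H := by
      intro r hr
      rw [enorm_mul, ← ofReal_norm]
      exact mul_le_mul' (ENNReal.ofReal_le_ofReal
        (norm_contourWeight_top_le b (Set.Ioc_subset_Icc_self hr)))
        (hH r (Set.Ioc_subset_Icc_self hr))
    refine (setLIntegral_mono' measurableSet_Ioc this).trans (le_of_eq ?_)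
    have e2 : ENNReal.ofReal c₁ = ENNReal.ofReal (A * (1 + 6 ^ (b.re - 1))) *
        ENNReal.ofReal (1 - (-1)) := by
      rw [hc₁, ← ENNReal.ofReal_mul (by positivity)]
      norm_num
    rw [lintegral_const, Measure.restrict_apply_univ, Real.volume_Ioc, e2]
    ring
  have hside : ∀ (r : ℝ) (B : ℝ → ℝ≥0∞), (r = 1 ∨ r = -1) → Measurable B →
      (∀ v ∈ Set.Ioc (0 : ℝ) 2, ‖cwave (t * r + v * Complex.I) f x‖ₑ ≤ B v) →
      ‖Complex.I * ∫ v : ℝ in 0..(4 / 3), contourWeight b (r + v * Complex.I) *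
        G (r + v * Complex.I)‖ₑ ≤ ENNReal.ofReal c₂ *
          ∫⁻ v in Set.Ioc (0 : ℝ) 2, ENNReal.ofReal (v ^ (b.re - 1)) * B v := by
    intro r B hr hB hv
    have hI : ‖Complex.I‖ₑ = 1 := by rw [← ofReal_norm]; simp
    rw [enorm_mul, hI, one_mul, intervalIntegral.integral_of_le (by norm_num)]
    refine (enorm_integral_le_lintegral_enorm _).trans ?_
    have : ∀ u ∈ Set.Ioc (0 : ℝ) (4 / 3), ‖contourWeight b (r + u * Complex.I) *
        G (r + u * Complex.I)‖ₑ ≤ ENNReal.ofReal (A * (2 ^ (b.re - 1) + 6 ^ (b.re - 1))) *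
          (ENNReal.ofReal (u ^ (b.re - 1)) * B (t * u)) := by
      intro u hu
      rw [enorm_mul, ← ofReal_norm, ← mul_assoc, ← ENNReal.ofReal_mul (by positivity)]
      refine mul_le_mul' (ENNReal.ofReal_le_ofReal ?_) ?_
      · rw [mul_assoc]
        exact norm_contourWeight_side_le b hr hu
      · have h3 := hv (t * u) ⟨mul_pos ht0 hu.1, by nlinarith [ht.2, hu.2, hu.1, ht.1]⟩
        have e : t * (r + u * Complex.I) = t * r + (t * u : ℝ) * Complex.I := by push_cast; ring
        simp only [hG]
        rw [e]
        exact h3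
    refine (setLIntegral_mono' measurableSet_Ioc this).trans ?_
    have e2 : ENNReal.ofReal c₂ = ENNReal.ofReal (A * (2 ^ (b.re - 1) + 6 ^ (b.re - 1))) *
        ENNReal.ofReal (1 + (3 / 2) ^ (-(b.re - 1))) := ENNReal.ofReal_mul (by positivity)
    rw [lintegral_const_mul' _ _ ENNReal.ofReal_ne_top, e2, mul_assoc]
    exact mul_le_mul_right (lintegral_rpow_comp_mul_le ht hB) _
  have hs1 := hside 1 B₁ (Or.inl rfl) hB₁ (by simpa using h₁)
  have hs2 := hside (-1) B₂ (Or.inr rfl) hB₂ (by simpa using h₂)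
  refine (mul_le_mul_right ((enorm_sub_le (E := ℂ)).trans (add_le_add ((enorm_add_le _ _).trans
    (add_le_add htop hs2)) hs1)) _).trans ?_
  have hc10 : 0 ≤ c₁ := by positivity
  have hc20 : 0 ≤ c₂ := by positivity
  have hcc1 : ENNReal.ofReal c₁ ≤ ENNReal.ofReal (c₁ + c₂) := ENNReal.ofReal_le_ofReal (by linarith)
  have hcc2 : ENNReal.ofReal c₂ ≤ ENNReal.ofReal (c₁ + c₂) := ENNReal.ofReal_le_ofReal (by linarith)
  rw [ENNReal.coe_mul, mul_assoc]
  change (c₀ : ℝ≥0∞) * _ ≤ c₀ * (ENNReal.ofReal (c₁ + c₂) * _)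
  refine mul_le_mul_right ?_ _
  rw [mul_add, mul_add, add_right_comm]
  gcongr

/-! ### The maximal bound for Schwartz functions -/

/-- The complex conjugate of a Schwartz function. -/
noncomputable def conjSchwartz (f : 𝓢(EuclideanSpace ℝ (Fin n), ℂ)) :
    𝓢(EuclideanSpace ℝ (Fin n), ℂ) :=
  SchwartzMap.postcompCLM (𝕜 := ℝ) (Complex.conjCLE : ℂ →L[ℝ] ℂ) f

theorem conjSchwartz_apply (f : 𝓢(EuclideanSpace ℝ (Fin n), ℂ)) (x : EuclideanSpace ℝ (Fin n)) :
    conjSchwartz f x = (starRingEnd ℂ) (f x) := rfl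

theorem eLpNorm_conjSchwartz (f : 𝓢(EuclideanSpace ℝ (Fin n), ℂ)) (p : ℝ≥0∞) :
    eLpNorm (conjSchwartz f) p volume = eLpNorm f p volume :=
  eLpNorm_congr_norm_ae (.of_forall fun x => by rw [conjSchwartz_apply, RCLike.norm_conj])

theorem fourier_conjSchwartz (f : 𝓢(EuclideanSpace ℝ (Fin n), ℂ)) (ξ : EuclideanSpace ℝ (Fin n)) :
    𝓕 (conjSchwartz f : EuclideanSpace ℝ (Fin n) → ℂ) ξ =
      (starRingEnd ℂ) (𝓕 (f : EuclideanSpace ℝ (Fin n) → ℂ) (-ξ)) := by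
  rw [Real.fourier_eq', Real.fourier_eq', ← integral_conj]
  congr 1
  funext v
  rw [smul_eq_mul, smul_eq_mul, map_mul, ← Complex.exp_conj, conjSchwartz_apply, inner_neg_right]
  simp [map_ofNat]

/-- Conjugation reverses the sign of the time, so estimates for positive times suffice. -/
theorem norm_cwave_neg (t v : ℝ) (f : 𝓢(EuclideanSpace ℝ (Fin n), ℂ))
    (x : EuclideanSpace ℝ (Fin n)) :
    ‖cwave (-t + v * Complex.I) f x‖ = ‖cwave (t + v * Complex.I) (conjSchwartz f) x‖ := by
  have : cwave (-t + v * Complex.I) f x =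
      (starRingEnd ℂ) (cwave (t + v * Complex.I) (conjSchwartz f) x) := by
    rw [cwave, cwave, multOp_eq, multOp_eq, ← integral_conj, ← integral_neg_eq_self]
    congr 1
    funext ξ
    rw [fourier_conjSchwartz, norm_neg, map_mul, map_mul, ← Complex.exp_conj,
      ← Complex.exp_conj, inner_neg_left]
    have e1 : (starRingEnd ℂ) (2 * Real.pi * (inner ℝ ξ x : ℝ) * Complex.I) =
        2 * Real.pi * ((-inner ℝ ξ x : ℝ) : ℂ) * Complex.I := by
      simp [map_ofNat]
    have e2 : (starRingEnd ℂ) (2 * Real.pi * Complex.I * (t + v * Complex.I) * ‖ξ‖) =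
        2 * Real.pi * Complex.I * (-t + v * Complex.I) * ‖ξ‖ := by
      simp only [map_mul, map_add, Complex.conj_ofReal, Complex.conj_I, map_ofNat]
      ring
    rw [e1, e2]
    simp
  rw [this, RCLike.norm_conj]

/-- The heat regularization at scale `c` maps `L^p` to `L^q`. -/
theorem eLpNorm_heat_le {p q : ℝ≥0∞} (hp : 1 ≤ p) (hpq : p ≤ q) :
    ∃ C : ℝ≥0, ∀ c : ℝ, 0 < c → ∀ f : 𝓢(EuclideanSpace ℝ (Fin n), ℂ),
      eLpNorm (heat c f) q volume ≤ C * ENNReal.ofReal (1 + (c ^ n)⁻¹) * eLpNorm f p volume := by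
  obtain ⟨C₁, h₁⟩ := eLpNorm_multOp_schwartz_le (gaussMonomial n 0)
  obtain ⟨C₂, h₂⟩ := enorm_multOp_schwartz_le (gaussMonomial n 0) p hp
  refine ⟨C₁ + C₂, fun c hc f => ?_⟩
  have hfp : eLpNorm f p volume ≠ ∞ := (f.eLpNorm_lt_top p volume).ne
  have e : (heat c f : EuclideanSpace ℝ (Fin n) → ℂ) =
      multOp (fun ξ => gaussMonomial n 0 (c • ξ)) f := by
    funext x
    exact heat_apply c f x
  rw [e, ← eLpNorm_enorm]
  refine eLpNorm_le_of_le_of_forall_le hp hpq (by finiteness) ?_ fun x => ?_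
  · rw [eLpNorm_enorm]
    refine (h₁ p hp c hc f).trans ?_
    have h3 : (1 : ℝ≥0∞) ≤ ENNReal.ofReal (1 + (c ^ n)⁻¹) := by
      rw [ENNReal.one_le_ofReal]
      have : 0 < (c ^ n)⁻¹ := by positivity
      linarith
    calc C₁ * eLpNorm f p volume = C₁ * 1 * eLpNorm f p volume := by rw [mul_one]
      _ ≤ ((C₁ + C₂ : ℝ≥0) : ℝ≥0∞) * ENNReal.ofReal (1 + (c ^ n)⁻¹) * eLpNorm f p volume := by
        gcongr
        exact le_self_add
  · refine (h₂ c hc f x).trans ?_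
    gcongr
    exact le_add_self

/-- At heights comparable to `1` the half-wave flow is dominated, uniformly in the time, by an
average of heat regularizations. -/
theorem exists_top_bound {p q : ℝ≥0∞} (hp : 1 ≤ p) (hpq : p ≤ q) :
    ∃ C : ℝ≥0, ∀ f : 𝓢(EuclideanSpace ℝ (Fin n), ℂ), ∃ H : EuclideanSpace ℝ (Fin n) → ℝ≥0∞,
      Measurable H ∧
      (∀ t ∈ Set.Icc (1 : ℝ) (3 / 2), ∀ r ∈ Set.Icc (-1 : ℝ) 1, ∀ x,
        ‖cwave (t * (r + (4 / 3 : ℝ) * Complex.I)) f x‖ₑ ≤ H x) ∧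
      eLpNorm H q volume ≤ C * eLpNorm f p volume := by
  obtain ⟨C, hC⟩ := eLpNorm_heat_le (n := n) hp hpq
  have hpi := Real.pi_pos
  have hpi3 := Real.pi_gt_three
  -- a majorant, uniform in `t` and `r`, of the subordination weight at `w = 2πt (4/3 - ir)`
  set κ : ℝ → ℝ := fun v => 6 * Real.pi / Real.sqrt Real.pi * (v ^ (-1 / 2 : ℝ) * Real.exp (-v))
    with hκ
  have hκm : Measurable κ := by fun_prop
  have hκ0 : ∀ v ∈ Set.Ioi (0 : ℝ), 0 < κ v := fun v hv => by
    have := Real.rpow_pos_of_pos (show 0 < v from hv) (-1 / 2)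
    simp only [hκ]
    positivity
  have hG : ∀ s : ℝ, -1 < s → IntegrableOn (fun v : ℝ => v ^ s * Real.exp (-v)) (Set.Ioi 0) :=
    fun s hs => by
      have := integrableOn_rpow_mul_exp_neg_mul_rpow (p := 1) (s := s) (b := 1) hs one_pos one_pos
      simp only [Real.rpow_one, neg_mul, one_mul] at this
      exact this
  set K : ℝ → ℝ := fun v => κ v * (1 + ((2 * Real.sqrt v)⁻¹ ^ n)⁻¹) with hK
  have hKi : IntegrableOn K (Set.Ioi 0) := by
    have h1 := ((hG (-1 / 2) (by norm_num)).const_mul (6 * Real.pi / Real.sqrt Real.pi)).add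
      ((hG ((n - 1) / 2) (by
        have : (0 : ℝ) ≤ n := Nat.cast_nonneg n
        linarith)).const_mul (6 * Real.pi / Real.sqrt Real.pi * 2 ^ n))
    refine IntegrableOn.congr_fun h1 (fun v hv => ?_) measurableSet_Ioi
    have hv : 0 < v := hv
    have e1 : ((2 * Real.sqrt v)⁻¹ ^ n)⁻¹ = 2 ^ n * v ^ ((n : ℝ) / 2) := by
      rw [inv_pow, inv_inv, mul_pow, Real.sqrt_eq_rpow, ← Real.rpow_natCast (v ^ (1 / 2 : ℝ)),
        ← Real.rpow_mul hv.le]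
      congr 2
      ring
    have e2 : v ^ (((n : ℝ) - 1) / 2) = v ^ (-1 / 2 : ℝ) * v ^ ((n : ℝ) / 2) := by
      rw [← Real.rpow_add hv]
      congr 1
      ring
    simp only [hK, hκ, Pi.add_apply]
    rw [e1, e2]
    ring
  have hKpos : ∀ v ∈ Set.Ioi (0 : ℝ), 0 < K v := fun v hv => by
    have := hκ0 v hv
    have hv : 0 < v := hv
    simp only [hK]
    positivity
  have hKt : ∫⁻ v in Set.Ioi (0 : ℝ), ENNReal.ofReal (K v) ≠ ∞ := by
    rw [← ofReal_integral_eq_lintegral_ofReal hKi ((ae_restrict_iff' measurableSet_Ioi).2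
      (.of_forall fun v hv => (hKpos v hv).le))]
    exact ENNReal.ofReal_ne_top
  refine ⟨C * (∫⁻ v in Set.Ioi (0 : ℝ), ENNReal.ofReal (K v)).toNNReal, fun f => ?_⟩
  set F : EuclideanSpace ℝ (Fin n) → ℝ → ℝ≥0∞ := fun x v =>
    ENNReal.ofReal (κ v) * ‖heat (2 * Real.sqrt v)⁻¹ f x‖ₑ with hF
  have hFm : Measurable (Function.uncurry F) := by
    have h0 : Measurable fun z : ℝ × EuclideanSpace ℝ (Fin n) => (2 * Real.sqrt z.1)⁻¹ := by
      fun_prop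
    have h2 : Measurable fun z : ℝ × EuclideanSpace ℝ (Fin n) => (2 * Real.sqrt z.1)⁻¹ • z.2 :=
      h0.smul measurable_snd
    have h4 := measurable_multOp (P := ℝ) (M := fun r ξ =>
      gaussMonomial n 0 ((2 * Real.sqrt r)⁻¹ • ξ))
      ((gaussMonomial n 0).continuous.measurable.comp h2) f
    simp only [hF, heat_apply]
    exact ((hκm.comp measurable_snd).ennreal_ofReal).mul h4.enorm
  refine ⟨fun x => ∫⁻ v in Set.Ioi (0 : ℝ), F x v, hFm.lintegral_prod_right', ?_, ?_⟩
  · intro t ht r hr x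
    set w : ℂ := ((2 * Real.pi * t * (4 / 3) : ℝ) : ℂ) + ((-(2 * Real.pi * t * r) : ℝ) : ℂ) *
      Complex.I with hw
    have ht0 : 0 < t := by linarith [ht.1]
    have hwre : w.re = 2 * Real.pi * t * (4 / 3) := by
      rw [hw, Complex.add_re, Complex.re_ofReal_mul, Complex.ofReal_re, Complex.I_re]
      ring
    -- the height `4/3` exceeds `|r| ≤ 1`, so that `Re w² > 0`
    have hw2 : (w ^ 2).re = (2 * Real.pi * t) ^ 2 * ((4 / 3) ^ 2 - r ^ 2) := by
      have : w ^ 2 = (((2 * Real.pi * t) ^ 2 * ((4 / 3) ^ 2 - r ^ 2) : ℝ) : ℂ) +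
          ((-2 * (2 * Real.pi * t) ^ 2 * (4 / 3) * r : ℝ) : ℂ) * Complex.I := by
        rw [hw]
        push_cast
        linear_combination ((2 * Real.pi * t * r : ℂ)) ^ 2 * Complex.I_sq
      rw [this, Complex.add_re, Complex.re_ofReal_mul, Complex.ofReal_re, Complex.I_re]
      ring
    have hr2 : 7 / 9 ≤ (4 / 3 : ℝ) ^ 2 - r ^ 2 := by nlinarith [hr.1, hr.2]
    have hpt : 6 ≤ 2 * Real.pi * t := by nlinarith [ht.1]
    have hw2' : 1 ≤ (w ^ 2).re := by
      rw [hw2]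
      nlinarith
    have hwn : ‖w‖ ≤ 6 * Real.pi * 1 := by
      have h1 : ‖w‖ ^ 2 = (2 * Real.pi * t) ^ 2 * ((4 / 3) ^ 2 + r ^ 2) := by
        rw [Complex.sq_norm, hw, Complex.normSq_add_mul_I]
        ring
      have h2 : (2 * Real.pi * t) ^ 2 * ((4 / 3) ^ 2 + r ^ 2) ≤ (3 * Real.pi) ^ 2 * 4 := by
        have : 2 * Real.pi * t ≤ 3 * Real.pi := by nlinarith [ht.2]
        have : (4 / 3 : ℝ) ^ 2 + r ^ 2 ≤ 4 := by nlinarith [hr.1, hr.2]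
        gcongr
      refine abs_le_of_sq_le_sq' ?_ (by positivity) |>.2
      rw [h1]
      nlinarith
    set c : ℝ → ℂ := fun v => w / Real.sqrt Real.pi * ((v ^ (-1 / 2 : ℝ) : ℝ) : ℂ) *
      Complex.exp (-v * w ^ 2) with hc
    have hcκ : ∀ v ∈ Set.Ioi (0 : ℝ), ‖c v‖ ≤ κ v := by
      intro v hv
      have hv : 0 < v := hv
      have h1 : ‖Complex.exp (-v * w ^ 2)‖ ≤ Real.exp (-v) := by
        rw [Complex.norm_exp, Real.exp_le_exp]
        have : (-v * w ^ 2 : ℂ).re = -v * (w ^ 2).re := by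
          rw [← Complex.ofReal_neg, Complex.re_ofReal_mul]
        rw [this]
        nlinarith
      have hrp := Real.rpow_pos_of_pos hv (-1 / 2)
      simp only [hc, hκ]
      rw [norm_mul, norm_mul, norm_div, Complex.norm_real, Complex.norm_real,
        Real.norm_of_nonneg hrp.le, Real.norm_of_nonneg (Real.sqrt_nonneg _), mul_assoc]
      have : ‖w‖ ≤ 6 * Real.pi := by linarith
      gcongr
    set M : ℝ → EuclideanSpace ℝ (Fin n) → ℂ := fun v ξ => c v *
      gaussMonomial n 0 ((2 * Real.sqrt v)⁻¹ • ξ) with hMdef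
    have hcm : Measurable c := by
      have h1 : Measurable fun v : ℝ => v ^ (-1 / 2 : ℝ) := by fun_prop
      have h2 : Measurable fun v : ℝ => Complex.exp (-v * w ^ 2) := by fun_prop
      exact ((Complex.measurable_ofReal.comp h1).const_mul _).mul h2
    have hM : Measurable (Function.uncurry M) := by
      have h0 : Measurable fun z : ℝ × EuclideanSpace ℝ (Fin n) => (2 * Real.sqrt z.1)⁻¹ := by
        fun_prop
      have h2 : Measurable fun z : ℝ × EuclideanSpace ℝ (Fin n) => (2 * Real.sqrt z.1)⁻¹ • z.2 :=
        h0.smul measurable_snd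
      exact (hcm.comp measurable_fst).mul ((gaussMonomial n 0).continuous.measurable.comp h2)
    have hκi : IntegrableOn κ (Set.Ioi 0) := (hG (-1 / 2) (by norm_num)).const_mul _
    have hint := integrable_symbol (ν := volume.restrict (Set.Ioi 0)) hM f (κ := κ) hκi
      (B := fun _ => 1) (by simpa using integrable_fourier f) (by
        filter_upwards [ae_restrict_mem measurableSet_Ioi] with v hv ξ
        simp only [hMdef]
        rw [gauss_smul, norm_mul, Complex.norm_real, Real.norm_of_nonneg (Real.exp_pos _).le]
        have h2 : Real.exp (-((2 * Real.sqrt v)⁻¹ ^ 2 * ‖ξ‖ ^ 2)) ≤ 1 := by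
          rw [Real.exp_le_one_iff]
          have : 0 ≤ (2 * Real.sqrt v)⁻¹ ^ 2 * ‖ξ‖ ^ 2 := by positivity
          linarith
        exact mul_le_mul (hcκ v hv) h2 (Real.exp_pos _).le (hκ0 v hv).le)
    have hsym : (fun ξ : EuclideanSpace ℝ (Fin n) =>
        Complex.exp (2 * Real.pi * Complex.I * (t * (r + (4 / 3 : ℝ) * Complex.I)) * ‖ξ‖)) =
        fun ξ => ∫ v in Set.Ioi (0 : ℝ), M v ξ := by
      funext ξ
      have h1 := exp_neg_mul_eq_integral (w := w) (by rw [hwre]; positivity)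
        (by linarith) (norm_nonneg ξ)
      have h2 : 2 * Real.pi * Complex.I * (t * (r + (4 / 3 : ℝ) * Complex.I)) * ‖ξ‖ =
          -w * ‖ξ‖ := by
        rw [hw]
        push_cast
        linear_combination (2 * Real.pi * t * (4 / 3) * ‖ξ‖ : ℂ) * Complex.I_sq
      rw [h2, h1]
      refine setIntegral_congr_fun measurableSet_Ioi fun v hv => ?_
      have hv : 0 < v := hv
      simp only [hMdef, hc]
      rw [gauss_smul]
      have h3 : (2 * Real.sqrt v)⁻¹ ^ 2 * ‖ξ‖ ^ 2 = ‖ξ‖ ^ 2 / (4 * v) := by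
        rw [inv_pow, mul_pow, Real.sq_sqrt hv.le]
        field_simp
        ring
      rw [h3]
      push_cast
      ring
    rw [cwave, hsym, multOp_integral M f hint]
    refine (enorm_integral_le_lintegral_enorm _).trans
      (setLIntegral_mono' measurableSet_Ioi fun v hv => ?_)
    simp only [hMdef, hF]
    rw [multOp_const_mul, enorm_mul, heat_apply, ← ofReal_norm (c v)]
    exact mul_le_mul_left (ENNReal.ofReal_le_ofReal (hcκ v hv)) _
  · refine (eLpNorm_lintegral_le (μ := volume) (ν := volume.restrict (Set.Ioi 0))
      (hp.trans hpq) hFm.aemeasurable (K := fun v => ENNReal.ofReal (K v))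
      hKi.1.aemeasurable.ennreal_ofReal ?_ (.of_forall fun v => ENNReal.ofReal_ne_top)
      (A := C * eLpNorm f p volume) ?_).trans (le_of_eq ?_)
    · filter_upwards [ae_restrict_mem measurableSet_Ioi] with v hv
      simpa using hKpos v hv
    · filter_upwards [ae_restrict_mem measurableSet_Ioi] with v hv
      have hκv := hκ0 v hv
      have hv : 0 < v := hv
      simp only [hF]
      refine (eLpNorm_const_mul_ennreal_le ENNReal.ofReal_ne_top _).trans ?_
      rw [eLpNorm_enorm]
      refine (mul_le_mul_right (hC _ (by positivity) f) _).trans (le_of_eq ?_)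
      simp only [hK]
      rw [ENNReal.ofReal_mul hκv.le]
      ring
    · rw [ENNReal.coe_mul, ENNReal.coe_toNNReal hKt]
      ring

/-- The maximal bound for the times in `I`, through a measurable majorant of the maximal
function. -/
def MaximalBound (n : ℕ) (α : ℂ) (p q : ℝ≥0∞) (I : Set ℝ) : Prop :=
  ∃ C : ℝ≥0, ∀ f : 𝓢(EuclideanSpace ℝ (Fin n), ℂ), ∃ S : EuclideanSpace ℝ (Fin n) → ℝ≥0∞,
    Measurable S ∧ (∀ t ∈ I, ∀ x, ‖steinMean α t f x‖ₑ ≤ S x) ∧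
      eLpNorm S q volume ≤ C * eLpNorm f p volume

/-- The maximal estimate for Schwartz functions, for times in `[5/4, 3/2]`, which leaves room inside
`[1, 2]` for the circles used in Cauchy's estimate. -/
theorem maximalBound_core {m : ℕ} {p q : ℝ≥0∞} (hp : 1 ≤ p) (hpq : p ≤ q) {s : ℝ} (hs0 : 0 ≤ s)
    (hLS : LocalSmoothing (m + 1) p q s) {α : ℂ} (hα : s + (q⁻¹).toReal < (α + m / 2).re) :
    MaximalBound (m + 1) α p q (Set.Icc (5 / 4) (3 / 2)) := by
  have hq : 1 ≤ q := hp.trans hpq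
  set κ := (q⁻¹).toReal with hκ
  have hκ0 : 0 ≤ κ := ENNReal.toReal_nonneg
  set b := (α + m / 2).re with hb
  obtain ⟨s', hs1, hs2⟩ : ∃ s', s < s' ∧ s' + κ < b := ⟨(s + (b - κ)) / 2, by linarith, by linarith⟩
  obtain ⟨K, hK⟩ := enorm_steinMean_le (m := m) (α := α) (by linarith)
  obtain ⟨C₁, hC₁⟩ := exists_horizontal_bound hp hq hs0 hs1 hLS
  obtain ⟨C₂, hC₂⟩ := exists_top_bound (n := m + 1) hp hpq
  set e := b - 1 + -(s' + κ) with he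
  -- `e > -1` because `s' + 1/q < Re (α + m/2)`
  have hei : IntegrableOn (fun v : ℝ => v ^ e) (Set.Ioc 0 2) := by
    have := intervalIntegral.intervalIntegrable_rpow' (a := 0) (b := 2) (r := e) (by linarith)
    rwa [intervalIntegrable_iff_integrableOn_Ioc_of_le (by norm_num)] at this
  set J := ∫⁻ v in Set.Ioc (0 : ℝ) 2, ENNReal.ofReal (v ^ e) with hJ
  have hJt : J ≠ ∞ := by
    rw [hJ, ← ofReal_integral_eq_lintegral_ofReal hei ((ae_restrict_iff' measurableSet_Ioc).2
      (.of_forall fun v hv => Real.rpow_nonneg hv.1.le _))]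
    exact ENNReal.ofReal_ne_top
  refine ⟨K * (C₂ + C₁ * J.toNNReal + C₁ * J.toNNReal), fun f => ?_⟩
  obtain ⟨B₁, hB₁m, hB₁, hB₁n⟩ := hC₁ f
  -- negative times are handled through the conjugate of `f`
  obtain ⟨B₂, hB₂m, hB₂, hB₂n⟩ := hC₁ (conjSchwartz f)
  obtain ⟨H, hHm, hH, hHn⟩ := hC₂ f
  have hpow : Measurable fun v : ℝ => v ^ (b - 1) := by fun_prop
  have hFm : ∀ B : EuclideanSpace ℝ (Fin (m + 1)) → ℝ → ℝ≥0∞, Measurable (Function.uncurry B) →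
      Measurable (Function.uncurry fun x v => ENNReal.ofReal (v ^ (b - 1)) * B x v) := fun B hB =>
    ((hpow.comp measurable_snd).ennreal_ofReal).mul hB
  have hFn : ∀ B : EuclideanSpace ℝ (Fin (m + 1)) → ℝ → ℝ≥0∞, Measurable (Function.uncurry B) →
      (∀ u ∈ Set.Ioc (0 : ℝ) 2, eLpNorm (fun x => B x u) q volume ≤
        C₁ * ENNReal.ofReal (u ^ (-(s' + κ))) * eLpNorm f p volume) →
      eLpNorm (fun x => ∫⁻ v in Set.Ioc (0 : ℝ) 2, ENNReal.ofReal (v ^ (b - 1)) * B x v) q volume ≤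
        C₁ * J.toNNReal * eLpNorm f p volume := by
    intro B hB hBn
    refine (eLpNorm_lintegral_le (μ := volume) (ν := volume.restrict (Set.Ioc 0 2)) hq
      (hFm B hB).aemeasurable (K := fun v => ENNReal.ofReal (v ^ e))
      hei.1.aemeasurable.ennreal_ofReal ?_ (.of_forall fun v => ENNReal.ofReal_ne_top)
      (A := C₁ * eLpNorm f p volume) ?_).trans (le_of_eq ?_)
    · filter_upwards [ae_restrict_mem measurableSet_Ioc] with v hv
      simpa using Real.rpow_pos_of_pos hv.1 e
    · filter_upwards [ae_restrict_mem measurableSet_Ioc] with v hv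
      refine (eLpNorm_const_mul_ennreal_le ENNReal.ofReal_ne_top _).trans ?_
      refine (mul_le_mul_right (hBn v hv) _).trans (le_of_eq ?_)
      rw [he, Real.rpow_add hv.1, ENNReal.ofReal_mul (Real.rpow_nonneg hv.1.le _)]
      ring
    · rw [ENNReal.coe_toNNReal hJt]
      ring
  have hm₁ := (hFm B₁ hB₁m).lintegral_prod_right' (ν := volume.restrict (Set.Ioc (0 : ℝ) 2))
  have hm₂ := (hFm B₂ hB₂m).lintegral_prod_right' (ν := volume.restrict (Set.Ioc (0 : ℝ) 2))
  have hn₁ := hFn B₁ hB₁m hB₁n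
  have hn₂ := hFn B₂ hB₂m (by simpa only [eLpNorm_conjSchwartz] using hB₂n)
  simp only [Function.uncurry] at hm₁ hm₂
  set I₁ : EuclideanSpace ℝ (Fin (m + 1)) → ℝ≥0∞ :=
    fun x => ∫⁻ v in Set.Ioc (0 : ℝ) 2, ENNReal.ofReal (v ^ (b - 1)) * B₁ x v with hI₁
  set I₂ : EuclideanSpace ℝ (Fin (m + 1)) → ℝ≥0∞ :=
    fun x => ∫⁻ v in Set.Ioc (0 : ℝ) 2, ENNReal.ofReal (v ^ (b - 1)) * B₂ x v with hI₂
  refine ⟨fun x => K * (H x + I₁ x + I₂ x), ((hHm.add hm₁).add hm₂).const_mul _, ?_, ?_⟩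
  · intro t ht x
    have ht' : t ∈ Set.Icc (1 : ℝ) (3 / 2) := ⟨by linarith [ht.1], ht.2⟩
    refine hK f x t ht' (B₁ x) (B₂ x) (H x) (hB₁m.comp measurable_prodMk_left)
      (hB₂m.comp measurable_prodMk_left) (fun v hv => hB₁ v hv t ht x) (fun v hv => ?_)
      (fun r hr => hH t ht' r hr x)
    have h1 := hB₂ v hv t ht x
    rwa [← ofReal_norm, ← norm_cwave_neg, ofReal_norm] at h1
  · refine (eLpNorm_const_mul_ennreal_le ENNReal.coe_ne_top _).trans ?_
    rw [ENNReal.coe_mul, mul_assoc]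
    refine mul_le_mul_right ?_ _
    have h1 := eLpNorm_add_le (μ := volume) (hHm.add hm₁).aestronglyMeasurable
      hm₂.aestronglyMeasurable hq
    have h2 := eLpNorm_add_le (μ := volume) hHm.aestronglyMeasurable hm₁.aestronglyMeasurable hq
    refine (h1.trans (add_le_add (h2.trans (add_le_add hHn hn₁)) hn₂)).trans (le_of_eq ?_)
    push_cast
    ring

/-! ### Scaling -/

theorem eLpNorm_comp_smul {ε : Type*} [TopologicalSpace ε] [ContinuousENorm ε]
    {g : EuclideanSpace ℝ (Fin n) → ε} (hg : StronglyMeasurable g)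
    {c : ℝ} (hc : 0 < c) (p : ℝ≥0∞) :
    eLpNorm (fun y => g (c • y)) p volume =
      ENNReal.ofReal ((c ^ n)⁻¹) ^ (1 / p).toReal * eLpNorm g p volume := by
  have h1 := Measure.map_addHaar_smul (volume : Measure (EuclideanSpace ℝ (Fin n))) hc.ne'
  rw [finrank_euclideanSpace_fin, abs_of_nonneg (by positivity)] at h1
  have h2 := eLpNorm_map_measure (μ := (volume : Measure (EuclideanSpace ℝ (Fin n)))) (p := p)
    (f := fun y => c • y) (g := g) hg.aestronglyMeasurable (by fun_prop)
  rw [h1, eLpNorm_smul_measure_of_ne_zero (by simp; positivity)] at h2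
  rw [smul_eq_mul] at h2
  exact h2.symm

/-- The dilate `y ↦ f(c y)` of a Schwartz function. -/
noncomputable def dilate (c : ℝ) (hc : c ≠ 0) (f : 𝓢(EuclideanSpace ℝ (Fin n), ℂ)) :
    𝓢(EuclideanSpace ℝ (Fin n), ℂ) :=
  SchwartzMap.compCLMOfContinuousLinearEquiv ℂ
    (ContinuousLinearEquiv.smulLeft (Units.mk0 c hc)) f

theorem dilate_apply (c : ℝ) (hc : c ≠ 0) (f : 𝓢(EuclideanSpace ℝ (Fin n), ℂ))
    (x : EuclideanSpace ℝ (Fin n)) : dilate c hc f x = f (c • x) := rfl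

theorem steinMean_dilate (α : ℂ) (t : ℝ) {c : ℝ} (hc : c ≠ 0)
    (f : 𝓢(EuclideanSpace ℝ (Fin n), ℂ)) (x : EuclideanSpace ℝ (Fin n)) :
    steinMean α t (dilate c hc f) x = steinMean α (c * t) f (c • x) := by
  refine (steinMean_unique t (dilate c hc f) x (F := fun β => steinMean β (c * t) f (c • x))
    (differentiable_steinMean _ _ _) (fun β hβ => ?_) α).symm
  simp only [steinMean_of_re_pos hβ, dilate_apply, smul_sub, smul_smul]

theorem MaximalBound.mono {α : ℂ} {p q : ℝ≥0∞} {I J : Set ℝ} (h : MaximalBound n α p q I)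
    (hJI : J ⊆ I) : MaximalBound n α p q J := by
  obtain ⟨C, hC⟩ := h
  refine ⟨C, fun f => ?_⟩
  obtain ⟨S, h1, h2, h3⟩ := hC f
  exact ⟨S, h1, fun t ht => h2 t (hJI ht), h3⟩

theorem MaximalBound.union {α : ℂ} {p q : ℝ≥0∞} (hq : 1 ≤ q) {I J : Set ℝ}
    (hI : MaximalBound n α p q I) (hJ : MaximalBound n α p q J) : MaximalBound n α p q (I ∪ J) := by
  obtain ⟨C₁, h₁⟩ := hI
  obtain ⟨C₂, h₂⟩ := hJ
  refine ⟨C₁ + C₂, fun f => ?_⟩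
  obtain ⟨S₁, hm₁, hb₁, hn₁⟩ := h₁ f
  obtain ⟨S₂, hm₂, hb₂, hn₂⟩ := h₂ f
  refine ⟨S₁ + S₂, hm₁.add hm₂, ?_, ?_⟩
  · rintro t (ht | ht) x
    · exact (hb₁ t ht x).trans le_self_add
    · exact (hb₂ t ht x).trans le_add_self
  · refine (eLpNorm_add_le hm₁.aestronglyMeasurable hm₂.aestronglyMeasurable hq).trans ?_
    refine (add_le_add hn₁ hn₂).trans (le_of_eq ?_)
    push_cast
    ring

theorem MaximalBound.scale {α : ℂ} {p q : ℝ≥0∞} {I J : Set ℝ} (h : MaximalBound n α p q I) {c : ℝ}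
    (hc : 0 < c) (hJ : ∀ t ∈ J, c * t ∈ I) : MaximalBound n α p q J := by
  obtain ⟨C, hC⟩ := h
  have hc' : 0 < c⁻¹ := inv_pos.2 hc
  have hfin : ∀ (d : ℝ) (r : ℝ≥0∞), 0 < d →
      ENNReal.ofReal ((d ^ n)⁻¹) ^ (1 / r).toReal ≠ ∞ := fun d r hd =>
    ENNReal.rpow_ne_top_of_nonneg ENNReal.toReal_nonneg ENNReal.ofReal_ne_top
  set A₁ := ENNReal.ofReal ((c ^ n)⁻¹) ^ (1 / q).toReal with hA₁
  set A₂ := ENNReal.ofReal ((c⁻¹ ^ n)⁻¹) ^ (1 / p).toReal with hA₂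
  refine ⟨A₁.toNNReal * C * A₂.toNNReal, fun f => ?_⟩
  obtain ⟨S, hm, hb, hn⟩ := hC (dilate c⁻¹ hc'.ne' f)
  refine ⟨fun x => S (c • x), hm.comp (measurable_const_smul c), fun t ht x => ?_, ?_⟩
  · have h1 := hb (c * t) (hJ t ht) (c • x)
    rwa [steinMean_dilate, ← mul_assoc, inv_mul_cancel₀ hc.ne', one_mul, smul_smul,
      inv_mul_cancel₀ hc.ne', one_smul] at h1
  · rw [eLpNorm_comp_smul hm.stronglyMeasurable hc]
    have h1 : eLpNorm (dilate c⁻¹ hc'.ne' f) p volume = A₂ * eLpNorm f p volume :=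
      eLpNorm_comp_smul f.continuous.stronglyMeasurable hc' p
    rw [h1] at hn
    rw [ENNReal.coe_mul, ENNReal.coe_mul, ENNReal.coe_toNNReal (hfin c q hc),
      ENNReal.coe_toNNReal (hfin _ p hc')]
    refine (mul_le_mul_right hn _).trans (le_of_eq ?_)
    ring

/-- `[1, 2]` is covered by four dilates of `[5/4, 3/2]`. -/
theorem maximalBound_Icc_one_two {m : ℕ} {p q : ℝ≥0∞} (hp : 1 ≤ p) (hpq : p ≤ q) {s : ℝ}
    (hs0 : 0 ≤ s) (hLS : LocalSmoothing (m + 1) p q s) {α : ℂ}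
    (hα : s + (q⁻¹).toReal < (α + m / 2).re) :
    MaximalBound (m + 1) α p q (Set.Icc 1 2) := by
  have h0 := maximalBound_core hp hpq hs0 hLS hα
  have hq := hp.trans hpq
  have h1 : ∀ {c a b : ℝ}, 0 < c → 5 / 4 ≤ c * a → c * b ≤ 3 / 2 →
      MaximalBound (m + 1) α p q (Set.Icc a b) := fun hc ha hb =>
    h0.scale hc fun t ht =>
      ⟨ha.trans (mul_le_mul_of_nonneg_left ht.1 hc.le), (mul_le_mul_of_nonneg_left ht.2 hc.le).trans hb⟩
  have hA := h1 (c := 5 / 4) (a := 1) (b := 6 / 5) (by norm_num) (by norm_num) (by norm_num)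
  have hB := h1 (c := 25 / 24) (a := 6 / 5) (b := 36 / 25) (by norm_num) (by norm_num) (by norm_num)
  have hC := h1 (c := 125 / 144) (a := 36 / 25) (b := 216 / 125) (by norm_num) (by norm_num)
    (by norm_num)
  have hD := h1 (c := 625 / 864) (a := 216 / 125) (b := 2) (by norm_num) (by norm_num) (by norm_num)
  refine (((hA.union hq hB).union hq hC).union hq hD).mono fun t ht => ?_
  simp only [Set.mem_union, Set.mem_Icc] at ht ⊢
  by_contra hcon
  simp only [not_or, not_and, not_le] at hcon
  obtain ⟨⟨⟨g1, g2⟩, g3⟩, g4⟩ := hcon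
  linarith [g1 ht.1, g2 (g1 ht.1).le, g3 (g2 (g1 ht.1).le).le, g4 (g3 (g2 (g1 ht.1).le).le).le]

/-! ### Local smoothing requires nonnegative regularity -/

/-- The wave packet with Fourier transform `e^{-|ξ - a|²}`. -/
noncomputable def wavePacket (a : EuclideanSpace ℝ (Fin n)) : 𝓢(EuclideanSpace ℝ (Fin n), ℂ) :=
  𝓕⁻ (SchwartzMap.compSubConstCLM ℂ a (gaussMonomial n 0))

theorem fourier_wavePacket (a ξ : EuclideanSpace ℝ (Fin n)) :
    𝓕 (wavePacket a : EuclideanSpace ℝ (Fin n) → ℂ) ξ =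
      ((Real.exp (-‖ξ - a‖ ^ 2) : ℝ) : ℂ) := by
  rw [← SchwartzMap.fourier_coe, wavePacket, FourierTransform.fourier_fourierInv_eq]
  change gaussMonomial n 0 (ξ - a) = _
  rw [gaussMonomial_apply]
  push_cast
  simp

/-- A multiplier acting on a wave packet is the translated multiplier acting on the Gaussian. -/
theorem multOp_wavePacket (m : EuclideanSpace ℝ (Fin n) → ℂ) (a x : EuclideanSpace ℝ (Fin n)) :
    multOp m (wavePacket a) x = Complex.exp (2 * Real.pi * inner ℝ a x * Complex.I) *
      multOp (fun η => m (η + a)) (wavePacket 0) x := by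
  rw [multOp_eq, multOp_eq, ← integral_const_mul, ← integral_add_right_eq_self _ a]
  congr 1
  funext η
  rw [fourier_wavePacket, fourier_wavePacket, add_sub_cancel_right, sub_zero, inner_add_left,
    ← mul_assoc (Complex.exp _) (Complex.exp _), ← Complex.exp_add]
  congr 2
  push_cast
  ring

theorem norm_multOp_wavePacket (m : EuclideanSpace ℝ (Fin n) → ℂ)
    (a x : EuclideanSpace ℝ (Fin n)) :
    ‖multOp m (wavePacket a) x‖ = ‖multOp (fun η => m (η + a)) (wavePacket 0) x‖ := by
  rw [multOp_wavePacket, norm_mul, norm_exp_inner, one_mul]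

/-- The heat flow damps a wave packet of frequency `a` by `e^{-w|a|²/(1 + w)}`. -/
theorem norm_heat_wavePacket {w : ℝ} (hw : 0 ≤ w) (a x : EuclideanSpace ℝ (Fin n)) :
    ‖heat (Real.sqrt w) (wavePacket a) x‖ =
      Real.exp (-(‖a‖ ^ 2 * (w / (1 + w)))) * ‖heat (Real.sqrt w) (wavePacket 0) x‖ := by
  set b := (1 + w)⁻¹ • a with hb
  have h1 : heat (Real.sqrt w) (wavePacket a) x =
      (Real.exp (-(‖a‖ ^ 2 * (w / (1 + w)))) : ℂ) *
        multOp (fun ξ => gaussMonomial n 0 (Real.sqrt w • (ξ - b))) (wavePacket b) x := by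
    rw [heat_apply, ← multOp_const_mul, multOp_eq, multOp_eq]
    congr 1
    funext ξ
    rw [fourier_wavePacket, fourier_wavePacket, gauss_smul, gauss_smul]
    congr 1
    norm_cast
    rw [← Real.exp_add, ← Real.exp_add, ← Real.exp_add, Real.sq_sqrt hw]
    congr 1
    have e1 : ‖ξ - b‖ ^ 2 = ‖ξ‖ ^ 2 - 2 * ((1 + w)⁻¹ * inner ℝ ξ a) + ((1 + w)⁻¹) ^ 2 * ‖a‖ ^ 2 := by
      rw [norm_sub_sq_real, hb, real_inner_smul_right, norm_smul, mul_pow, Real.norm_eq_abs, sq_abs]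
    rw [e1, norm_sub_sq_real]
    have : 1 + w ≠ 0 := by positivity
    field_simp
    ring
  rw [h1, norm_mul, norm_multOp_wavePacket, heat_apply]
  congr 1
  · norm_cast
    exact Real.norm_of_nonneg (Real.exp_pos _).le
  · simp only [add_sub_cancel_right]

/-- The Bessel potential of negative order as a superposition of heat operators. -/
theorem sobolevSymbol_neg_eq_integral {a : ℝ} (ha : 0 < a) (ξ : EuclideanSpace ℝ (Fin n)) :
    (((1 + ‖ξ‖ ^ 2) ^ (-a) : ℝ) : ℂ) = ∫ w in Set.Ioi (0 : ℝ),
      (((Real.Gamma a)⁻¹ * (w ^ (a - 1) * Real.exp (-w)) : ℝ) : ℂ) *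
        gaussMonomial n 0 (Real.sqrt w • ξ) := by
  have h1 := Real.integral_rpow_mul_exp_neg_mul_Ioi ha (r := 1 + ‖ξ‖ ^ 2) (by positivity)
  have h2 : (1 + ‖ξ‖ ^ 2) ^ (-a) = (Real.Gamma a)⁻¹ *
      ∫ w in Set.Ioi (0 : ℝ), w ^ (a - 1) * Real.exp (-((1 + ‖ξ‖ ^ 2) * w)) := by
    have := (Real.Gamma_pos_of_pos ha).ne'
    rw [h1, one_div, Real.inv_rpow (by positivity), Real.rpow_neg (by positivity)]
    field_simp
  rw [h2, ← integral_const_mul, ← integral_complex_ofReal]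
  refine setIntegral_congr_fun measurableSet_Ioi fun w hw => ?_
  have hw : 0 < w := hw
  rw [gauss_smul, Real.sq_sqrt hw.le, ← Complex.ofReal_mul]
  congr 1
  rw [mul_assoc, mul_assoc, ← Real.exp_add]
  congr 3
  ring

/-- Sobolev norms of negative order tend to zero along wave packets of increasing frequency: at every
scale the heat flow damps them, and `sobolevSymbol_neg_eq_integral` superposes the scales. -/
theorem tendsto_sobolevNorm_wavePacket {s : ℝ} (hs : s < 0) {p : ℝ≥0∞} (hp : 1 ≤ p)
    {e : EuclideanSpace ℝ (Fin n)} (he : ‖e‖ = 1) :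
    Filter.Tendsto (fun N : ℕ => sobolevNorm s p (wavePacket ((N : ℝ) • e))) Filter.atTop
      (nhds 0) := by
  set a : ℝ := -s / 2 with ha
  have ha0 : 0 < a := by linarith
  obtain ⟨C, hC⟩ := eLpNorm_multOp_schwartz_le (gaussMonomial n 0)
  set A : ℝ≥0∞ := C * eLpNorm (wavePacket (0 : EuclideanSpace ℝ (Fin n))) p volume with hA
  have hAt : A ≠ ∞ :=
    ENNReal.mul_ne_top ENNReal.coe_ne_top (SchwartzMap.eLpNorm_lt_top _ p volume).ne
  have hΓ := Real.Gamma_pos_of_pos ha0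
  set κ : ℝ → ℝ := fun w => (Real.Gamma a)⁻¹ * (w ^ (a - 1) * Real.exp (-w)) with hκ
  have hκ0 : ∀ w ∈ Set.Ioi (0 : ℝ), 0 < κ w := fun w hw => by
    have := Real.rpow_pos_of_pos (show 0 < w from hw) (a - 1)
    simp only [hκ]
    positivity
  have hκi : IntegrableOn κ (Set.Ioi 0) := by
    have := integrableOn_rpow_mul_exp_neg_mul_rpow (p := 1) (s := a - 1) (b := 1) (by linarith)
      one_pos one_pos
    simp only [Real.rpow_one, neg_mul, one_mul] at this
    exact this.const_mul _
  have hκm : Measurable κ := by fun_prop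
  set D : ℕ → ℝ → ℝ := fun N w => Real.exp (-((N : ℝ) ^ 2 * (w / (1 + w)))) with hD
  have hDm : ∀ N, Measurable (D N) := fun N => by fun_prop
  have hbound : ∀ N : ℕ, sobolevNorm s p (wavePacket ((N : ℝ) • e)) ≤
      A * ∫⁻ w in Set.Ioi (0 : ℝ), ENNReal.ofReal (κ w * D N w) := by
    intro N
    set f := wavePacket ((N : ℝ) • e) with hf
    set M : ℝ → EuclideanSpace ℝ (Fin n) → ℂ := fun w ξ => (κ w : ℂ) *
      gaussMonomial n 0 (Real.sqrt w • ξ) with hM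
    have hMm : Measurable (Function.uncurry M) := by
      have h0 : Measurable fun z : ℝ × EuclideanSpace ℝ (Fin n) => Real.sqrt z.1 := by fun_prop
      have h2 : Measurable fun z : ℝ × EuclideanSpace ℝ (Fin n) => Real.sqrt z.1 • z.2 :=
        h0.smul measurable_snd
      exact (Complex.measurable_ofReal.comp (hκm.comp measurable_fst)).mul
        ((gaussMonomial n 0).continuous.measurable.comp h2)
    have hint := integrable_symbol (ν := volume.restrict (Set.Ioi 0)) hMm f (κ := κ) hκi
      (B := fun _ => 1) (by simpa using integrable_fourier f) (by
        filter_upwards [ae_restrict_mem measurableSet_Ioi] with w hw ξ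
        have := hκ0 w hw
        simp only [hM]
        rw [gauss_smul, norm_mul, Complex.norm_real, Complex.norm_real,
          Real.norm_of_nonneg (Real.exp_pos _).le, Real.norm_of_nonneg this.le]
        have h2 : Real.exp (-(Real.sqrt w ^ 2 * ‖ξ‖ ^ 2)) ≤ 1 := by
          rw [Real.exp_le_one_iff]
          have : 0 ≤ Real.sqrt w ^ 2 * ‖ξ‖ ^ 2 := by positivity
          linarith
        exact mul_le_mul_of_nonneg_left h2 this.le)
    have hrep : ∀ x, multOp (fun ξ => (((1 + ‖ξ‖ ^ 2) ^ (s / 2) : ℝ) : ℂ)) f x =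
        ∫ w in Set.Ioi (0 : ℝ), (κ w : ℂ) * heat (Real.sqrt w) f x := by
      intro x
      have h1 : (fun ξ : EuclideanSpace ℝ (Fin n) => (((1 + ‖ξ‖ ^ 2) ^ (s / 2) : ℝ) : ℂ)) =
          fun ξ => ∫ w in Set.Ioi (0 : ℝ), M w ξ := by
        funext ξ
        have : s / 2 = -a := by rw [ha]; ring
        rw [this, sobolevSymbol_neg_eq_integral ha0]
      rw [h1, multOp_integral M f hint]
      refine setIntegral_congr_fun measurableSet_Ioi fun w _ => ?_
      simp only [hM]
      rw [multOp_const_mul, heat_apply]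
    have hFm : Measurable (Function.uncurry fun (x : EuclideanSpace ℝ (Fin n)) (w : ℝ) =>
        ‖(κ w : ℂ) * heat (Real.sqrt w) f x‖ₑ) := by
      have h0 : Measurable fun z : ℝ × EuclideanSpace ℝ (Fin n) => Real.sqrt z.1 := by fun_prop
      have h2 : Measurable fun z : ℝ × EuclideanSpace ℝ (Fin n) => Real.sqrt z.1 • z.2 :=
        h0.smul measurable_snd
      have h4 := measurable_multOp (P := ℝ) (M := fun r ξ => gaussMonomial n 0 (Real.sqrt r • ξ))
        ((gaussMonomial n 0).continuous.measurable.comp h2) f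
      simp only [heat_apply]
      exact ((Complex.measurable_ofReal.comp (hκm.comp measurable_snd)).mul h4).enorm
    rw [sobolevNorm_eq_multOp]
    refine le_trans (eLpNorm_mono_enorm (g := fun x => ∫⁻ w in Set.Ioi (0 : ℝ),
      ‖(κ w : ℂ) * heat (Real.sqrt w) f x‖ₑ) fun x => ?_) (eLpNorm_lintegral_le (μ := volume)
      (ν := volume.restrict (Set.Ioi 0)) hp hFm.aemeasurable
      (K := fun w => ENNReal.ofReal (κ w * D N w))
      ((hκm.mul (hDm N)).ennreal_ofReal).aemeasurable ?_
      (.of_forall fun v => ENNReal.ofReal_ne_top) ?_)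
    · rw [hrep, enorm_eq_self]
      exact enorm_integral_le_lintegral_enorm _
    · filter_upwards [ae_restrict_mem measurableSet_Ioi] with w hw
      have := hκ0 w hw
      have h2 : 0 < D N w := Real.exp_pos _
      simpa using mul_pos this h2
    · filter_upwards [ae_restrict_mem measurableSet_Ioi] with w hw
      have hκw := hκ0 w hw
      have hw : 0 < w := hw
      have h1 : ∀ x, ‖(κ w : ℂ) * heat (Real.sqrt w) f x‖ₑ = ENNReal.ofReal (κ w * D N w) *
          ‖multOp (fun ξ => gaussMonomial n 0 (Real.sqrt w • ξ)) (wavePacket 0) x‖ₑ := by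
        intro x
        rw [← ofReal_norm, norm_mul, hf, norm_heat_wavePacket hw.le, Complex.norm_real,
          Real.norm_of_nonneg hκw.le, ← ofReal_norm, ← heat_apply,
          ← ENNReal.ofReal_mul (mul_nonneg hκw.le (Real.exp_pos _).le)]
        congr 1
        rw [norm_smul, he, mul_one, Real.norm_of_nonneg (Nat.cast_nonneg N)]
        ring
      simp only [h1]
      refine (eLpNorm_const_mul_ennreal_le ENNReal.ofReal_ne_top _).trans ?_
      rw [eLpNorm_enorm]
      exact mul_le_mul_right (hC p hp _ (Real.sqrt_pos.2 hw) _) _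
  have hlim : Filter.Tendsto (fun N : ℕ => ∫⁻ w in Set.Ioi (0 : ℝ), ENNReal.ofReal (κ w * D N w))
      Filter.atTop (nhds 0) := by
    have h1 := tendsto_lintegral_of_dominated_convergence (μ := volume.restrict (Set.Ioi (0 : ℝ)))
      (F := fun (N : ℕ) w => ENNReal.ofReal (κ w * D N w)) (f := fun _ => 0)
      (fun w => ENNReal.ofReal (κ w)) (fun N => (hκm.mul (hDm N)).ennreal_ofReal)
      (fun N => by
        filter_upwards [ae_restrict_mem measurableSet_Ioi] with w hw
        have hκw := hκ0 w hw
        have hw : 0 < w := hw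
        refine ENNReal.ofReal_le_ofReal (mul_le_of_le_one_right hκw.le ?_)
        simp only [hD]
        rw [Real.exp_le_one_iff]
        have : 0 ≤ (N : ℝ) ^ 2 * (w / (1 + w)) := by positivity
        linarith)
      (by
        rw [← ofReal_integral_eq_lintegral_ofReal hκi ((ae_restrict_iff' measurableSet_Ioi).2
          (.of_forall fun v hv => (hκ0 v hv).le))]
        exact ENNReal.ofReal_ne_top)
      (by
        filter_upwards [ae_restrict_mem measurableSet_Ioi] with w hw
        have hw : 0 < w := hw
        have hpos : 0 < w / (1 + w) := by positivity
        have h2 : Filter.Tendsto (fun N : ℕ => (N : ℝ) ^ 2 * (w / (1 + w))) Filter.atTop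
            Filter.atTop :=
          ((Filter.tendsto_pow_atTop two_ne_zero).comp tendsto_natCast_atTop_atTop).atTop_mul_const
            hpos
        have h3 := (Real.tendsto_exp_neg_atTop_nhds_zero.comp h2).const_mul (κ w)
        rw [mul_zero] at h3
        simpa using ENNReal.tendsto_ofReal h3)
    simpa using h1
  have h5 := ENNReal.Tendsto.const_mul (a := A) hlim (Or.inr hAt)
  rw [mul_zero] at h5
  exact tendsto_of_tendsto_of_tendsto_of_le_of_le tendsto_const_nhds h5 (fun _ => zero_le) hbound

/-- In the limit of high frequency a wave packet is transported rigidly by the half-wave flow. -/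
theorem tendsto_wavePacket_transport {e : EuclideanSpace ℝ (Fin n)} (he : ‖e‖ = 1) (t : ℝ)
    (x : EuclideanSpace ℝ (Fin n)) :
    Filter.Tendsto (fun N : ℕ => multOp (fun η => Complex.exp (2 * Real.pi * Complex.I * t *
      ((‖η + (N : ℝ) • e‖ - N : ℝ) : ℂ))) (wavePacket 0) x) Filter.atTop
      (nhds (wavePacket 0 (x + t • e))) := by
  -- the linearization `|η + Ne| - N → η · e` of the phase
  have hlim : ∀ η : EuclideanSpace ℝ (Fin n),
      Filter.Tendsto (fun N : ℕ => ‖η + (N : ℝ) • e‖ - N) Filter.atTop (nhds (inner ℝ η e)) := by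
    intro η
    have h0 : Filter.Tendsto (fun N : ℕ => 2 * ‖η‖ ^ 2 / (N : ℝ)) Filter.atTop (nhds 0) :=
      tendsto_const_div_atTop_nhds_zero_nat _
    refine tendsto_iff_norm_sub_tendsto_zero.2 (squeeze_zero' (.of_forall fun N => norm_nonneg _)
      ?_ h0)
    filter_upwards [Filter.eventually_gt_atTop 0] with N hN
    have hN : (0 : ℝ) < N := Nat.cast_pos.2 hN
    set d := ‖η + (N : ℝ) • e‖ with hd
    set i := inner ℝ η e with hi
    have h1 : d ^ 2 = ‖η‖ ^ 2 + 2 * (N * i) + N ^ 2 := by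
      rw [hd, norm_add_sq_real, real_inner_smul_right, norm_smul, he, mul_one, Real.norm_eq_abs,
        sq_abs]
    have h2 : |i| ≤ ‖η‖ := by simpa [he] using abs_real_inner_le_norm η e
    have h3 : |N - d| ≤ ‖η‖ := by
      have := abs_norm_sub_norm_le ((N : ℝ) • e) (η + (N : ℝ) • e)
      simpa [norm_smul, he] using this
    have h4 : 0 ≤ d := norm_nonneg _
    rw [Real.norm_eq_abs, le_div_iff₀ hN]
    have h5 : (d - N - i) * (d + N) = ‖η‖ ^ 2 + i * (N - d) := by linear_combination h1
    calc |d - N - i| * N ≤ |d - N - i| * (d + N) := by gcongr; linarith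
      _ = |(d - N - i) * (d + N)| := by rw [abs_mul, abs_of_pos (by linarith : 0 < d + N)]
      _ ≤ |‖η‖ ^ 2| + |i * (N - d)| := by rw [h5]; exact abs_add_le _ _
      _ ≤ ‖η‖ ^ 2 + ‖η‖ * ‖η‖ := by
        rw [abs_mul, abs_of_nonneg (sq_nonneg ‖η‖)]
        gcongr
      _ = _ := by ring
  have hval : wavePacket 0 (x + t • e) = multOp (fun η => Complex.exp (2 * Real.pi * Complex.I * t *
      ((inner ℝ η e : ℝ) : ℂ))) (wavePacket 0) x := by
    have := multOp_exp_inner (-t) e (wavePacket 0) x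
    rw [neg_smul, sub_neg_eq_add] at this
    rw [← this]
    congr 1
    funext η
    congr 1
    push_cast
    ring
  rw [hval]
  simp only [multOp_eq]
  have hnorm : ∀ b : ℝ, ‖Complex.exp (2 * Real.pi * Complex.I * t * b)‖ = 1 := fun b => by
    have := Complex.norm_exp_ofReal_mul_I (2 * Real.pi * t * b)
    rw [← this]
    congr 2
    push_cast
    ring
  have hfc := continuous_fourier (wavePacket (0 : EuclideanSpace ℝ (Fin n)))
  refine tendsto_integral_of_dominated_convergence
    (fun ξ => ‖𝓕 (wavePacket (0 : EuclideanSpace ℝ (Fin n)) : EuclideanSpace ℝ (Fin n) → ℂ) ξ‖)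
    (fun N => Continuous.aestronglyMeasurable (by fun_prop)) (integrable_fourier _).norm
    (fun N => .of_forall fun η => ?_) (.of_forall fun η => ?_)
  · rw [norm_mul, norm_mul, norm_exp_inner, hnorm, one_mul, one_mul]
  · refine Filter.Tendsto.const_mul _ (Filter.Tendsto.mul_const _ ?_)
    exact (Complex.continuous_exp.tendsto _).comp
      (((Complex.continuous_ofReal.tendsto _).comp (hlim η)).const_mul _)

/-- A local smoothing estimate cannot gain derivatives: wave packets are merely transported. -/
theorem LocalSmoothing.nonneg {m : ℕ} {p q : ℝ≥0∞} {s : ℝ} (hp : 1 ≤ p) (hq : 1 ≤ q)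
    (hLS : LocalSmoothing (m + 1) p q s) : 0 ≤ s := by
  by_contra! hs
  obtain ⟨C, hC⟩ := hLS
  set e : EuclideanSpace ℝ (Fin (m + 1)) := EuclideanSpace.single 0 1 with he
  have he1 : ‖e‖ = 1 := by simp [he]
  set μ : Measure (EuclideanSpace ℝ (Fin (m + 1)) × ℝ) :=
    volume.prod (volume.restrict (Set.Icc 1 2)) with hμ
  set F : ℕ → EuclideanSpace ℝ (Fin (m + 1)) × ℝ → ℂ := fun N z =>
    multOp (fun η => Complex.exp (2 * Real.pi * Complex.I * z.2 *
      ((‖η + (N : ℝ) • e‖ - N : ℝ) : ℂ))) (wavePacket 0) z.1 with hF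
  have hFm : ∀ N, Measurable (F N) := fun N => by
    refine measurable_multOp (P := ℝ) (M := fun t η => Complex.exp (2 * Real.pi * Complex.I * t *
      ((‖η + (N : ℝ) • e‖ - N : ℝ) : ℂ))) (Continuous.measurable ?_) _
    unfold Function.uncurry
    fun_prop
  -- removing unimodular factors from the half-wave flow of the wave packet leaves `F N`
  have hnorm : ∀ N z, ‖F N z‖ = ‖halfWave z.2 (wavePacket ((N : ℝ) • e)) z.1‖ := by
    intro N z
    rw [halfWave_eq_multOp, norm_multOp_wavePacket _ ((N : ℝ) • e) z.1]
    have h1 : (fun η : EuclideanSpace ℝ (Fin (m + 1)) =>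
        Complex.exp (2 * Real.pi * Complex.I * z.2 * ‖η + (N : ℝ) • e‖)) = fun η =>
        Complex.exp (2 * Real.pi * Complex.I * z.2 * N) * Complex.exp (2 * Real.pi * Complex.I *
          z.2 * ((‖η + (N : ℝ) • e‖ - N : ℝ) : ℂ)) := by
      funext η
      rw [← Complex.exp_add]
      congr 1
      push_cast
      ring
    have h2 : ‖Complex.exp (2 * Real.pi * Complex.I * z.2 * N)‖ = 1 := by
      have := Complex.norm_exp_ofReal_mul_I (2 * Real.pi * z.2 * N)
      rw [← this]
      congr 2
      push_cast
      ring
    rw [h1, multOp_const_mul, norm_mul, h2, one_mul]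
  have hlim0 : Filter.Tendsto (fun N => eLpNorm (F N) q μ) Filter.atTop (nhds 0) := by
    have h1 := ENNReal.Tendsto.const_mul (a := (C : ℝ≥0∞))
      (tendsto_sobolevNorm_wavePacket hs hp he1) (Or.inr ENNReal.coe_ne_top)
    rw [mul_zero] at h1
    refine tendsto_of_tendsto_of_tendsto_of_le_of_le tendsto_const_nhds h1 (fun _ => zero_le)
      fun N => ?_
    have h2 : eLpNorm (F N) q μ = eLpNorm (fun z : EuclideanSpace ℝ (Fin (m + 1)) × ℝ =>
        halfWave z.2 (wavePacket ((N : ℝ) • e)) z.1) q μ :=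
      eLpNorm_congr_norm_ae (.of_forall (hnorm N))
    simp only
    rw [h2]
    exact hC _
  -- by Fatou the transported packet would vanish
  have h1 := Lp.eLpNorm_lim_le_liminf_eLpNorm (p := q) (μ := μ)
    (fun N => (hFm N).aestronglyMeasurable)
    (fun z => wavePacket 0 (z.1 + z.2 • e))
    (.of_forall fun z => tendsto_wavePacket_transport he1 z.2 z.1)
  rw [hlim0.liminf_eq, nonpos_iff_eq_zero] at h1
  have hcont : Continuous fun z : EuclideanSpace ℝ (Fin (m + 1)) × ℝ =>
      wavePacket 0 (z.1 + z.2 • e) := by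
    have := (wavePacket (0 : EuclideanSpace ℝ (Fin (m + 1)))).continuous
    fun_prop
  rw [eLpNorm_eq_zero_iff hcont.aestronglyMeasurable (zero_lt_one.trans_le hq).ne'] at h1
  have h2 := Measure.ae_ae_of_ae_prod ((Measure.measurePreserving_swap).quasiMeasurePreserving.ae h1)
  have hne : (volume.restrict (Set.Icc (1 : ℝ) 2)) ≠ 0 := by
    rw [Ne, Measure.restrict_eq_zero]
    simp
  have : (ae (volume.restrict (Set.Icc (1 : ℝ) 2))).NeBot := ae_neBot.2 hne
  obtain ⟨t, ht⟩ := h2.exists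
  have hc2 : Continuous fun x : EuclideanSpace ℝ (Fin (m + 1)) =>
      wavePacket 0 (x + t • e) := by
    have := (wavePacket (0 : EuclideanSpace ℝ (Fin (m + 1)))).continuous
    fun_prop
  have h3 := (hc2.ae_eq_iff_eq volume (continuous_const (y := (0 : ℂ)))).1 ht
  have h4 : (wavePacket (0 : EuclideanSpace ℝ (Fin (m + 1))) :
      EuclideanSpace ℝ (Fin (m + 1)) → ℂ) = 0 := by
    funext x
    have := congrFun h3 (x - t • e)
    simpa using this
  have h5 := fourier_wavePacket (0 : EuclideanSpace ℝ (Fin (m + 1))) 0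
  rw [h4, Real.fourier_eq'] at h5
  simp at h5

/-! ### Decay of the spherical means of a Schwartz function -/

theorem steinMean_eq_ballMean {α : ℂ} (hα : 0 < α.re) (t : ℝ) (f : 𝓢(EuclideanSpace ℝ (Fin n), ℂ))
    (x : EuclideanSpace ℝ (Fin n)) : steinMean α t f x = ballMean α fun y => f (x - t • y) :=
  steinMean_of_re_pos hα t f x

theorem integrableOn_weight_mul {β : ℂ} (hβ : 0 < β.re) {g : EuclideanSpace ℝ (Fin n) → ℂ}
    (hg : Continuous g) : IntegrableOn (fun y => ((1 - ‖y‖ ^ 2 : ℝ) : ℂ) ^ (β - 1) * g y)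
      (Metric.closedBall (0 : EuclideanSpace ℝ (Fin n)) 1) :=
  (integrable_integrand (β := β - 1) (by simpa using hβ) hg).congr_set_ae closedBall_ae_eq

/-- `f ↦ 𝔐^α_t f(x)` as a linear functional on the Schwartz space. -/
noncomputable def steinMeanLinear (α : ℂ) (t : ℝ) (x : EuclideanSpace ℝ (Fin n)) :
    𝓢(EuclideanSpace ℝ (Fin n), ℂ) →ₗ[ℂ] ℂ where
  toFun f := steinMean α t f x
  map_add' f g := by
    refine (steinMean_unique t (f + g) x (F := fun β => steinMean β t f x + steinMean β t g x)
      ((differentiable_steinMean t f x).add (differentiable_steinMean t g x)) ?_ α).symm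
    intro β hβ
    have hc : ∀ h : 𝓢(EuclideanSpace ℝ (Fin n), ℂ), Continuous fun y => h (x - t • y) := fun h =>
      (contDiff_shift t h x).continuous
    rw [steinMean_of_re_pos hβ, steinMean_of_re_pos hβ, ← mul_add,
      ← integral_add (integrableOn_weight_mul hβ (hc f)) (integrableOn_weight_mul hβ (hc g))]
    simp only [add_apply, mul_add]
  map_smul' c f := by
    refine (steinMean_unique t (c • f) x (F := fun β => c • steinMean β t f x)
      ((differentiable_steinMean t f x).const_smul c) ?_ α).symm
    intro β hβ
    rw [steinMean_of_re_pos hβ, smul_eq_mul, mul_left_comm, ← integral_const_mul]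
    simp only [smul_apply, smul_eq_mul, mul_left_comm]

theorem steinMeanLinear_apply (α : ℂ) (t : ℝ) (x : EuclideanSpace ℝ (Fin n))
    (f : 𝓢(EuclideanSpace ℝ (Fin n), ℂ)) : steinMeanLinear α t x f = steinMean α t f x := rfl

/-- The partial derivative `∂ᵢφ` of a Schwartz function. -/
noncomputable def partialSchwartz (i : Fin n) (φ : 𝓢(EuclideanSpace ℝ (Fin n), ℂ)) :
    𝓢(EuclideanSpace ℝ (Fin n), ℂ) :=
  SchwartzMap.evalCLM ℂ (EuclideanSpace ℝ (Fin n)) ℂ (EuclideanSpace.single i 1)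
    (SchwartzMap.fderivCLM ℂ (EuclideanSpace ℝ (Fin n)) ℂ φ)

/-- The radial derivative `x ↦ x · ∇φ(x)` of a Schwartz function. -/
noncomputable def eulerSchwartz (φ : 𝓢(EuclideanSpace ℝ (Fin n), ℂ)) :
    𝓢(EuclideanSpace ℝ (Fin n), ℂ) :=
  ∑ i, SchwartzMap.smulLeftCLM ℂ (fun z : EuclideanSpace ℝ (Fin n) => ((z i : ℝ) : ℂ))
    (partialSchwartz i φ)

theorem hasTemperateGrowth_coord (i : Fin n) :
    (fun z : EuclideanSpace ℝ (Fin n) => ((z i : ℝ) : ℂ)).HasTemperateGrowth :=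
  (Complex.ofRealCLM.comp (EuclideanSpace.proj (𝕜 := ℝ) i)).hasTemperateGrowth

theorem fderiv_apply_eq_sum (φ : 𝓢(EuclideanSpace ℝ (Fin n), ℂ)) (z v : EuclideanSpace ℝ (Fin n)) :
    fderiv ℝ φ z v = ∑ i, ((v i : ℝ) : ℂ) * partialSchwartz i φ z := by
  have h2 : v = ∑ i, v i • EuclideanSpace.single i (1 : ℝ) := by
    ext j
    simp [Finset.sum_apply, Pi.single_apply]
  conv_lhs => rw [h2]
  rw [map_sum]
  refine Finset.sum_congr rfl fun i _ => ?_
  rw [map_smul, Complex.real_smul]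
  rfl

theorem eulerSchwartz_apply (φ : 𝓢(EuclideanSpace ℝ (Fin n), ℂ)) (z : EuclideanSpace ℝ (Fin n)) :
    eulerSchwartz φ z = fderiv ℝ φ z z := by
  rw [fderiv_apply_eq_sum, eulerSchwartz, sum_apply]
  refine Finset.sum_congr rfl fun i _ => ?_
  rw [SchwartzMap.smulLeftCLM_apply_apply (hasTemperateGrowth_coord i), smul_eq_mul]

/-- The order of the mean is lowered by one at the cost of one derivative: this is
`ballMean_recurrence` continued analytically, with the radial derivative in `y` of
`φ (x - t y)` rewritten as `(z · ∇φ)(z) - x · ∇φ(z)` at `z = x - t y`. -/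
theorem steinMean_recurrence (α : ℂ) (t : ℝ) (φ : 𝓢(EuclideanSpace ℝ (Fin n), ℂ))
    (x : EuclideanSpace ℝ (Fin n)) :
    steinMean α t φ x = (α + n / 2) * steinMean (α + 1) t φ x +
      1 / 2 * (steinMean (α + 1) t (eulerSchwartz φ) x -
        ∑ i, ((x i : ℝ) : ℂ) * steinMean (α + 1) t (partialSchwartz i φ) x) := by
  set θ : 𝓢(EuclideanSpace ℝ (Fin n), ℂ) :=
    eulerSchwartz φ - ∑ i, ((x i : ℝ) : ℂ) • partialSchwartz i φ with hθ
  have h1 : ∀ β, steinMean β t θ x = steinMean β t (eulerSchwartz φ) x -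
      ∑ i, ((x i : ℝ) : ℂ) * steinMean β t (partialSchwartz i φ) x := by
    intro β
    rw [← steinMeanLinear_apply, hθ, map_sub, map_sum]
    simp only [map_smul, steinMeanLinear_apply, smul_eq_mul]
  rw [← h1]
  have hrad : radialDeriv (fun y => φ (x - t • y)) = fun y => θ (x - t • y) := by
    funext y
    have hd : HasFDerivAt (fun y : EuclideanSpace ℝ (Fin n) => φ (x - t • y))
        ((fderiv ℝ φ (x - t • y)).comp (-(t • ContinuousLinearMap.id ℝ _))) y := by
      have h2 : HasFDerivAt (fun y : EuclideanSpace ℝ (Fin n) => x - t • y)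
          (-(t • ContinuousLinearMap.id ℝ _)) y := ((hasFDerivAt_id y).const_smul t).const_sub x
      exact (φ.differentiableAt.hasFDerivAt (x := x - t • y)).comp y h2
    have h3 : (-(t • ContinuousLinearMap.id ℝ (EuclideanSpace ℝ (Fin n)))) y =
        (x - t • y) - x := by simp
    rw [radialDeriv, hd.fderiv, ContinuousLinearMap.comp_apply, h3, map_sub, ← eulerSchwartz_apply,
      fderiv_apply_eq_sum φ _ x, hθ, sub_apply, sum_apply]
    simp only [smul_apply, smul_eq_mul]
  have hE : Differentiable ℂ fun β : ℂ => (β + n / 2) * steinMean (β + 1) t φ x +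
      1 / 2 * steinMean (β + 1) t θ x := by
    have e1 : ∀ g : 𝓢(EuclideanSpace ℝ (Fin n), ℂ), Differentiable ℂ fun β : ℂ =>
        steinMean (β + 1) t g x := fun g =>
      (differentiable_steinMean t g x).comp (differentiable_id.add_const 1)
    exact ((differentiable_id.add_const _).mul (e1 φ)).add ((e1 θ).const_mul _)
  have hev : (fun β => steinMean β t φ x) = fun β : ℂ => (β + n / 2) * steinMean (β + 1) t φ x +
      1 / 2 * steinMean (β + 1) t θ x := by
    refine AnalyticOnNhd.eq_of_eventuallyEq (z₀ := 3)
      ((differentiable_steinMean t φ x).differentiableOn.analyticOnNhd isOpen_univ)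
      (hE.differentiableOn.analyticOnNhd isOpen_univ) ?_
    have h3 : ∀ᶠ β : ℂ in nhds 3, 2 < β.re :=
      (isOpen_lt continuous_const Complex.continuous_re).mem_nhds (by simp; norm_num)
    filter_upwards [h3] with β hβ
    have hβ1 : 0 < (β + 1).re := by simp; linarith
    rw [steinMean_eq_ballMean (by linarith), steinMean_eq_ballMean hβ1, steinMean_eq_ballMean hβ1,
      ballMean_recurrence hβ ((contDiff_shift t φ x).of_le (by exact_mod_cast le_top)), hrad]
  exact congrFun hev α

theorem exists_pow_mul_norm_steinMean_le_of_re_pos {α : ℂ} (hα : 0 < α.re) (t : ℝ) (N : ℕ)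
    (φ : 𝓢(EuclideanSpace ℝ (Fin n), ℂ)) :
    ∃ C : ℝ, ∀ x, (1 + ‖x‖) ^ N * ‖steinMean α t φ x‖ ≤ C := by
  have hφ := SchwartzMap.one_add_le_sup_seminorm_apply (𝕜 := ℂ) (m := (N, 0)) (k := N) (n := 0)
    le_rfl le_rfl φ
  simp only [norm_iteratedFDeriv_zero] at hφ
  obtain ⟨K, hK⟩ : ∃ K : ℝ, ∀ z, (1 + ‖z‖) ^ N * ‖φ z‖ ≤ K := ⟨_, hφ⟩
  set W : EuclideanSpace ℝ (Fin n) → ℝ := fun y => (1 - ‖y‖ ^ 2) ^ (α.re - 1) with hW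
  have hWi : IntegrableOn W (Metric.ball 0 1) := integrableOn_weight hα
  refine ⟨‖(Complex.Gamma α)⁻¹‖ * ∫ y in Metric.ball (0 : EuclideanSpace ℝ (Fin n)) 1,
    W y * ((1 + |t|) ^ N * K), fun x => ?_⟩
  rw [steinMean_of_re_pos hα, norm_mul, setIntegral_congr_set closedBall_ae_eq, mul_left_comm]
  refine mul_le_mul_of_nonneg_left ?_ (norm_nonneg _)
  rw [← abs_of_nonneg (show 0 ≤ (1 + ‖x‖) ^ N by positivity), ← Real.norm_eq_abs,
    ← Complex.norm_real, ← norm_mul, ← integral_const_mul]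
  refine norm_integral_le_of_norm_le (hWi.mul_const _) ?_
  refine (ae_restrict_iff' measurableSet_ball).mpr (.of_forall fun y hy => ?_)
  have hy1 : ‖y‖ < 1 := by simpa using hy
  rw [norm_mul, norm_mul, Complex.norm_cpow_eq_rpow_re_of_pos (weight_pos hy).1, Complex.sub_re,
    Complex.one_re, mul_left_comm]
  refine mul_le_mul_of_nonneg_left ?_ (Real.rpow_nonneg (weight_pos hy).1.le _)
  rw [Complex.norm_real, Real.norm_of_nonneg (by positivity)]
  -- Peetre's inequality
  have h1 : 1 + ‖x‖ ≤ (1 + |t|) * (1 + ‖x - t • y‖) := by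
    have h2 : ‖x‖ ≤ ‖x - t • y‖ + ‖t • y‖ := by simpa using norm_add_le (x - t • y) (t • y)
    have h3 : ‖t • y‖ ≤ |t| := by
      rw [norm_smul, Real.norm_eq_abs]
      exact mul_le_of_le_one_right (abs_nonneg t) hy1.le
    nlinarith [abs_nonneg t, norm_nonneg (x - t • y)]
  calc (1 + ‖x‖) ^ N * ‖φ (x - t • y)‖
      ≤ ((1 + |t|) * (1 + ‖x - t • y‖)) ^ N * ‖φ (x - t • y)‖ := by gcongr
    _ = (1 + |t|) ^ N * ((1 + ‖x - t • y‖) ^ N * ‖φ (x - t • y)‖) := by rw [mul_pow, mul_assoc]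
    _ ≤ (1 + |t|) ^ N * K := by gcongr; exact hK _

/-- The spherical means of a Schwartz function decay rapidly: this is clear where the defining
integral converges, and `steinMean_recurrence` carries it to all orders. -/
theorem exists_pow_mul_norm_steinMean_le (α : ℂ) (t : ℝ) (N : ℕ)
    (φ : 𝓢(EuclideanSpace ℝ (Fin n), ℂ)) :
    ∃ C : ℝ, ∀ x, (1 + ‖x‖) ^ N * ‖steinMean α t φ x‖ ≤ C := by
  obtain ⟨k, hk⟩ := exists_nat_gt (-α.re)
  have hk : -(k : ℝ) < α.re := by linarith
  induction k generalizing α N φ with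
  | zero => exact exists_pow_mul_norm_steinMean_le_of_re_pos (by simpa using hk) t N φ
  | succ k ih =>
    have hk1 : -(k : ℝ) < (α + 1).re := by
      push_cast at hk
      simp only [Complex.add_re, Complex.one_re]
      linarith
    obtain ⟨C₁, h₁⟩ := ih (α + 1) N φ (by linarith) hk1
    obtain ⟨C₂, h₂⟩ := ih (α + 1) N (eulerSchwartz φ) (by linarith) hk1
    -- one more power of decay absorbs the factor `x i` in the recurrence
    choose C₃ h₃ using fun i => ih (α + 1) (N + 1) (partialSchwartz i φ) (by linarith) hk1
    refine ⟨‖α + n / 2‖ * C₁ + 1 / 2 * (C₂ + ∑ i, C₃ i), fun x => ?_⟩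
    have hpos : 0 ≤ (1 + ‖x‖) ^ N := by positivity
    rw [steinMean_recurrence]
    have h4 : ‖∑ i, ((x i : ℝ) : ℂ) * steinMean (α + 1) t (partialSchwartz i φ) x‖ ≤
        ∑ i, ‖x‖ * ‖steinMean (α + 1) t (partialSchwartz i φ) x‖ := by
      refine (norm_sum_le _ _).trans (Finset.sum_le_sum fun i _ => ?_)
      rw [norm_mul, Complex.norm_real]
      exact mul_le_mul_of_nonneg_right (PiLp.norm_apply_le x i) (norm_nonneg _)
    have h5 : (1 + ‖x‖) ^ N * ∑ i, ‖x‖ * ‖steinMean (α + 1) t (partialSchwartz i φ) x‖ ≤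
        ∑ i, C₃ i := by
      rw [Finset.mul_sum]
      refine Finset.sum_le_sum fun i _ => le_trans ?_ (h₃ i x)
      rw [pow_succ, ← mul_assoc]
      gcongr
      linarith
    have h6 : ‖(α + n / 2) * steinMean (α + 1) t φ x + 1 / 2 *
        (steinMean (α + 1) t (eulerSchwartz φ) x -
          ∑ i, ((x i : ℝ) : ℂ) * steinMean (α + 1) t (partialSchwartz i φ) x)‖ ≤
        ‖α + n / 2‖ * ‖steinMean (α + 1) t φ x‖ + 1 / 2 *
          (‖steinMean (α + 1) t (eulerSchwartz φ) x‖ +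
            ∑ i, ‖x‖ * ‖steinMean (α + 1) t (partialSchwartz i φ) x‖) := by
      refine (norm_add_le _ _).trans ?_
      rw [norm_mul, norm_mul]
      have : ‖(1 / 2 : ℂ)‖ = 1 / 2 := by norm_num
      rw [this]
      gcongr
      exact (norm_sub_le _ _).trans (by gcongr)
    refine (mul_le_mul_of_nonneg_left h6 hpos).trans ?_
    have h7 := mul_le_mul_of_nonneg_left (h₁ x) (norm_nonneg (α + n / 2))
    have h8 := h₂ x
    linarith

/-! ### Continuity and self-duality of the spherical means -/

theorem norm_halfWave_le (t : ℝ) (f : 𝓢(EuclideanSpace ℝ (Fin n), ℂ))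
    (x : EuclideanSpace ℝ (Fin n)) :
    ‖halfWave t f x‖ ≤ ∫ ξ, ‖𝓕 (f : EuclideanSpace ℝ (Fin n) → ℂ) ξ‖ := by
  rw [halfWave_eq_multOp, multOp_eq]
  refine (norm_integral_le_integral_norm _).trans_eq ?_
  congr 1
  funext ξ
  have h1 : ‖Complex.exp (2 * Real.pi * Complex.I * t * ‖ξ‖)‖ = 1 := by
    rw [← Complex.norm_exp_ofReal_mul_I (2 * Real.pi * t * ‖ξ‖)]
    congr 2
    push_cast
    ring
  have h2 : ‖Complex.exp (2 * Real.pi * inner ℝ ξ x * Complex.I)‖ = 1 := by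
    rw [← Complex.norm_exp_ofReal_mul_I (2 * Real.pi * inner ℝ ξ x)]
    congr 2
    push_cast
    ring
  rw [norm_mul, norm_mul, h1, h2, one_mul, one_mul]

/-- The Poisson formula gives joint continuity in `(t, x)`, by dominated convergence. -/
theorem continuous_steinMean {m : ℕ} {α : ℂ} (hα : 0 < (α + m / 2).re)
    (f : 𝓢(EuclideanSpace ℝ (Fin (m + 1)), ℂ)) :
    Continuous fun z : ℝ × EuclideanSpace ℝ (Fin (m + 1)) => steinMean α z.1 f z.2 := by
  simp only [steinMean_eq_integral_halfWave hα]
  refine continuous_const.mul (continuous_const.mul ?_)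
  have hW : ∀ z : ℝ × EuclideanSpace ℝ (Fin (m + 1)), Continuous fun r : ℝ =>
      halfWave (z.1 * r) f z.2 := fun z =>
    Continuous.comp (g := fun z : ℝ × EuclideanSpace ℝ (Fin (m + 1)) => halfWave z.1 f z.2)
      (f := fun r : ℝ => (z.1 * r, z.2)) (continuous_halfWave f) (by fun_prop)
  have hW' : ∀ r : ℝ, Continuous fun z : ℝ × EuclideanSpace ℝ (Fin (m + 1)) =>
      halfWave (z.1 * r) f z.2 := fun r =>
    Continuous.comp (g := fun z : ℝ × EuclideanSpace ℝ (Fin (m + 1)) => halfWave z.1 f z.2)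
      (f := fun z : ℝ × EuclideanSpace ℝ (Fin (m + 1)) => (z.1 * r, z.2))
      (continuous_halfWave f) (by fun_prop)
  have hi := integrable_truncPow_one_sub_sq hα
  refine continuous_of_dominated
    (bound := fun r => ‖truncPow (α + m / 2) (1 - r ^ 2)‖ *
      ∫ ξ, ‖𝓕 (f : EuclideanSpace ℝ (Fin (m + 1)) → ℂ) ξ‖)
    (fun z => hi.aestronglyMeasurable.mul (hW z).aestronglyMeasurable)
    (fun z => .of_forall fun r => ?_) (hi.norm.mul_const _)
    (.of_forall fun r => continuous_const.mul (hW' r))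
  rw [norm_mul]
  exact mul_le_mul_of_nonneg_left (norm_halfWave_le _ f _) (norm_nonneg _)

theorem integral_halfWave_mul (t : ℝ) (g φ : 𝓢(EuclideanSpace ℝ (Fin n), ℂ)) :
    ∫ x, halfWave t g x * φ x = ∫ x, g x * halfWave t φ x := by
  set e : EuclideanSpace ℝ (Fin n) → ℂ := fun ξ =>
    Complex.exp (2 * Real.pi * Complex.I * t * ‖ξ‖) with he
  have hec : Continuous e := by fun_prop
  have hen : ∀ ξ, ‖e ξ‖ = 1 := fun ξ => by
    rw [← Complex.norm_exp_ofReal_mul_I (2 * Real.pi * t * ‖ξ‖)]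
    simp only [he]
    congr 2
    push_cast
    ring
  have hint : ∀ {h : EuclideanSpace ℝ (Fin n) → ℂ}, Integrable h → Integrable fun ξ => e ξ * h ξ :=
    fun {h} hh => hh.bdd_mul hec.aestronglyMeasurable (.of_forall fun ξ => (hen ξ).le)
  have hinv : ∀ h : 𝓢(EuclideanSpace ℝ (Fin n), ℂ),
      Integrable (𝓕⁻ (h : EuclideanSpace ℝ (Fin n) → ℂ)) := fun h => by
    rw [← SchwartzMap.fourierInv_coe]
    exact (𝓕⁻ h).integrable
  have h1 : ∫ x, halfWave t g x * φ x =
      ∫ ξ, (e ξ * 𝓕 (g : EuclideanSpace ℝ (Fin n) → ℂ) ξ) * 𝓕⁻ (φ : EuclideanSpace ℝ (Fin n) → ℂ) ξ :=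
    integral_fourierInv_mul (hint (integrable_fourier g)) φ.integrable
  have h2 : ∫ x, g x * halfWave t φ x = ∫ x, halfWave t φ x * g x := by simp only [mul_comm]
  have h3 : ∫ x, halfWave t φ x * g x =
      ∫ ξ, (e ξ * 𝓕 (φ : EuclideanSpace ℝ (Fin n) → ℂ) ξ) * 𝓕⁻ (g : EuclideanSpace ℝ (Fin n) → ℂ) ξ :=
    integral_fourierInv_mul (hint (integrable_fourier φ)) g.integrable
  -- the symbol is even, and `ξ ↦ -ξ` exchanges the two Fourier transforms
  rw [h1, h2, h3, ← integral_neg_eq_self]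
  congr 1
  funext ξ
  have h4 : e (-ξ) = e ξ := by simp [he]
  have h5 : 𝓕 (g : EuclideanSpace ℝ (Fin n) → ℂ) (-ξ) = 𝓕⁻ (g : EuclideanSpace ℝ (Fin n) → ℂ) ξ :=
    (Real.fourierInv_eq_fourier_neg _ _).symm
  have h6 : 𝓕⁻ (φ : EuclideanSpace ℝ (Fin n) → ℂ) (-ξ) = 𝓕 (φ : EuclideanSpace ℝ (Fin n) → ℂ) ξ := by
    rw [Real.fourierInv_eq_fourier_neg, neg_neg]
  rw [h4, h5, h6]
  ring

/-- For Schwartz functions, the spherical mean is its own transpose. -/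
theorem integral_steinMean_mul {m : ℕ} {α : ℂ} (hα : 0 < (α + m / 2).re) (t : ℝ)
    (g φ : 𝓢(EuclideanSpace ℝ (Fin (m + 1)), ℂ)) :
    ∫ x, steinMean α t g x * φ x = ∫ x, g x * steinMean α t φ x := by
  have hi := integrable_truncPow_one_sub_sq hα
  have key : ∀ g φ : 𝓢(EuclideanSpace ℝ (Fin (m + 1)), ℂ),
      ∫ x, steinMean α t g x * φ x = (Real.pi : ℂ) ^ (m / 2 : ℂ) * ((Complex.Gamma (α + m / 2))⁻¹ *
        ∫ r : ℝ, truncPow (α + m / 2) (1 - r ^ 2) * ∫ x, halfWave (t * r) g x * φ x) := by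
    intro g φ
    have hW : Continuous fun z : EuclideanSpace ℝ (Fin (m + 1)) × ℝ =>
        halfWave (t * z.2) g z.1 :=
      Continuous.comp (g := fun z : ℝ × EuclideanSpace ℝ (Fin (m + 1)) => halfWave z.1 g z.2)
        (f := fun z : EuclideanSpace ℝ (Fin (m + 1)) × ℝ => (t * z.2, z.1))
        (continuous_halfWave g) (by fun_prop)
    have hint : Integrable (fun z : EuclideanSpace ℝ (Fin (m + 1)) × ℝ =>
        halfWave (t * z.2) g z.1 * (φ z.1 * truncPow (α + m / 2) (1 - z.2 ^ 2)))
        (volume.prod volume) :=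
      (φ.integrable.mul_prod hi).bdd_mul hW.aestronglyMeasurable
        (.of_forall fun z => norm_halfWave_le _ g z.1)
    have h1 : ∀ x, steinMean α t g x * φ x = (Real.pi : ℂ) ^ (m / 2 : ℂ) *
        ((Complex.Gamma (α + m / 2))⁻¹ *
          ∫ r : ℝ, halfWave (t * r) g x * (φ x * truncPow (α + m / 2) (1 - r ^ 2))) := by
      intro x
      rw [steinMean_eq_integral_halfWave hα, mul_assoc, mul_assoc, ← integral_mul_const]
      congr 3
      funext r
      ring
    simp only [h1]
    rw [integral_const_mul, integral_const_mul, integral_integral_swap hint]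
    congr 3
    funext r
    rw [← integral_const_mul]
    congr 1
    funext x
    ring
  have h2 : ∫ x, g x * steinMean α t φ x = ∫ x, steinMean α t φ x * g x := by simp only [mul_comm]
  rw [h2, key, key]
  congr 3
  funext r
  rw [integral_halfWave_mul]
  simp only [mul_comm]

/-- The means of a Schwartz function are bounded and integrable. -/
theorem memLp_steinMean {m : ℕ} {α : ℂ} (hα : 0 < (α + m / 2).re) (t : ℝ)
    (φ : 𝓢(EuclideanSpace ℝ (Fin (m + 1)), ℂ)) {r : ℝ≥0∞} (hr : 1 ≤ r) :
    MemLp (steinMean α t φ) r volume := by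
  have hc : Continuous (steinMean α t φ) :=
    Continuous.comp (g := fun z : ℝ × EuclideanSpace ℝ (Fin (m + 1)) => steinMean α z.1 φ z.2)
      (f := fun x : EuclideanSpace ℝ (Fin (m + 1)) => (t, x)) (continuous_steinMean hα φ)
      (by fun_prop)
  obtain ⟨C, hC⟩ := exists_pow_mul_norm_steinMean_le α t (m + 2) φ
  have hC0 : 0 ≤ C := le_trans (by positivity) (hC 0)
  have hle : ∀ x, ‖steinMean α t φ x‖ ≤ C * (1 + ‖x‖) ^ (-((m + 2 : ℕ) : ℝ)) := by
    intro x
    have h0 : 0 < (1 + ‖x‖) ^ (m + 2) := by positivity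
    rw [Real.rpow_neg (by positivity), Real.rpow_natCast, ← div_eq_mul_inv, le_div_iff₀ h0, mul_comm]
    exact hC x
  have hint : Integrable (steinMean α t φ) := by
    have h1 : Integrable fun x : EuclideanSpace ℝ (Fin (m + 1)) =>
        (1 + ‖x‖) ^ (-((m + 2 : ℕ) : ℝ)) := integrable_one_add_norm (by simp)
    exact (h1.const_mul C).mono' hc.aestronglyMeasurable (.of_forall hle)
  have hbd : ∀ x, ‖steinMean α t φ x‖ ≤ C := fun x => by
    refine le_trans ?_ (hC x)
    exact le_mul_of_one_le_left (norm_nonneg _) (one_le_pow₀ (by linarith [norm_nonneg x]))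
  refine ⟨hc.aestronglyMeasurable, ?_⟩
  set A : ℝ≥0∞ := eLpNorm (steinMean α t φ) 1 volume + ENNReal.ofReal C with hA
  have hAt : A ≠ ∞ := ENNReal.add_ne_top.2
    ⟨(memLp_one_iff_integrable.2 hint).2.ne, ENNReal.ofReal_ne_top⟩
  have := eLpNorm_le_of_le_of_forall_le (μ := (volume : Measure (EuclideanSpace ℝ (Fin (m + 1)))))
    le_rfl hr (h := fun x => ‖steinMean α t φ x‖ₑ) hAt
    (by rw [eLpNorm_enorm]; exact le_self_add)
    (fun x => by
      rw [← ofReal_norm]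
      exact (ENNReal.ofReal_le_ofReal (hbd x)).trans le_add_self)
  rw [eLpNorm_enorm] at this
  exact this.trans_lt hAt.lt_top

/-! ### Extension to `L^p` by density, for finite `p` -/

theorem ae_ne_top_of_eLpNorm_ne_top {X : Type*} [MeasurableSpace X] {μ : Measure X} {q : ℝ≥0∞}
    (hq : 1 ≤ q) {T : X → ℝ≥0∞} (hT : Measurable T) (h : eLpNorm T q μ ≠ ∞) :
    ∀ᵐ x ∂μ, T x ≠ ∞ := by
  rcases eq_or_ne q ∞ with rfl | hqt
  · rw [eLpNorm_exponent_top] at h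
    filter_upwards [ae_le_eLpNormEssSup (f := T) (μ := μ)] with x hx hT'
    rw [enorm_eq_self, hT', top_le_iff] at hx
    exact h hx
  · have hq0 : q ≠ 0 := (zero_lt_one.trans_le hq).ne'
    have hq1 : 0 < q.toReal := ENNReal.toReal_pos hq0 hqt
    have h1 := lintegral_rpow_enorm_lt_top_of_eLpNorm_lt_top hq0 hqt h.lt_top
    simp only [enorm_eq_self] at h1
    filter_upwards [ae_lt_top (hT.pow_const _) h1.ne] with x hx hT'
    rw [hT', ENNReal.top_rpow_of_pos hq1] at hx
    exact lt_irrefl _ hx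

theorem exists_schwartz_eLpNorm_sub_le {p : ℝ≥0∞} (hp : 1 ≤ p) (hpt : p ≠ ∞)
    {f : EuclideanSpace ℝ (Fin n) → ℂ} (hf : MemLp f p volume) {ε : ℝ≥0∞} (hε : ε ≠ 0)
    (hεt : ε ≠ ∞) : ∃ g : 𝓢(EuclideanSpace ℝ (Fin n), ℂ), eLpNorm (f - ⇑g) p volume ≤ ε := by
  obtain ⟨g, h1, h2, h3⟩ := MemLp.exist_eLpNorm_sub_le hpt hp hf (ENNReal.toReal_pos hε hεt)
  rw [ENNReal.ofReal_toReal hεt] at h3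
  exact ⟨h1.toSchwartzMap h2, h3⟩

/-- Every `L^p` function with `p < ∞` is the sum of a geometrically convergent series of Schwartz
functions. -/
theorem exists_schwartz_series {p : ℝ≥0∞} (hp : 1 ≤ p) (hpt : p ≠ ∞)
    {f : EuclideanSpace ℝ (Fin n) → ℂ} (hf : MemLp f p volume) (h0 : eLpNorm f p volume ≠ 0) :
    ∃ g : ℕ → 𝓢(EuclideanSpace ℝ (Fin n), ℂ),
      (∀ k, eLpNorm (g k) p volume ≤ (2 : ℝ≥0∞)⁻¹ ^ k * (3 * eLpNorm f p volume)) ∧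
      Filter.Tendsto (fun k => eLpNorm (f - ⇑(∑ j ∈ Finset.range k, g j)) p volume) Filter.atTop
        (nhds 0) := by
  set A := eLpNorm f p volume with hA
  have hAt : A ≠ ∞ := hf.2.ne
  have h2t : ∀ k : ℕ, (2 : ℝ≥0∞)⁻¹ ^ k ≠ ∞ := fun k => ENNReal.pow_ne_top (by simp)
  have h20 : ∀ k : ℕ, (2 : ℝ≥0∞)⁻¹ ^ k ≠ 0 := fun k => pow_ne_zero _ (by simp)
  choose h hh using fun k : ℕ => exists_schwartz_eLpNorm_sub_le hp hpt hf
    (mul_ne_zero (h20 k) h0) (ENNReal.mul_ne_top (h2t k) hAt)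
  -- a telescoping series
  set g : ℕ → 𝓢(EuclideanSpace ℝ (Fin n), ℂ) := fun k => Nat.casesOn k (h 0)
    fun j => h (j + 1) - h j with hg
  have hsum : ∀ k, ∑ j ∈ Finset.range (k + 1), g j = h k := by
    intro k
    rw [Finset.sum_range_succ']
    change ∑ j ∈ Finset.range k, (h (j + 1) - h j) + h 0 = h k
    rw [Finset.sum_range_sub, sub_add_cancel]
  refine ⟨g, fun k => ?_, ?_⟩
  · rcases k with _ | k
    · change eLpNorm (h 0) p volume ≤ _
      have e1 : (h 0 : EuclideanSpace ℝ (Fin n) → ℂ) = f - (f - ⇑(h 0)) := by simp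
      rw [e1]
      refine (eLpNorm_sub_le hf.1 (hf.1.sub (h 0).continuous.aestronglyMeasurable) hp).trans ?_
      have := hh 0
      rw [pow_zero, one_mul] at this ⊢
      calc eLpNorm f p volume + eLpNorm (f - ⇑(h 0)) p volume ≤ A + A := by gcongr
        _ ≤ 3 * A := by
          rw [← two_mul]
          gcongr
          norm_num
    · change eLpNorm ⇑(h (k + 1) - h k) p volume ≤ _
      have e1 : (⇑(h (k + 1) - h k) : EuclideanSpace ℝ (Fin n) → ℂ) =
          (f - ⇑(h k)) - (f - ⇑(h (k + 1))) := by
        funext x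
        simp
      rw [e1]
      refine (eLpNorm_sub_le (hf.1.sub (h k).continuous.aestronglyMeasurable)
        (hf.1.sub (h (k + 1)).continuous.aestronglyMeasurable) hp).trans ?_
      have e2 : (2 : ℝ≥0∞)⁻¹ ^ k = 2 * 2⁻¹ ^ (k + 1) := by
        rw [pow_succ, mul_left_comm, ENNReal.mul_inv_cancel two_ne_zero ENNReal.ofNat_ne_top, mul_one]
      calc eLpNorm (f - ⇑(h k)) p volume + eLpNorm (f - ⇑(h (k + 1))) p volume
          ≤ 2⁻¹ ^ k * A + 2⁻¹ ^ (k + 1) * A := add_le_add (hh k) (hh (k + 1))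
        _ = 2⁻¹ ^ (k + 1) * (3 * A) := by
          rw [e2]
          ring
  · rw [← Filter.tendsto_add_atTop_iff_nat 1]
    simp only [hsum]
    have h1 : Filter.Tendsto (fun k : ℕ => (2 : ℝ≥0∞)⁻¹ ^ k * A) Filter.atTop (nhds 0) := by
      have := ENNReal.Tendsto.mul_const (b := A)
        (ENNReal.tendsto_pow_atTop_nhds_zero_of_lt_one (r := (2 : ℝ≥0∞)⁻¹) (by simp)) (Or.inr hAt)
      rwa [zero_mul] at this
    exact tendsto_of_tendsto_of_tendsto_of_le_of_le tendsto_const_nhds h1 (fun _ => zero_le) hh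

/-- The maximal estimate on Schwartz functions extends to `L^p` with `p` finite: along a
geometrically convergent series the majorants are summable in `L^q`, so that the spherical means
converge uniformly in `t` at almost every point. -/
theorem MaximalBound.exists_extension {m : ℕ} {α : ℂ} (hα : 0 < (α + m / 2).re) {p q : ℝ≥0∞}
    (hp : 1 ≤ p) (hpt : p ≠ ∞) (hq : 1 ≤ q) {I : Set ℝ} (hM : MaximalBound (m + 1) α p q I) :
    ∃ C : ℝ≥0, ∀ f : EuclideanSpace ℝ (Fin (m + 1)) → ℂ, MemLp f p volume →
      ∃ u : ℝ → EuclideanSpace ℝ (Fin (m + 1)) → ℂ,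
        (∀ t ∈ I, MemLp (u t) q volume ∧ IsSteinMean α t f (u t)) ∧
        (∀ᵐ x, ContinuousOn (fun t => u t x) I) ∧
        eLpNorm (fun x => ⨆ t ∈ I, ‖u t x‖ₑ) q volume ≤ C * eLpNorm f p volume := by
  obtain ⟨C, hC⟩ := hM
  refine ⟨6 * C, fun f hf => ?_⟩
  rcases eq_or_ne (eLpNorm f p volume) 0 with h0 | h0
  · refine ⟨0, fun t _ => ⟨MemLp.zero, fun φ => ?_⟩, .of_forall fun x => continuousOn_const, ?_⟩
    · have h1 := (eLpNorm_eq_zero_iff hf.1 (zero_lt_one.trans_le hp).ne').1 h0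
      have h2 : (fun x => f x * steinMean α t φ x) =ᵐ[volume] fun _ => 0 := by
        filter_upwards [h1] with x hx
        rw [hx, Pi.zero_apply, zero_mul]
      rw [integral_congr_ae h2]
      simp
    · simp
  obtain ⟨g, hg, hlim⟩ := exists_schwartz_series hp hpt hf h0
  set A := eLpNorm f p volume with hA
  have hAt : A ≠ ∞ := hf.2.ne
  choose S hSm hSb hSn using fun k => hC (g k)
  set T : EuclideanSpace ℝ (Fin (m + 1)) → ℝ≥0∞ := fun x => ∑' k, S k x with hT
  have hTm : Measurable T := Measurable.tsum hSm
  -- Minkowski's inequality with the counting measure; the factor `6` is `∑ 2^{-k} * 3`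
  have hTn : eLpNorm T q volume ≤ ((6 * C : ℝ≥0) : ℝ≥0∞) * A := by
    have h1 := eLpNorm_lintegral_le (μ := (volume : Measure (EuclideanSpace ℝ (Fin (m + 1)))))
      (ν := (Measure.count : Measure ℕ)) hq (F := fun x k => S k x)
      (measurable_from_prod_countable_left fun k => hSm k).aemeasurable
      (K := fun k => (2 : ℝ≥0∞)⁻¹ ^ k) (measurable_of_countable _).aemeasurable
      (.of_forall fun k => pow_ne_zero _ (by simp))
      (.of_forall fun k => ENNReal.pow_ne_top (by simp)) (A := C * (3 * A))
      (.of_forall fun k => by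
        refine (hSn k).trans ?_
        rw [mul_left_comm]
        exact mul_le_mul_right (hg k) _)
    simp only [lintegral_count] at h1
    rw [ENNReal.tsum_geometric, ENNReal.one_sub_inv_two, inv_inv] at h1
    refine h1.trans_eq ?_
    push_cast
    ring
  have hTt : eLpNorm T q volume ≠ ∞ :=
    (hTn.trans_lt (ENNReal.mul_lt_top ENNReal.coe_lt_top hAt.lt_top)).ne
  have hTfin : ∀ᵐ x, T x ≠ ∞ := ae_ne_top_of_eLpNorm_ne_top hq hTm hTt
  have hSfin : ∀ {x}, T x ≠ ∞ → ∀ k, S k x ≠ ∞ := fun hx k =>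
    ne_top_of_le_ne_top hx (ENNReal.le_tsum k)
  have hle : ∀ {x}, T x ≠ ∞ → ∀ t ∈ I, ∀ k, ‖steinMean α t (g k) x‖ ≤ (S k x).toReal :=
    fun {x} hx t ht k => by
      rw [← toReal_enorm]
      exact ENNReal.toReal_mono (hSfin hx k) (hSb k t ht x)
  have hsummable : ∀ {x}, T x ≠ ∞ → ∀ t ∈ I, Summable fun k => steinMean α t (g k) x :=
    fun hx t ht => .of_norm_bounded (ENNReal.summable_toReal hx) (hle hx t ht)
  have hcm : ∀ t, ∀ φ : 𝓢(EuclideanSpace ℝ (Fin (m + 1)), ℂ), Continuous (steinMean α t φ) :=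
    fun t φ =>
    Continuous.comp (g := fun z : ℝ × EuclideanSpace ℝ (Fin (m + 1)) => steinMean α z.1 φ z.2)
      (f := fun x : EuclideanSpace ℝ (Fin (m + 1)) => (t, x)) (continuous_steinMean hα φ)
      (by fun_prop)
  set F : ℕ → 𝓢(EuclideanSpace ℝ (Fin (m + 1)), ℂ) := fun k => ∑ j ∈ Finset.range k, g j with hF
  have hFs : ∀ k t x, steinMean α t (F k) x = ∑ j ∈ Finset.range k, steinMean α t (g j) x := by
    intro k t x
    rw [← steinMeanLinear_apply, hF, map_sum]
    rfl
  set u : ℝ → EuclideanSpace ℝ (Fin (m + 1)) → ℂ := fun t x => ∑' k, steinMean α t (g k) x with hu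
  have htend : ∀ {x}, T x ≠ ∞ → ∀ t ∈ I,
      Filter.Tendsto (fun k => steinMean α t (F k) x) Filter.atTop (nhds (u t x)) := by
    intro x hx t ht
    simp only [hFs]
    exact (hsummable hx t ht).hasSum.tendsto_sum_nat
  have hFle : ∀ {x}, T x ≠ ∞ → ∀ t ∈ I, ∀ k, ‖steinMean α t (F k) x‖ ≤ (T x).toReal := by
    intro x hx t ht k
    rw [← toReal_enorm]
    refine ENNReal.toReal_mono hx ?_
    rw [hFs]
    refine (enorm_sum_le _ _).trans ((Finset.sum_le_sum fun j _ => hSb j t ht x).trans ?_)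
    exact ENNReal.sum_le_tsum _
  have hule : ∀ {x}, T x ≠ ∞ → ∀ t ∈ I, ‖u t x‖ₑ ≤ T x := by
    intro x hx t ht
    have h1 : ‖u t x‖ ≤ (T x).toReal :=
      le_of_tendsto (htend hx t ht).norm (.of_forall fun k => hFle hx t ht k)
    rw [← ofReal_norm]
    exact ENNReal.ofReal_le_of_le_toReal h1
  have hum : ∀ t ∈ I, AEStronglyMeasurable (u t) volume := fun t ht =>
    aestronglyMeasurable_of_tendsto_ae Filter.atTop
      (fun k => (hcm t (F k)).aestronglyMeasurable) (hTfin.mono fun x hx => htend hx t ht)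
  -- both sides of the duality for the partial sums pass to the limit
  refine ⟨u, fun t ht => ⟨⟨hum t ht, ?_⟩, fun φ => ?_⟩, ?_, ?_⟩
  · exact (eLpNorm_mono_enorm_ae (g := T) (hTfin.mono fun x hx => by
      simpa using hule hx t ht)).trans_lt hTt.lt_top
  · have hTr : MemLp (fun x => (T x).toReal) q volume := by
      refine ⟨hTm.ennreal_toReal.aestronglyMeasurable, lt_of_le_of_lt ?_ hTt.lt_top⟩
      refine eLpNorm_mono_enorm_ae (hTfin.mono fun x hx => ?_)
      rw [enorm_eq_self, Real.enorm_of_nonneg ENNReal.toReal_nonneg, ENNReal.ofReal_toReal hx]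
    have hq' : q.HolderConjugate q.conjExponent := .conjExponent hq
    have hp' : p.HolderConjugate p.conjExponent := .conjExponent hp
    have hp1 : 1 ≤ p.conjExponent := by
      rw [ENNReal.conjExponent]
      exact le_self_add
    -- left side: dominated convergence, with the majorant `T |φ|`
    have hL : Filter.Tendsto (fun k => ∫ x, steinMean α t (F k) x * φ x) Filter.atTop
        (nhds (∫ x, u t x * φ x)) := by
      refine tendsto_integral_of_dominated_convergence (fun x => (T x).toReal * ‖φ x‖)
        (fun k => ((hcm t (F k)).mul φ.continuous).aestronglyMeasurable) ?_ ?_ ?_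
      · exact hTr.integrable_mul (φ.memLp q.conjExponent).norm
      · intro k
        filter_upwards [hTfin] with x hx
        rw [norm_mul]
        exact mul_le_mul_of_nonneg_right (hFle hx t ht k) (norm_nonneg _)
      · filter_upwards [hTfin] with x hx
        exact (htend hx t ht).mul_const _
    have hw := memLp_steinMean hα t φ hp1
    -- right side: `L^p` convergence against a function in the dual exponent
    have hR : Filter.Tendsto (fun k => ∫ x, F k x * steinMean α t φ x) Filter.atTop
        (nhds (∫ x, f x * steinMean α t φ x)) := by
      refine tendsto_integral_of_L1 _ (hf.1.mul hw.1) (.of_forall fun k =>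
        ((F k).memLp p).integrable_mul hw) ?_
      have h1 : Filter.Tendsto (fun k => eLpNorm (f - ⇑(F k)) p volume *
          eLpNorm (steinMean α t φ) p.conjExponent volume) Filter.atTop (nhds 0) := by
        have := ENNReal.Tendsto.mul_const hlim
          (Or.inr hw.2.ne : (0 : ℝ≥0∞) ≠ 0 ∨ eLpNorm (steinMean α t φ) p.conjExponent volume ≠ ∞)
        rwa [zero_mul] at this
      refine tendsto_of_tendsto_of_tendsto_of_le_of_le tendsto_const_nhds h1 (fun _ => zero_le)
        fun k => ?_
      have h2 := eLpNorm_smul_le_mul_eLpNorm (r := 1) (p := p) (q := p.conjExponent) hw.1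
        (hf.1.sub (F k).continuous.aestronglyMeasurable)
      refine le_trans (le_of_eq ?_) h2
      rw [eLpNorm_one_eq_lintegral_enorm]
      congr 1
      funext x
      rw [Pi.smul_apply', Pi.sub_apply, smul_eq_mul, sub_mul, ← enorm_neg, neg_sub]
      rfl
    refine tendsto_nhds_unique hL ?_
    simp only [integral_steinMean_mul hα]
    exact hR
  · filter_upwards [hTfin] with x hx
    exact continuousOn_tsum (fun k => (Continuous.comp (g := fun z : ℝ × EuclideanSpace ℝ
      (Fin (m + 1)) => steinMean α z.1 (g k) z.2) (f := fun t : ℝ => (t, x))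
      (continuous_steinMean hα (g k)) (by fun_prop)).continuousOn)
      (ENNReal.summable_toReal hx) fun k t ht => hle hx t ht k
  · refine (eLpNorm_mono_enorm_ae (g := T) ?_).trans hTn
    filter_upwards [hTfin] with x hx
    simp only [enorm_eq_self]
    exact iSup₂_le fun t ht => hule hx t ht

/-! ### Dilated integrable kernels acting on bounded functions -/

theorem norm_integral_kernel_le {k h g : EuclideanSpace ℝ (Fin n) → ℂ} (hk : Integrable k)
    (hh : Integrable h) {B : ℝ} (hB : ∀ x, ‖g x‖ ≤ B) (t : ℝ) (x : EuclideanSpace ℝ (Fin n)) :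
    ‖∫ y, (k y - h y) * g (x - t • y)‖ ≤ (∫ y, ‖k y - h y‖) * B := by
  rw [← integral_mul_const]
  refine norm_integral_le_of_norm_le ((hk.sub hh).norm.mul_const B) (.of_forall fun y => ?_)
  rw [norm_mul]
  exact mul_le_mul_of_nonneg_left (hB _) (norm_nonneg _)

theorem integrable_kernel_mul {k g : EuclideanSpace ℝ (Fin n) → ℂ} (hk : Integrable k)
    (hg : Measurable g) {B : ℝ} (hB : ∀ x, ‖g x‖ ≤ B) (t : ℝ) (x : EuclideanSpace ℝ (Fin n)) :
    Integrable fun y => k y * g (x - t • y) := by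
  have hm : Measurable fun y => g (x - t • y) := hg.comp (by fun_prop)
  exact hk.mul_bdd (c := B) hm.aestronglyMeasurable (.of_forall fun y => hB _)

theorem continuousOn_integral_compactly_supported_kernel {h g : EuclideanSpace ℝ (Fin n) → ℂ}
    (hc : Continuous h) (hs : HasCompactSupport h) (hg : Measurable g) {B : ℝ}
    (hB : ∀ x, ‖g x‖ ≤ B) (x : EuclideanSpace ℝ (Fin n)) :
    ContinuousOn (fun t : ℝ => ∫ y, h y * g (x - t • y)) (Set.Icc 1 2) := by
  -- the dilation is moved from `g`, which is merely measurable, to the continuous kernel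
  have h1 : Set.EqOn (fun t : ℝ => ∫ y, h y * g (x - t • y))
      (fun t : ℝ => |(t⁻¹ ^ n)| • ∫ z, h (t⁻¹ • z) * g (x - z)) (Set.Icc 1 2) := by
    intro t ht
    have ht0 : t ≠ 0 := (zero_lt_one.trans_le ht.1).ne'
    have h2 := Measure.integral_comp_smul (μ := (volume : Measure (EuclideanSpace ℝ (Fin n))))
      (fun z => h (t⁻¹ • z) * g (x - z)) t
    simp only [smul_smul, inv_mul_cancel₀ ht0, one_smul, finrank_euclideanSpace,
      Fintype.card_fin, ← inv_pow] at h2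
    exact h2
  refine ContinuousOn.congr ?_ h1
  have hinv : ContinuousOn (fun t : ℝ => t⁻¹) (Set.Icc 1 2) :=
    continuousOn_id.inv₀ fun t ht => (zero_lt_one.trans_le ht.1).ne'
  refine ContinuousOn.smul (hinv.pow n).abs ?_
  obtain ⟨K, hK⟩ := hc.bounded_above_of_compact_support hs
  obtain ⟨R, hR⟩ := hs.isCompact.isBounded.subset_closedBall 0
  have hK0 : 0 ≤ K := (norm_nonneg _).trans (hK 0)
  have hB0 : 0 ≤ B := (norm_nonneg _).trans (hB 0)
  have hgm : Measurable fun z => g (x - z) := hg.comp (by fun_prop)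
  refine continuousOn_of_dominated
    (bound := (Metric.closedBall (0 : EuclideanSpace ℝ (Fin n)) (2 * R)).indicator fun _ => K * B)
    (fun t _ => ((hc.comp (continuous_const_smul _)).aestronglyMeasurable).mul
      hgm.aestronglyMeasurable) (fun t ht => .of_forall fun z => ?_) ?_
    (.of_forall fun z => ?_)
  · rw [norm_mul]
    by_cases hz : z ∈ Metric.closedBall (0 : EuclideanSpace ℝ (Fin n)) (2 * R)
    · rw [Set.indicator_of_mem hz]
      exact mul_le_mul (hK _) (hB _) (norm_nonneg _) hK0
    · rw [Set.indicator_of_notMem hz]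
      have ht0 : 0 < t := zero_lt_one.trans_le ht.1
      have h3 : h (t⁻¹ • z) = 0 := by
        by_contra h4
        have h5 := hR (subset_tsupport h h4)
        rw [mem_closedBall_zero_iff, norm_smul, Real.norm_of_nonneg (inv_nonneg.2 ht0.le),
          inv_mul_le_iff₀ ht0] at h5
        have hR0 : 0 ≤ R := by
          by_contra hneg
          have := norm_nonneg z
          nlinarith
        exact hz (mem_closedBall_zero_iff.2 (h5.trans (mul_le_mul_of_nonneg_right ht.2 hR0)))
      rw [h3, norm_zero, zero_mul]
  · exact (integrable_indicator_iff Metric.isClosed_closedBall.measurableSet).2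
      (integrableOn_const (isCompact_closedBall _ _).measure_lt_top.ne)
  · exact (hc.comp_continuousOn (hinv.smul continuousOn_const)).mul continuousOn_const

/-- Averaging a bounded function over the dilates of an integrable kernel depends continuously on
the dilation parameter, at every point: approximate the kernel in `L¹` by continuous ones. -/
theorem continuousOn_integral_kernel {k g : EuclideanSpace ℝ (Fin n) → ℂ} (hk : Integrable k)
    (hg : Measurable g) {B : ℝ} (hB : ∀ x, ‖g x‖ ≤ B) (x : EuclideanSpace ℝ (Fin n)) :
    ContinuousOn (fun t : ℝ => ∫ y, k y * g (x - t • y)) (Set.Icc 1 2) := by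
  have hB0 : 0 ≤ B := (norm_nonneg _).trans (hB 0)
  refine continuousOn_of_uniform_approx_of_continuousOn fun V hV => ?_
  obtain ⟨ε, hε, hεV⟩ := Metric.mem_uniformity_dist.1 hV
  have hδ : 0 < ε / (B + 1) := by positivity
  obtain ⟨h, hs, hle, hc, hi⟩ := hk.exists_hasCompactSupport_integral_sub_le hδ
  refine ⟨_, continuousOn_integral_compactly_supported_kernel hc hs hg hB x, fun t _ => hεV ?_⟩
  rw [dist_eq_norm, ← integral_sub (integrable_kernel_mul hk hg hB t x)
    (integrable_kernel_mul hi hg hB t x)]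
  simp only [← sub_mul]
  refine (norm_integral_kernel_le hk hi hB t x).trans_lt ?_
  calc (∫ y, ‖k y - h y‖) * B ≤ ε / (B + 1) * B := by gcongr
    _ < ε := by
      rw [div_mul_eq_mul_div, div_lt_iff₀ (by positivity)]
      nlinarith

/-- Averaging over the dilates of an even kernel is its own transpose. -/
theorem integral_integral_kernel_mul {k g φ : EuclideanSpace ℝ (Fin n) → ℂ} (hk : Integrable k)
    (hkm : Measurable k) (hke : ∀ y, k (-y) = k y) (hg : Measurable g) {B : ℝ}
    (hB : ∀ x, ‖g x‖ ≤ B) (hφ : Integrable φ) (hφm : Measurable φ) (t : ℝ) :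
    ∫ x, (∫ y, k y * g (x - t • y)) * φ x = ∫ x, g x * ∫ y, k y * φ (x - t • y) := by
  have hgm : Measurable fun z : EuclideanSpace ℝ (Fin n) × EuclideanSpace ℝ (Fin n) =>
      g (z.2 - t • z.1) := hg.comp (by fun_prop)
  have hφm' : Measurable fun z : EuclideanSpace ℝ (Fin n) × EuclideanSpace ℝ (Fin n) =>
      φ (z.2 + t • z.1) := hφm.comp (by fun_prop)
  have hint : Integrable (fun z : EuclideanSpace ℝ (Fin n) × EuclideanSpace ℝ (Fin n) =>
      (k z.1 * φ z.2) * g (z.2 - t • z.1)) (volume.prod volume) :=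
    (hk.mul_prod hφ).mul_bdd (c := B) hgm.aestronglyMeasurable (.of_forall fun z => hB _)
  have hint' : Integrable (fun z : EuclideanSpace ℝ (Fin n) × EuclideanSpace ℝ (Fin n) =>
      (k z.1 * φ (z.2 + t • z.1)) * g z.2) (volume.prod volume) := by
    have hm : AEStronglyMeasurable (fun z : EuclideanSpace ℝ (Fin n) × EuclideanSpace ℝ (Fin n) =>
        (k z.1 * φ (z.2 + t • z.1)) * g z.2) (volume.prod volume) :=
      (((hkm.comp measurable_fst).mul hφm').mul (hg.comp measurable_snd)).aestronglyMeasurable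
    rw [integrable_prod_iff hm]
    obtain ⟨h1, h2⟩ := (integrable_prod_iff hint.aestronglyMeasurable).1 hint
    refine ⟨h1.mono fun y hy => ?_, h2.congr (.of_forall fun y => ?_)⟩
    · have := hy.comp_add_right (t • y)
      simpa only [add_sub_cancel_right] using this
    · have := integral_add_right_eq_self (μ := volume)
        (fun x => ‖(k y * φ x) * g (x - t • y)‖) (t • y)
      simp only [add_sub_cancel_right] at this
      exact this.symm
  calc ∫ x, (∫ y, k y * g (x - t • y)) * φ x
      = ∫ x, ∫ y, (k y * φ x) * g (x - t • y) := by
        congr 1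
        funext x
        rw [← integral_mul_const]
        congr 1
        funext y
        ring
    _ = ∫ y, ∫ x, (k y * φ x) * g (x - t • y) := (integral_integral_swap hint).symm
    _ = ∫ y, ∫ x, (k y * φ (x + t • y)) * g x := by
        congr 1
        funext y
        have := integral_add_right_eq_self (μ := volume)
          (fun x => (k y * φ x) * g (x - t • y)) (t • y)
        simp only [add_sub_cancel_right] at this
        exact this.symm
    _ = ∫ x, ∫ y, (k y * φ (x + t • y)) * g x := integral_integral_swap hint'
    _ = ∫ x, g x * ∫ y, k y * φ (x - t • y) := by
        congr 1
        funext x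
        rw [integral_mul_const, mul_comm, ← integral_neg_eq_self (fun y => k y * φ (x - t • y))]
        simp only [hke, smul_neg, sub_neg_eq_add]

/-! ### Bounded functions -/

/-- The kernel `Γ(α)⁻¹ (1 - |y|²)₊^(α - 1)` of `𝔐^α_1`, integrable for `Re α > 0`. -/
noncomputable def steinKernel (α : ℂ) : EuclideanSpace ℝ (Fin n) → ℂ :=
  (Metric.closedBall (0 : EuclideanSpace ℝ (Fin n)) 1).indicator fun y =>
    (Complex.Gamma α)⁻¹ * ((1 - ‖y‖ ^ 2 : ℝ) : ℂ) ^ (α - 1)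

theorem measurable_steinKernel (α : ℂ) :
    Measurable (steinKernel α : EuclideanSpace ℝ (Fin n) → ℂ) := by
  refine Measurable.indicator ?_ Metric.isClosed_closedBall.measurableSet
  refine Measurable.const_mul ?_ _
  have h1 : Measurable fun y : EuclideanSpace ℝ (Fin n) => ((1 - ‖y‖ ^ 2 : ℝ) : ℂ) :=
    Continuous.measurable (by fun_prop)
  exact h1.pow_const _

theorem integrable_steinKernel {α : ℂ} (hα : 0 < α.re) :
    Integrable (steinKernel α : EuclideanSpace ℝ (Fin n) → ℂ) := by
  refine (integrable_indicator_iff Metric.isClosed_closedBall.measurableSet).2 ?_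
  have := integrableOn_weight_mul (n := n) hα (g := fun _ => 1) continuous_const
  simp only [mul_one] at this
  exact this.const_mul _

theorem steinKernel_neg (α : ℂ) (y : EuclideanSpace ℝ (Fin n)) :
    steinKernel α (-y) = steinKernel α y := by
  simp [steinKernel, Set.indicator]

theorem steinMean_eq_integral_steinKernel {α : ℂ} (hα : 0 < α.re) (t : ℝ)
    (f : 𝓢(EuclideanSpace ℝ (Fin n), ℂ)) (x : EuclideanSpace ℝ (Fin n)) :
    steinMean α t f x = ∫ y, steinKernel α y * f (x - t • y) := by
  rw [steinMean_of_re_pos hα, ← integral_const_mul,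
    ← integral_indicator Metric.isClosed_closedBall.measurableSet]
  congr 1
  funext y
  by_cases hy : y ∈ Metric.closedBall (0 : EuclideanSpace ℝ (Fin n)) 1
  · rw [steinKernel, Set.indicator_of_mem hy, Set.indicator_of_mem hy, mul_assoc]
  · rw [steinKernel, Set.indicator_of_notMem hy, Set.indicator_of_notMem hy, zero_mul]

/-- For `Re α > 0` the kernel is integrable and the means of a bounded function are given by it. They are
continuous in `t` at every point, once the function has been modified on a null set. -/
theorem exists_extension_top {α : ℂ} (hα : 0 < α.re) :
    ∃ C : ℝ≥0, ∀ f : EuclideanSpace ℝ (Fin n) → ℂ, MemLp f ∞ volume →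
      ∃ u : ℝ → EuclideanSpace ℝ (Fin n) → ℂ,
        (∀ t ∈ Set.Icc (1 : ℝ) 2, MemLp (u t) ∞ volume ∧ IsSteinMean α t f (u t)) ∧
        (∀ᵐ x, ContinuousOn (fun t => u t x) (Set.Icc 1 2)) ∧
        eLpNorm (fun x => ⨆ t ∈ Set.Icc (1 : ℝ) 2, ‖u t x‖ₑ) ∞ volume ≤
          C * eLpNorm f ∞ volume := by
  have hk := integrable_steinKernel (n := n) hα
  have hkm := measurable_steinKernel (n := n) α
  set L : ℝ := ∫ y, ‖(steinKernel α : EuclideanSpace ℝ (Fin n) → ℂ) y‖ with hL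
  have hL0 : 0 ≤ L := integral_nonneg fun y => norm_nonneg _
  refine ⟨L.toNNReal, fun f hf => ?_⟩
  set B : ℝ := (eLpNorm f ∞ volume).toReal with hBdef
  have hB0 : 0 ≤ B := ENNReal.toReal_nonneg
  have hft : eLpNorm f ∞ volume ≠ ∞ := hf.2.ne
  -- a representative that is measurable and bounded everywhere
  obtain ⟨g, hgm, hB, hfg⟩ : ∃ g : EuclideanSpace ℝ (Fin n) → ℂ, Measurable g ∧
      (∀ x, ‖g x‖ ≤ B) ∧ f =ᵐ[volume] g := by
    have hmk : Measurable (hf.1.mk f) := hf.1.stronglyMeasurable_mk.measurable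
    have hs : MeasurableSet {x | ‖hf.1.mk f x‖ ≤ B} := measurableSet_le hmk.norm measurable_const
    refine ⟨{x | ‖hf.1.mk f x‖ ≤ B}.indicator (hf.1.mk f), hmk.indicator hs, fun x => ?_, ?_⟩
    · by_cases hx : x ∈ {x | ‖hf.1.mk f x‖ ≤ B}
      · rw [Set.indicator_of_mem hx]
        exact hx
      · rw [Set.indicator_of_notMem hx, norm_zero]
        exact hB0
    · filter_upwards [hf.1.ae_eq_mk, ae_le_eLpNormEssSup (f := f)] with x h1 h2
      have hx : x ∈ {x | ‖hf.1.mk f x‖ ≤ B} := by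
        rw [Set.mem_ofPred_eq, ← h1, ← toReal_enorm, hBdef, eLpNorm_exponent_top]
        rw [eLpNorm_exponent_top] at hft
        exact ENNReal.toReal_mono hft h2
      rw [Set.indicator_of_mem hx, h1]
  set u : ℝ → EuclideanSpace ℝ (Fin n) → ℂ := fun t x => ∫ y, steinKernel α y * g (x - t • y)
    with hu
  have hle : ∀ t x, ‖u t x‖ₑ ≤ L.toNNReal * eLpNorm f ∞ volume := by
    intro t x
    have h1 := norm_integral_kernel_le (h := fun _ => 0) hk (integrable_zero _ _ _) hB t x
    simp only [sub_zero] at h1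
    rw [← ofReal_norm]
    refine (ENNReal.ofReal_le_ofReal h1).trans_eq ?_
    rw [ENNReal.ofReal_mul hL0, hBdef, ENNReal.ofReal_toReal hft]
    rfl
  have hum : ∀ t, AEStronglyMeasurable (u t) volume := by
    intro t
    have h1 : Measurable fun z : EuclideanSpace ℝ (Fin n) × EuclideanSpace ℝ (Fin n) =>
        g (z.1 - t • z.2) := hgm.comp (by fun_prop)
    have h2 := ((hkm.comp measurable_snd).mul h1).aestronglyMeasurable
      (μ := (volume : Measure (EuclideanSpace ℝ (Fin n))).prod
        (volume : Measure (EuclideanSpace ℝ (Fin n))))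
    exact h2.integral_prod_right'
  refine ⟨u, fun t _ => ⟨⟨hum t, ?_⟩, fun φ => ?_⟩,
    .of_forall fun x => continuousOn_integral_kernel hk hgm hB x, ?_⟩
  · rw [eLpNorm_exponent_top]
    exact (eLpNormEssSup_le_of_ae_enorm_bound (.of_forall (hle t))).trans_lt
      (ENNReal.mul_lt_top ENNReal.coe_lt_top hft.lt_top)
  · have h1 : ∫ x, f x * steinMean α t φ x = ∫ x, g x * steinMean α t φ x :=
      integral_congr_ae (hfg.mono fun x hx => by simp only [hx])
    rw [h1]
    simp only [steinMean_eq_integral_steinKernel hα]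
    exact integral_integral_kernel_mul hk hkm (steinKernel_neg α) hgm hB φ.integrable
      φ.continuous.measurable t
  · rw [eLpNorm_exponent_top]
    refine eLpNormEssSup_le_of_ae_enorm_bound (.of_forall fun x => ?_)
    rw [enorm_eq_self]
    exact iSup₂_le fun t _ => hle t x

/-! ### Unboundedness on `L^∞` in negative order -/

/-- If `f` is supported in a ball of radius less than one, then at the origin the integral defining
the mean of order `α` with `t = 1` converges and gives its value for every `α`. -/
theorem steinMean_one_zero_of_support {f : 𝓢(EuclideanSpace ℝ (Fin n), ℂ)} {r : ℝ} (hr0 : 0 ≤ r)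
    (hr : r < 1) (hf : ∀ y, r ≤ ‖y‖ → f y = 0) (α : ℂ) :
    steinMean α 1 f 0 = (Complex.Gamma α)⁻¹ *
      ∫ y in Metric.closedBall (0 : EuclideanSpace ℝ (Fin n)) 1,
        ((1 - ‖y‖ ^ 2 : ℝ) : ℂ) ^ (α - 1) * f (0 - (1 : ℝ) • y) := by
  set F : ℂ → EuclideanSpace ℝ (Fin n) → ℂ := fun b y =>
    ((1 - ‖y‖ ^ 2 : ℝ) : ℂ) ^ (b - 1) * f (0 - (1 : ℝ) • y) with hF
  -- the integral is entire in the order, since the weight is bounded above and below on the support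
  refine (steinMean_unique 1 f 0 (F := fun β => (Complex.Gamma β)⁻¹ *
    ∫ y in Metric.closedBall (0 : EuclideanSpace ℝ (Fin n)) 1, F β y) ?_ (fun β _ => rfl) α).symm
  intro β
  refine (Complex.differentiable_one_div_Gamma β).mul ?_
  have hwm : Measurable fun y : EuclideanSpace ℝ (Fin n) => ((1 - ‖y‖ ^ 2 : ℝ) : ℂ) :=
    Continuous.measurable (by fun_prop)
  have hfc : Continuous fun y => f (0 - (1 : ℝ) • y) := (contDiff_shift 1 f 0).continuous
  obtain ⟨K, hK⟩ : ∃ K : ℝ, ∀ y, ‖f y‖ ≤ K := ⟨_, SchwartzMap.norm_le_seminorm ℂ f⟩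
  have hK0 : 0 ≤ K := (norm_nonneg _).trans (hK 0)
  have hc : 0 < 1 - r ^ 2 := by nlinarith
  set R : ℝ := ‖β‖ + 2 with hR
  have hR0 : 0 ≤ R := by positivity
  set M : ℝ := (1 - r ^ 2) ^ (-R) with hM
  have hM0 : 0 ≤ M := Real.rpow_nonneg hc.le _
  have hw : ∀ y : EuclideanSpace ℝ (Fin n), ‖y‖ < r → 1 - r ^ 2 ≤ 1 - ‖y‖ ^ 2 ∧ 1 - ‖y‖ ^ 2 ≤ 1 :=
    fun y hy => by constructor <;> nlinarith [norm_nonneg y]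
  have hpow : ∀ b ∈ Metric.ball β 1, ∀ y : EuclideanSpace ℝ (Fin n), ‖y‖ < r →
      ‖((1 - ‖y‖ ^ 2 : ℝ) : ℂ) ^ (b - 1)‖ ≤ M := by
    intro b hb y hy
    obtain ⟨h1, h2⟩ := hw y hy
    have h0 : 0 < 1 - ‖y‖ ^ 2 := hc.trans_le h1
    have hbre : -R ≤ (b - 1).re := by
      have h3 : ‖b - β‖ < 1 := by simpa [dist_eq_norm] using hb
      have h4 := (abs_le.mp (Complex.abs_re_le_norm (b - β))).1
      have h5 := (abs_le.mp (Complex.abs_re_le_norm β)).1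
      simp only [Complex.sub_re, Complex.one_re] at h4 ⊢
      linarith
    rw [Complex.norm_cpow_eq_rpow_re_of_pos h0]
    exact (Real.rpow_le_rpow_of_exponent_ge h0 h2 hbre).trans
      (Real.rpow_le_rpow_of_nonpos hc h1 (by linarith))
  have hlog : ∀ y : EuclideanSpace ℝ (Fin n), ‖y‖ < r →
      ‖Complex.log ((1 - ‖y‖ ^ 2 : ℝ) : ℂ)‖ ≤ -Real.log (1 - r ^ 2) := by
    intro y hy
    obtain ⟨h1, h2⟩ := hw y hy
    have h0 : 0 < 1 - ‖y‖ ^ 2 := hc.trans_le h1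
    rw [← Complex.ofReal_log h0.le, Complex.norm_real, Real.norm_eq_abs,
      abs_of_nonpos (Real.log_nonpos h0.le h2)]
    exact neg_le_neg (Real.log_le_log hc h1)
  have hl0 : 0 ≤ -Real.log (1 - r ^ 2) := by
    have := Real.log_nonpos hc.le (by nlinarith)
    linarith
  have hz : ∀ y : EuclideanSpace ℝ (Fin n), r ≤ ‖y‖ → f (0 - (1 : ℝ) • y) = 0 := fun y hy =>
    hf _ (by simpa using hy)
  have hcm : ∀ c : ℝ, IntegrableOn (fun _ : EuclideanSpace ℝ (Fin n) => c)
      (Metric.closedBall 0 1) := fun c =>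
    integrableOn_const (isCompact_closedBall _ _).measure_lt_top.ne
  have hFm : ∀ b, AEStronglyMeasurable (F b) (volume.restrict (Metric.closedBall 0 1)) := fun b =>
    ((hwm.pow_const _).mul hfc.measurable).aestronglyMeasurable
  refine (hasDerivAt_integral_of_dominated_loc_of_deriv_le (F := F)
    (F' := fun b y => ((1 - ‖y‖ ^ 2 : ℝ) : ℂ) ^ (b - 1) *
      (Complex.log ((1 - ‖y‖ ^ 2 : ℝ) : ℂ) * f (0 - (1 : ℝ) • y)))
    (bound := fun _ => M * (-Real.log (1 - r ^ 2) * K))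
    (s := Metric.ball β 1) (Metric.ball_mem_nhds _ one_pos) (.of_forall hFm) ?_ ?_ ?_
    (hcm _) ?_).2.differentiableAt
  · refine Integrable.mono' (hcm (M * K)) (hFm β) (.of_forall fun y => ?_)
    rcases le_or_gt r ‖y‖ with hy | hy
    · simp only [hF]
      rw [hz y hy, mul_zero, norm_zero]
      positivity
    · rw [norm_mul]
      exact mul_le_mul (hpow β (Metric.mem_ball_self one_pos) y hy) (hK _) (norm_nonneg _) hM0
  · exact ((hwm.pow_const _).mul ((Complex.measurable_log.comp hwm).mul
      hfc.measurable)).aestronglyMeasurable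
  · refine .of_forall fun y b hb => ?_
    rcases le_or_gt r ‖y‖ with hy | hy
    · rw [hz y hy, mul_zero, mul_zero, norm_zero]
      positivity
    · rw [norm_mul, norm_mul]
      exact mul_le_mul (hpow b hb y hy) (mul_le_mul (hlog y hy) (hK _) (norm_nonneg _) hl0)
        (by positivity) hM0
  · refine .of_forall fun y b _ => ?_
    rcases le_or_gt r ‖y‖ with hy | hy
    · simp only [hF, hz y hy, mul_zero]
      exact hasDerivAt_const _ _
    · have h0 : 0 < 1 - ‖y‖ ^ 2 := hc.trans_le (hw y hy).1
      have h1 : HasDerivAt (fun b : ℂ => b - 1) 1 b := (hasDerivAt_id b).sub_const 1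
      have h2 := (h1.const_cpow (c := ((1 - ‖y‖ ^ 2 : ℝ) : ℂ))
        (Or.inl (Complex.ofReal_ne_zero.mpr h0.ne'))).mul_const (f (0 - (1 : ℝ) • y))
      rw [mul_one, mul_assoc] at h2
      exact h2

/-- The converse of `integrableOn_weight`, by polar coordinates. -/
theorem not_integrableOn_weight {m : ℕ} {a : ℝ} (ha : a ≤ 0) :
    ¬ IntegrableOn (fun y : EuclideanSpace ℝ (Fin (m + 1)) => (1 - ‖y‖ ^ 2) ^ (a - 1))
      (Metric.ball 0 1) := by
  intro h
  rw [integrableOn_fun_norm_addHaar volume (f := fun r : ℝ => (1 - r ^ 2) ^ (a - 1))] at h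
  have h1 := (integrableOn_Icc_iff_integrableOn_Ioo (μ := volume)).2
    (h.mono_set (Set.Ioo_subset_Ioo_left (a₁ := 0) (a₂ := (1 / 2 : ℝ)) (by norm_num)))
  have h2 : ContinuousOn (fun y : ℝ =>
      (y ^ (Module.finrank ℝ (EuclideanSpace ℝ (Fin (m + 1))) - 1))⁻¹ * (1 + y) ^ (1 - a))
      (Set.Icc (1 / 2) 1) := by
    refine ContinuousOn.mul (ContinuousOn.inv₀ (by fun_prop) fun y hy => ?_)
      (ContinuousOn.rpow_const (by fun_prop) fun y hy => ?_)
    · have : (0 : ℝ) < y := by linarith [hy.1]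
      positivity
    · left
      linarith [hy.1]
  have h3 := (h1.mul_continuousOn h2 isCompact_Icc).mono_set Set.Ioo_subset_Icc_self
  have h4 : IntegrableOn (fun y : ℝ => (1 - y) ^ (a - 1)) (Set.Ioo (1 / 2) 1) := by
    refine h3.congr_fun (fun y hy => ?_) measurableSet_Ioo
    have hy0 : (0 : ℝ) < y := by linarith [hy.1]
    have e1 : 1 - y ^ 2 = (1 - y) * (1 + y) := by ring
    have e2 : (1 + y) ^ (a - 1) * (1 + y) ^ (1 - a) = 1 := by
      rw [← Real.rpow_add (by linarith)]
      simp
    have e3 : y ^ (Module.finrank ℝ (EuclideanSpace ℝ (Fin (m + 1))) - 1) ≠ 0 := by positivity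
    simp only [smul_eq_mul]
    rw [e1, Real.mul_rpow (by linarith [hy.2]) (by linarith)]
    calc _ = (y ^ (Module.finrank ℝ (EuclideanSpace ℝ (Fin (m + 1))) - 1) *
          (y ^ (Module.finrank ℝ (EuclideanSpace ℝ (Fin (m + 1))) - 1))⁻¹) *
          (1 - y) ^ (a - 1) * ((1 + y) ^ (a - 1) * (1 + y) ^ (1 - a)) := by ring
      _ = (1 - y) ^ (a - 1) := by rw [mul_inv_cancel₀ e3, e2, one_mul, mul_one]
  have h5 : IntegrableOn (fun x : ℝ => x ^ (a - 1)) (Set.Ioo 0 (1 / 2)) := by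
    rw [← intervalIntegrable_iff_integrableOn_Ioo_of_le (by norm_num)] at h4 ⊢
    have := (h4.comp_sub_left 1).symm
    norm_num at this
    exact this
  rw [intervalIntegral.integrableOn_Ioo_rpow_iff (by norm_num)] at h5
  linarith

/-- The maximal estimate on `L^∞` fails for `-1 < a < 0`: tested at `t = 1`, `x = 0` on bump functions
equal to one on `|y| ≤ ρ`, it bounds the integral of `(1 - |y|²)^(a - 1)` uniformly in `ρ < 1`. -/
theorem MaximalBound.not_top_of_neg {m : ℕ} {a : ℝ} (ha : -1 < a) (ha0 : a < 0)
    (ham : 0 < ((a : ℂ) + m / 2).re) :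
    ¬ MaximalBound (m + 1) a ∞ ∞ (Set.Icc 1 2) := by
  rintro ⟨C, hC⟩
  refine not_integrableOn_weight (m := m) ha0.le ?_
  -- `Γ` has no pole at `a` because `-1 < a < 0`
  have hΓ : Complex.Gamma a ≠ 0 := by
    refine Complex.Gamma_ne_zero fun k hk => ?_
    have h1 : a = -(k : ℝ) := by exact_mod_cast hk
    rcases Nat.eq_zero_or_pos k with rfl | hk0
    · simp at h1
      linarith
    · have : (1 : ℝ) ≤ k := by exact_mod_cast hk0
      linarith
  set W : EuclideanSpace ℝ (Fin (m + 1)) → ℝ := fun y => (1 - ‖y‖ ^ 2) ^ (a - 1) with hW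
  have hWm : Measurable W := by
    have h1 : Measurable fun y : EuclideanSpace ℝ (Fin (m + 1)) => (1 - ‖y‖ ^ 2 : ℝ) :=
      Continuous.measurable (by fun_prop)
    exact h1.pow_const _
  set D : ℝ≥0∞ := ENNReal.ofReal (‖Complex.Gamma a‖ * C) with hD
  have key : ∀ ρ : ℝ, 0 < ρ → ρ < 1 →
      ∫⁻ y in Metric.ball (0 : EuclideanSpace ℝ (Fin (m + 1))) ρ, ENNReal.ofReal (W y) ≤ D := by
    intro ρ hρ0 hρ1
    set b : ContDiffBump (0 : EuclideanSpace ℝ (Fin (m + 1))) :=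
      ⟨ρ, (1 + ρ) / 2, hρ0, by linarith⟩ with hb
    have hcs : HasCompactSupport fun y => ((b y : ℝ) : ℂ) :=
      b.hasCompactSupport.comp_left Complex.ofReal_zero
    have hcd : ContDiff ℝ (⊤ : ℕ∞) fun y => ((b y : ℝ) : ℂ) :=
      Complex.ofRealCLM.contDiff.comp b.contDiff
    set f : 𝓢(EuclideanSpace ℝ (Fin (m + 1)), ℂ) := hcs.toSchwartzMap hcd with hf
    have hfb : ∀ y, f y = ((b y : ℝ) : ℂ) := fun y => rfl
    have hbz : ∀ y : EuclideanSpace ℝ (Fin (m + 1)), (1 + ρ) / 2 ≤ ‖y‖ → b y = 0 := fun y hy =>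
      b.zero_of_le_dist (by simpa using hy)
    obtain ⟨S, -, hS, hSn⟩ := hC f
    have hf1 : eLpNorm f ∞ volume ≤ 1 := by
      rw [eLpNorm_exponent_top]
      refine eLpNormEssSup_le_of_ae_enorm_bound (.of_forall fun y => ?_)
      rw [hfb, ← ofReal_norm, Complex.norm_real, Real.norm_of_nonneg b.nonneg]
      exact ENNReal.ofReal_le_one.2 b.le_one
    -- the essential bound holds at the origin by continuity
    have hbound : ‖steinMean (a : ℂ) 1 f 0‖ ≤ C := by
      have h1 : ∀ᵐ x, ‖steinMean (a : ℂ) 1 f x‖ ≤ C := by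
        rw [eLpNorm_exponent_top] at hSn
        filter_upwards [ae_le_eLpNormEssSup (f := S)
          (μ := (volume : Measure (EuclideanSpace ℝ (Fin (m + 1)))))] with x hx
        rw [enorm_eq_self] at hx
        have h2 : ‖steinMean (a : ℂ) 1 f x‖ₑ ≤ C :=
          (hS 1 ⟨le_rfl, one_le_two⟩ x).trans (hx.trans (hSn.trans
            ((mul_le_mul_right hf1 _).trans_eq (mul_one _))))
        rw [← toReal_enorm]
        exact ENNReal.toReal_mono ENNReal.coe_ne_top h2
      have h2 : Continuous (steinMean (a : ℂ) 1 f) :=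
        Continuous.comp (g := fun z : ℝ × EuclideanSpace ℝ (Fin (m + 1)) => steinMean a z.1 f z.2)
          (f := fun x : EuclideanSpace ℝ (Fin (m + 1)) => ((1 : ℝ), x)) (continuous_steinMean ham f)
          (by fun_prop)
      have h3 : IsClosed {x | ‖steinMean (a : ℂ) 1 f x‖ ≤ C} := isClosed_le h2.norm continuous_const
      have h4 := (Measure.dense_of_ae h1).closure_eq
      rw [h3.closure_eq] at h4
      exact h4.symm.subset (Set.mem_univ _)
    have hw0 : ∀ y ∈ Metric.closedBall (0 : EuclideanSpace ℝ (Fin (m + 1))) 1, 0 ≤ 1 - ‖y‖ ^ 2 := by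
      intro y hy
      rw [mem_closedBall_zero_iff] at hy
      nlinarith [norm_nonneg y]
    have hval : steinMean (a : ℂ) 1 f 0 = (Complex.Gamma a)⁻¹ *
        ((∫ y in Metric.closedBall (0 : EuclideanSpace ℝ (Fin (m + 1))) 1, W y * b y : ℝ) : ℂ) := by
      rw [steinMean_one_zero_of_support (r := (1 + ρ) / 2) (by linarith) (by linarith)
        (fun y hy => by rw [hfb, hbz y hy, Complex.ofReal_zero]), ← integral_complex_ofReal]
      congr 1
      refine setIntegral_congr_fun Metric.isClosed_closedBall.measurableSet fun y hy => ?_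
      simp only [one_smul, zero_sub, hfb, ContDiffBump.neg]
      rw [Complex.ofReal_mul, hW, Complex.ofReal_cpow (hw0 y hy)]
      push_cast
      rfl
    have hint : IntegrableOn (fun y => W y * b y)
        (Metric.closedBall (0 : EuclideanSpace ℝ (Fin (m + 1))) 1) := by
      have hc0 : 0 < 1 - ((1 + ρ) / 2) ^ 2 := by nlinarith
      refine Integrable.mono' (g := fun _ => (1 - ((1 + ρ) / 2) ^ 2) ^ (a - 1))
        (integrableOn_const (isCompact_closedBall _ _).measure_lt_top.ne)
        (hWm.mul b.continuous.measurable).aestronglyMeasurable (.of_forall fun y => ?_)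
      have hp := Real.rpow_nonneg hc0.le (a - 1)
      rcases le_or_gt ((1 + ρ) / 2) ‖y‖ with hy | hy
      · rw [hbz y hy, mul_zero, norm_zero]
        exact hp
      · have h1 : 1 - ((1 + ρ) / 2) ^ 2 ≤ 1 - ‖y‖ ^ 2 := by nlinarith [norm_nonneg y]
        have h2 : 0 ≤ W y := Real.rpow_nonneg (hc0.le.trans h1) _
        rw [Real.norm_of_nonneg (mul_nonneg h2 b.nonneg)]
        exact (mul_le_of_le_one_right h2 b.le_one).trans
          (Real.rpow_le_rpow_of_nonpos hc0 h1 (by linarith))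
    have hnn : ∀ y ∈ Metric.closedBall (0 : EuclideanSpace ℝ (Fin (m + 1))) 1, 0 ≤ W y * b y :=
      fun y hy => mul_nonneg (Real.rpow_nonneg (hw0 y hy) _) b.nonneg
    calc ∫⁻ y in Metric.ball (0 : EuclideanSpace ℝ (Fin (m + 1))) ρ, ENNReal.ofReal (W y)
        = ∫⁻ y in Metric.ball (0 : EuclideanSpace ℝ (Fin (m + 1))) ρ,
            ENNReal.ofReal (W y * b y) := by
          refine setLIntegral_congr_fun measurableSet_ball fun y hy => ?_
          rw [b.one_of_mem_closedBall (Metric.ball_subset_closedBall hy), mul_one]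
      _ ≤ ∫⁻ y in Metric.closedBall (0 : EuclideanSpace ℝ (Fin (m + 1))) 1,
            ENNReal.ofReal (W y * b y) :=
          lintegral_mono_set ((Metric.ball_subset_ball hρ1.le).trans Metric.ball_subset_closedBall)
      _ = ENNReal.ofReal (∫ y in Metric.closedBall (0 : EuclideanSpace ℝ (Fin (m + 1))) 1,
            W y * b y) := (ofReal_integral_eq_lintegral_ofReal hint
          ((ae_restrict_iff' Metric.isClosed_closedBall.measurableSet).2 (.of_forall hnn))).symm
      _ ≤ D := by
          refine ENNReal.ofReal_le_ofReal ?_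
          rw [hval, norm_mul, norm_inv, Complex.norm_real, inv_mul_le_iff₀ (norm_pos_iff.2 hΓ)]
            at hbound
          exact (le_abs_self _).trans hbound
  -- monotone convergence as `ρ → 1`
  refine ⟨hWm.aestronglyMeasurable, ?_⟩
  have hρ : ∀ i : ℕ, 0 < 1 - 1 / ((i : ℝ) + 2) ∧ 1 - 1 / ((i : ℝ) + 2) < 1 := fun i => by
    have h1 : 0 < 1 / ((i : ℝ) + 2) := by positivity
    have h2 : 1 / ((i : ℝ) + 2) < 1 := by
      rw [div_lt_one (by positivity)]
      linarith [(Nat.cast_nonneg i : (0 : ℝ) ≤ i)]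
    constructor <;> linarith
  have hU : Metric.ball (0 : EuclideanSpace ℝ (Fin (m + 1))) 1 =
      ⋃ i : ℕ, Metric.ball 0 (1 - 1 / ((i : ℝ) + 2)) := by
    ext y
    simp only [Set.mem_iUnion, mem_ball_zero_iff]
    constructor
    · intro hy
      obtain ⟨i, hi⟩ := exists_nat_one_div_lt (sub_pos.2 hy)
      refine ⟨i, ?_⟩
      have : 1 / ((i : ℝ) + 2) ≤ 1 / ((i : ℝ) + 1) :=
        one_div_le_one_div_of_le (by positivity) (by linarith)
      linarith
    · rintro ⟨i, hi⟩
      exact hi.trans (hρ i).2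
  have hdir : Monotone fun i : ℕ =>
      Metric.ball (0 : EuclideanSpace ℝ (Fin (m + 1))) (1 - 1 / ((i : ℝ) + 2)) := by
    intro i j hij
    refine Metric.ball_subset_ball ?_
    have h1 : (i : ℝ) ≤ j := by exact_mod_cast hij
    have : 1 / ((j : ℝ) + 2) ≤ 1 / ((i : ℝ) + 2) :=
      one_div_le_one_div_of_le (by positivity) (by linarith)
    linarith
  have h1 : ∫⁻ y in Metric.ball (0 : EuclideanSpace ℝ (Fin (m + 1))) 1, ‖W y‖ₑ =
      ∫⁻ y in Metric.ball (0 : EuclideanSpace ℝ (Fin (m + 1))) 1, ENNReal.ofReal (W y) := by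
    refine setLIntegral_congr_fun measurableSet_ball fun y hy => ?_
    exact Real.enorm_of_nonneg (Real.rpow_nonneg (weight_pos hy).1.le _)
  rw [HasFiniteIntegral, h1, hU, setLIntegral_iUnion_of_directed _ hdir.directed_le]
  exact (iSup_le fun i => key _ (hρ i).1 (hρ i).2).trans_lt ENNReal.ofReal_lt_top

/-- On `L^∞` a local smoothing estimate can only yield positive orders. -/
theorem LocalSmoothing.re_pos_of_top {m : ℕ} {s : ℝ} (hs0 : 0 ≤ s)
    (hLS : LocalSmoothing (m + 1) ∞ ∞ s) {α : ℂ} (hα : s < (α + m / 2).re) : 0 < α.re := by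
  by_contra hneg
  rw [not_lt] at hneg
  rw [re_add_half] at hα
  -- a negative order, above `-1`, that the local smoothing estimate still reaches
  set a : ℝ := max ((s - m / 2) / 2) (-(1 / 2)) with ha
  have h1 : s - m / 2 < 0 := by linarith
  have ha0 : a < 0 := max_lt (by linarith) (by norm_num)
  have ha1 : -1 < a := lt_of_lt_of_le (by norm_num) (le_max_right _ _)
  have ha2 : s - m / 2 < a := lt_of_lt_of_le (by linarith) (le_max_left _ _)
  have h2 : ((a : ℂ) + m / 2).re = a + m / 2 := by rw [re_add_half, Complex.ofReal_re]
  refine MaximalBound.not_top_of_neg (m := m) ha1 ha0 (by rw [h2]; linarith)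
    (maximalBound_Icc_one_two le_top le_rfl hs0 hLS ?_)
  rw [h2]
  simp only [ENNReal.inv_top, ENNReal.toReal_zero]
  linarith

end SteinSpherical

theorem proposition4p5 (n : ℕ) (hn : 2 ≤ n) (p q : ℝ≥0∞) (hp : 1 ≤ p) (hpq : p ≤ q) (s : ℝ)
    (hLS : SteinSpherical.LocalSmoothing n p q s)
    (α : ℂ) (hα : s - ((n : ℝ) - 1) / 2 + (q⁻¹).toReal < α.re) :
    ∃ C : ℝ≥0,
      (∀ f : 𝓢(EuclideanSpace ℝ (Fin n), ℂ),
        eLpNorm (fun x => ⨆ t ∈ Set.Icc (1 : ℝ) 2, ‖SteinSpherical.steinMean α t f x‖ₑ) q volume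
          ≤ C * eLpNorm f p volume) ∧
      (∀ f : EuclideanSpace ℝ (Fin n) → ℂ, MemLp f p volume →
        ∃ u : ℝ → EuclideanSpace ℝ (Fin n) → ℂ,
          (∀ t ∈ Set.Icc (1 : ℝ) 2,
            MemLp (u t) q volume ∧ SteinSpherical.IsSteinMean α t f (u t)) ∧
          (∀ᵐ x, ContinuousOn (fun t => u t x) (Set.Icc 1 2)) ∧
          eLpNorm (fun x => ⨆ t ∈ Set.Icc (1 : ℝ) 2, ‖u t x‖ₑ) q volume
            ≤ C * eLpNorm f p volume) := by
  -- `m = n - 1`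
  obtain ⟨m, rfl⟩ : ∃ m, n = m + 1 := ⟨n - 1, by omega⟩
  have hq : 1 ≤ q := hp.trans hpq
  have hs0 : 0 ≤ s := hLS.nonneg hp hq
  have hκ : 0 ≤ (q⁻¹).toReal := ENNReal.toReal_nonneg
  have hα' : s + (q⁻¹).toReal < (α + m / 2).re := by
    rw [SteinSpherical.re_add_half]
    push_cast at hα
    linarith
  have hM := SteinSpherical.maximalBound_Icc_one_two hp hpq hs0 hLS hα'
  have hext : ∃ C : ℝ≥0, ∀ f : EuclideanSpace ℝ (Fin (m + 1)) → ℂ, MemLp f p volume →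
      ∃ u : ℝ → EuclideanSpace ℝ (Fin (m + 1)) → ℂ,
        (∀ t ∈ Set.Icc (1 : ℝ) 2,
          MemLp (u t) q volume ∧ SteinSpherical.IsSteinMean α t f (u t)) ∧
        (∀ᵐ x, ContinuousOn (fun t => u t x) (Set.Icc 1 2)) ∧
        eLpNorm (fun x => ⨆ t ∈ Set.Icc (1 : ℝ) 2, ‖u t x‖ₑ) q volume
          ≤ C * eLpNorm f p volume := by
    rcases eq_or_ne p ∞ with rfl | hpt
    · obtain rfl : q = ∞ := top_le_iff.1 hpq
      exact SteinSpherical.exists_extension_top (hLS.re_pos_of_top hs0 (by linarith))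
    · exact hM.exists_extension (by linarith) hp hpt hq
  obtain ⟨C₁, h₁⟩ := hM
  obtain ⟨C₂, h₂⟩ := hext
  refine ⟨max C₁ C₂, fun f => ?_, fun f hf => ?_⟩
  · obtain ⟨S, -, hS, hSn⟩ := h₁ f
    refine (eLpNorm_mono_enorm (g := S) fun x => ?_).trans (hSn.trans ?_)
    · simp only [enorm_eq_self]
      exact iSup₂_le fun t ht => hS t ht x
    · gcongr
      exact le_max_left _ _
  · obtain ⟨u, hu, hc, hn⟩ := h₂ f hf
    refine ⟨u, hu, hc, hn.trans ?_⟩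
    gcongr
    exact le_max_right _ _
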